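/- A run-length straight-line program (RLSLP) $G$ over an alphabet $\Sigma=\{0,\dots,\sigma-1\}$ is a finite set of variables, one of them the start variable, each with exactly one rule of the form $A\to a$ ($a\in\Sigma$), $A\to BC$, or $A\to B^t$ with $t\ge 3$, such that no variable can be reached from itself. Each variable expands to a unique string; $G$ represents the expansion $T[1..n]$ of its start variable. The size $|G|$ is the sum of the sizes of the rules, which are $1$, $2$ and $2$, respectively. Let $f:\Sigma^*\to R$ be composable with composition function $h:R\times R\to R$, that is, $f(X\cdot Y)=h(f(X),f(Y))$ for all strings $X,Y$. Computation takes place on a word RAM with words of $w$ bits (unit cost for memory access, comparison, $+$, $-$, $\times$, division and remainder of words). The elements of $R$ are represented, by an injective encoding, as $c$ words each; since $n\le 2^w$, this is possible in particular whenever $|R|\le n^{c}$. The value $f(a)$ for a single symbol $a\in\Sigma$ and the value $h(x,y)$ for $x,y\in R$ are provided by subroutines that take time $t_f$ and $t_h\ge 1$ per call. Theorem. For every $c\in\mathbb N$ there are two programs (for construction and for queries) and a constant $K$, all depending only on $c$, such that the following holds for all $\Sigma$, $R$, $f$, $h$, $t_f$, $t_h$, encodings of $R$, RLSLPs $G$ with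 $n=|T|$, and all word lengths $w$ with $K(n+|G|)\le 2^w$ for which every number in the description of $G$ is below $2^w$. Given $G$, the first program builds, in time at most $K\,|G|\,\bigl(t_f+t_h(\lfloor\log_2 n\rfloor+1)\bigr)=\mathcal O(|G|(t_f+t_h\log n))$, a data structure of at most $K|G|$ words. Given this data structure and any $1\le i\le j\le n$, the second program computes $f(T[i..j])$ in time at most $K\,t_h(\lfloor\log_2 n\rfloor+1)=\mathcal O(t_h\log n)$, and leaves the data structure intact. -/

import Mathlib

/-! # Run-length straight-line programs -/

/-- Right-hand sides over the alphabet `Fin σ` and the variables `Fin v`: `A → a`, `A → B C`,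
`A → B^t`. -/
inductive RLRule (σ v : ℕ) where
  | term (a : Fin σ)
  | pair (B C : Fin v)
  | run (B : Fin v) (t : ℕ)

namespace RLRule

variable {σ v : ℕ}

/-- The variable `B` occurs in the right-hand side. -/
def Mentions (B : Fin v) : RLRule σ v → Prop
  | term _ => False
  | pair C D => B = C ∨ B = D
  | run C _ => B = C

/-- The length of the right-hand side, where `B^t` counts as the two integers `B` and `t`. -/
def size : RLRule σ v → ℕ
  | term _ => 1
  | pair _ _ => 2
  | run _ _ => 2

/-- A right-hand side as three numbers. -/
def encode : RLRule σ v → List ℕ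
  | term a => [0, a, 0]
  | pair B C => [1, B, C]
  | run B t => [2, B, t]

end RLRule

/-- A run-length straight-line program over the alphabet `Fin σ`. The variables are numbered in
an arbitrary order. -/
structure RLSLP (σ : ℕ) where
  numVars : ℕ
  rule : Fin numVars → RLRule σ numVars
  start : Fin numVars
  /-- run-length rules `A → B^t` have `t ≥ 3` -/
  three_le : ∀ A B t, rule A = RLRule.run B t → 3 ≤ t
  /-- no variable can be reached again from itself -/
  acyclic : ∀ A, ¬ Relation.TransGen (fun B A => (rule A).Mentions B) A A

namespace RLSLP

variable {σ : ℕ}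

theorem wf (G : RLSLP σ) : WellFounded (fun B A => (G.rule A).Mentions B) := by
  have : Std.Irrefl (Relation.TransGen (fun B A => (G.rule A).Mentions B)) := ⟨G.acyclic⟩
  have h := Finite.wellFounded_of_trans_of_irrefl
    (Relation.TransGen (fun B A => (G.rule A).Mentions B))
  exact Subrelation.wf (fun hab => Relation.TransGen.single hab) h

/-- One unfolding step of the expansion, given the expansions of the variables on the right. -/
def expandStep (G : RLSLP σ) (A : Fin G.numVars)
    (ih : ∀ B, (G.rule A).Mentions B → List (Fin σ)) : List (Fin σ) :=
  match hr : G.rule A with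
  | .term a => [a]
  | .pair B C =>
      ih B (by rw [hr]; exact Or.inl rfl) ++ ih C (by rw [hr]; exact Or.inr rfl)
  | .run B t => (List.replicate t (ih B (by rw [hr]; exact rfl))).flatten

/-- The string `exp(A)` generated by the variable `A`. -/
noncomputable def expand (G : RLSLP σ) : Fin G.numVars → List (Fin σ) :=
  G.wf.fix (fun A ih => G.expandStep A ih)

theorem expand_eq (G : RLSLP σ) (A : Fin G.numVars) :
    G.expand A = match G.rule A with
      | .term a => [a]
      | .pair B C => G.expand B ++ G.expand C
      | .run B t => (List.replicate t (G.expand B)).flatten := by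
  have h : G.expand A = G.expandStep A (fun B _ => G.expand B) := G.wf.fix_eq _ A
  rw [h, expandStep]
  split <;> rename_i hr <;> simp [hr]

/-- The string represented by `G`. -/
noncomputable def text (G : RLSLP σ) : List (Fin σ) := G.expand G.start

/-- The size `|G|`: the sum of the sizes of the right-hand sides. -/
def size (G : RLSLP σ) : ℕ := ∑ A, (G.rule A).size

/-- The grammar as it is given to a machine: the number of variables, the start variable, and
three numbers for the rule of each variable. -/
def encode (G : RLSLP σ) : List ℕ :=
  G.numVars :: (G.start : ℕ) :: (List.ofFn fun A => (G.rule A).encode).flatten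

end RLSLP

/-! # Composable functions -/

/-- `h` is a composition function of `f`. -/
def IsComposition {α R : Type*} (f : List α → R) (h : R → R → R) : Prop :=
  ∀ X Y : List α, f (X ++ Y) = h (f X) (f Y)

/-! # A unit-cost word RAM

The machine has registers and a random access memory. Each register and each memory cell holds a
`w`-bit word, that is, a number below `2 ^ w`. A program is a fixed text that does not depend on
the input or on `w`. -/

namespace WordRAM

inductive BinOp where
  | add | sub | mul | div | mod | lt | eq

/-- Operations on `w`-bit words. The result is reduced modulo `2 ^ w`, subtraction is cut off
at `0`, a quotient by `0` is `0`, and comparisons return `0` or `1`. -/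
def BinOp.eval (w : ℕ) (o : BinOp) (a b : ℕ) : ℕ :=
  (match o with
    | .add => a + b
    | .sub => a - b
    | .mul => a * b
    | .div => a / b
    | .mod => a % b
    | .lt => if a < b then 1 else 0
    | .eq => if a = b then 1 else 0) % 2 ^ w

/-- Expressions: constants, registers, memory access at a computed address, operations. -/
inductive Expr where
  | const (k : ℕ)
  | reg (x : ℕ)
  | load (e : Expr)
  | bin (o : BinOp) (e₁ e₂ : Expr)

structure State where
  reg : ℕ → ℕ
  mem : ℕ → ℕ

def Expr.eval (w : ℕ) (s : State) : Expr → ℕ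
  | const k => k % 2 ^ w
  | reg x => s.reg x
  | load e => s.mem (e.eval w s)
  | bin o e₁ e₂ => o.eval w (e₁.eval w s) (e₂.eval w s)

/-- Evaluating an expression takes one time unit for each of its nodes. -/
def Expr.cost : Expr → ℕ
  | const _ => 1
  | reg _ => 1
  | load e => e.cost + 1
  | bin _ e₁ e₂ => e₁.cost + e₂.cost + 1

/-- Programs. `callF d a` and `callH d a b` invoke two external subroutines, whose values occupy
blocks of `c` consecutive memory cells. The argument of the first is the word `a`; the arguments
of the second are the blocks that start at the addresses `a` and `b`. The value is written to the
block that starts at the address `d`. -/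
inductive Prog where
  | skip
  | set (x : ℕ) (e : Expr)
  | store (d e : Expr)
  | callF (d a : Expr)
  | callH (d a b : Expr)
  | seq (p q : Prog)
  | ite (e : Expr) (p q : Prog)
  | loop (e : Expr) (p : Prog)

/-- The two external subroutines and their running times. -/
structure Subroutines (c : ℕ) where
  f : ℕ → Fin c → ℕ
  h : (Fin c → ℕ) → (Fin c → ℕ) → Fin c → ℕ
  timeF : ℕ
  timeH : ℕ

/-- The contents of the block of `c` cells that starts at address `a`. -/
def readBlock (c : ℕ) (m : ℕ → ℕ) (a : ℕ) : Fin c → ℕ := fun k => m (a + k)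

/-- Write a block of `c` words from address `a` on. There are `2 ^ w` addresses; what would lie
beyond them is lost. -/
def writeBlock {c : ℕ} (w : ℕ) (m : ℕ → ℕ) (a : ℕ) (b : Fin c → ℕ) : ℕ → ℕ := fun x =>
  if hx : a ≤ x ∧ x - a < c ∧ x < 2 ^ w then b ⟨x - a, hx.2.1⟩ % 2 ^ w else m x

/-- `Exec w O p s t s'`: on words of `w` bits and with the subroutines `O`, the program `p`
started in the state `s` halts after `t` time units in the state `s'`. -/
inductive Exec {c : ℕ} (w : ℕ) (O : Subroutines c) : Prog → State → ℕ → State → Prop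
  | skip (s : State) : Exec w O .skip s 1 s
  | set (x : ℕ) (e : Expr) (s : State) :
      Exec w O (.set x e) s (e.cost + 1) ⟨Function.update s.reg x (e.eval w s), s.mem⟩
  | store (d e : Expr) (s : State) :
      Exec w O (.store d e) s (d.cost + e.cost + 1)
        ⟨s.reg, Function.update s.mem (d.eval w s) (e.eval w s)⟩
  | callF (d a : Expr) (s : State) :
      Exec w O (.callF d a) s (d.cost + a.cost + O.timeF + 1)
        ⟨s.reg, writeBlock w s.mem (d.eval w s) (O.f (a.eval w s))⟩
  | callH (d a b : Expr) (s : State) :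
      Exec w O (.callH d a b) s (d.cost + a.cost + b.cost + O.timeH + 1)
        ⟨s.reg, writeBlock w s.mem (d.eval w s)
          (O.h (readBlock c s.mem (a.eval w s)) (readBlock c s.mem (b.eval w s)))⟩
  | seq {p q : Prog} {s s₁ s₂ : State} {t₁ t₂ : ℕ} (hp : Exec w O p s t₁ s₁)
      (hq : Exec w O q s₁ t₂ s₂) : Exec w O (.seq p q) s (t₁ + t₂) s₂
  | ite_true {e : Expr} {p q : Prog} {s s₁ : State} {t : ℕ} (he : e.eval w s ≠ 0)
      (hp : Exec w O p s t s₁) : Exec w O (.ite e p q) s (e.cost + 1 + t) s₁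
  | ite_false {e : Expr} {p q : Prog} {s s₁ : State} {t : ℕ} (he : e.eval w s = 0)
      (hq : Exec w O q s t s₁) : Exec w O (.ite e p q) s (e.cost + 1 + t) s₁
  | loop_true {e : Expr} {p : Prog} {s s₁ s₂ : State} {t₁ t₂ : ℕ} (he : e.eval w s ≠ 0)
      (hp : Exec w O p s t₁ s₁) (hl : Exec w O (.loop e p) s₁ t₂ s₂) :
      Exec w O (.loop e p) s (e.cost + 1 + t₁ + t₂) s₂
  | loop_false {e : Expr} {p : Prog} {s : State} (he : e.eval w s = 0) :
      Exec w O (.loop e p) s (e.cost + 1) s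

/-- The initial state on an input: the input stands at the beginning of the memory, everything
else is `0`. -/
def State.ofInput (input : List ℕ) : State := ⟨fun _ => 0, fun a => input.getD a 0⟩

/-- The initial state on two numbers, which stand in the registers `0` and `1`, and a given
memory. -/
def State.ofQuery (i j : ℕ) (m : ℕ → ℕ) : State :=
  ⟨fun x => if x = 0 then i else if x = 1 then j else 0, m⟩

/-- The block of words that represents `r` under the encoding `enc`. -/
def code {R : Type*} {c w : ℕ} (enc : R ↪ (Fin c → Fin (2 ^ w))) (r : R) : Fin c → ℕ :=
  fun k => (enc r k : ℕ)

/-- The subroutines compute `f` on strings of length one, and `h`. -/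
structure Subroutines.Compute {σ c w : ℕ} {R : Type*} (O : Subroutines c)
    (enc : R ↪ (Fin c → Fin (2 ^ w))) (f : List (Fin σ) → R) (h : R → R → R) : Prop where
  f_eq : ∀ a : Fin σ, O.f a = code enc (f [a])
  h_eq : ∀ x y : R, O.h (code enc x) (code enc y) = code enc (h x y)

end WordRAM

/-- The substring `T[i..j]`, with positions counted from one. -/
def substring {α : Type*} (T : List α) (i j : ℕ) : List α := (T.take j).drop (i - 1)

/-! The grammar is rebalanced into a structure of logarithmic depth, on which a query is a descent
along the two ends of a substring.

Let `occ A` be the number of nodes labelled `A` in the derivation tree. No variable reaches itself,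
so nodes with equal labels carry disjoint factors of the text and `occ A * len A ≤ n`
(`occ_mul_len_le`). With `lw` and `lu` the logarithms of `len` and `occ`, this gives `lw A + lu A ≤
log n`. From a reachable variable to one in its rule, `lw` never grows and `lu` never falls. The
edges of pair rules that change neither form disjoint paths, the symmetric centroid paths: two such
children would make their parent too long (`sc_spec`), and two such parents would make their child
too frequent (`sc_inj`). Every other edge strictly decreases `lw` or strictly increases `lu`, so
only the paths themselves can be long.

A path is shortcut by a Cartesian tree. Its variables receive consecutive integer intervals below `2
^ (lw + lu + 2)`, whose lengths measure how many occurrences are gained and how much length is lost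
at each step. The level `lam` of a variable that has a successor is the largest exponent `l` for
which its interval contains a multiple of `2 ^ l`; the last variable of a path gets a level above
all others. As in the ruler sequence, between two variables of equal level there is one of a higher
level (`Walk.lam_ne`). The node of `A` has five children: its left sibling on the path, the left
siblings that are skipped, the next variable `N` of higher level, the skipped right siblings, and
its own right sibling. The skipped siblings are gathered in two side nodes for each skipped variable
`D`. These serve only the last variable of higher level before `D` (`Prev.unique`), so three nodes
for each variable suffice. Gathering for `A` takes at most `lam A` steps, since the levels met
increase.

Depth is controlled by the potentials `rk` (nodes) and `rkT` (side nodes). A long sibling forces a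
long interval, hence a high level (`le_lam_sibling`); the same holds for a variable that is entered
from outside of its path by a frequent parent (`rk_le_of_mentions`). So the costs inside the
Cartesian trees telescope, the ranks decrease at every edge, and the root has rank at most `11 log n
+ 3` (`rk_start_le`). At a rule `A → B ^ t` the rank drops by more than `log t` (`rk_lt_of_run`),
which pays for repeated squaring.

A query splits a slice among the children of a node. Whole and empty parts are settled at once, and
the number `cuts` of ends inside of a string is at most two and does not grow under splitting. Hence
the total time is of the order `timeH` times `cuts` times rank, plus a constant number of steps
(`Rep.treats`).

The remainder verifies the two programs. All arithmetic must stay below `2 ^ w`; for this reason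
variables with `occ = 0`, whose expansions may be much longer than the text, are skipped after the
topological search. -/

set_option linter.unusedSimpArgs false

namespace WordRAM

/-! # Verification of programs -/

instance : Add Expr := ⟨Expr.bin .add⟩
instance : Sub Expr := ⟨Expr.bin .sub⟩
instance : Mul Expr := ⟨Expr.bin .mul⟩
instance : Div Expr := ⟨Expr.bin .div⟩
instance : Mod Expr := ⟨Expr.bin .mod⟩
instance (n : ℕ) : OfNat Expr n := ⟨Expr.const n⟩

/-- The expression that compares two numbers. -/
abbrev Expr.less (a b : Expr) : Expr := Expr.bin .lt a b

/-- The expression that tests two numbers for equality. -/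
abbrev Expr.equal (a b : Expr) : Expr := Expr.bin .eq a b

/-- The value of an expression in unbounded arithmetic. -/
def Expr.val (s : State) : Expr → ℕ
  | .const k => k
  | .reg x => s.reg x
  | .load e => s.mem (e.val s)
  | .bin .add a b => a.val s + b.val s
  | .bin .sub a b => a.val s - b.val s
  | .bin .mul a b => a.val s * b.val s
  | .bin .div a b => a.val s / b.val s
  | .bin .mod a b => a.val s % b.val s
  | .bin .lt a b => if a.val s < b.val s then 1 else 0
  | .bin .eq a b => if a.val s = b.val s then 1 else 0

/-- No overflow occurs in the evaluation of an expression. -/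
def Expr.Safe (w : ℕ) (s : State) : Expr → Prop
  | .const k => k < 2 ^ w
  | .reg _ => True
  | .load e => e.Safe w s
  | .bin .add a b => a.Safe w s ∧ b.Safe w s ∧ a.val s + b.val s < 2 ^ w
  | .bin .sub a b => a.Safe w s ∧ b.Safe w s ∧ a.val s < 2 ^ w
  | .bin .mul a b => a.Safe w s ∧ b.Safe w s ∧ a.val s * b.val s < 2 ^ w
  | .bin .div a b => a.Safe w s ∧ b.Safe w s ∧ a.val s < 2 ^ w
  | .bin .mod a b => a.Safe w s ∧ b.Safe w s ∧ a.val s < 2 ^ w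
  | .bin .lt a b => a.Safe w s ∧ b.Safe w s ∧ 1 < 2 ^ w
  | .bin .eq a b => a.Safe w s ∧ b.Safe w s ∧ 1 < 2 ^ w

/-- Registers and memory cells are not assumed to be bounded. Subtraction, division and remainder
therefore need a bound on their first operand, which in turn bounds their result. -/
theorem Expr.eval_eq_val {w : ℕ} {s : State} {e : Expr} (h : e.Safe w s) :
    e.eval w s = e.val s := by
  induction e with
  | const k => exact Nat.mod_eq_of_lt h
  | reg x => rfl
  | load e ih => simp only [Expr.eval, Expr.val, ih h]
  | bin o a b iha ihb =>
    cases o <;> simp only [Expr.Safe] at h <;>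
      simp only [Expr.eval, Expr.val, BinOp.eval, iha h.1, ihb h.2.1]
    · exact Nat.mod_eq_of_lt h.2.2
    · exact Nat.mod_eq_of_lt (lt_of_le_of_lt (Nat.sub_le _ _) h.2.2)
    · exact Nat.mod_eq_of_lt h.2.2
    · exact Nat.mod_eq_of_lt (lt_of_le_of_lt (Nat.div_le_self _ _) h.2.2)
    · exact Nat.mod_eq_of_lt (lt_of_le_of_lt (Nat.mod_le _ _) h.2.2)
    · split <;> exact Nat.mod_eq_of_lt (by omega)
    · split <;> exact Nat.mod_eq_of_lt (by omega)

section simps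
variable (w : ℕ) (s : State) (a b : Expr) (n : ℕ)

@[simp] theorem val_num : Expr.val s ofNat(n) = (OfNat.ofNat n : ℕ) := rfl
@[simp] theorem val_const : Expr.val s (.const n) = n := rfl
@[simp] theorem val_reg : Expr.val s (.reg n) = s.reg n := rfl
@[simp] theorem val_load : Expr.val s (.load a) = s.mem (a.val s) := rfl
@[simp] theorem val_add : Expr.val s (a + b) = a.val s + b.val s := rfl
@[simp] theorem val_sub : Expr.val s (a - b) = a.val s - b.val s := rfl
@[simp] theorem val_mul : Expr.val s (a * b) = a.val s * b.val s := rfl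
@[simp] theorem val_div : Expr.val s (a / b) = a.val s / b.val s := rfl
@[simp] theorem val_mod : Expr.val s (a % b) = a.val s % b.val s := rfl
@[simp] theorem val_less : Expr.val s (.bin .lt a b) = if a.val s < b.val s then 1 else 0 := rfl
@[simp] theorem val_equal : Expr.val s (.bin .eq a b) = if a.val s = b.val s then 1 else 0 := rfl
@[simp] theorem safe_num : Expr.Safe w s ofNat(n) ↔ (OfNat.ofNat n : ℕ) < 2 ^ w := Iff.rfl
@[simp] theorem safe_const : Expr.Safe w s (.const n) ↔ n < 2 ^ w := Iff.rfl
@[simp] theorem safe_reg : Expr.Safe w s (.reg n) ↔ True := Iff.rfl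
@[simp] theorem safe_load : Expr.Safe w s (.load a) ↔ a.Safe w s := Iff.rfl
@[simp] theorem safe_add : Expr.Safe w s (a + b) ↔
    a.Safe w s ∧ b.Safe w s ∧ a.val s + b.val s < 2 ^ w := Iff.rfl
@[simp] theorem safe_sub : Expr.Safe w s (a - b) ↔ a.Safe w s ∧ b.Safe w s ∧ a.val s < 2 ^ w := Iff.rfl
@[simp] theorem safe_mul : Expr.Safe w s (a * b) ↔
    a.Safe w s ∧ b.Safe w s ∧ a.val s * b.val s < 2 ^ w := Iff.rfl
@[simp] theorem safe_div : Expr.Safe w s (a / b) ↔ a.Safe w s ∧ b.Safe w s ∧ a.val s < 2 ^ w := Iff.rfl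
@[simp] theorem safe_mod : Expr.Safe w s (a % b) ↔ a.Safe w s ∧ b.Safe w s ∧ a.val s < 2 ^ w := Iff.rfl
@[simp] theorem safe_less : Expr.Safe w s (.bin .lt a b) ↔ a.Safe w s ∧ b.Safe w s ∧ 1 < 2 ^ w := Iff.rfl
@[simp] theorem safe_equal : Expr.Safe w s (.bin .eq a b) ↔ a.Safe w s ∧ b.Safe w s ∧ 1 < 2 ^ w := Iff.rfl
@[simp] theorem cost_num : Expr.cost ofNat(n) = 1 := rfl
@[simp] theorem cost_const : Expr.cost (.const n) = 1 := rfl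
@[simp] theorem cost_reg : Expr.cost (.reg n) = 1 := rfl
@[simp] theorem cost_load : Expr.cost (.load a) = a.cost + 1 := rfl
@[simp] theorem cost_add : Expr.cost (a + b) = a.cost + b.cost + 1 := rfl
@[simp] theorem cost_sub : Expr.cost (a - b) = a.cost + b.cost + 1 := rfl
@[simp] theorem cost_mul : Expr.cost (a * b) = a.cost + b.cost + 1 := rfl
@[simp] theorem cost_div : Expr.cost (a / b) = a.cost + b.cost + 1 := rfl
@[simp] theorem cost_mod : Expr.cost (a % b) = a.cost + b.cost + 1 := rfl
@[simp] theorem cost_bin (o : BinOp) : Expr.cost (.bin o a b) = a.cost + b.cost + 1 := rfl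

end simps

/-- The state after an assignment to a register. -/
def State.set (s : State) (x v : ℕ) : State := ⟨Function.update s.reg x v, s.mem⟩

/-- The state after an assignment to a memory cell. -/
def State.put (s : State) (a v : ℕ) : State := ⟨s.reg, Function.update s.mem a v⟩

@[simp] theorem State.set_reg (s : State) (x v y : ℕ) :
    (s.set x v).reg y = if y = x then v else s.reg y := by
  simp [State.set, Function.update_apply]

@[simp] theorem State.set_mem (s : State) (x v : ℕ) : (s.set x v).mem = s.mem := rfl

@[simp] theorem State.put_reg (s : State) (a v : ℕ) : (s.put a v).reg = s.reg := rfl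

@[simp] theorem State.put_mem (s : State) (a v : ℕ) : (s.put a v).mem = Function.update s.mem a v := rfl

/-! ### Sufficient preconditions and the timing of loops -/

section wp
variable {c : ℕ} (w : ℕ) (O : Subroutines c)

/-- A sufficient condition for a program to halt, after a time and in a state that satisfy `Q`. -/
def wp : Prog → (ℕ → State → Prop) → State → Prop
  | .skip, Q, s => Q 1 s
  | .set x e, Q, s => e.Safe w s ∧ Q (e.cost + 1) (s.set x (e.val s))
  | .store d e, Q, s => d.Safe w s ∧ e.Safe w s ∧ Q (d.cost + e.cost + 1) (s.put (d.val s) (e.val s))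
  | .callF d a, Q, s => d.Safe w s ∧ a.Safe w s ∧ Q (d.cost + a.cost + O.timeF + 1)
        ⟨s.reg, writeBlock w s.mem (d.val s) (O.f (a.val s))⟩
  | .callH d a b, Q, s => d.Safe w s ∧ a.Safe w s ∧ b.Safe w s ∧
      Q (d.cost + a.cost + b.cost + O.timeH + 1)
        ⟨s.reg, writeBlock w s.mem (d.val s)
          (O.h (readBlock c s.mem (a.val s)) (readBlock c s.mem (b.val s)))⟩
  | .seq p q, Q, s => wp p (fun t s₁ => wp q (fun t' s₂ => Q (t + t') s₂) s₁) s
  | .ite e p q, Q, s => e.Safe w s ∧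
      (e.val s ≠ 0 → wp p (fun t s₁ => Q (e.cost + 1 + t) s₁) s) ∧
      (e.val s = 0 → wp q (fun t s₁ => Q (e.cost + 1 + t) s₁) s)
  | .loop e p, Q, s => ∃ t s', Exec w O (.loop e p) s t s' ∧ Q t s'

variable {w O}

/-- Straight-line code and branches follow the rules of `Exec`. For a loop the condition already
contains an execution, which `wp_loop` or `Iter.exec` has to supply. -/
theorem wp_sound {p : Prog} {Q : ℕ → State → Prop} {s : State} (h : wp w O p Q s) :
    ∃ t s', Exec w O p s t s' ∧ Q t s' := by
  induction p generalizing Q s with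
  | skip => exact ⟨_, _, .skip s, h⟩
  | set x e =>
    refine ⟨_, _, .set x e s, ?_⟩
    rw [Expr.eval_eq_val h.1]; exact h.2
  | store d e =>
    refine ⟨_, _, .store d e s, ?_⟩
    rw [Expr.eval_eq_val h.1, Expr.eval_eq_val h.2.1]; exact h.2.2
  | callF d a =>
    refine ⟨_, _, .callF d a s, ?_⟩
    rw [Expr.eval_eq_val h.1, Expr.eval_eq_val h.2.1]; exact h.2.2
  | callH d a b =>
    refine ⟨_, _, .callH d a b s, ?_⟩
    rw [Expr.eval_eq_val h.1, Expr.eval_eq_val h.2.1, Expr.eval_eq_val h.2.2.1]; exact h.2.2.2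
  | seq p q ihp ihq =>
    obtain ⟨t, s₁, h1, h2⟩ := ihp h
    obtain ⟨t', s₂, h3, h4⟩ := ihq h2
    exact ⟨_, _, .seq h1 h3, h4⟩
  | ite e p q ihp ihq =>
    by_cases he : e.val s = 0
    · obtain ⟨t, s₁, h1, h2⟩ := ihq (h.2.2 he)
      exact ⟨_, _, .ite_false (by rw [Expr.eval_eq_val h.1, he]) h1, h2⟩
    · obtain ⟨t, s₁, h1, h2⟩ := ihp (h.2.1 he)
      exact ⟨_, _, .ite_true (by rwa [Expr.eval_eq_val h.1]) h1, h2⟩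
  | loop e p ih => exact h

theorem wp_mono {p : Prog} {Q Q' : ℕ → State → Prop} {s : State} (h : wp w O p Q s)
    (hQ : ∀ t s', Q t s' → Q' t s') : wp w O p Q' s := by
  induction p generalizing Q Q' s with
  | skip => exact hQ _ _ h
  | set x e => exact ⟨h.1, hQ _ _ h.2⟩
  | store d e => exact ⟨h.1, h.2.1, hQ _ _ h.2.2⟩
  | callF d a => exact ⟨h.1, h.2.1, hQ _ _ h.2.2⟩
  | callH d a b => exact ⟨h.1, h.2.1, h.2.2.1, hQ _ _ h.2.2.2⟩
  | seq p q ihp ihq =>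
    exact ihp h fun t s₁ h1 => ihq h1 fun t' s₂ h2 => hQ _ _ h2
  | ite e p q ihp ihq =>
    exact ⟨h.1, fun he => ihp (h.2.1 he) fun t s₁ h1 => hQ _ _ h1,
      fun he => ihq (h.2.2 he) fun t s₁ h1 => hQ _ _ h1⟩
  | loop e p ih =>
    obtain ⟨t, s', h1, h2⟩ := h
    exact ⟨t, s', h1, hQ _ _ h2⟩

/-- The rule for loops that make at most `N` rounds. -/
theorem wp_loop {e : Expr} {p : Prog} (I : ℕ → State → Prop) (T : ℕ)
    (step : ∀ n s, I n s → e.Safe w s ∧ (e.val s ≠ 0 →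
      ∃ n', n = n' + 1 ∧ wp w O p (fun t s' => t ≤ T ∧ I n' s') s))
    {N : ℕ} {s : State} (h0 : I N s) {Q : ℕ → State → Prop}
    (hQ : ∀ t s' n, t ≤ (N + 1) * (T + e.cost + 1) → I n s' → e.val s' = 0 → Q t s') :
    wp w O (.loop e p) Q s := by
  induction N generalizing s Q with
  | zero =>
    obtain ⟨hs, h⟩ := step _ _ h0
    by_cases he : e.val s = 0
    · exact ⟨_, _, .loop_false (by rw [Expr.eval_eq_val hs, he]), hQ _ _ 0 (by omega) h0 he⟩
    · obtain ⟨n', hn, _⟩ := h he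
      omega
  | succ N ih =>
    obtain ⟨hs, h⟩ := step _ _ h0
    by_cases he : e.val s = 0
    · refine ⟨_, _, .loop_false (by rw [Expr.eval_eq_val hs, he]), hQ _ _ _ ?_ h0 he⟩
      rw [add_mul]; omega
    · obtain ⟨n', hn, hw⟩ := h he
      obtain rfl : N = n' := by omega
      obtain ⟨t, s₁, h1, ht, hI⟩ := wp_sound hw
      obtain ⟨t', s₂, h3, h4⟩ := ih (s := s₁) hI
        (Q := fun t' s' => Q (e.cost + 1 + t + t') s') (fun t' s' n ht' hI' he' => by
          refine hQ _ _ n ?_ hI' he'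
          rw [add_mul (N + 1) 1]; omega)
      exact ⟨_, _, .loop_true (by rwa [Expr.eval_eq_val hs]) h1 h3, h4⟩

/-- The loop body has been executed some number of times, with a true condition each time. -/
inductive Iter (w : ℕ) (O : Subroutines c) (e : Expr) (p : Prog) : State → ℕ → State → Prop
  | refl (s : State) : Iter w O e p s 0 s
  | step {s s₁ s₂ : State} {t t' : ℕ} (he : e.eval w s ≠ 0) (hp : Exec w O p s t s₁)
      (h : Iter w O e p s₁ t' s₂) : Iter w O e p s (e.cost + 1 + t + t') s₂

/-- This composition is the purpose of `Iter`: during a query, the treatment of one stack entry is a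
stretch of rounds of a single loop, and the recursion over the tree glues such stretches together.
-/
theorem Iter.trans {e : Expr} {p : Prog} {s s₁ s₂ : State} {t t' : ℕ}
    (h : Iter w O e p s t s₁) (h' : Iter w O e p s₁ t' s₂) : Iter w O e p s (t + t') s₂ := by
  induction h with
  | refl => simpa using h'
  | step he hp _ ih =>
    have := Iter.step he hp (ih h')
    rwa [← add_assoc] at this

theorem Iter.exec {e : Expr} {p : Prog} {s s' : State} {t : ℕ} (h : Iter w O e p s t s')
    (he : e.eval w s' = 0) : Exec w O (.loop e p) s (t + (e.cost + 1)) s' := by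
  induction h with
  | refl => simpa using Exec.loop_false he
  | step he' hp _ ih =>
    have := Exec.loop_true he' hp (ih he)
    rwa [← add_assoc] at this

end wp

/-- A sequence of programs. -/
infixr:60 " ;; " => Prog.seq

/-- Register contents as an expression. -/
local notation "R" => Expr.reg

/-- Memory contents as an expression. -/
local notation "M" => Expr.load

/-! # Combining values of the composable function -/

/-- The subroutines compute a composable function, given by the blocks that hold its values. -/
structure Composes {c σ : ℕ} (w : ℕ) (O : Subroutines c) (val : List (Fin σ) → Fin c → ℕ) :
    Prop where
  f_eq : ∀ a : Fin σ, O.f a = val [a]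
  h_eq : ∀ X Y, O.h (val X) (val Y) = val (X ++ Y)
  lt : ∀ X k, val X k < 2 ^ w
  pos : 1 ≤ O.timeH

/-- The pointer `a` represents the string `Y`, where `0` is the pointer for the empty string. -/
def Holds {c σ : ℕ} (val : List (Fin σ) → Fin c → ℕ) (m : ℕ → ℕ) (a : ℕ) (Y : List (Fin σ)) :
    Prop := (a = 0 ∧ Y = []) ∨ (a ≠ 0 ∧ readBlock c m a = val Y)

/-- Given pointers to values of `Y` and `X` in registers 40, 41 and `k` in register 42, compute the
value of `X ^ k ++ Y`, where registers 43 and 44 point to blocks for the result and for powers. -/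
def prependBody : Prog :=
  .ite (R 42 % 2) (.callH (R 43) (R 41) (R 40) ;; .set 40 (R 43)) .skip ;;
  .callH (R 44) (R 41) (R 41) ;; .set 41 (R 44) ;; .set 42 (R 42 / 2)

/-- Prepend a power of a string, by `prependBody`. -/
def prepend : Prog :=
  .ite (R 42) (.ite (R 40) .skip (.set 40 (R 41) ;; .set 42 (R 42 - 1)) ;;
    .loop (R 42) prependBody) .skip

/-! ### Blocks of words, and powers by repeated squaring -/

section blocks
variable {c w : ℕ} {m m' : ℕ → ℕ} {a x : ℕ} {b : Fin c → ℕ}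

theorem writeBlock_of_ne (h : ∀ i < c, x ≠ a + i) : writeBlock w m a b x = m x := by
  unfold writeBlock
  split
  · rename_i hx
    exact absurd (by omega) (h (x - a) hx.2.1)
  · rfl

theorem readBlock_congr (h : ∀ i < c, m' (a + i) = m (a + i)) :
    readBlock c m' a = readBlock c m a := by
  funext k
  exact h k k.2

theorem readBlock_writeBlock (hb : ∀ k, b k < 2 ^ w) (ha : a + c ≤ 2 ^ w) :
    readBlock c (writeBlock w m a b) a = b := by
  funext k
  have hk := k.2
  have hx : a ≤ a + (k : ℕ) ∧ a + (k : ℕ) - a < c ∧ a + (k : ℕ) < 2 ^ w := by omega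
  simp only [readBlock, writeBlock, hx, and_self, dite_true]
  rw [Nat.mod_eq_of_lt (hb _)]
  congr
  simp

end blocks

section prepend
variable {c σ w : ℕ} {O : Subroutines c} {val : List (Fin σ) → Fin c → ℕ}

theorem Holds.congr {m m' : ℕ → ℕ} {a : ℕ} {Y : List (Fin σ)} (h : Holds val m a Y)
    (hm : ∀ i < c, m' (a + i) = m (a + i)) : Holds val m' a Y := by
  rcases h with h | ⟨h, h'⟩
  · exact Or.inl h
  · exact Or.inr ⟨h, by rw [readBlock_congr hm, h']⟩

theorem replicate_flatten_double {α : Type*} (X : List α) (k : ℕ) :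
    (List.replicate k (X ++ X)).flatten = (List.replicate (2 * k) X).flatten := by
  induction k with
  | zero => rfl
  | succ k ih =>
    rw [show 2 * (k + 1) = 2 * k + 1 + 1 by ring, List.replicate_succ, List.replicate_succ,
      List.replicate_succ]
    simp [ih]

theorem replicate_flatten_succ' {α : Type*} (X : List α) (k : ℕ) :
    (List.replicate (k + 1) X).flatten = (List.replicate k X).flatten ++ X := by
  rw [List.replicate_succ']; simp

/-- The product is written before the square is computed, so the block of `X` must be disjoint from
the destination. The operands may otherwise coincide with the blocks that are written, because a
call reads its arguments before it writes: `Z` may stand in the destination, and `X` in the scratch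
block. -/
theorem wp_prependBody (hO : Composes w O val) (hw : 10 ≤ 2 ^ w) {s : State} {X Z : List (Fin σ)}
    {Q : ℕ → State → Prop} (hk : s.reg 42 < 2 ^ w)
    (hZ : s.reg 40 ≠ 0 ∧ readBlock c s.mem (s.reg 40) = val Z) (hZs : s.reg 40 + c ≤ s.reg 44)
    (hX : readBlock c s.mem (s.reg 41) = val X)
    (hXd : ∀ i < c, ∀ j < c, s.reg 41 + i ≠ s.reg 43 + j)
    (hD : s.reg 43 ≠ 0) (hDs : s.reg 43 + c ≤ s.reg 44) (hS : s.reg 44 + c ≤ 2 ^ w)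
    (hQ : ∀ t s', t ≤ 30 * O.timeH →
      s'.reg 40 ≠ 0 ∧ readBlock c s'.mem (s'.reg 40) =
        val ((List.replicate (s.reg 42 % 2) X).flatten ++ Z) →
      s'.reg 41 = s.reg 44 → readBlock c s'.mem (s.reg 44) = val (X ++ X) →
      s'.reg 42 = s.reg 42 / 2 → (s'.reg 40 = s.reg 40 ∨ s'.reg 40 = s.reg 43) →
      (∀ x, (∀ i < c, x ≠ s.reg 43 + i) → (∀ i < c, x ≠ s.reg 44 + i) → s'.mem x = s.mem x) →
      (∀ x, x < 40 ∨ x = 43 ∨ x = 44 → s'.reg x = s.reg x) → Q t s') :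
    wp w O prependBody Q s := by
  have hpos := hO.pos
  have key : readBlock c (writeBlock w s.mem (s.reg 43) (val (X ++ Z))) (s.reg 41) =
      val X := by
    rw [readBlock_congr fun i hi => writeBlock_of_ne (hXd i hi), hX]
  simp [prependBody, wp, State.set_reg, State.set_mem, hX, hZ.2, hk, hO.h_eq, key]
  refine ⟨by omega, fun h1 => ⟨by omega, ?_⟩, fun h0 => ⟨by omega, ?_⟩⟩
  · apply hQ
    · omega
    · simp only [State.set_reg, State.set_mem]
      refine ⟨by simpa using hD, ?_⟩
      simp only [Nat.reduceEqDiff, if_false, if_true, h1]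
      rw [readBlock_congr (m := writeBlock w s.mem (s.reg 43) (val (X ++ Z)))
        (fun i hi => writeBlock_of_ne fun j hj => by omega),
        readBlock_writeBlock (hO.lt _) (by omega)]
      simp
    · simp [State.set_reg]
    · simp only [State.set_mem]
      rw [readBlock_writeBlock (hO.lt _) (by omega)]
    · simp [State.set_reg]
    · simp [State.set_reg]
    · intro x hx hx'
      simp only [State.set_mem]
      rw [writeBlock_of_ne hx', writeBlock_of_ne hx]
    · intro x hx
      simp only [State.set_reg]
      grind
  · apply hQ
    · omega
    · simp only [State.set_reg, State.set_mem]
      simp only [Nat.reduceEqDiff, if_false, h0]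
      refine ⟨hZ.1, ?_⟩
      rw [readBlock_congr (m := s.mem)
        (fun i hi => writeBlock_of_ne fun j hj => by omega)]
      simp [hZ.2]
    · simp [State.set_reg]
    · simp only [State.set_mem]
      rw [readBlock_writeBlock (hO.lt _) (by omega)]
    · simp [State.set_reg]
    · simp [State.set_reg]
    · intro x hx hx'
      simp only [State.set_mem]
      rw [writeBlock_of_ne hx']
    · intro x hx
      simp only [State.set_reg]
      grind

/-- Repeated squaring: a round replaces `X` by `X ++ X` and halves the exponent, after one copy has
been moved to `Y` if the exponent was odd. This gives at most `log k + 1` rounds with two calls of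
`h` each. -/
theorem wp_prepend (hO : Composes w O val) (hw : 10 ≤ 2 ^ w) {s : State} {X Y : List (Fin σ)}
    {Q : ℕ → State → Prop} (hk : s.reg 42 < 2 ^ w)
    (hY : Holds val s.mem (s.reg 40) Y) (hYs : s.reg 40 + c ≤ s.reg 44)
    (hX : s.reg 42 ≠ 0 → s.reg 41 ≠ 0 ∧ readBlock c s.mem (s.reg 41) = val X ∧
      s.reg 41 + c ≤ s.reg 44 ∧ ∀ i < c, ∀ j < c, s.reg 41 + i ≠ s.reg 43 + j)
    (hD : s.reg 43 ≠ 0) (hDs : s.reg 43 + c ≤ s.reg 44) (hS : s.reg 44 + c ≤ 2 ^ w)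
    (hQ : ∀ t s', t ≤ 100 * O.timeH * (Nat.log 2 (s.reg 42) + 1) →
      Holds val s'.mem (s'.reg 40) ((List.replicate (s.reg 42) X).flatten ++ Y) →
      (s'.reg 40 = s.reg 40 ∨ s.reg 42 ≠ 0 ∧ s'.reg 40 = s.reg 41 ∨ s'.reg 40 = s.reg 43) →
      (∀ x, (∀ i < c, x ≠ s.reg 43 + i) → (∀ i < c, x ≠ s.reg 44 + i) → s'.mem x = s.mem x) →
      (∀ x, x < 40 ∨ x = 43 ∨ x = 44 → s'.reg x = s.reg x) → Q t s') :
    wp w O prepend Q s := by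
  have hpos := hO.pos
  by_cases h42 : s.reg 42 = 0
  · simp only [prepend, wp, val_reg, safe_reg, h42, true_and]
    refine ⟨fun h => absurd rfl h, fun _ => hQ _ _ ?_ ?_ (Or.inl rfl) (fun _ _ _ => rfl)
      fun _ _ => rfl⟩
    · simp [h42]; omega
    · simpa [h42] using hY
  obtain ⟨hp, hX1, hXs, hXd⟩ := hX h42
  -- The loop, for a start value that is present. Its invariant is that `X' ^ k' ++ Z'` does not
  -- change, where `X'`, `k'`, `Z'` are the current base, exponent and accumulated string.
  have main : ∀ (s₁ : State) (Z : List (Fin σ)) (Q : ℕ → State → Prop),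
      s₁.mem = s.mem → (∀ x, x < 40 ∨ x = 43 ∨ x = 44 → s₁.reg x = s.reg x) →
      s₁.reg 41 = s.reg 41 → s₁.reg 42 ≤ s.reg 42 →
      (s₁.reg 40 = s.reg 40 ∨ s₁.reg 40 = s.reg 41) →
      s₁.reg 40 ≠ 0 ∧ readBlock c s₁.mem (s₁.reg 40) = val Z →
      (∀ t s', t ≤ 70 * O.timeH * (Nat.log 2 (s.reg 42) + 1) →
        s'.reg 40 ≠ 0 ∧ readBlock c s'.mem (s'.reg 40) =
          val ((List.replicate (s₁.reg 42) X).flatten ++ Z) →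
        (s'.reg 40 = s₁.reg 40 ∨ s'.reg 40 = s.reg 43) →
        (∀ x, (∀ i < c, x ≠ s.reg 43 + i) → (∀ i < c, x ≠ s.reg 44 + i) → s'.mem x = s.mem x) →
        (∀ x, x < 40 ∨ x = 43 ∨ x = 44 → s'.reg x = s.reg x) → Q t s') →
      wp w O (.loop (R 42) prependBody) Q s₁ := by
    intro s₁ Z Q hm hr h41 h42' h40 hZ hQ
    refine wp_loop (fun n s' => s'.reg 42 < 2 ^ n ∧ s'.reg 42 < 2 ^ w ∧ ∃ X' Z',
        (s'.reg 40 ≠ 0 ∧ readBlock c s'.mem (s'.reg 40) = val Z') ∧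
        s'.reg 40 + c ≤ s.reg 44 ∧
        readBlock c s'.mem (s'.reg 41) = val X' ∧
        (∀ i < c, ∀ j < c, s'.reg 41 + i ≠ s.reg 43 + j) ∧
        (List.replicate (s'.reg 42) X').flatten ++ Z' =
          (List.replicate (s₁.reg 42) X).flatten ++ Z ∧
        (s'.reg 40 = s₁.reg 40 ∨ s'.reg 40 = s.reg 43) ∧
        (∀ x, (∀ i < c, x ≠ s.reg 43 + i) → (∀ i < c, x ≠ s.reg 44 + i) →
          s'.mem x = s.mem x) ∧
        (∀ x, x < 40 ∨ x = 43 ∨ x = 44 → s'.reg x = s.reg x)) (30 * O.timeH) ?_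
        (N := Nat.log 2 (s.reg 42) + 1) ?_ ?_
    · rintro n s' ⟨hn, hlt, X', Z', hZ', hZs, hX', hXd', heq, h40', hm', hr'⟩
      refine ⟨trivial, fun hne => ?_⟩
      simp only [val_reg] at hne
      have h43 := hr' 43 (by simp)
      have h44 := hr' 44 (by simp)
      obtain ⟨n', rfl⟩ : ∃ n', n = n' + 1 := by
        cases n with
        | zero => simp at hn; omega
        | succ n' => exact ⟨n', rfl⟩
      refine ⟨n', rfl, ?_⟩
      refine wp_prependBody hO hw hlt hZ' (by omega) hX' (by rwa [h43]) (by rwa [h43]) (by omega)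
        (by omega) ?_
      intro t s'' ht g40 g41 gX g42 g40' gm gr
      refine ⟨ht, ?_, ?_, X' ++ X', _, g40, ?_, by rw [g41]; exact gX, ?_, ?_, ?_, ?_, ?_⟩
      · rw [g42]; rw [pow_succ] at hn; omega
      · rw [g42]; omega
      · rcases g40' with h | h <;> omega
      · intro i hi j hj; omega
      · rw [← heq, g42, replicate_flatten_double]
        conv_rhs => rw [← Nat.div_add_mod (s'.reg 42) 2, List.replicate_add, List.flatten_append]
        rw [List.append_assoc]
      · rcases g40' with h | h
        · rw [h]; exact h40'
        · rw [h, h43]; exact Or.inr rfl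
      · intro x hx hx'
        rw [gm x (by rwa [h43]) (by rwa [h44]), hm' x hx hx']
      · intro x hx
        rw [gr x hx, hr' x hx]
    · refine ⟨lt_of_le_of_lt h42' (Nat.lt_pow_succ_log_self (by norm_num) _), by omega, X, Z, hZ,
        ?_, ?_, ?_, rfl, Or.inl rfl, fun x _ _ => by rw [hm], hr⟩
      · rcases h40 with h | h <;> omega
      · rw [hm, h41]; exact hX1
      · rw [h41]; exact hXd
    · rintro t s' n ht ⟨-, -, X', Z', hZ', -, -, -, heq, h40', hm', hr'⟩ he
      simp only [val_reg] at he
      rw [he] at heq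
      simp only [List.replicate_zero, List.flatten_nil, List.nil_append] at heq
      refine hQ t s' (ht.trans ?_) ⟨hZ'.1, by rw [hZ'.2, heq]⟩ h40' hm' hr'
      simp only [cost_reg]
      generalize Nat.log 2 (s.reg 42) = L
      nlinarith
  have hT : O.timeH ≤ O.timeH * (Nat.log 2 (s.reg 42) + 1) := Nat.le_mul_of_pos_right _ (by omega)
  simp only [prepend, wp, val_reg, safe_reg, h42, true_and]
  refine ⟨fun _ => ⟨fun h40 => ?_, fun h40 => ?_⟩, fun h => absurd h id⟩
  · rcases hY with ⟨h, _⟩ | hY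
    · exact absurd h h40
    refine main s Y _ rfl (fun _ _ => rfl) rfl le_rfl (Or.inl rfl) hY ?_
    intro t s' ht g40 g40' gm gr
    refine hQ _ _ ?_ (Or.inr g40) (by tauto) gm gr
    simp only [cost_reg]; nlinarith
  -- No subroutine provides the value of the empty string. If `Y` is empty, one copy of `X` becomes
  -- the start value and the exponent drops by one.
  · rcases hY with ⟨_, rfl⟩ | ⟨h, _⟩
    swap
    · exact absurd h40 h
    simp only [safe_sub, safe_reg, safe_num, val_reg, true_and, State.set_reg, val_sub, val_num]
    refine ⟨⟨by omega, hk⟩, ?_⟩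
    refine main _ X _ rfl ?_ ?_ ?_ ?_ ?_ ?_
    · intro x hx; simp only [State.set_reg]; grind
    · simp [State.set_reg]
    · simp [State.set_reg]
    · simp [State.set_reg]
    · simp [State.set_reg, State.set_mem, hp, hX1]
    intro t s' ht g40 g40' gm gr
    refine hQ _ _ ?_ (Or.inr ⟨g40.1, ?_⟩) ?_ gm gr
    · simp only [cost_reg, cost_sub, cost_num]; nlinarith
    · rw [g40.2]
      have h1 := replicate_flatten_succ' X (s.reg 42 - 1)
      rw [Nat.sub_add_cancel (by omega)] at h1
      simp [State.set_reg, h1]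
    · simp only [State.set_reg] at g40'
      simp at g40'
      tauto

end prepend

end WordRAM

namespace RLSLP

/-! # Occurrences and symmetric centroid paths -/

variable {σ : ℕ} (G : RLSLP σ)

/-- How often `B` occurs in the rule of `A`. -/
def mult (A B : Fin G.numVars) : ℕ :=
  match G.rule A with
  | .term _ => 0
  | .pair C D => (if B = C then 1 else 0) + if B = D then 1 else 0
  | .run C t => if B = C then t else 0

/-- The length of the expansion of a variable. -/
noncomputable def len (A : Fin G.numVars) : ℕ := (G.expand A).length

variable {G}

theorem mult_eq_zero {A B : Fin G.numVars} (h : ¬ (G.rule A).Mentions B) : G.mult A B = 0 := by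
  unfold mult
  cases hr : G.rule A <;> simp only [hr, RLRule.Mentions, not_or] at h ⊢ <;> simp [h]

theorem mult_pos {A B : Fin G.numVars} (h : (G.rule A).Mentions B) : 0 < G.mult A B := by
  unfold mult
  cases hr : G.rule A with
  | term a => simp [hr, RLRule.Mentions] at h
  | pair C D =>
    simp only [hr, RLRule.Mentions] at h
    rcases h with h | h <;> simp [h]
  | run C t =>
    simp only [hr, RLRule.Mentions] at h
    have := G.three_le A C t hr
    simp [h]; omega

theorem mult_pair {A C D : Fin G.numVars} (h : G.rule A = .pair C D) (B : Fin G.numVars) :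
    G.mult A B = (if B = C then 1 else 0) + if B = D then 1 else 0 := by
  simp only [mult, h]

theorem mult_run {A C : Fin G.numVars} {t : ℕ} (h : G.rule A = .run C t) (B : Fin G.numVars) :
    G.mult A B = if B = C then t else 0 := by
  simp only [mult, h]

theorem mult_term {A : Fin G.numVars} {a : Fin σ} (h : G.rule A = .term a) (B : Fin G.numVars) :
    G.mult A B = 0 := by
  simp only [mult, h]

theorem expand_term {A : Fin G.numVars} {a : Fin σ} (h : G.rule A = .term a) :
    G.expand A = [a] := by
  rw [expand_eq, h]

theorem expand_pair {A C D : Fin G.numVars} (h : G.rule A = .pair C D) :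
    G.expand A = G.expand C ++ G.expand D := by
  rw [expand_eq, h]

theorem expand_run {A C : Fin G.numVars} {t : ℕ} (h : G.rule A = .run C t) :
    G.expand A = (List.replicate t (G.expand C)).flatten := by
  rw [expand_eq, h]

theorem len_term {A : Fin G.numVars} {a : Fin σ} (h : G.rule A = .term a) : G.len A = 1 := by
  rw [len, expand_term h]; rfl

theorem len_pair {A C D : Fin G.numVars} (h : G.rule A = .pair C D) :
    G.len A = G.len C + G.len D := by
  rw [len, expand_pair h, List.length_append]; rfl

theorem len_run {A C : Fin G.numVars} {t : ℕ} (h : G.rule A = .run C t) :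
    G.len A = t * G.len C := by
  rw [len, expand_run h]; simp [len]

/-- Equality holds for pairs and runs; only a terminal rule loses its single symbol. -/
theorem sum_mult_mul_len_le (A : Fin G.numVars) : ∑ C, G.mult A C * G.len C ≤ G.len A := by
  cases hr : G.rule A with
  | term a => simp [mult_term hr]
  | pair C D => simp [mult_pair hr, len_pair hr, add_mul, Finset.sum_add_distrib]
  | run C t => simp [mult_run hr, len_run hr]

theorem len_pos (A : Fin G.numVars) : 0 < G.len A := by
  induction A using G.wf.induction with
  | _ A ih =>
    cases hr : G.rule A with
    | term a => simp [len_term hr]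
    | pair C D =>
      have := ih C (by simp [hr, RLRule.Mentions])
      rw [len_pair hr]; omega
    | run C t =>
      have := ih C (by simp [hr, RLRule.Mentions])
      have := G.three_le A C t hr
      rw [len_run hr]; positivity

/-! ### Counting nodes of the derivation tree -/

variable (G) in
open Classical in
/-- The number of nodes with label `B` in the derivation tree of `A`. -/
noncomputable def occIn (B : Fin G.numVars) : Fin G.numVars → ℕ :=
  G.wf.fix fun A ih => (if A = B then 1 else 0) +
    ∑ C, if h : (G.rule A).Mentions C then G.mult A C * ih C h else 0

theorem occIn_eq (B A : Fin G.numVars) :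
    G.occIn B A = (if A = B then 1 else 0) + ∑ C, G.mult A C * G.occIn B C := by
  classical
  rw [occIn, G.wf.fix_eq]
  congr 1
  refine Finset.sum_congr rfl fun C _ => ?_
  split_ifs with h
  · rfl
  · rw [mult_eq_zero h, zero_mul]

/-- Paths from `A` to `B` are counted by their last edge instead of their first. This form computes
`occ` from the start variable downwards, as the topological search does. -/
theorem occIn_parents (B A : Fin G.numVars) :
    G.occIn B A = (if A = B then 1 else 0) + ∑ D, G.mult D B * G.occIn D A := by
  induction A using G.wf.induction with
  | _ A ih =>
    have h1 : ∑ C, G.mult A C * G.occIn B C =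
        ∑ C, G.mult A C * ((if C = B then 1 else 0) + ∑ D, G.mult D B * G.occIn D C) := by
      refine Finset.sum_congr rfl fun C _ => ?_
      by_cases h : (G.rule A).Mentions C
      · rw [ih C h]
      · simp [mult_eq_zero h]
    rw [occIn_eq, h1]
    congr 1
    simp only [fun D => occIn_eq (G := G) D A, mul_add, Finset.sum_add_distrib, mul_ite, mul_one,
      mul_zero, Finset.sum_ite_eq, Finset.sum_ite_eq', Finset.mem_univ, if_true, Finset.mul_sum]
    rw [Finset.sum_comm]
    congr 1
    refine Finset.sum_congr rfl fun D _ => Finset.sum_congr rfl fun C _ => by ring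

theorem reaches_of_occIn {B A : Fin G.numVars} (h : G.occIn B A ≠ 0) :
    A = B ∨ Relation.TransGen (fun B A => (G.rule A).Mentions B) B A := by
  induction A using G.wf.induction with
  | _ A ih =>
    by_cases hAB : A = B
    · exact Or.inl hAB
    rw [occIn_eq, if_neg hAB, zero_add] at h
    obtain ⟨C, -, hC⟩ := Finset.exists_ne_zero_of_sum_ne_zero h
    have hm : (G.rule A).Mentions C := by
      by_contra hm
      simp [mult_eq_zero hm] at hC
    rcases ih C hm (fun h0 => by simp [h0] at hC) with rfl | h
    · exact Or.inr (.single hm)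
    · exact Or.inr (h.tail hm)

/-- Nodes with the same label are never nested, so the factors of `exp(A)` below them are disjoint.
-/
theorem occIn_mul_len_le (B A : Fin G.numVars) : G.occIn B A * G.len B ≤ G.len A := by
  induction A using G.wf.induction with
  | _ A ih =>
    rw [occIn_eq]
    split_ifs with hAB
    -- Below a node labelled `A` the label `A` does not return, so the root is the only occurrence.
    · have h0 : ∑ C, G.mult A C * G.occIn B C = 0 := by
        refine Finset.sum_eq_zero fun C _ => ?_
        by_contra hC
        have hm : (G.rule A).Mentions C := by
          by_contra hm
          simp [mult_eq_zero hm] at hC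
        rcases reaches_of_occIn (fun h0 => hC (by rw [h0, mul_zero])) with rfl | h
        · subst hAB; exact G.acyclic A (.single hm)
        · subst hAB; exact G.acyclic A (h.tail hm)
      rw [h0, hAB]; simp
    · rw [zero_add, Finset.sum_mul]
      refine le_trans (Finset.sum_le_sum fun C _ => ?_) (sum_mult_mul_len_le A)
      by_cases h : (G.rule A).Mentions C
      · rw [mul_assoc]; exact Nat.mul_le_mul_left _ (ih C h)
      · simp [mult_eq_zero h]

variable (G) in
/-- The number of nodes with label `B` in the derivation tree. -/
noncomputable def occ (B : Fin G.numVars) : ℕ := G.occIn B G.start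

theorem occ_eq (B : Fin G.numVars) :
    G.occ B = (if G.start = B then 1 else 0) + ∑ D, G.mult D B * G.occ D := occIn_parents _ _

theorem occ_mul_len_le (B : Fin G.numVars) : G.occ B * G.len B ≤ G.text.length :=
  occIn_mul_len_le _ _

theorem occ_le (B : Fin G.numVars) : G.occ B ≤ G.text.length :=
  le_trans (Nat.le_mul_of_pos_right _ (len_pos B)) (occ_mul_len_le B)

theorem mult_mul_occ_le (A B : Fin G.numVars) : G.mult A B * G.occ A ≤ G.occ B := by
  rw [occ_eq B]
  exact le_trans (Finset.single_le_sum (f := fun D => G.mult D B * G.occ D)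
    (fun _ _ => Nat.zero_le _) (Finset.mem_univ A)) (Nat.le_add_left _ _)

theorem occ_pos_of_mentions {A B : Fin G.numVars} (h : (G.rule A).Mentions B) (hA : 0 < G.occ A) :
    0 < G.occ B :=
  lt_of_lt_of_le (Nat.mul_pos (mult_pos h) hA) (mult_mul_occ_le A B)

theorem occ_le_of_mentions {A B : Fin G.numVars} (h : (G.rule A).Mentions B) :
    G.occ A ≤ G.occ B :=
  le_trans (Nat.le_mul_of_pos_left _ (mult_pos h)) (mult_mul_occ_le A B)

theorem occ_start : 0 < G.occ G.start := by
  rw [occ_eq]; simp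

/-! ### Symmetric centroid paths, their intervals and levels -/

variable (G)

noncomputable def lw (A : Fin G.numVars) : ℕ := Nat.log 2 (G.len A)
noncomputable def lu (A : Fin G.numVars) : ℕ := Nat.log 2 (G.occ A)

open Classical in
/-- The successor of a variable on its symmetric centroid path. -/
noncomputable def sc (A : Fin G.numVars) : Option (Fin G.numVars) :=
  if G.occ A = 0 then none else
  match G.rule A with
  | .pair B C =>
    if G.lw B = G.lw A ∧ G.lu B = G.lu A then some B
    else if G.lw C = G.lw A ∧ G.lu C = G.lu A then some C else none
  | _ => none

/-- The number of occurrences of the predecessor on the symmetric centroid path, or `0`. -/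
noncomputable def pp (B : Fin G.numVars) : ℕ := ∑ A, if G.sc A = some B then G.occ A else 0

/-- The left end of the interval of a variable on its symmetric centroid path. -/
noncomputable def lo (A : Fin G.numVars) : ℕ :=
  G.pp A * 2 ^ G.lw A + (2 * 2 ^ G.lw A - G.len A) * 2 ^ G.lu A

/-- The right end of the interval of a variable on its symmetric centroid path. -/
noncomputable def hi (A : Fin G.numVars) : ℕ := (G.sc A).elim 0 G.lo

/-- The largest `l` such that the interval of the variable contains a multiple of `2 ^ l`. -/
noncomputable def lam (A : Fin G.numVars) : ℕ :=
  if G.sc A = none then G.lw A + G.lu A + 2 else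
    Nat.findGreatest (fun l => (G.lo A - 1) / 2 ^ l < (G.hi A - 1) / 2 ^ l) (G.lw A + G.lu A + 2)

variable {G}

theorem pow_lw_le (A : Fin G.numVars) : 2 ^ G.lw A ≤ G.len A :=
  Nat.pow_log_le_self 2 (len_pos A).ne'

theorem len_lt (A : Fin G.numVars) : G.len A < 2 * 2 ^ G.lw A := by
  have := Nat.lt_pow_succ_log_self (b := 2) (by norm_num) (G.len A)
  rw [pow_succ] at this
  unfold lw; omega

theorem pow_lu_le {A : Fin G.numVars} (h : 0 < G.occ A) : 2 ^ G.lu A ≤ G.occ A :=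
  Nat.pow_log_le_self 2 h.ne'

theorem occ_lt (A : Fin G.numVars) : G.occ A < 2 * 2 ^ G.lu A := by
  have := Nat.lt_pow_succ_log_self (b := 2) (by norm_num) (G.occ A)
  rw [pow_succ] at this
  unfold lu; omega

/-- If the other child also had length at least `2 ^ lw A`, the two lengths would add up to at least
`2 * 2 ^ lw A`, which exceeds `len A`. In particular the rule is not `A → B B`, and the choice of
the left child in `sc` is never ambiguous. -/
theorem sc_spec {A B : Fin G.numVars} (h : G.sc A = some B) : 0 < G.occ A ∧
    G.lw B = G.lw A ∧ G.lu B = G.lu A ∧ ∃ D, G.lw D < G.lw A ∧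
      (G.rule A = .pair B D ∨ G.rule A = .pair D B) := by
  unfold sc at h
  split at h
  · simp at h
  rename_i h0
  refine ⟨Nat.pos_of_ne_zero h0, ?_⟩
  have key : ∀ C D, G.len C + G.len D = G.len A → G.lw C = G.lw A → G.lw D < G.lw A := by
    intro C D hl hC
    by_contra hD
    have h1 := pow_lw_le C
    have h2 := pow_lw_le D
    have h3 := len_lt A
    have h4 : 2 ^ G.lw A ≤ 2 ^ G.lw D := Nat.pow_le_pow_right (by norm_num) (by omega)
    rw [hC] at h1
    omega
  split at h
  · rename_i C D hr
    have hl := len_pair hr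
    split_ifs at h with h1 h2
    · obtain rfl : C = B := by simpa using h
      exact ⟨h1.1, h1.2, D, key C D hl.symm h1.1, Or.inl hr⟩
    · obtain rfl : D = B := by simpa using h
      exact ⟨h2.1, h2.2, C, key D C (by omega) h2.1, Or.inr hr⟩
  · simp at h

theorem sc_ne_none_left {A B C : Fin G.numVars} (hr : G.rule A = .pair B C) (h : 0 < G.occ A) :
    G.sc A = if G.lw B = G.lw A ∧ G.lu B = G.lu A then some B
      else if G.lw C = G.lw A ∧ G.lu C = G.lu A then some C else none := by
  unfold sc
  rw [if_neg (by omega), hr]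

theorem sc_mentions {A B : Fin G.numVars} (h : G.sc A = some B) : (G.rule A).Mentions B := by
  obtain ⟨-, -, -, D, -, hr | hr⟩ := sc_spec h <;> simp [hr, RLRule.Mentions]

/-- In the sum over parents that gives `occ B`, the parent `A` and the path predecessor are
different terms. -/
theorem pp_add_le {A B : Fin G.numVars} (h : (G.rule A).Mentions B) (hsc : G.sc A ≠ some B) :
    G.occ A + G.pp B ≤ G.occ B := by
  classical
  have h1 : G.occ A + G.pp B =
      ∑ D, ((if D = A then G.occ A else 0) + if G.sc D = some B then G.occ D else 0) := by
    rw [Finset.sum_add_distrib]; simp [pp]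
  rw [h1, occ_eq B]
  refine le_trans (Finset.sum_le_sum fun D _ => ?_) (Nat.le_add_left _ _)
  by_cases hD : D = A
  · subst hD
    simp only [if_true, hsc, if_false, add_zero]
    exact Nat.le_mul_of_pos_left _ (mult_pos h)
  · simp only [hD, if_false, zero_add]
    split_ifs with h2
    · exact Nat.le_mul_of_pos_left _ (mult_pos (sc_mentions h2))
    · exact Nat.zero_le _

theorem pp_le (B : Fin G.numVars) : G.pp B ≤ G.occ B := by
  rw [occ_eq B, pp]
  refine le_trans (Finset.sum_le_sum fun D _ => ?_) (Nat.le_add_left _ _)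
  split_ifs with h2
  · exact Nat.le_mul_of_pos_left _ (mult_pos (sc_mentions h2))
  · exact Nat.zero_le _

/-- Two predecessors would each contribute at least `2 ^ lu B` occurrences to `occ B`, which is less
than `2 * 2 ^ lu B`. -/
theorem sc_inj {A A' B : Fin G.numVars} (h : G.sc A = some B) (h' : G.sc A' = some B) :
    A = A' := by
  classical
  by_contra hne
  have h1 : G.occ A + G.occ A' ≤ G.pp B := by
    have := Finset.sum_le_sum_of_subset (f := fun A => if G.sc A = some B then G.occ A else 0)
      (Finset.subset_univ {A, A'})
    rw [Finset.sum_pair hne, h, h'] at this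
    simpa [pp] using this
  have h2 := pp_le B
  have h3 := occ_lt B
  obtain ⟨hA, -, hl, -⟩ := sc_spec h
  obtain ⟨hA', -, hl', -⟩ := sc_spec h'
  have h4 := pow_lu_le hA
  have h5 := pow_lu_le hA'
  rw [← hl] at h4
  rw [← hl'] at h5
  omega

theorem pp_eq {A B : Fin G.numVars} (h : G.sc A = some B) : G.pp B = G.occ A := by
  rw [pp, Finset.sum_eq_single A]
  · simp [h]
  · intro D _ hD
    rw [if_neg fun h' => hD (sc_inj h' h)]
  · simp

theorem hi_eq {A B : Fin G.numVars} (h : G.sc A = some B) : G.hi A = G.lo B := by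
  simp [hi, h]

/-- The inequality `len A < 2 * 2 ^ lw A` is strict, so left ends are positive and the subtraction
of one in the definition of `lam` is never truncated. -/
theorem lo_pos (A : Fin G.numVars) : 0 < G.lo A := by
  have := len_lt A
  have : 0 < (2 * 2 ^ G.lw A - G.len A) * 2 ^ G.lu A := Nat.mul_pos (by omega) (by positivity)
  unfold lo; omega

/-- The first summand is below `2 * 2 ^ (lw + lu)` since `pp ≤ occ`, the second is at most that.
Both logarithms are constant on a path, so one bound serves all of its intervals. -/
theorem lo_lt (A : Fin G.numVars) : G.lo A < 2 ^ (G.lw A + G.lu A + 2) := by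
  have h1 := lt_of_le_of_lt (pp_le A) (occ_lt A)
  have h2 := len_pos A
  have h3 : (2 * 2 ^ G.lw A - G.len A) * 2 ^ G.lu A ≤ 2 * 2 ^ G.lw A * 2 ^ G.lu A :=
    Nat.mul_le_mul_right _ (Nat.sub_le _ _)
  have h4 : G.pp A * 2 ^ G.lw A < 2 * 2 ^ G.lu A * 2 ^ G.lw A :=
    Nat.mul_lt_mul_of_pos_right h1 (by positivity)
  rw [pow_add, pow_add]
  unfold lo
  nlinarith

theorem pow_add_le_text {A : Fin G.numVars} (h : 0 < G.occ A) :
    2 ^ (G.lw A + G.lu A) ≤ G.text.length := by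
  rw [pow_add, mul_comm]
  exact le_trans (Nat.mul_le_mul (pow_lu_le h) (pow_lw_le A)) (occ_mul_len_le A)

/-- The interval of a variable is at least as long as the expansion of the other variable in its
rule, weighted with the number of occurrences. -/
theorem hi_ge {A B D : Fin G.numVars} (h : G.sc A = some B)
    (hr : G.rule A = .pair B D ∨ G.rule A = .pair D B) :
    G.lo A + (G.occ A - G.pp A) * 2 ^ G.lw A + G.len D * 2 ^ G.lu A = G.hi A := by
  obtain ⟨hA, hw, hu, -⟩ := sc_spec h
  have hl : G.len A = G.len B + G.len D := by
    rcases hr with hr | hr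
    · exact len_pair hr
    · rw [len_pair hr, add_comm]
  have h1 := pp_le A
  have h2 := len_lt A
  rw [hi_eq h, lo, lo, hw, hu, pp_eq h]
  obtain ⟨x, hx⟩ := Nat.exists_eq_add_of_le h1
  obtain ⟨y, hy⟩ := Nat.exists_eq_add_of_le h2.le
  have e1 : 2 * 2 ^ G.lw A - G.len A = y := by omega
  have e2 : 2 * 2 ^ G.lw A - G.len B = y + G.len D := by omega
  rw [e1, e2, hx, Nat.add_sub_cancel_left]
  ring

theorem lo_lt_hi {A B : Fin G.numVars} (h : G.sc A = some B) : G.lo A < G.hi A := by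
  obtain ⟨-, -, -, D, -, hr⟩ := sc_spec h
  have := hi_ge h hr
  have : 0 < G.len D * 2 ^ G.lu A := Nat.mul_pos (len_pos D) (by positivity)
  omega

theorem hi_lt {A B : Fin G.numVars} (h : G.sc A = some B) :
    G.hi A < 2 ^ (G.lw A + G.lu A + 2) := by
  obtain ⟨-, hw, hu, -⟩ := sc_spec h
  rw [hi_eq h, ← hw, ← hu]; exact lo_lt B

theorem lam_none {A : Fin G.numVars} (h : G.sc A = none) : G.lam A = G.lw A + G.lu A + 2 := by
  simp [lam, h]

/-- The bound on the search in `lam` is no restriction: for larger `l` the whole interval lies below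
`2 ^ l`, and both quotients vanish. -/
theorem le_lam {A B : Fin G.numVars} (h : G.sc A = some B) {l : ℕ}
    (hl : (G.lo A - 1) / 2 ^ l < (G.hi A - 1) / 2 ^ l) : l ≤ G.lam A := by
  unfold lam
  rw [if_neg (by simp [h])]
  refine Nat.le_findGreatest ?_ hl
  by_contra hc
  have h1 : G.hi A - 1 < 2 ^ l :=
    lt_of_le_of_lt (Nat.sub_le _ _) (lt_of_lt_of_le (hi_lt h)
      (Nat.pow_le_pow_right (by norm_num) (by omega)))
  rw [Nat.div_eq_of_lt h1] at hl
  exact Nat.not_lt_zero _ hl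

theorem lam_spec {A B : Fin G.numVars} (h : G.sc A = some B) :
    (G.lo A - 1) / 2 ^ G.lam A < (G.hi A - 1) / 2 ^ G.lam A := by
  unfold lam
  rw [if_neg (by simp [h])]
  refine Nat.findGreatest_spec (P := fun l => (G.lo A - 1) / 2 ^ l < (G.hi A - 1) / 2 ^ l)
    (Nat.zero_le _) ?_
  have := lo_lt_hi h
  have := lo_pos A
  simp; omega

theorem lam_lt {A B : Fin G.numVars} (h : G.sc A = some B) :
    G.lam A < G.lw A + G.lu A + 2 := by
  have h1 := lam_spec h
  have h2 := hi_lt h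
  by_contra hc
  have h3 : G.hi A - 1 < 2 ^ G.lam A :=
    lt_of_le_of_lt (Nat.sub_le _ _) (lt_of_lt_of_le h2
      (Nat.pow_le_pow_right (by norm_num) (by omega)))
  rw [Nat.div_eq_of_lt h3] at h1
  exact Nat.not_lt_zero _ h1

theorem lam_le (A : Fin G.numVars) : G.lam A ≤ G.lw A + G.lu A + 2 := by
  cases h : G.sc A with
  | none => rw [lam_none h]
  | some B => exact (lam_lt h).le

/-- The quotient `(x - 1) / 2 ^ k` increases from `lo` to `hi` exactly when the half-open interval
from `lo` to `hi` contains a multiple of `2 ^ k`. This lemma and `exists_dvd` translate between the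
two forms. -/
theorem le_lam_of_dvd {A B : Fin G.numVars} (h : G.sc A = some B) {x k : ℕ} (h1 : G.lo A ≤ x)
    (h2 : x < G.hi A) (hd : 2 ^ k ∣ x) : k ≤ G.lam A := by
  obtain ⟨q, rfl⟩ := hd
  refine le_lam h ?_
  have hp := lo_pos A
  have hk : 0 < 2 ^ k := by positivity
  have h3 : q ≤ (G.hi A - 1) / 2 ^ k := by
    rw [Nat.le_div_iff_mul_le hk, mul_comm]; omega
  have h4 : (G.lo A - 1) / 2 ^ k < q := by
    rw [Nat.div_lt_iff_lt_mul hk, mul_comm]; omega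
  omega

theorem exists_dvd {A B : Fin G.numVars} (h : G.sc A = some B) :
    ∃ q, G.lo A ≤ 2 ^ G.lam A * q ∧ 2 ^ G.lam A * q < G.hi A := by
  have h1 := lam_spec h
  have h2 := lo_lt_hi h
  refine ⟨(G.hi A - 1) / 2 ^ G.lam A, ?_, ?_⟩
  · have hk : 0 < 2 ^ G.lam A := by positivity
    rw [Nat.div_lt_iff_lt_mul hk, mul_comm] at h1
    omega
  · have := Nat.mul_div_le (G.hi A - 1) (2 ^ G.lam A)
    omega

/-- Among `2 ^ k` consecutive integers there is a multiple of `2 ^ k`. Every lower bound on a level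
comes from the length of the interval in this way. -/
theorem le_lam_of_pow_le {A B : Fin G.numVars} (h : G.sc A = some B) {k : ℕ}
    (hk : G.lo A + 2 ^ k ≤ G.hi A) : k ≤ G.lam A := by
  refine le_lam h ?_
  have hp := lo_pos A
  have h0 : 0 < 2 ^ k := by positivity
  calc (G.lo A - 1) / 2 ^ k < (G.lo A - 1) / 2 ^ k + 1 := Nat.lt_succ_self _
    _ = (G.lo A - 1 + 2 ^ k) / 2 ^ k := (Nat.add_div_right _ h0).symm
    _ ≤ _ := Nat.div_le_div_right (by omega)

/-! ## Walks along symmetric centroid paths -/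

variable (G) in
/-- A nonempty walk along a symmetric centroid path, with levels below `b` in its interior. -/
inductive Walk (b : ℕ) (A : Fin G.numVars) : Fin G.numVars → Prop
  | single {B : Fin G.numVars} (h : G.sc A = some B) : Walk b A B
  | snoc {B C : Fin G.numVars} (h : Walk b A B) (hB : G.lam B < b) (hC : G.sc B = some C) :
      Walk b A C

theorem Walk.mono {b b' : ℕ} {A B : Fin G.numVars} (h : G.Walk b A B) (hb : b ≤ b') :
    G.Walk b' A B := by
  induction h with
  | single h => exact .single h
  | snoc _ hB hC ih => exact .snoc ih (by omega) hC

theorem Walk.trans {b : ℕ} {A B C : Fin G.numVars} (h : G.Walk b A B) (hB : G.lam B < b)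
    (h' : G.Walk b B C) : G.Walk b A C := by
  induction h' with
  | single h' => exact .snoc h hB h'
  | snoc _ hB hC ih => exact .snoc ih hB hC

theorem Walk.lw_lu {b : ℕ} {A B : Fin G.numVars} (h : G.Walk b A B) :
    G.lw B = G.lw A ∧ G.lu B = G.lu A := by
  induction h with
  | single h => exact ⟨(sc_spec h).2.1, (sc_spec h).2.2.1⟩
  | snoc _ _ hC ih => rw [(sc_spec hC).2.1, (sc_spec hC).2.2.1]; exact ih

theorem Walk.exists_sc {b : ℕ} {A B : Fin G.numVars} (h : G.Walk b A B) :
    ∃ C, G.sc A = some C := by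
  induction h with
  | single h => exact ⟨_, h⟩
  | snoc _ _ _ ih => exact ih

theorem Walk.occ_pos {b : ℕ} {A B : Fin G.numVars} (h : G.Walk b A B) : 0 < G.occ B := by
  have key : ∀ A B, G.sc A = some B → 0 < G.occ B := fun A B h =>
    occ_pos_of_mentions (sc_mentions h) (sc_spec h).1
  cases h with
  | single h => exact key _ _ h
  | snoc _ _ hC => exact key _ _ hC

/-- The intervals of consecutive variables abut, so those of the interior variables fill the gap
between `hi A` and `lo B`. A multiple of `2 ^ k` in the gap thus lies in the interval of an interior
variable, whose level is below `b`. -/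
theorem Walk.cover {b : ℕ} {A B : Fin G.numVars} (h : G.Walk b A B) : G.hi A ≤ G.lo B ∧
    ∀ x k, G.hi A ≤ x → x < G.lo B → 2 ^ k ∣ x → k < b := by
  induction h with
  | single h =>
    rw [hi_eq h]
    exact ⟨le_rfl, fun x k h1 h2 _ => by omega⟩
  | @snoc B C _ hB hC ih =>
    have h1 := lo_lt_hi hC
    rw [hi_eq hC] at h1
    refine ⟨by omega, fun x k hx hx' hd => ?_⟩
    by_cases hxB : x < G.lo B
    · exact ih.2 x k hx hxB hd
    · exact lt_of_le_of_lt (le_lam_of_dvd hC (by omega) (by rwa [hi_eq hC]) hd) hB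

/-- Between two variables of the same level there is one of a higher level. -/
theorem Walk.lam_ne {A B : Fin G.numVars} (h : G.Walk (G.lam A) A B) : G.lam A ≠ G.lam B := by
  intro heq
  obtain ⟨A', hA⟩ := h.exists_sc
  have hlt := lam_lt hA
  -- The last variable of a path has level `lw + lu + 2`, which no other variable of the path
  -- attains.
  cases hB : G.sc B with
  | none =>
    have := lam_none hB
    rw [h.lw_lu.1, h.lw_lu.2] at this
    omega
  | some B' =>
    obtain ⟨q₁, h1, h2⟩ := exists_dvd hA
    obtain ⟨q₂, h3, h4⟩ := exists_dvd hB
    obtain ⟨hle, hcov⟩ := h.cover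
    rw [← heq] at h3 h4
    have hq : q₁ < q₂ := by
      have : 2 ^ G.lam A * q₁ < 2 ^ G.lam A * q₂ := by omega
      exact lt_of_mul_lt_mul_left this (Nat.zero_le _)
    have heven : ∀ q, q % 2 = 0 → 2 ^ (G.lam A + 1) ∣ 2 ^ G.lam A * q := by
      intro q hq
      rw [pow_succ]
      exact Nat.mul_dvd_mul_left _ (Nat.dvd_of_mod_eq_zero hq)
    -- An even `q₁` would raise the level of `A`. Hence `q₁ + 1` is even, and `2 ^ lam A * (q₁ +
    -- 1)`, a multiple of the next power of two, is at most `2 ^ lam A * q₂`. It lies in the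
    -- interval of `A`, in the gap, or in the interval of `B`, and it is too divisible for each of
    -- them.
    have hodd : (q₁ + 1) % 2 = 0 := by
      by_contra hc
      have := le_lam_of_dvd hA h1 h2 (heven q₁ (by omega))
      omega
    have h5 : 2 ^ G.lam A * (q₁ + 1) ≤ 2 ^ G.lam A * q₂ := Nat.mul_le_mul_left _ hq
    have h6 : 2 ^ G.lam A * q₁ < 2 ^ G.lam A * (q₁ + 1) :=
      Nat.mul_lt_mul_of_pos_left (by omega) (by positivity)
    have h7 := heven _ hodd
    generalize 2 ^ G.lam A * (q₁ + 1) = y at *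
    by_cases hy : y < G.hi A
    · have := le_lam_of_dvd hA (by omega) hy h7
      omega
    by_cases hy' : y < G.lo B
    · have := hcov y _ (by omega) hy' h7
      omega
    · have := le_lam_of_dvd hB (by omega) (by omega) h7
      omega

variable (G) in
/-- `B` is the next variable of higher level after `A` on the symmetric centroid path. -/
def Next (A B : Fin G.numVars) : Prop := G.Walk (G.lam A) A B ∧ G.lam A < G.lam B

variable (G) in
/-- `A` is the last variable of higher level before `B` on the symmetric centroid path. -/
def Prev (A B : Fin G.numVars) : Prop := G.Walk (G.lam B) A B ∧ G.lam B < G.lam A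

/-- Going back along the path is deterministic by `sc_inj`. A walk with interior levels below `b`
has to stop at the first variable whose level is not below `b`, and both `A` and `A'` are that
variable. -/
theorem Prev.unique {A A' B : Fin G.numVars} (h : G.Prev A B) (h' : G.Prev A' B) : A = A' := by
  obtain ⟨h, hA⟩ := h
  obtain ⟨h', hA'⟩ := h'
  generalize G.lam B = b at *
  induction h with
  | single h =>
    cases h' with
    | single h' => exact sc_inj h h'
    | snoc h1 hB hC =>
      rw [sc_inj hC h] at hB; omega
  | snoc h1 hB hC ih =>
    cases h' with
    | single h' =>
      rw [sc_inj hC h'] at hB; omega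
    | snoc h1' hB' hC' =>
      rw [sc_inj hC' hC] at h1'
      exact ih h1'

/-! ## Ranks -/

variable (G)

/-- The rank of the balanced node of a variable. -/
noncomputable def rk (A : Fin G.numVars) : ℕ :=
  5 * G.lw A + 5 * (Nat.log 2 G.text.length - G.lu A) + 1 + (G.lw A + G.lu A + 2 - G.lam A)

/-- The rank of the nodes for the neighbours of the path that hang from `A` and from what lies
below `A` in the Cartesian tree. -/
noncomputable def rkT (A : Fin G.numVars) : ℕ :=
  (G.lam A - G.lu A) + 4 * (G.lw A - 1) + 5 * (Nat.log 2 G.text.length - G.lu A) + 4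

variable {G}

theorem lw_add_lu_le {A : Fin G.numVars} (h : 0 < G.occ A) :
    G.lw A + G.lu A ≤ Nat.log 2 G.text.length :=
  Nat.le_log_of_pow_le (by norm_num) (pow_add_le_text h)

theorem lu_le_lu {A B : Fin G.numVars} (h : (G.rule A).Mentions B) : G.lu A ≤ G.lu B :=
  Nat.log_mono_right (occ_le_of_mentions h)

/-- As `A` does not precede `B` on a path, `B` has at least `occ A` occurrences beyond those of its
path predecessor. Its interval then contains a stretch of length at least `2 ^ (lu A + lw B)`, which
forces a high level. The last summand of `rk B` is therefore at most `lu B - lu A + 2`, and the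
growth of `lu` pays for it. -/
theorem rk_le_of_mentions {A B : Fin G.numVars} (h : (G.rule A).Mentions B) (hA : 0 < G.occ A)
    (hsc : G.sc A ≠ some B) :
    G.rk B ≤ 5 * G.lw B + 5 * (Nat.log 2 G.text.length - G.lu B) + 3 + (G.lu B - G.lu A) := by
  have hle := lu_le_lu h
  have hlam : G.lu A + G.lw B ≤ G.lam B := by
    cases hB : G.sc B with
    | none => rw [lam_none hB]; omega
    | some C =>
      obtain ⟨-, -, -, D, -, hr⟩ := sc_spec hB
      have h1 := hi_ge hB hr
      have h2 := pp_add_le h hsc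
      refine le_lam_of_pow_le hB ?_
      have h3 : 2 ^ (G.lu A + G.lw B) ≤ (G.occ B - G.pp B) * 2 ^ G.lw B := by
        rw [pow_add]
        exact Nat.mul_le_mul_right _ (le_trans (pow_lu_le hA) (by omega))
      omega
  unfold rk
  omega

/-- The length that is lost when passing from `A` to `B` is `len D`, and it enters the interval of
`A` with weight `2 ^ lu A`. -/
theorem le_lam_sibling {A B D : Fin G.numVars} (h : G.sc A = some B)
    (hr : G.rule A = .pair B D ∨ G.rule A = .pair D B) : G.lw D + G.lu A ≤ G.lam A := by
  refine le_lam_of_pow_le h ?_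
  have h1 := hi_ge h hr
  have h3 : 2 ^ (G.lw D + G.lu A) ≤ G.len D * 2 ^ G.lu A := by
    rw [pow_add]
    exact Nat.mul_le_mul_right _ (pow_lw_le D)
  omega

/-- Of the summand `5 * lw D`, four parts are covered by `4 * (lw A - 1)`, as `lw D < lw A`, and the
fifth by `lam A - lu A`, by `le_lam_sibling`. The growth from `lu A` to `lu D` is covered by the
coefficient five of `log n - lu`. -/
theorem rk_sibling {A B D : Fin G.numVars} (h : G.sc A = some B)
    (hr : G.rule A = .pair B D ∨ G.rule A = .pair D B) (hD : G.lw D < G.lw A) :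
    G.rk D < G.rkT A ∧ G.rk D < G.rk A := by
  have hA := (sc_spec h).1
  have hm : (G.rule A).Mentions D := by rcases hr with hr | hr <;> simp [hr, RLRule.Mentions]
  have h1 := rk_le_of_mentions hm hA (fun h' => by
    have := (sc_spec h').2.1
    omega)
  have h2 := le_lam_sibling h hr
  have h3 := lu_le_lu hm
  have h4 := lw_add_lu_le hA
  have h5 := lw_add_lu_le (occ_pos_of_mentions hm hA)
  have h6 := lam_lt h
  refine ⟨?_, ?_⟩
  · unfold rkT; omega
  · refine lt_of_le_of_lt h1 ?_
    unfold rk; omega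

/-- `le_lam_sibling` gives `lu A ≤ lam A`, so that the truncated difference `lam - lu` really grows
with the level. -/
theorem rkT_lt {A B A' : Fin G.numVars} (h : G.sc A = some A') (hw : G.lw A = G.lw B)
    (hu : G.lu A = G.lu B) (hl : G.lam A < G.lam B) : G.rkT A < G.rkT B := by
  obtain ⟨-, -, -, D, -, hr⟩ := sc_spec h
  have := le_lam_sibling h hr
  unfold rkT
  rw [hw, hu]
  omega

/-- Along a path `rkT` grows with the level while `rk` falls with it. They do not cross, because the
level of a variable with a successor is at most `lw + lu + 1`. -/
theorem rkT_lt_rk {A B A' : Fin G.numVars} (h : G.sc B = some A') (hw : G.lw A = G.lw B)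
    (hu : G.lu A = G.lu B) (hl : G.lam A < G.lam B) : G.rkT A < G.rk B := by
  obtain ⟨-, -, -, D, hD, hr⟩ := sc_spec h
  have := le_lam_sibling h hr
  have := lam_lt h
  unfold rkT rk
  rw [hw, hu]
  omega

theorem rk_lt_of_next {A B : Fin G.numVars} (h : G.Next A B) : G.rk B < G.rk A := by
  obtain ⟨hw, hu⟩ := h.1.lw_lu
  have := h.2
  have := lam_le B
  unfold rk
  rw [hw, hu] at *
  omega

/-- A child with both logarithms equal to those of `A` would have been chosen as successor. So `lw`
drops or `lu` grows, and one such step with coefficient five outweighs the additive terms of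
`rk_le_of_mentions`. -/
theorem rk_lt_of_last {A B : Fin G.numVars} (h : G.sc A = none) (hA : 0 < G.occ A) {C : Fin G.numVars}
    (hr : G.rule A = .pair B C ∨ G.rule A = .pair C B) : G.rk B < G.rk A := by
  have hm : (G.rule A).Mentions B := by rcases hr with hr | hr <;> simp [hr, RLRule.Mentions]
  have h1 := rk_le_of_mentions hm hA (by simp [h])
  have h2 := lu_le_lu hm
  have h3 := lw_add_lu_le hA
  have h4 := lw_add_lu_le (occ_pos_of_mentions hm hA)
  have h5 : G.lw B ≤ G.lw A := by
    refine Nat.log_mono_right ?_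
    rcases hr with hr | hr <;> rw [len_pair hr] <;> omega
  have h6 : ¬ (G.lw B = G.lw A ∧ G.lu B = G.lu A) := by
    intro hc
    rcases hr with hr | hr <;> rw [sc_ne_none_left hr hA] at h
    · simp [hc] at h
    · split_ifs at h
  refine lt_of_le_of_lt h1 ?_
  unfold rk
  omega

/-- Here `lw` drops by at least `log t`, which is at least one. Of the five units gained for each
unit of `log t`, one is set aside for the squarings and the others cover the additive constant. -/
theorem rk_lt_of_run {A B : Fin G.numVars} {t : ℕ} (hr : G.rule A = .run B t) (hA : 0 < G.occ A) :
    G.rk B + Nat.log 2 t < G.rk A := by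
  have hm : (G.rule A).Mentions B := by simp [hr, RLRule.Mentions]
  have hsc : G.sc A = none := by unfold sc; rw [hr]; split <;> rfl
  have h1 := rk_le_of_mentions hm hA (by simp [hsc])
  have h2 := lu_le_lu hm
  have h3 := lw_add_lu_le hA
  have h4 := lw_add_lu_le (occ_pos_of_mentions hm hA)
  have ht := G.three_le A B t hr
  have h5 : Nat.log 2 t + G.lw B ≤ G.lw A := by
    refine Nat.le_log_of_pow_le (by norm_num) ?_
    rw [pow_add, len_run hr]
    exact Nat.mul_le_mul (Nat.pow_log_le_self 2 (by omega)) (pow_lw_le B)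
  have h6 : 1 ≤ Nat.log 2 t := Nat.le_log_of_pow_le (by norm_num) (by omega)
  unfold rk at *
  omega

theorem rk_start_le : G.rk G.start ≤ 11 * Nat.log 2 G.text.length + 3 := by
  have := lw_add_lu_le (G := G) occ_start
  unfold rk
  omega

end RLSLP

namespace WordRAM

local notation "R" => Expr.reg
local notation "M" => Expr.load

/-! # Nodes of a balanced program -/

section rep
variable {c σ : ℕ} (val : List (Fin σ) → Fin c → ℕ) (m : ℕ → ℕ) (F : Set ℕ) (top : ℕ)

/-- The first two cells of a node hold the length of its string and a pointer to its value. All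
cells that are used belong to `F`. -/
structure Head (a : ℕ) (X : List (Fin σ)) : Prop where
  cells : ∀ i < 8, a + i ∈ F
  len : m a = X.length
  ptr : X ≠ [] → m (a + 1) ≠ 0 ∧ m (a + 1) + c ≤ top ∧ (∀ i < c, m (a + 1) + i ∈ F) ∧
    readBlock c m (m (a + 1)) = val X

/-- The node at address `a` represents the string `X`, by means of a tree of the given rank. -/
inductive Rep : ℕ → List (Fin σ) → ℕ → Prop
  | leaf {a : ℕ} {X : List (Fin σ)} {r : ℕ} (h : Head val m F top a X) (hX : X.length ≤ 1) :
      Rep a X r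
  | cat {a : ℕ} {X : ℕ → List (Fin σ)} {r r' : ℕ}
      (h : Head val m F top a (X 0 ++ (X 1 ++ (X 2 ++ (X 3 ++ X 4))))) (h2 : m (a + 2) = 0)
      (hX : ∀ i < 5, Rep (m (a + 3 + i)) (X i) r) (hr : r < r') :
      Rep a (X 0 ++ (X 1 ++ (X 2 ++ (X 3 ++ X 4)))) r'
  | run {a : ℕ} {X : List (Fin σ)} {r r' : ℕ}
      (h : Head val m F top a (List.replicate (m (a + 2)) X).flatten) (h2 : m (a + 2) ≠ 0)
      (hX : Rep (m (a + 3)) X r) (hne : X ≠ []) (hr : r + Nat.log 2 (m (a + 2)) < r') :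
      Rep a (List.replicate (m (a + 2)) X).flatten r'

variable {val m F top}

theorem Rep.head {a r : ℕ} {X : List (Fin σ)} (h : Rep val m F top a X r) :
    Head val m F top a X := by
  cases h <;> assumption

theorem Rep.mono {a r r' : ℕ} {X : List (Fin σ)} (h : Rep val m F top a X r) (hr : r ≤ r') :
    Rep val m F top a X r' := by
  cases h with
  | leaf h hX => exact .leaf h hX
  | cat h h2 hX hr' => exact .cat h h2 hX (by omega)
  | run h h2 hX hne hr' => exact .run h h2 hX hne (by omega)

theorem Head.congr {m' : ℕ → ℕ} {F' : Set ℕ} {top' a : ℕ} {X : List (Fin σ)}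
    (h : Head val m F top a X) (hm : ∀ x ∈ F, m' x = m x) (hF : F ⊆ F') (htop : top ≤ top') :
    Head val m' F' top' a X := by
  have h1 := hm _ (h.cells 1 (by omega))
  have h0 := hm _ (h.cells 0 (by omega))
  refine ⟨fun i hi => hF (h.cells i hi), by rw [← h.len]; exact h0, fun hX => ?_⟩
  obtain ⟨p1, p2, p3, p4⟩ := h.ptr hX
  rw [h1]
  refine ⟨p1, by omega, fun i hi => hF (p3 i hi), ?_⟩
  rw [← p4]
  exact readBlock_congr fun i hi => hm _ (p3 i hi)

/-- Frame rule: a representation depends only on the cells in `F`, so it survives writes elsewhere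
and may be regarded in a larger region. -/
theorem Rep.congr {m' : ℕ → ℕ} {F' : Set ℕ} {top' a r : ℕ} {X : List (Fin σ)}
    (h : Rep val m F top a X r) (hm : ∀ x ∈ F, m' x = m x) (hF : F ⊆ F') (htop : top ≤ top') :
    Rep val m' F' top' a X r := by
  induction h with
  | leaf h hX => exact .leaf (h.congr hm hF htop) hX
  | @cat a X r r' h h2 hX hr ih =>
    refine .cat (h.congr hm hF htop) ?_ (fun i hi => ?_) hr
    · rw [hm _ (h.cells 2 (by omega)), h2]
    · rw [add_assoc, hm _ (h.cells (3 + i) (by omega)), ← add_assoc]; exact ih i hi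
  | @run a X r r' h h2 hX hne hr ih =>
    have e2 := hm _ (h.cells 2 (by omega))
    have e3 := hm _ (h.cells 3 (by omega))
    rw [← e2] at h h2 hr ⊢
    exact .run (h.congr hm hF htop) h2 (by rw [e3]; exact ih) hne hr

end rep

/-- Prepend child number `i` of the node whose address is in register 30. -/
def addChild (i : ℕ) : Prog :=
  .set 33 (M (R 30 + Expr.const (3 + i))) ;; .set 34 (M (R 33)) ;; .set 32 (R 32 + R 34) ;;
  .set 41 (M (R 33 + 1)) ;; .set 42 (Expr.less 0 (R 34)) ;; prepend

/-- Compute the length and the value of the concatenation node whose address is in register 30,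
where registers 43 and 44 point to blocks for the value and for scratch work. -/
def makeCat : Prog :=
  .set 40 0 ;; .set 32 0 ;; addChild 4 ;; addChild 3 ;; addChild 2 ;; addChild 1 ;; addChild 0 ;;
  .store (R 30) (R 32) ;; .store (R 30 + 1) (R 40) ;; .store (R 30 + 2) 0

/-! ### Correctness of concatenation nodes -/

section makeCat
variable {c σ w : ℕ} {O : Subroutines c} {val : List (Fin σ) → Fin c → ℕ}

/-- The blocks at the addresses `D` and `T` and the node at the address `q` are disjoint from each
other and from the set `F`, which lies below `T`. -/
structure Layout (c w : ℕ) (F : Set ℕ) (q D T : ℕ) : Prop where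
  pow : 100 ≤ 2 ^ w
  top : T + c ≤ 2 ^ w
  node : q + 8 ≤ T
  dest : D + c ≤ T
  dest_ne : D ≠ 0
  disj : ∀ i < 8, ∀ j < c, q + i ≠ D + j
  below : ∀ x ∈ F, x < T
  fresh : ∀ j < c, D + j ∉ F

/-- The state after some of the children have been combined. -/
structure Partial (val : List (Fin σ) → Fin c → ℕ) (F : Set ℕ) (s₀ : State) (Y : List (Fin σ))
    (s : State) : Prop where
  reg : ∀ x, x < 32 ∨ x = 43 ∨ x = 44 → s.reg x = s₀.reg x
  mem : ∀ x, (∀ i < c, x ≠ s₀.reg 43 + i) → (∀ i < c, x ≠ s₀.reg 44 + i) → s.mem x = s₀.mem x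
  len : s.reg 32 = Y.length
  holds : Holds val s.mem (s.reg 40) Y
  top : s.reg 40 + c ≤ s₀.reg 44
  ptr : s.reg 40 ≠ 0 → ∀ i < c, s.reg 40 + i ∈ F ∨ ∃ j < c, s.reg 40 + i = s₀.reg 43 + j

/-- Children are added from the last to the first, because `prepend` extends on the left. Apart from
the stated frame, the value of the accumulated string may be shared with a child, so `Partial`
records where its block can lie. -/
theorem wp_addChild (hO : Composes w O val) {F : Set ℕ} {s₀ s : State} {i r : ℕ} (hi : i < 5)
    {X Y : List (Fin σ)} (hL : Layout c w F (s₀.reg 30) (s₀.reg 43) (s₀.reg 44))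
    (hP : Partial val F s₀ Y s)
    (hX : Rep val s₀.mem F (s₀.reg 44) (s₀.mem (s₀.reg 30 + 3 + i)) X r)
    (hlen : X.length + Y.length < 2 ^ w) {Q : ℕ → State → Prop}
    (hQ : ∀ t s', t ≤ 150 * O.timeH → Partial val F s₀ (X ++ Y) s' → Q t s') :
    wp w O (addChild i) Q s := by
  have hpos := hO.pos
  have h30 := hP.reg 30 (by simp)
  have h43 := hP.reg 43 (by simp)
  have h44 := hP.reg 44 (by simp)
  have hpow := hL.pow
  have htop := hL.top
  have hnode := hL.node
  have e1 : s.mem (s₀.reg 30 + (3 + i)) = s₀.mem (s₀.reg 30 + 3 + i) := by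
    rw [hP.mem, add_assoc]
    · intro j hj; exact hL.disj _ (by omega) j hj
    · intro j hj; omega
  have hF : ∀ x ∈ F, s.mem x = s₀.mem x := fun x hx => by
    refine hP.mem x (fun j hj h => hL.fresh j hj (h ▸ hx)) (fun j hj h => ?_)
    have := hL.below x hx; omega
  have hd := hX.head.congr hF subset_rfl le_rfl
  have hd1 := hL.below _ (hd.cells 1 (by omega))
  generalize s₀.mem (s₀.reg 30 + 3 + i) = a at *
  have e2 := hd.len
  have hY := hP.len
  simp only [addChild, wp, safe_load, safe_add, safe_reg, safe_const, safe_num, safe_less, val_add,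
    val_load, val_reg, val_const, val_num, val_less, State.set_reg, State.set_mem, cost_load,
    cost_add, cost_reg, cost_const, cost_num, cost_bin, h30, e1, e2, hY, true_and,
    Nat.reduceEqDiff, if_true, if_false]
  refine ⟨⟨by omega, by omega⟩, by omega, ⟨by omega, by omega⟩, by omega, ?_⟩
  -- The exponent is one for a nonempty child and zero for an empty one, whose pointer to a value
  -- has no meaning.
  apply wp_prepend hO (X := X) (Y := Y) (by omega)
  · simp only [State.set_reg, Nat.reduceEqDiff, if_true]
    split <;> omega
  · simpa [State.set_reg, State.set_mem] using hP.holds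
  · simpa [State.set_reg, h44] using hP.top
  · simp only [State.set_reg, State.set_mem, Nat.reduceEqDiff, if_true, if_false, h43, h44]
    intro h
    have hXne : X ≠ [] := by rintro rfl; simp at h
    obtain ⟨p1, p2, p3, p4⟩ := hd.ptr hXne
    refine ⟨p1, p4, p2, fun i hi j hj h => hL.fresh j hj (h ▸ p3 i hi)⟩
  · simpa [State.set_reg, h43] using hL.dest_ne
  · simpa [State.set_reg, h43, h44] using hL.dest
  · simpa [State.set_reg, h44] using hL.top
  simp only [State.set_reg, State.set_mem, Nat.reduceEqDiff, if_true, if_false, h43, h44]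
  intro t s' ht gH g40 gm gr
  have hk : (List.replicate (if 0 < X.length then 1 else 0) X).flatten = X := by
    split
    · simp
    · rename_i h
      have : X = [] := List.length_eq_zero_iff.mp (by omega)
      simp [this]
  have hlog : Nat.log 2 (if 0 < X.length then 1 else 0) = 0 := by split <;> simp
  rw [hk] at gH
  rw [hlog] at ht
  have g32 := gr 32 (by simp)
  have g40' : s'.reg 40 = s.reg 40 ∨ X ≠ [] ∧ s'.reg 40 = s.mem (a + 1) ∨
      s'.reg 40 = s₀.reg 43 := by
    rcases g40 with h | ⟨h1, h2⟩ | h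
    · exact Or.inl h
    · refine Or.inr (Or.inl ⟨?_, h2⟩)
      rintro rfl; simp at h1
    · exact Or.inr (Or.inr h)
  refine hQ _ _ (by omega) ⟨?_, ?_, ?_, gH, ?_, ?_⟩
  · intro x hx
    rw [gr x (by omega), ← hP.reg x hx]
    grind
  · intro x hx hx'
    rw [gm x hx hx', hP.mem x hx hx']
  · rw [g32]; simp [add_comm]
  · rcases g40' with h | ⟨hX', h⟩ | h
    · rw [h]; exact hP.top
    · rw [h]; exact (hd.ptr hX').2.1
    · rw [h]; exact hL.dest
  · intro hne j hj
    rcases g40' with h | ⟨hX', h⟩ | h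
    · rw [h] at hne ⊢; exact hP.ptr hne j hj
    · rw [h]; exact Or.inl ((hd.ptr hX').2.2.1 j hj)
    · rw [h]; exact Or.inr ⟨j, hj, rfl⟩

theorem wp_makeCat (hO : Composes w O val) {F F' : Set ℕ} {s : State} {r : ℕ}
    {X : ℕ → List (Fin σ)} (hL : Layout c w F (s.reg 30) (s.reg 43) (s.reg 44))
    (hX : ∀ i < 5, Rep val s.mem F (s.reg 44) (s.mem (s.reg 30 + 3 + i)) (X i) r)
    (hF : F ⊆ F') (hq : ∀ i < 8, s.reg 30 + i ∉ F ∧ s.reg 30 + i ∈ F')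
    (hD : ∀ i < c, s.reg 43 + i ∈ F')
    (hlen : (X 0 ++ (X 1 ++ (X 2 ++ (X 3 ++ X 4)))).length < 2 ^ w) {Q : ℕ → State → Prop}
    (hQ : ∀ t s', t ≤ 800 * O.timeH →
      Rep val s'.mem F' (s.reg 44) (s.reg 30) (X 0 ++ (X 1 ++ (X 2 ++ (X 3 ++ X 4)))) (r + 1) →
      (∀ x, (∀ i < 3, x ≠ s.reg 30 + i) → (∀ i < c, x ≠ s.reg 43 + i) →
        (∀ i < c, x ≠ s.reg 44 + i) → s'.mem x = s.mem x) →
      (∀ x, x < 32 ∨ x = 43 ∨ x = 44 → s'.reg x = s.reg x) → Q t s') :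
    wp w O makeCat Q s := by
  have hpos := hO.pos
  have hpow := hL.pow
  have htop := hL.top
  have hnode := hL.node
  simp only [List.length_append] at hlen
  have h0 : Partial val F s [] ((s.set 40 0).set 32 0) := by
    refine ⟨?_, ?_, ?_, ?_, ?_, ?_⟩
    · intro x hx
      simp only [State.set_reg]; grind
    · intro x _ _; rfl
    · simp [State.set_reg]
    · simp [State.set_reg, Holds]
    · have := hL.dest
      simp [State.set_reg]; omega
    · simp [State.set_reg]
  simp only [makeCat, wp, safe_num, val_num, cost_num]
  refine ⟨by omega, by omega, ?_⟩
  refine wp_addChild hO (by omega) hL h0 (hX 4 (by omega)) (by simp; omega) fun t4 s4 ht4 h4 => ?_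
  refine wp_addChild hO (by omega) hL h4 (hX 3 (by omega)) (by simp; omega) fun t3 s3 ht3 h3 => ?_
  refine wp_addChild hO (by omega) hL h3 (hX 2 (by omega)) (by simp; omega) fun t2 s2 ht2 h2 => ?_
  refine wp_addChild hO (by omega) hL h2 (hX 1 (by omega)) (by simp; omega) fun t1 s1 ht1 h1 => ?_
  refine wp_addChild hO (by omega) hL h1 (hX 0 (by omega)) (by simp; omega) fun t0 s' ht0 hs' => ?_
  have h30 := hs'.reg 30 (by simp)
  simp only [safe_reg, safe_add, safe_num, val_reg, val_add, val_num, State.put_reg, h30,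
    cost_reg, cost_add, cost_num, true_and, List.append_nil] at *
  refine ⟨⟨by omega, by omega⟩, ⟨by omega, by omega⟩, by omega, ?_⟩
  have hlen' := hs'.len
  set Z := X 0 ++ (X 1 ++ (X 2 ++ (X 3 ++ X 4))) with hZ
  have hfr : ∀ x, (∀ i < 3, x ≠ s.reg 30 + i) → (∀ i < c, x ≠ s.reg 43 + i) →
        (∀ i < c, x ≠ s.reg 44 + i) →
        (((s'.put (s.reg 30) (s'.reg 32)).put (s.reg 30 + 1) (s'.reg 40)).put (s.reg 30 + 2) 0).mem x
          = s.mem x := by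
    intro x hx h43 h44
    simp only [State.put_mem]
    rw [Function.update_of_ne (hx 2 (by omega)), Function.update_of_ne (hx 1 (by omega)),
      Function.update_of_ne (a := x) (a' := s.reg 30) (hx 0 (by omega)), hs'.mem x h43 h44]
  refine hQ _ _ (by omega) ?_ hfr ?_
  · refine .cat ⟨fun i hi => (hq i hi).2, ?_, fun hne => ?_⟩ ?_ (fun i hi => ?_) (Nat.lt_succ_self r)
    · simp [State.put_mem, hlen', hZ]
    · have e1 : (((s'.put (s.reg 30) (s'.reg 32)).put (s.reg 30 + 1) (s'.reg 40)).put
          (s.reg 30 + 2) 0).mem (s.reg 30 + 1) = s'.reg 40 := by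
        simp [State.put_mem]
      rw [e1]
      rcases hs'.holds with ⟨h, h'⟩ | ⟨h, h'⟩
      · exact absurd h' hne
      -- The value is either that of a child, inside `F`, or stands in the destination block. The
      -- cells of the node are disjoint from both, so writing them does not damage it.
      have hnq : ∀ i < c, ∀ j < 8, s'.reg 40 + i ≠ s.reg 30 + j := by
        intro i hi j hj hc
        rcases hs'.ptr h i hi with h1 | ⟨k, hk, h1⟩
        · exact (hq j hj).1 (hc ▸ h1)
        · exact hL.disj j hj k hk (by omega)
      refine ⟨h, hs'.top, fun i hi => ?_, ?_⟩
      · rcases hs'.ptr h i hi with h1 | ⟨j, hj, h1⟩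
        · exact hF h1
        · rw [h1]; exact hD j hj
      · rw [← h']
        refine readBlock_congr fun i hi => ?_
        have n0 := hnq i hi 0 (by omega)
        have n1 := hnq i hi 1 (by omega)
        have n2 := hnq i hi 2 (by omega)
        simp only [State.put_mem]
        rw [Function.update_of_ne n2, Function.update_of_ne n1,
          Function.update_of_ne (a' := s.reg 30) n0]
    · simp [State.put_mem]
    · rw [hfr]
      · refine (hX i hi).congr (fun x hx => hfr x ?_ ?_ ?_) hF le_rfl
        · intro j hj h; exact (hq j (by omega)).1 (h ▸ hx)
        · intro j hj h; exact hL.fresh j hj (h ▸ hx)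
        · intro j hj h
          have := hL.below x hx; omega
      · intro j hj; omega
      · intro j hj
        rw [add_assoc]
        exact hL.disj _ (by omega) j hj
      · intro j hj; omega
  · intro x hx
    simp only [State.put_reg]
    exact hs'.reg x hx

end makeCat

end WordRAM

namespace RLSLP

/-! # Topological orders -/

variable {σ : ℕ} (G : RLSLP σ)

/-- How often `B` is written in the rule of `A`. -/
def deg (A B : Fin G.numVars) : ℕ :=
  match G.rule A with
  | .term _ => 0
  | .pair C D => (if B = C then 1 else 0) + if B = D then 1 else 0
  | .run C _ => if B = C then 1 else 0

variable {G}

theorem deg_pos_iff {A B : Fin G.numVars} : 0 < G.deg A B ↔ (G.rule A).Mentions B := by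
  unfold deg
  cases hr : G.rule A with
  | term a => simp [RLRule.Mentions]
  | pair C D =>
    simp only [RLRule.Mentions]
    by_cases h1 : B = C <;> by_cases h2 : B = D <;> simp [h1, h2]
  | run C t =>
    simp only [RLRule.Mentions]
    by_cases h1 : B = C <;> simp [h1]

theorem deg_le (A B : Fin G.numVars) : G.deg A B ≤ 2 := by
  unfold deg
  cases G.rule A with
  | term a => simp
  | pair C D => dsimp only; split_ifs <;> simp
  | run C t => dsimp only; split_ifs <;> simp

theorem deg_pair {A C D : Fin G.numVars} (h : G.rule A = .pair C D) (B : Fin G.numVars) :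
    G.deg A B = (if B = C then 1 else 0) + if B = D then 1 else 0 := by
  simp only [deg, h]

theorem deg_run {A C : Fin G.numVars} {t : ℕ} (h : G.rule A = .run C t) (B : Fin G.numVars) :
    G.deg A B = if B = C then 1 else 0 := by
  simp only [deg, h]

theorem deg_term {A : Fin G.numVars} {a : Fin σ} (h : G.rule A = .term a) (B : Fin G.numVars) :
    G.deg A B = 0 := by
  simp only [deg, h]

/-- On a finite set an acyclic relation is well founded in both directions. This direction gives
induction from parents to children. -/
theorem wf_flip (G : RLSLP σ) : WellFounded (fun A B => (G.rule A).Mentions B) := by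
  have : Std.Irrefl (Function.swap (Relation.TransGen fun B A => (G.rule A).Mentions B)) :=
    ⟨G.acyclic⟩
  have : IsTrans _ (Function.swap (Relation.TransGen fun B A => (G.rule A).Mentions B)) :=
    ⟨fun a b c h1 h2 => Relation.TransGen.trans h2 h1⟩
  have h := Finite.wellFounded_of_trans_of_irrefl
    (Function.swap (Relation.TransGen fun B A => (G.rule A).Mentions B))
  exact Subrelation.wf (fun hab => Relation.TransGen.single hab) h

variable (G) in
/-- The invariant of a topological search: `ord` lists the variables that were found, of which the
first `k` have been processed. -/
structure TopSearch (ind num : Fin G.numVars → ℕ) (ord : List (Fin G.numVars)) (k : ℕ) : Prop where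
  nodup : ord.Nodup
  le : k ≤ ord.length
  ind_eq : ∀ B, ind B = ∑ A, if A ∈ ord.take k then 0 else G.deg A B
  mem_iff : ∀ B, B ∈ ord ↔ ind B = 0
  num_eq : ∀ B, num B = (if G.start = B then 1 else 0) +
    ∑ A, if A ∈ ord.take k then G.mult A B * G.occ A else 0
  top : ∀ i (hi : i < ord.length) A, (G.rule A).Mentions ord[i] → A ∈ ord.take i

variable (G) in
/-- A list of all variables in which every variable precedes those in its rule. -/
structure TopOrder (ord : List (Fin G.numVars)) : Prop where
  nodup : ord.Nodup
  mem : ∀ A, A ∈ ord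
  top : ∀ i (hi : i < ord.length) A, (G.rule A).Mentions ord[i] → A ∈ ord.take i

namespace TopSearch

variable {ind num : Fin G.numVars → ℕ} {ord : List (Fin G.numVars)} {k : ℕ}

theorem length_le (h : G.TopSearch ind num ord k) : ord.length ≤ G.numVars := by
  simpa using h.nodup.length_le_card

theorem num_eq_occ (h : G.TopSearch ind num ord k) {B : Fin G.numVars}
    (hB : ∀ A, (G.rule A).Mentions B → A ∈ ord.take k) : num B = G.occ B := by
  rw [h.num_eq, occ_eq B]
  congr 1
  refine Finset.sum_congr rfl fun A _ => ?_
  by_cases hA : (G.rule A).Mentions B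
  · rw [if_pos (hB A hA)]
  · simp [mult_eq_zero hA]

theorem not_mem_take (h : G.TopSearch ind num ord k) (hk : k < ord.length) :
    ord[k] ∉ ord.take k := by
  intro hc
  obtain ⟨j, hj, he⟩ := List.mem_take_iff_getElem.mp hc
  have := (List.Nodup.getElem_inj_iff h.nodup).mp he
  omega

theorem deg_le_ind (h : G.TopSearch ind num ord k) (hk : k < ord.length) (B : Fin G.numVars) :
    G.deg ord[k] B ≤ ind B := by
  rw [h.ind_eq]
  have := Finset.single_le_sum (f := fun A => if A ∈ ord.take k then 0 else G.deg A B)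
    (fun _ _ => Nat.zero_le _) (Finset.mem_univ ord[k])
  simpa [h.not_mem_take hk] using this

theorem num_getElem (h : G.TopSearch ind num ord k) (hk : k < ord.length) :
    num ord[k] = G.occ ord[k] :=
  h.num_eq_occ fun A hA => h.top k hk A hA

/-- The counter and the increment that is due are distinct parts of the sum over parents that
defines `occ B`. With `occ B ≤ n`, no counter overflows. -/
theorem num_add_le (h : G.TopSearch ind num ord k) (hk : k < ord.length) (B : Fin G.numVars) :
    num B + G.mult ord[k] B * G.occ ord[k] ≤ G.occ B := by
  classical
  rw [h.num_eq, occ_eq B, add_assoc]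
  refine Nat.add_le_add_left ?_ _
  have h1 : G.mult ord[k] B * G.occ ord[k] =
      ∑ A, if A = ord[k] then G.mult A B * G.occ A else 0 := by simp
  rw [h1, ← Finset.sum_add_distrib]
  refine Finset.sum_le_sum fun A _ => ?_
  have := h.not_mem_take hk
  split_ifs with h2 h3
  · subst h3; exact absurd h2 this
  · omega
  · omega
  · omega

/-- One round of Kahn's algorithm. A variable joins the queue exactly when the processed rule
contains all of its remaining occurrences. -/
theorem step (h : G.TopSearch ind num ord k) (hk : k < ord.length)
    {ind' num' : Fin G.numVars → ℕ} {new : List (Fin G.numVars)} (hnew : new.Nodup)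
    (hmem : ∀ B, B ∈ new ↔ 0 < G.deg ord[k] B ∧ ind B = G.deg ord[k] B)
    (hind : ∀ B, ind' B = ind B - G.deg ord[k] B)
    (hnum : ∀ B, num' B = num B + G.mult ord[k] B * G.occ ord[k]) :
    G.TopSearch ind' num' (ord ++ new) (k + 1) := by
  classical
  have hnm := h.not_mem_take hk
  have htake : (ord ++ new).take (k + 1) = ord.take k ++ [ord[k]] := by
    rw [List.take_append_of_le_length (by omega), List.take_succ_eq_append_getElem hk]
  have hmem' : ∀ A, A ∈ (ord ++ new).take (k + 1) ↔ A ∈ ord.take k ∨ A = ord[k] := by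
    intro A; rw [htake, List.mem_append, List.mem_singleton]
  have hind' : ∀ B, ind' B = ∑ A, if A ∈ (ord ++ new).take (k + 1) then 0 else G.deg A B := by
    intro B
    have h1 : ind B = G.deg ord[k] B +
        ∑ A, if A ∈ (ord ++ new).take (k + 1) then 0 else G.deg A B := by
      have h2 : G.deg ord[k] B = ∑ A, if A = ord[k] then G.deg A B else 0 := by simp
      rw [h.ind_eq, h2, ← Finset.sum_add_distrib]
      refine Finset.sum_congr rfl fun A _ => ?_
      simp only [hmem' A]
      by_cases h3 : A = ord[k]
      · simp [h3, hnm]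
      · simp [h3]
    rw [hind, h1]; omega
  refine ⟨?_, by simp; omega, hind', ?_, ?_, ?_⟩
  · refine List.nodup_append.mpr ⟨h.nodup, hnew, fun A hA B hB hAB => ?_⟩
    subst hAB
    have h1 := (h.mem_iff A).mp hA
    have h2 := (hmem A).mp hB
    omega
  · intro B
    have := h.deg_le_ind hk B
    rw [List.mem_append, h.mem_iff, hmem, hind]
    omega
  · intro B
    rw [hnum, h.num_eq, add_assoc]
    congr 1
    have h2 : G.mult ord[k] B * G.occ ord[k] =
        ∑ A, if A = ord[k] then G.mult A B * G.occ A else 0 := by simp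
    rw [h2, ← Finset.sum_add_distrib]
    refine Finset.sum_congr rfl fun A _ => ?_
    simp only [hmem' A]
    by_cases h3 : A = ord[k]
    · simp [h3, hnm]
    · simp [h3]
  · intro i hi A hA
    by_cases hi' : i < ord.length
    · rw [List.getElem_append_left hi'] at hA
      rw [List.take_append_of_le_length hi'.le]
      exact h.top i hi' A hA
    -- The counter of a new variable has just reached zero, so every rule that mentions it belongs
    -- to the processed prefix.
    · have hB : (ord ++ new)[i] ∈ new := by
        rw [List.getElem_append_right (by omega)]; exact List.getElem_mem _
      generalize (ord ++ new)[i] = B at *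
      have h1 : ind' B = 0 := by
        have := (hmem B).mp hB
        rw [hind]; omega
      rw [hind' B] at h1
      have h2 := (Finset.sum_eq_zero_iff.mp h1) A (Finset.mem_univ _)
      have h3 := deg_pos_iff.mpr hA
      have h4 : A ∈ (ord ++ new).take (k + 1) := by
        by_contra hc
        rw [if_neg hc] at h2; omega
      exact (List.take_subset_take_left _ (by omega)) h4

/-- When the queue is exhausted, it contains every variable: by induction from parents to children,
all parents of a variable have been processed, hence its counter is zero. -/
theorem complete (h : G.TopSearch ind num ord ord.length) :
    G.TopOrder ord ∧ ord.length = G.numVars ∧ ∀ B, num B = G.occ B := by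
  have hall : ∀ B, B ∈ ord := by
    intro B
    induction B using G.wf_flip.induction with
    | _ B ih =>
      rw [h.mem_iff, h.ind_eq]
      refine Finset.sum_eq_zero fun A _ => ?_
      rw [List.take_length]
      split_ifs with hA
      · rfl
      · by_contra hc
        exact hA (ih A (deg_pos_iff.mp (Nat.pos_of_ne_zero hc)))
  refine ⟨⟨h.nodup, hall, h.top⟩, ?_, fun B => h.num_eq_occ fun A _ => ?_⟩
  · have h1 := h.length_le
    have h2 : Fintype.card (Fin G.numVars) ≤ ord.length := by
      rw [← List.toFinset_card_of_nodup h.nodup, ← Finset.card_univ]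
      exact Finset.card_le_card fun A _ => by simpa using hall A
    simp at h2; omega
  · rw [List.take_length]; exact hall A

end TopSearch

/-- The variables in the rule of a variable come after it. -/
theorem TopOrder.mem_drop {ord : List (Fin G.numVars)} (h : G.TopOrder ord) {i : ℕ}
    (hi : i < ord.length) {B : Fin G.numVars} (hB : (G.rule ord[i]).Mentions B) :
    B ∈ ord.drop (i + 1) := by
  obtain ⟨j, hj, rfl⟩ := List.getElem_of_mem (h.mem B)
  obtain ⟨i', hi', he⟩ := List.mem_take_iff_getElem.mp (h.top j hj _ hB)
  have := (List.Nodup.getElem_inj_iff h.nodup).mp he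
  refine List.mem_drop_iff_getElem.mpr ⟨j - (i + 1), by omega, ?_⟩
  congr 1
  omega

theorem TopOrder.not_mem_drop {ord : List (Fin G.numVars)} (h : G.TopOrder ord) {i : ℕ}
    (hi : i < ord.length) : ord[i] ∉ ord.drop (i + 1) := by
  intro hc
  obtain ⟨j, hj, he⟩ := List.mem_drop_iff_getElem.mp hc
  have := (List.Nodup.getElem_inj_iff h.nodup).mp he
  omega

/-! # Access to the encoding of a program -/

theorem getD_flatten {L : List (List ℕ)} (hL : ∀ l ∈ L, l.length = 3) (i j : ℕ) (hj : j < 3) :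
    L.flatten.getD (3 * i + j) 0 = (L.getD i []).getD j 0 := by
  induction L generalizing i with
  | nil => simp
  | cons l L ih =>
    have hl := hL l (by simp)
    rw [List.flatten_cons]
    cases i with
    | zero =>
      simp only [mul_zero, zero_add]
      rw [List.getD_append _ _ _ _ (by omega)]; simp
    | succ i =>
      rw [List.getD_append_right _ _ _ _ (by omega), hl,
        show 3 * (i + 1) + j - 3 = 3 * i + j by omega, ih (fun l' h' => hL l' (by simp [h'])) i]
      simp

theorem encode_getD (G : RLSLP σ) (A : Fin G.numVars) (j : ℕ) (hj : j < 3) :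
    G.encode.getD (2 + 3 * A + j) 0 = (G.rule A).encode.getD j 0 := by
  rw [encode, show 2 + 3 * (A : ℕ) + j = (3 * A + j) + 1 + 1 by omega, List.getD_cons_succ,
    List.getD_cons_succ, getD_flatten _ _ _ hj]
  · congr 1
    rw [List.getD_eq_getElem _ _ (by simp)]
    simp
  · intro l hl
    simp only [List.mem_ofFn] at hl
    obtain ⟨B, rfl⟩ := hl
    cases G.rule B <;> rfl

theorem length_encode (G : RLSLP σ) : G.encode.length = 2 + 3 * G.numVars := by
  have : ∀ A, ((G.rule A).encode).length = 3 := fun A => by cases G.rule A <;> rfl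
  simp [encode, List.length_flatten, List.map_ofFn, Function.comp_def, this]
  omega

theorem numVars_le_size (G : RLSLP σ) : G.numVars ≤ G.size := by
  have : ∑ _A : Fin G.numVars, 1 ≤ G.size :=
    Finset.sum_le_sum fun A _ => by cases G.rule A <;> simp [RLRule.size]
  simpa using this

end RLSLP

namespace WordRAM

local notation "R" => Expr.reg
local notation "M" => Expr.load

/-! # The layout of the data structure -/

/-- The number of cells for each variable. -/
@[irreducible] def stride (c : ℕ) : ℕ := 33 + 3 * c

/-- The address of the record of variable number `A`, where `V` is the number of variables. -/
@[irreducible] def recAt (c V A : ℕ) : ℕ := 2 + 3 * V + stride c * A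

/-- The address of the record of a variable, where register 2 holds the address of the first. -/
def recE (c : ℕ) (e : Expr) : Expr := R 2 + Expr.const (stride c) * e

section layout
variable {c V : ℕ}

/-- Division with remainder by the stride recovers the variable and the field. -/
theorem recAt_add_inj {A B f f' : ℕ} (hf : f < stride c) (hf' : f' < stride c)
    (h : recAt c V A + f = recAt c V B + f') : A = B ∧ f = f' := by
  have h1 : stride c * A + f = stride c * B + f' := by unfold recAt at h; omega
  have h2 : (stride c * A + f) / stride c = A := by
    rw [Nat.mul_add_div (by omega), Nat.div_eq_of_lt hf, add_zero]
  have h3 : (stride c * B + f') / stride c = B := by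
    rw [Nat.mul_add_div (by omega), Nat.div_eq_of_lt hf', add_zero]
  have h4 : A = B := by rw [← h2, ← h3, h1]
  subst h4
  exact ⟨rfl, by omega⟩

theorem lt_stride {f : ℕ} (h : f < 33) : f < stride c := by unfold stride; omega

theorem recAt_ne {A B f f' : ℕ} (hf : f < stride c) (hf' : f' < stride c)
    (h : ¬ (A = B ∧ f = f')) : recAt c V A + f ≠ recAt c V B + f' :=
  fun he => h (recAt_add_inj hf hf' he)

theorem update_recAt {m : ℕ → ℕ} {A B f f' v : ℕ} (hf : f < 33) (hf' : f' < 33) :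
    Function.update m (recAt c V A + f) v (recAt c V B + f') =
      if B = A ∧ f' = f then v else m (recAt c V B + f') := by
  split_ifs with h
  · rw [h.1, h.2, Function.update_self]
  · exact Function.update_of_ne (recAt_ne (lt_stride hf') (lt_stride hf) h) _ _

theorem recAt_succ (A : ℕ) : recAt c V (A + 1) = recAt c V A + stride c := by
  unfold recAt; ring

theorem recAt_mono {A B : ℕ} (h : A ≤ B) : recAt c V A ≤ recAt c V B := by
  unfold recAt
  exact Nat.add_le_add_left (Nat.mul_le_mul_left _ h) _

theorem recAt_le {A : ℕ} (h : A ≤ V) : recAt c V A + stride c ≤ recAt c V (V + 1) := by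
  rw [← recAt_succ]; exact recAt_mono (by omega)

theorem le_recAt (A : ℕ) : 2 + 3 * V + stride c * A ≤ recAt c V A := by
  rw [recAt]

theorem fold_recAt (A : ℕ) : 2 + 3 * V + stride c * A = recAt c V A := by
  rw [recAt]

theorem val_recE {s : State} {e : Expr} : (recE c e).val s = s.reg 2 + stride c * e.val s := rfl

theorem safe_recE {w : ℕ} {s : State} {e : Expr} : (recE c e).Safe w s ↔
    (stride c < 2 ^ w ∧ e.Safe w s ∧ stride c * e.val s < 2 ^ w) ∧
    s.reg 2 + stride c * e.val s < 2 ^ w := by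
  exact ⟨fun h => h.2, fun h => ⟨trivial, h⟩⟩

theorem cost_recE {e : Expr} : (recE c e).cost = e.cost + 4 := by
  simp only [recE, cost_add, cost_mul, cost_reg, cost_const]; omega

end layout

/-- The words are long enough. -/
structure Fits {σ : ℕ} (G : RLSLP σ) (c w : ℕ) : Prop where
  size_le : recAt c G.numVars (G.numVars + 1) + 3 * c + 1000 * (G.text.length + 1) ≤ 2 ^ w

/-- The fixed registers and the input. -/
structure Env {σ : ℕ} (G : RLSLP σ) (c : ℕ) (s : State) : Prop where
  r2 : s.reg 2 = 2 + 3 * G.numVars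
  r3 : s.reg 3 = G.numVars
  r44 : s.reg 44 = recAt c G.numVars (G.numVars + 1)
  inp : ∀ x < 2 + 3 * G.numVars, s.mem x = G.encode.getD x 0

section env
variable {σ c w : ℕ} {G : RLSLP σ} {s : State}

theorem Env.cell (h : Env G c s) (A : Fin G.numVars) {j : ℕ} (hj : j < 3) :
    s.mem (2 + 3 * A + j) = (G.rule A).encode.getD j 0 := by
  have := A.2
  rw [h.inp _ (by omega), RLSLP.encode_getD G A j hj]

theorem Env.cell0 (h : Env G c s) (A : Fin G.numVars) :
    s.mem (2 + 3 * A) = (G.rule A).encode.getD 0 0 := h.cell A (j := 0) (by omega)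

theorem Env.congr {s' : State} (h : Env G c s) (h2 : s'.reg 2 = s.reg 2) (h3 : s'.reg 3 = s.reg 3)
    (h44 : s'.reg 44 = s.reg 44) (hm : ∀ x < 2 + 3 * G.numVars, s'.mem x = s.mem x) :
    Env G c s' :=
  ⟨h2.trans h.r2, h3.trans h.r3, h44.trans h.r44, fun x hx => (hm x hx).trans (h.inp x hx)⟩

theorem Env.set (h : Env G c s) {x v : ℕ} (hx : x ≠ 2 ∧ x ≠ 3 ∧ x ≠ 44) : Env G c (s.set x v) := by
  refine h.congr ?_ ?_ ?_ fun _ _ => rfl <;> rw [State.set_reg, if_neg (by tauto)]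

theorem Env.put (h : Env G c s) {A f v : ℕ} :
    Env G c (s.put (recAt c G.numVars A + f) v) := by
  refine h.congr rfl rfl rfl fun x hx => Function.update_of_ne ?_ _ _
  unfold recAt; omega

theorem Fits.rec_lt (h : Fits G c w) {A : ℕ} (hA : A ≤ G.numVars) :
    recAt c G.numVars A + stride c + 3 * c + 1000 * (G.text.length + 1) ≤ 2 ^ w := by
  have h1 := recAt_le (c := c) hA
  have h2 := h.size_le
  linarith

end env

/-! # Topological search -/

section search
variable {σ c w : ℕ} {O : Subroutines c} {G : RLSLP σ}

/-- The tables of the topological search in memory. -/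
structure SearchMem (G : RLSLP σ) (c : ℕ) (m : ℕ → ℕ) (ind num : Fin G.numVars → ℕ)
    (ord : List (Fin G.numVars)) : Prop where
  ind : ∀ A : Fin G.numVars, m (recAt c G.numVars A + 24) = ind A
  ord : ∀ i (hi : i < ord.length), m (recAt c G.numVars i + 25) = ord[i]
  num : ∀ A : Fin G.numVars, m (recAt c G.numVars A + 26) = num A
  zero : ∀ A ≤ G.numVars, ∀ f < 33, (A = G.numVars ∨ (f ≠ 24 ∧ f ≠ 25 ∧ f ≠ 26)) →
    m (recAt c G.numVars A + f) = 0

theorem update_input {m : ℕ → ℕ} {A f v x : ℕ} (hx : x < 2 + 3 * G.numVars) :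
    Function.update m (recAt c G.numVars A + f) v x = m x := by
  refine Function.update_of_ne ?_ _ _
  unfold recAt; omega

theorem SearchMem.set_ind {m : ℕ → ℕ} {ind num : Fin G.numVars → ℕ} {ord : List (Fin G.numVars)}
    (h : SearchMem G c m ind num ord) (B : Fin G.numVars) (v : ℕ) :
    SearchMem G c (Function.update m (recAt c G.numVars B + 24) v) (Function.update ind B v) num
      ord := by
  refine ⟨fun A => ?_, fun i hi => ?_, fun A => ?_, fun A hA f hf hz => ?_⟩
  · rw [update_recAt (by omega) (by omega), h.ind, Function.update_apply]
    simp [Fin.ext_iff]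
  · rw [update_recAt (by omega) (by omega), h.ord i hi]; simp
  · rw [update_recAt (by omega) (by omega), h.num]; simp
  · have := B.2
    rw [update_recAt (by omega) (by omega), h.zero A hA f hf hz, if_neg (by omega)]

theorem SearchMem.set_num {m : ℕ → ℕ} {ind num : Fin G.numVars → ℕ} {ord : List (Fin G.numVars)}
    (h : SearchMem G c m ind num ord) (B : Fin G.numVars) (v : ℕ) :
    SearchMem G c (Function.update m (recAt c G.numVars B + 26) v) ind (Function.update num B v)
      ord := by
  refine ⟨fun A => ?_, fun i hi => ?_, fun A => ?_, fun A hA f hf hz => ?_⟩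
  · rw [update_recAt (by omega) (by omega), h.ind]; simp
  · rw [update_recAt (by omega) (by omega), h.ord i hi]; simp
  · rw [update_recAt (by omega) (by omega), h.num, Function.update_apply]
    simp [Fin.ext_iff]
  · have := B.2
    rw [update_recAt (by omega) (by omega), h.zero A hA f hf hz, if_neg (by omega)]

theorem SearchMem.push {m : ℕ → ℕ} {ind num : Fin G.numVars → ℕ} {ord : List (Fin G.numVars)}
    (h : SearchMem G c m ind num ord) (B : Fin G.numVars) (hlt : ord.length < G.numVars) :
    SearchMem G c (Function.update m (recAt c G.numVars ord.length + 25) B) ind num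
      (ord ++ [B]) := by
  refine ⟨fun A => ?_, fun i hi => ?_, fun A => ?_, fun A hA f hf hz => ?_⟩
  · rw [update_recAt (by omega) (by omega), h.ind]; simp
  · rw [update_recAt (by omega) (by omega)]
    simp only [List.length_append, List.length_singleton] at hi
    by_cases hi' : i = ord.length
    · subst hi'; simp
    · rw [if_neg (by omega), h.ord i (by omega), List.getElem_append_left]
  · rw [update_recAt (by omega) (by omega), h.num]; simp
  · rw [update_recAt (by omega) (by omega), h.zero A hA f hf hz, if_neg (by omega)]

/-- Count one more occurrence of the variable with the given number. -/
def countOne (c : ℕ) (e : Expr) : Prog :=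
  .set 6 (recE c e + 24) ;; .store (R 6) (M (R 6) + 1)

/-- Count the occurrences of variables in the rule of the variable in register 4. -/
def countRule (c : ℕ) : Prog :=
  .set 5 (2 + 3 * R 4) ;; .ite (M (R 5)) (countOne c (M (R 5 + 1))) .skip ;;
  .ite (Expr.equal (M (R 5)) 1) (countOne c (M (R 5 + 2))) .skip ;; .set 4 (R 4 + 1)

theorem wp_countOne (hf : Fits G c w) {s : State} (hs : Env G c s) {e : Expr}
    {ind num : Fin G.numVars → ℕ} {ord : List (Fin G.numVars)}
    (hm : SearchMem G c s.mem ind num ord) {B : Fin G.numVars} (he : e.Safe w s) (hB : e.val s = B)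
    (hind : ind B + 1 < 2 ^ w) {Q : ℕ → State → Prop}
    (hQ : ∀ t s', t ≤ e.cost + 20 → Env G c s' → (∀ x, x ≠ 6 → s'.reg x = s.reg x) →
      SearchMem G c s'.mem (Function.update ind B (ind B + 1)) num ord → Q t s') :
    wp w O (countOne c e) Q s := by
  have h1 := hf.rec_lt B.2.le
  have h2 := le_recAt (c := c) (V := G.numVars) B
  simp only [countOne, wp, safe_load, safe_add, safe_reg, safe_num, val_add, val_load, val_reg,
    val_num, State.set_reg, State.set_mem, cost_load, cost_add, cost_reg, cost_num, val_recE,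
    safe_recE, cost_recE, hB, he, hs.r2, fold_recAt, hm.ind, if_true, true_and]
  refine ⟨⟨⟨⟨by omega, by omega⟩, by omega⟩, by omega, by omega⟩, ⟨by omega, hind⟩, ?_⟩
  refine hQ _ _ (by omega) (hs.congr ?_ ?_ ?_ ?_) ?_ ?_
  · simp [State.put_reg, State.set_reg]
  · simp [State.put_reg, State.set_reg]
  · simp [State.put_reg, State.set_reg]
  · intro x hx; exact update_input hx
  · intro x hx
    simp [State.put_reg, State.set_reg, hx]
  · exact hm.set_ind B _

theorem wp_countRule (hf : Fits G c w) {s : State} (hs : Env G c s)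
    {ind num : Fin G.numVars → ℕ} {ord : List (Fin G.numVars)}
    (hm : SearchMem G c s.mem ind num ord) {A : Fin G.numVars} (hA : s.reg 4 = A)
    (hind : ∀ B, ind B + 2 < 2 ^ w) {Q : ℕ → State → Prop}
    (hQ : ∀ t s', t ≤ 200 → Env G c s' → s'.reg 4 = A + 1 →
      SearchMem G c s'.mem (fun B => ind B + G.deg A B) num ord → Q t s') :
    wp w O (countRule c) Q s := by
  have h1 := hf.rec_lt A.2.le
  have h2 := le_recAt (c := c) (V := G.numVars) A
  have hVA := A.2
  have h3 := hf.rec_lt (A := 0) (by omega)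
  have h4 := le_recAt (c := c) (V := G.numVars) 0
  have c0 := hs.cell A (j := 0) (by omega)
  have c1 := hs.cell A (j := 1) (by omega)
  have c2 := hs.cell A (j := 2) (by omega)
  have hs5 : Env G c (s.set 5 (2 + 3 * ↑A)) :=
    hs.congr (by simp [State.set_reg]) (by simp [State.set_reg]) (by simp [State.set_reg])
      (fun _ _ => rfl)
  simp only [add_zero] at c0
  simp only [countRule, wp, safe_load, safe_add, safe_mul, safe_reg, safe_num, val_add, val_mul,
    val_load, val_reg, val_num, State.set_reg, State.set_mem, cost_load, cost_add, cost_mul,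
    cost_reg, cost_num, cost_bin, safe_equal, val_equal, hA, c0, if_true, true_and]
  refine ⟨⟨by omega, ⟨by omega, by omega⟩, by omega⟩, ?_⟩
  cases hr : G.rule A with
  | term a =>
    simp only [RLRule.encode, List.getD_cons_zero, ne_eq, not_true, false_imp_iff, true_imp_iff,
      Nat.reduceEqDiff, if_false, zero_ne_one, true_and, and_assoc]
    repeat refine ⟨by omega, ?_⟩
    refine hQ _ _ (by omega) (hs5.congr ?_ ?_ ?_ fun _ _ => rfl) ?_ ?_
    · simp [State.set_reg]
    · simp [State.set_reg]
    · simp [State.set_reg]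
    · simp [State.set_reg]
    · simpa [RLSLP.deg_term hr] using hm
  | run B t =>
    simp only [hr, RLRule.encode, List.getD_cons_zero, ne_eq, OfNat.ofNat_ne_zero,
      not_false_eq_true, false_imp_iff, true_imp_iff, and_true, List.getD_cons_succ] at c0 c1 c2 ⊢
    refine wp_countOne hf hs5 hm (B := B) ?_ ?_ ?_ ?_
    · simp only [safe_load, safe_add, safe_reg, safe_num, State.set_reg, val_reg, val_num,
        if_true, true_and]
      omega
    · simp [State.set_reg, State.set_mem, c1]
    · have := hind B; omega
    intro t1 s1 ht1 hs1 hr1 hm1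
    have r5 := hr1 5 (by simp)
    have r4 := hr1 4 (by simp)
    have c0' := hs1.cell0 A
    simp only [State.set_reg, if_true, if_false, hA, hr, RLRule.encode, List.getD_cons_zero,
      cost_load, cost_add, cost_reg, cost_num, Nat.reduceEqDiff]
      at r5 r4 c0' ht1
    simp only [r5, r4, c0', Nat.reduceEqDiff, if_false, not_true, false_imp_iff,
      true_imp_iff, true_and, and_assoc]
    repeat refine ⟨by omega, ?_⟩
    refine hQ _ _ (by omega) (hs1.congr ?_ ?_ ?_ fun _ _ => rfl) ?_ ?_
    · simp [State.set_reg]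
    · simp [State.set_reg]
    · simp [State.set_reg]
    · simp [State.set_reg]
    · have e : (fun C => ind C + G.deg A C) = Function.update ind B (ind B + 1) := by
        funext C
        rw [RLSLP.deg_run hr, Function.update_apply]
        split_ifs with h
        · rw [h]
        · rfl
      rw [e]; exact hm1
  | pair B D =>
    simp only [hr, RLRule.encode, List.getD_cons_zero, ne_eq, one_ne_zero,
      not_false_eq_true, false_imp_iff, true_imp_iff, and_true, List.getD_cons_succ] at c0 c1 c2 ⊢
    refine wp_countOne hf hs5 hm (B := B) ?_ ?_ ?_ ?_
    · simp only [safe_load, safe_add, safe_reg, safe_num, State.set_reg, val_reg, val_num,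
        if_true, true_and]
      omega
    · simp [State.set_reg, State.set_mem, c1]
    · have := hind B; omega
    intro t1 s1 ht1 hs1 hr1 hm1
    have r5 := hr1 5 (by simp)
    have r4 := hr1 4 (by simp)
    have c0' := hs1.cell0 A
    have c2' := hs1.cell A (j := 2) (by omega)
    simp only [State.set_reg, if_true, if_false, hA, hr, RLRule.encode, List.getD_cons_zero,
      List.getD_cons_succ,
      cost_load, cost_add, cost_reg, cost_num, Nat.reduceEqDiff]
      at r5 r4 c0' c2' ht1
    simp only [r5, c0', if_true, one_ne_zero, not_false_eq_true, false_imp_iff,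
      true_imp_iff, and_true]
    refine ⟨⟨by omega, by omega⟩, ?_⟩
    refine wp_countOne hf hs1 hm1 (B := D) ?_ ?_ ?_ ?_
    · simp only [safe_load, safe_add, safe_reg, safe_num, r5, val_reg, val_num, true_and]
      omega
    · simp [r5, c2']
    · have h1 := hind B
      have h2 := hind D
      rw [Function.update_apply]; split_ifs <;> omega
    intro t2 s2 ht2 hs2 hr2 hm2
    have r4' := hr2 4 (by simp)
    rw [r4] at r4'
    simp only [cost_load, cost_add, cost_reg, cost_num] at ht2
    simp only [r4']
    refine ⟨⟨by omega, by omega⟩, ?_⟩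
    refine hQ _ _ (by omega) (hs2.congr ?_ ?_ ?_ fun _ _ => rfl) ?_ ?_
    · simp [State.set_reg]
    · simp [State.set_reg]
    · simp [State.set_reg]
    · simp [State.set_reg]
    · have e : (fun C => ind C + G.deg A C) = Function.update (Function.update ind B (ind B + 1)) D
          (Function.update ind B (ind B + 1) D + 1) := by
        funext C
        rw [RLSLP.deg_pair hr, Function.update_apply, Function.update_apply, Function.update_apply]
        split_ifs <;> simp_all
      rw [e]; exact hm2

end search

/-! ### Kahn's algorithm with numbers of occurrences -/

section search
variable {σ c w : ℕ} {O : Subroutines c} {G : RLSLP σ}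

/-- Put the variable in register 4 into the queue if it does not occur in any rule. -/
def enqueue (c : ℕ) : Prog :=
  .ite (M (recE c (R 4) + 24)) .skip (.store (recE c (R 7) + 25) (R 4) ;; .set 7 (R 7 + 1)) ;;
  .set 4 (R 4 + 1)

/-- Process an occurrence of the variable in register 10 in the rule of a variable, where register
11 holds the number of occurrences that it contributes. -/
def touch (c : ℕ) : Prog :=
  .set 12 (recE c (R 10)) ;; .store (R 12 + 24) (M (R 12 + 24) - 1) ;;
  .store (R 12 + 26) (M (R 12 + 26) + R 11) ;;
  .ite (M (R 12 + 24)) .skip (.store (recE c (R 7) + 25) (R 10) ;; .set 7 (R 7 + 1))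

/-- Process the next variable in the queue. -/
def visit (c : ℕ) : Prog :=
  .set 4 (M (recE c (R 8) + 25)) ;; .set 8 (R 8 + 1) ;; .set 5 (2 + 3 * R 4) ;;
  .set 9 (M (recE c (R 4) + 26)) ;;
  .ite (M (R 5)) (.set 10 (M (R 5 + 1)) ;;
    .ite (Expr.equal (M (R 5)) 1) (.set 11 (R 9)) (.set 11 (R 9 * M (R 5 + 2))) ;; touch c) .skip ;;
  .ite (Expr.equal (M (R 5)) 1) (.set 10 (M (R 5 + 2)) ;; .set 11 (R 9) ;; touch c) .skip

/-- Compute a topological order and the numbers of occurrences. -/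
def search (c : ℕ) : Prog :=
  .set 4 0 ;; .loop (Expr.less (R 4) (R 3)) (countRule c) ;; .set 4 0 ;; .set 7 0 ;;
  .loop (Expr.less (R 4) (R 3)) (enqueue c) ;; .store (recE c (M 1) + 26) 1 ;; .set 8 0 ;;
  .loop (Expr.less (R 8) (R 7)) (visit c)

theorem wp_touch (hf : Fits G c w) {s : State} (hs : Env G c s) {ind num : Fin G.numVars → ℕ}
    {ord : List (Fin G.numVars)} (hm : SearchMem G c s.mem ind num ord) {B : Fin G.numVars} {v : ℕ}
    (hB : s.reg 10 = B) (hv : s.reg 11 = v) (h7 : s.reg 7 = ord.length) (hind : ind B < 2 ^ w)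
    (hnum : num B + v < 2 ^ w) (hord : ind B - 1 = 0 → ord.length < G.numVars)
    {Q : ℕ → State → Prop}
    (hQ : ∀ t s', t ≤ 100 → Env G c s' → (∀ x, x ≠ 7 → x ≠ 12 → s'.reg x = s.reg x) →
      s'.reg 7 = (if ind B - 1 = 0 then ord ++ [B] else ord).length →
      SearchMem G c s'.mem (Function.update ind B (ind B - 1)) (Function.update num B (num B + v))
        (if ind B - 1 = 0 then ord ++ [B] else ord) → Q t s') :
    wp w O (touch c) Q s := by
  have h1 := hf.rec_lt B.2.le
  have h2 := le_recAt (c := c) (V := G.numVars) B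
  have hm1 := (hm.set_ind B (ind B - 1)).set_num B (num B + v)
  have e26 : Function.update s.mem (recAt c G.numVars B + 24) (ind B - 1)
      (recAt c G.numVars B + 26) = num B := by
    rw [update_recAt (by omega) (by omega), hm.num]; simp
  have e24 := hm1.ind B
  rw [Function.update_self] at e24
  simp only [touch, wp, safe_load, safe_add, safe_sub, safe_reg, safe_num, val_add, val_sub,
    val_load, val_reg, val_num, State.set_reg, State.set_mem, State.put_reg, State.put_mem,
    cost_load, cost_add, cost_sub, cost_reg, cost_num, val_recE, safe_recE, cost_recE, hB, hv, h7,
    hs.r2, fold_recAt, hm.ind, e26, e24, if_true, true_and, and_true, and_assoc, Nat.reduceEqDiff,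
    if_false]
  repeat refine ⟨by omega, ?_⟩
  refine ⟨fun hne => ?_, fun h0 => ?_⟩
  · rw [if_neg hne] at hQ
    refine hQ _ _ (by omega) (((hs.set (by decide)).put).put) ?_ ?_ hm1
    · intro x _ hx
      simp [State.put_reg, State.set_reg, hx]
    · simp [State.put_reg, State.set_reg, h7]
  · have hlt := hord h0
    have h3 := hf.rec_lt hlt.le
    have h4 := le_recAt (c := c) (V := G.numVars) ord.length
    rw [if_pos h0] at hQ
    repeat refine ⟨by omega, ?_⟩
    refine hQ _ _ (by omega) (((((hs.set (by decide)).put).put).put).set (by decide)) ?_ ?_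
      (hm1.push B hlt)
    · intro x hx7 hx
      simp [State.put_reg, State.set_reg, hx, hx7]
    · simp [State.set_reg]

theorem ind_le {ind num : Fin G.numVars → ℕ} {ord : List (Fin G.numVars)} {k : ℕ}
    (h : G.TopSearch ind num ord k) (B : Fin G.numVars) : ind B ≤ 2 * G.numVars := by
  rw [h.ind_eq]
  refine le_trans (Finset.sum_le_sum (g := fun _ => 2) fun A _ => ?_) ?_
  · split_ifs
    · omega
    · exact RLSLP.deg_le _ _
  · simp; omega

theorem length_lt_of_nodup {ord : List (Fin G.numVars)} {B : Fin G.numVars} (h : ord.Nodup)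
    (hB : B ∉ ord) : ord.length < G.numVars := by
  have := (List.nodup_cons.mpr ⟨hB, h⟩).length_le_card
  simp at this; omega

/-- The two occurrences are processed one after the other, and `B = D` is allowed. In that case the
counter is still positive after the first, so the variable is queued only once. -/
theorem _root_.RLSLP.TopSearch.step_pair {ind num : Fin G.numVars → ℕ}
    {ord : List (Fin G.numVars)} {k : ℕ} (ht : G.TopSearch ind num ord k) (hk : k < ord.length)
    {B D : Fin G.numVars} (hr : G.rule ord[k] = .pair B D) :
    G.TopSearch
      (Function.update (Function.update ind B (ind B - 1)) D
        (Function.update ind B (ind B - 1) D - 1))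
      (Function.update (Function.update num B (num B + G.occ ord[k])) D
        (Function.update num B (num B + G.occ ord[k]) D + G.occ ord[k]))
      (if Function.update ind B (ind B - 1) D - 1 = 0 then
        (if ind B - 1 = 0 then ord ++ [B] else ord) ++ [D]
        else if ind B - 1 = 0 then ord ++ [B] else ord) (k + 1) := by
  have hdB := ht.deg_le_ind hk B
  have hdD := ht.deg_le_ind hk D
  have key := ht.step hk (ind' := fun C => ind C - G.deg ord[k] C)
    (num' := fun C => num C + G.mult ord[k] C * G.occ ord[k])
    (new := (if ind B - 1 = 0 then [B] else []) ++
        (if Function.update ind B (ind B - 1) D - 1 = 0 then [D] else [])) ?_ (fun C => ?_)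
      (fun C => rfl) (fun C => rfl)
  · have e1 : (Function.update (Function.update ind B (ind B - 1)) D
        (Function.update ind B (ind B - 1) D - 1)) = fun C => ind C - G.deg ord[k] C := by
      funext C
      simp only [RLSLP.deg_pair hr, Function.update_apply]
      by_cases hCD : C = D
      · subst hCD
        by_cases hCB : C = B
        · subst hCB; simp; omega
        · simp [hCB]
      · by_cases hCB : C = B
        · subst hCB; simp [hCD]
        · simp [hCB, hCD]
    have e2 : (Function.update (Function.update num B (num B + G.occ ord[k])) D
        (Function.update num B (num B + G.occ ord[k]) D + G.occ ord[k])) =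
        fun C => num C + G.mult ord[k] C * G.occ ord[k] := by
      funext C
      simp only [RLSLP.mult_pair hr, Function.update_apply]
      by_cases hCD : C = D
      · subst hCD
        by_cases hCB : C = B
        · subst hCB; simp; ring
        · simp [hCB]
      · by_cases hCB : C = B
        · subst hCB; simp [hCD]
        · simp [hCB, hCD]
    rw [e1, e2]
    convert key using 1
    split_ifs <;> simp
  · rw [Function.update_apply]
    rw [RLSLP.deg_pair hr, if_pos rfl] at hdB
    by_cases hDB : D = B
    · subst hDB
      simp at hdB
      rw [if_pos rfl, if_neg (by omega : ¬ ind D - 1 = 0)]; split_ifs <;> simp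
    · split_ifs <;> simp [Ne.symm hDB]
  · rw [RLSLP.deg_pair hr, Function.update_apply]
    rw [RLSLP.deg_pair hr, if_pos rfl] at hdB
    rw [RLSLP.deg_pair hr, if_pos (rfl : D = D)] at hdD
    by_cases hDB : D = B
    · subst hDB
      simp at hdD
      rw [if_pos rfl, if_neg (by omega : ¬ ind D - 1 = 0)]
      by_cases hCD : C = D
      · subst hCD; split_ifs <;> simp <;> omega
      · simp [hCD]
    · rw [if_neg hDB]
      by_cases hCB : C = B
      · subst hCB
        have : ¬ C = D := fun h => hDB h.symm
        split_ifs <;> simp [this] <;> omega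
      · by_cases hCD : C = D
        · subst hCD
          split_ifs <;> simp [hCB] <;> omega
        · split_ifs <;> simp [hCB, hCD]

/-- The delicate point is overflow, in particular of the product `occ A * t` at a rule `A → B ^ t`.
By `num_add_le` the counter of `B` remains at most `occ B`, hence at most `n`, even after the
addition. -/
theorem wp_visit (hf : Fits G c w) {s : State} (hs : Env G c s) {ind num : Fin G.numVars → ℕ}
    {ord : List (Fin G.numVars)} {k : ℕ} (hm : SearchMem G c s.mem ind num ord)
    (ht : G.TopSearch ind num ord k) (hk : k < ord.length) (h8 : s.reg 8 = k)
    (h7 : s.reg 7 = ord.length) {Q : ℕ → State → Prop}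
    (hQ : ∀ t s' ind' num' ord', t ≤ 400 → Env G c s' → SearchMem G c s'.mem ind' num' ord' →
      G.TopSearch ind' num' ord' (k + 1) → s'.reg 8 = k + 1 → s'.reg 7 = ord'.length → Q t s') :
    wp w O (visit c) Q s := by
  have hlen := ht.length_le
  have hkV : k < G.numVars := by omega
  have hA := ord[k].2
  have h1 := hf.rec_lt hkV.le
  have h2 := le_recAt (c := c) (V := G.numVars) k
  have h3 := hf.rec_lt hA.le
  have h4 := le_recAt (c := c) (V := G.numVars) ord[k]
  have hocc := RLSLP.occ_le (G := G) ord[k]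
  have e26 := hm.num ord[k]
  rw [ht.num_getElem hk] at e26
  have e25 := hm.ord k hk
  have hind := ind_le ht
  have hnum := ht.num_add_le hk
  have hoccle := fun B => RLSLP.occ_le (G := G) B
  have hstep := fun ind' num' new => ht.step hk (ind' := ind') (num' := num') (new := new)
  have hdeg := ht.deg_le_ind hk
  have hmem := ht.mem_iff
  have hpair := fun B D => ht.step_pair hk (B := B) (D := D)
  generalize hAeq : ord[k] = A at *
  have c0 := hs.cell0 A
  have c1 := hs.cell A (j := 1) (by omega)
  have c2 := hs.cell A (j := 2) (by omega)
  simp only [visit, wp, safe_load, safe_add, safe_sub, safe_mul, safe_reg, safe_num, val_add,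
    val_sub, val_mul,
    val_load, val_reg, val_num, State.set_reg, State.set_mem, State.put_reg, State.put_mem,
    cost_load, cost_add, cost_mul, cost_sub, cost_reg, cost_num, val_recE, safe_recE, cost_recE, h8,
    hs.r2, fold_recAt, e25, e26, if_true, true_and, and_true, and_assoc, Nat.reduceEqDiff,
    if_false, c0, c1, c2, safe_equal, val_equal, cost_bin]
  repeat refine ⟨by omega, ?_⟩
  have hs4 : Env G c ((((s.set 4 A).set 8 (k + 1)).set 5 (2 + 3 * A)).set 9 (G.occ A)) :=
    (((hs.set (by decide)).set (by decide)).set (by decide)).set (by decide)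
  cases hr : G.rule A with
  | term a =>
    simp only [RLRule.encode, List.getD_cons_zero, ne_eq, not_true, false_imp_iff, true_imp_iff,
      true_and, Nat.reduceEqDiff, if_false, zero_ne_one]
    repeat refine ⟨by omega, ?_⟩
    refine hQ _ _ ind num ord ?_ hs4 hm ?_ ?_ ?_
    · omega
    · have := hstep ind num [] (by simp) (fun B => by simp [RLSLP.deg_term hr])
        (fun B => by simp [RLSLP.deg_term hr]) (fun B => by simp [RLSLP.mult_term hr])
      simpa using this
    · simp [State.set_reg]
    · simp [State.set_reg, h7]
  | run B t =>
    have ht3 := G.three_le A B t hr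
    have hmul := hnum B
    rw [RLSLP.mult_run hr, if_pos rfl, mul_comm] at hmul
    have hB := hoccle B
    have hd := hdeg B
    have hi := hind B
    rw [RLSLP.deg_run hr, if_pos rfl] at hd
    simp only [hr, RLRule.encode, List.getD_cons_zero, ne_eq, OfNat.ofNat_ne_zero, OfNat.ofNat_ne_one,
      not_false_eq_true, false_imp_iff, true_imp_iff, and_true, true_and, List.getD_cons_succ,
      not_true, if_false]
    repeat refine ⟨by omega, ?_⟩
    refine wp_touch hf (B := B) (v := G.occ A * t) ((hs4.set (by decide)).set (by decide)) hm ?_ ?_ ?_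
      (by omega) (by omega) ?_ ?_
    · simp [State.set_reg]
    · simp [State.set_reg]
    · simp [State.set_reg, h7]
    · intro h0
      refine length_lt_of_nodup (B := B) ht.nodup fun hc => ?_
      have := (hmem B).mp hc
      omega
    intro t1 s1 ht1 hs1 hr1 hr7 hm1
    have r5 := hr1 5 (by simp) (by simp)
    have r8 := hr1 8 (by simp) (by simp)
    have c0' := hs1.cell0 A
    simp only [State.set_reg, hr, RLRule.encode, List.getD_cons_zero, Nat.reduceEqDiff, if_false,
      if_true] at r5 r8 c0'
    simp only [r5, c0', OfNat.ofNat_ne_one, if_false, not_true, false_imp_iff, true_imp_iff,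
      true_and]
    repeat refine ⟨by omega, ?_⟩
    refine hQ _ _ _ _ _ (by omega) hs1 hm1 ?_ r8 hr7
    have := hstep (Function.update ind B (ind B - 1)) (Function.update num B (num B + G.occ A * t))
      (if ind B - 1 = 0 then [B] else []) (by split_ifs <;> simp) (fun C => ?_) (fun C => ?_)
      (fun C => ?_)
    · convert this using 1
      split_ifs <;> simp
    · rw [RLSLP.deg_run hr]
      by_cases hCB : C = B
      · subst hCB; split_ifs <;> simp <;> omega
      · rw [if_neg hCB]; split_ifs <;> simp [hCB]
    · rw [RLSLP.deg_run hr, Function.update_apply]; split_ifs with h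
      · rw [h]
      · rfl
    · rw [RLSLP.mult_run hr, Function.update_apply]; split_ifs with h
      · rw [h, mul_comm]
      · simp
  | pair B D =>
    have hmulB := hnum B
    have hmulD := hnum D
    have hB := hoccle B
    have hD := hoccle D
    have hdB := hdeg B
    have hdD := hdeg D
    have hiB := hind B
    have hiD := hind D
    rw [RLSLP.deg_pair hr, if_pos rfl] at hdB
    rw [RLSLP.deg_pair hr, if_pos (rfl : D = D)] at hdD
    rw [RLSLP.mult_pair hr, if_pos rfl] at hmulB
    rw [RLSLP.mult_pair hr, if_pos (rfl : D = D)] at hmulD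
    rw [add_mul, one_mul] at hmulB hmulD
    simp only [hr, RLRule.encode, List.getD_cons_zero, ne_eq, one_ne_zero,
      not_false_eq_true, false_imp_iff, true_imp_iff, and_true, true_and, List.getD_cons_succ,
      if_true]
    repeat refine ⟨by omega, ?_⟩
    refine wp_touch hf (B := B) (v := G.occ A) ((hs4.set (by decide)).set (by decide)) hm ?_ ?_ ?_
      (by omega) (by omega) ?_ ?_
    · simp [State.set_reg]
    · simp [State.set_reg]
    · simp [State.set_reg, h7]
    · intro h0
      refine length_lt_of_nodup (B := B) ht.nodup fun hc => ?_
      have := (hmem B).mp hc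
      omega
    intro t1 s1 ht1 hs1 hr1 hr7 hm1
    have r5 := hr1 5 (by simp) (by simp)
    have r8 := hr1 8 (by simp) (by simp)
    have r9 := hr1 9 (by simp) (by simp)
    have c0' := hs1.cell0 A
    have c2' := hs1.cell A (j := 2) (by omega)
    simp only [State.set_reg, hr, RLRule.encode, List.getD_cons_zero, Nat.reduceEqDiff, if_false,
      if_true, List.getD_cons_succ] at r5 r8 r9 c0' c2'
    simp only [r5, c0', c2', r9, one_ne_zero, if_true, not_false_eq_true, false_imp_iff,
      true_imp_iff, and_true]
    repeat refine ⟨by omega, ?_⟩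
    refine wp_touch hf (B := D) (v := G.occ A) ((hs1.set (by decide)).set (by decide)) hm1 ?_ ?_ ?_
      ?_ ?_ ?_ ?_
    · simp [State.set_reg]
    · simp [State.set_reg]
    · simp only [State.set_reg, Nat.reduceEqDiff, if_false]; exact hr7
    · rw [Function.update_apply]; split_ifs <;> omega
    · rw [Function.update_apply]; split_ifs with h
      · rw [if_pos h] at hmulD
        subst h; omega
      · omega
    · rw [Function.update_apply]
      intro h0
      have hD' : D ∉ ord := fun hc => by
        have := (hmem D).mp hc
        omega
      split_ifs with h1
      · refine length_lt_of_nodup (B := D) ?_ ?_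
        · refine List.nodup_append.mpr ⟨ht.nodup, by simp, fun C hC C' hC' hCC => ?_⟩
          simp only [List.mem_singleton] at hC'
          subst hCC hC'
          have := (hmem C).mp hC
          omega
        · rw [List.mem_append, List.mem_singleton]
          rintro (h | h)
          · exact hD' h
          · subst h
            simp at hdD; omega
      · exact length_lt_of_nodup ht.nodup hD'
    intro t2 s2 ht2 hs2 hr2 hr7' hm2
    have r8' := hr2 8 (by simp) (by simp)
    simp only [State.set_reg, Nat.reduceEqDiff, if_false, r8] at r8'
    refine hQ _ _ _ _ _ (by omega) hs2 hm2 ?_ r8' hr7'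
    exact hpair B D hr

theorem wp_enqueue (hf : Fits G c w) {s : State} (hs : Env G c s) {ind num : Fin G.numVars → ℕ}
    {ord : List (Fin G.numVars)} (hm : SearchMem G c s.mem ind num ord) {A : Fin G.numVars}
    (hA : s.reg 4 = A) (h7 : s.reg 7 = ord.length) (hlen : ord.length < G.numVars)
    {Q : ℕ → State → Prop}
    (hQ : ∀ t s', t ≤ 100 → Env G c s' → s'.reg 4 = A + 1 →
      s'.reg 7 = (if ind A = 0 then ord ++ [A] else ord).length →
      SearchMem G c s'.mem ind num (if ind A = 0 then ord ++ [A] else ord) → Q t s') :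
    wp w O (enqueue c) Q s := by
  have h1 := hf.rec_lt A.2.le
  have h2 := le_recAt (c := c) (V := G.numVars) A
  have h3 := hf.rec_lt hlen.le
  have h4 := le_recAt (c := c) (V := G.numVars) ord.length
  simp only [enqueue, wp, safe_load, safe_add, safe_sub, safe_reg, safe_num, val_add, val_sub,
    val_load, val_reg, val_num, State.set_reg, State.set_mem, State.put_reg, State.put_mem,
    cost_load, cost_add, cost_sub, cost_reg, cost_num, val_recE, safe_recE, cost_recE, hA, h7,
    hs.r2, fold_recAt, hm.ind, if_true, true_and, and_true, and_assoc, Nat.reduceEqDiff, if_false]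
  repeat refine ⟨by omega, ?_⟩
  refine ⟨fun hne => ?_, fun h0 => ?_⟩
  · rw [if_neg hne] at hQ
    repeat refine ⟨by omega, ?_⟩
    refine hQ _ _ (by omega) (hs.set (by decide)) ?_ ?_ hm
    · simp [State.set_reg]
    · simp [State.set_reg, h7]
  · rw [if_pos h0] at hQ
    repeat refine ⟨by omega, ?_⟩
    refine hQ _ _ (by omega) ((hs.put.set (by decide)).set (by decide)) ?_ ?_ (hm.push A hlen)
    · simp [State.set_reg]
    · simp [State.set_reg]

/-- The outcome of the topological search. -/
structure Searched (G : RLSLP σ) (c : ℕ) (m : ℕ → ℕ) (ord : List (Fin G.numVars)) : Prop where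
  top : G.TopOrder ord
  length : ord.length = G.numVars
  ord : ∀ i (hi : i < ord.length), m (recAt c G.numVars i + 25) = ord[i]
  occ : ∀ A : Fin G.numVars, m (recAt c G.numVars A + 26) = G.occ A
  zero : ∀ A ≤ G.numVars, ∀ f < 33, (A = G.numVars ∨ (f ≠ 24 ∧ f ≠ 25 ∧ f ≠ 26)) →
    m (recAt c G.numVars A + f) = 0

/-- Three passes of linear time: the occurrences in rules are counted, the variables that occur
nowhere are queued, and the queue is processed. The invariants of the first two passes concern the
variables with a number below the loop counter. -/
theorem wp_search (hf : Fits G c w) {s : State} (hs : Env G c s)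
    (hm : SearchMem G c s.mem (fun _ => 0) (fun _ => 0) []) {Q : ℕ → State → Prop}
    (hQ : ∀ t s' ord, t ≤ 2000 * (G.numVars + 1) → Env G c s' → Searched G c s'.mem ord → Q t s') :
    wp w O (search c) Q s := by
  classical
  have hV0 : 0 < G.numVars := lt_of_le_of_lt (Nat.zero_le _) G.start.2
  have h1 := hf.rec_lt (A := 0) (by omega)
  have h2 := le_recAt (c := c) (V := G.numVars) 0
  have hst := hf.rec_lt G.start.2.le
  have hst' := le_recAt (c := c) (V := G.numVars) G.start
  simp only [search, wp, safe_num, val_num, cost_num]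
  refine ⟨by omega, ?_⟩
  refine wp_loop (fun n s' => ∃ a, a + n = G.numVars ∧ Env G c s' ∧ s'.reg 4 = a ∧
    SearchMem G c s'.mem (fun B => ∑ A : Fin G.numVars, if A.1 < a then G.deg A B else 0)
      (fun _ => 0) []) 200 ?_ (N := G.numVars) ?_ ?_
  · rintro n s' ⟨a, han, he, h4, hm'⟩
    simp only [safe_less, safe_reg, val_less, val_reg, h4, he.r3, true_and]
    refine ⟨by omega, fun hne => ?_⟩
    have ha : a < G.numVars := by
      by_contra hc
      rw [if_neg hc] at hne; exact hne rfl
    obtain ⟨n', rfl⟩ : ∃ n', n = n' + 1 := ⟨n - 1, by omega⟩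
    refine ⟨n', rfl, ?_⟩
    refine wp_countRule hf he hm' (A := ⟨a, ha⟩) h4 ?_ ?_
    · intro B
      have : ∑ A : Fin G.numVars, (if A.1 < a then G.deg A B else 0) ≤ 2 * G.numVars := by
        refine le_trans (Finset.sum_le_sum (g := fun _ => 2) fun A _ => ?_) ?_
        · split_ifs
          · exact RLSLP.deg_le _ _
          · omega
        · simp; omega
      omega
    · intro t s1 ht he1 h41 hm1
      refine ⟨ht, a + 1, by omega, he1, h41, ?_⟩
      have e : (fun B => ∑ A : Fin G.numVars, if A.1 < a + 1 then G.deg A B else 0) =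
          fun B => (∑ A : Fin G.numVars, if A.1 < a then G.deg A B else 0) + G.deg ⟨a, ha⟩ B := by
        funext B
        have : G.deg ⟨a, ha⟩ B = ∑ A : Fin G.numVars, if A = ⟨a, ha⟩ then G.deg A B else 0 := by
          simp
        rw [this, ← Finset.sum_add_distrib]
        refine Finset.sum_congr rfl fun A _ => ?_
        simp only [Fin.ext_iff]
        split_ifs <;> omega
      rw [e]; exact hm1
  · refine ⟨0, by omega, hs.set (by decide), by simp [State.set_reg], ?_⟩
    simpa using hm
  rintro t1 s1 n ht1 ⟨a, han, he1, h4, hm1⟩ hex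
  simp only [val_less, val_reg, h4, he1.r3] at hex
  have haV : a = G.numVars := by
    by_contra hc
    rw [if_pos (by omega)] at hex; omega
  subst haV
  simp only [Fin.is_lt, if_true] at hm1
  set ind : Fin G.numVars → ℕ := fun B => ∑ A, G.deg A B with hind
  refine ⟨by omega, by omega, ?_⟩
  refine wp_loop (fun n s' => ∃ a ord, a + n = G.numVars ∧ Env G c s' ∧ s'.reg 4 = a ∧
    s'.reg 7 = ord.length ∧ SearchMem G c s'.mem ind (fun _ => 0) ord ∧ ord.Nodup ∧
    ∀ B, B ∈ ord ↔ B.1 < a ∧ ind B = 0) 100 ?_ (N := G.numVars) ?_ ?_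
  · rintro n s' ⟨a, ord, han, he, h4, h7, hm', hnd, hmem⟩
    simp only [safe_less, safe_reg, val_less, val_reg, h4, he.r3, true_and]
    refine ⟨by omega, fun hne => ?_⟩
    have ha : a < G.numVars := by
      by_contra hc
      rw [if_neg hc] at hne; exact hne rfl
    obtain ⟨n', rfl⟩ : ∃ n', n = n' + 1 := ⟨n - 1, by omega⟩
    refine ⟨n', rfl, ?_⟩
    have hnot : (⟨a, ha⟩ : Fin G.numVars) ∉ ord := fun hc => by
      have := ((hmem _).mp hc).1
      simp at this
    refine wp_enqueue hf he hm' (A := ⟨a, ha⟩) h4 h7 (length_lt_of_nodup hnd hnot) ?_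
    intro t s1 ht he1 h41 h71 hm1
    refine ⟨ht, a + 1, _, by omega, he1, h41, h71, hm1, ?_, ?_⟩
    · split_ifs
      · exact List.nodup_append.mpr ⟨hnd, by simp, fun C hC C' hC' hCC => by
          simp only [List.mem_singleton] at hC'
          subst hCC hC'
          exact hnot hC⟩
      · exact hnd
    · intro B
      by_cases hB : B = ⟨a, ha⟩
      · subst hB
        split_ifs with h0
        · simp [h0]
        · simp [h0, hnot]
      · have hB' : B.1 ≠ a := fun h => hB (Fin.ext h)
        have : B.1 < a + 1 ↔ B.1 < a := by omega
        rw [this, ← hmem B]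
        split_ifs <;> simp [hB]
  · refine ⟨0, [], by omega, (he1.set (by decide)).set (by decide), by simp [State.set_reg],
      by simp [State.set_reg], hm1, by simp, by simp⟩
  rintro t2 s2 n2 ht2 ⟨a, ord, han2, he2, h4, h7, hm2, hnd, hmem⟩ hex
  simp only [val_less, val_reg, h4, he2.r3] at hex
  have haV : a = G.numVars := by
    by_contra hc
    rw [if_pos (by omega)] at hex; omega
  subst haV
  have e1 : s2.mem 1 = G.start := by
    rw [he2.inp 1 (by omega)]; rfl
  simp only [safe_load, safe_add, safe_reg, safe_num, val_add, val_load, val_reg, val_num,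
    cost_load, cost_add, cost_reg, cost_num, val_recE, safe_recE, cost_recE, e1, he2.r2, fold_recAt,
    true_and, and_assoc]
  repeat refine And.intro (by omega) ?_
  have hm3 := hm2.set_num G.start 1
  have he3 : Env G c (s2.put (recAt c G.numVars G.start + 26) 1) := he2.put
  -- Before the first visit nothing has been processed, and the only node counted so far is the
  -- root, at the start variable.
  have ht0 : G.TopSearch ind (Function.update (fun _ => 0) G.start 1) ord 0 := by
    refine ⟨hnd, by omega, fun B => ?_, fun B => ?_, fun B => ?_, fun i hi A hA => ?_⟩
    · simp [hind]
    · rw [hmem]; simp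
    · simp [Function.update_apply, eq_comm]
    · exfalso
      have h0 := ((hmem ord[i]).mp (List.getElem_mem _)).2
      have := Finset.sum_eq_zero_iff.mp h0 A (Finset.mem_univ _)
      have := RLSLP.deg_pos_iff.mpr hA
      omega
  refine wp_loop (fun n s' => ∃ k ind' num' ord', k + n = G.numVars ∧ Env G c s' ∧
    SearchMem G c s'.mem ind' num' ord' ∧ G.TopSearch ind' num' ord' k ∧ s'.reg 8 = k ∧
    s'.reg 7 = ord'.length) 400 ?_ (N := G.numVars) ?_ ?_
  · rintro n s' ⟨k, ind', num', ord', hkn, he, hm', ht', h8, h7⟩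
    simp only [safe_less, safe_reg, val_less, val_reg, h8, h7, true_and]
    refine ⟨by omega, fun hne => ?_⟩
    have hk : k < ord'.length := by
      by_contra hc
      rw [if_neg hc] at hne; exact hne rfl
    have := ht'.length_le
    obtain ⟨n', rfl⟩ : ∃ n', n = n' + 1 := ⟨n - 1, by omega⟩
    refine ⟨n', rfl, ?_⟩
    refine wp_visit hf he hm' ht' hk h8 h7 ?_
    intro t s1 ind1 num1 ord1 ht1 he1 hm1 htop h8' h7'
    exact ⟨ht1, k + 1, ind1, num1, ord1, by omega, he1, hm1, htop, h8', h7'⟩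
  · exact ⟨0, _, _, ord, by omega, he3.set (by decide), hm3, ht0, by simp [State.set_reg],
      by simpa [State.set_reg, State.put_reg] using h7⟩
  rintro t3 s3 n3 ht3 ⟨k, ind', num', ord', hkn, he, hm', ht', h8, h7⟩ hex
  simp only [val_less, val_reg, h8, h7] at hex
  have hk : k = ord'.length := by
    have := ht'.le
    by_contra hc
    rw [if_pos (by omega)] at hex; omega
  subst hk
  obtain ⟨htop, hlen, hocc⟩ := ht'.complete
  simp only [cost_bin, cost_reg] at ht1 ht2 ht3
  refine hQ _ _ ord' ?_ he ⟨htop, hlen, hm'.ord, fun A => by rw [hm'.num, hocc], hm'.zero⟩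
  omega

end search

/-! # Lengths, powers of two and symmetric centroid paths -/

section measure
variable {σ c w : ℕ} {O : Subroutines c} {G : RLSLP σ}

/-- Compute the length of the variable whose record and rule stand at the addresses in registers 5
and 6. -/
def setLen (c : ℕ) : Prog :=
  .ite (M (R 6)) (.set 10 (recE c (M (R 6 + 1))) ;;
    .ite (Expr.equal (M (R 6)) 1)
      (.set 11 (recE c (M (R 6 + 2))) ;; .store (R 5) (M (R 10) + M (R 11)))
      (.store (R 5) (M (R 6 + 2) * M (R 10)))) (.store (R 5) 1)

/-- Store the largest power of two that is at most the number in field `f` into field `g`. -/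
def setPow (f g : ℕ) : Prog :=
  .set 9 1 ;; .loop (Expr.less (2 * R 9) (M (R 5 + Expr.const f) + 1)) (.set 9 (2 * R 9)) ;;
  .store (R 5 + Expr.const g) (R 9)

/-- The logarithms of length and of number of occurrences agree. -/
def same (e : Expr) : Expr :=
  Expr.equal (M (e + 27)) (M (R 5 + 27)) * Expr.equal (M (e + 28)) (M (R 5 + 28))

/-- Enter an edge of a symmetric centroid path. -/
def link (e : Expr) : Prog :=
  .store (R 5 + 30) e ;; .store (e + 29) (M (R 5 + 26))

/-- Determine the successor on the symmetric centroid path. -/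
def setSucc : Prog :=
  .ite (Expr.equal (M (R 6)) 1) (.ite (same (R 10)) (link (R 10))
    (.ite (same (R 11)) (link (R 11)) .skip)) .skip

/-- Fetch the next variable in reverse topological order. -/
def fetch (c : ℕ) : Prog :=
  .set 8 (R 8 - 1) ;; .set 4 (M (recE c (R 8) + 25)) ;; .set 5 (recE c (R 4)) ;;
  .set 6 (2 + 3 * R 4)

/-- Process the next variable in reverse topological order. -/
def measureOne (c : ℕ) : Prog :=
  fetch c ;; .ite (M (R 5 + 26)) (setLen c ;; setPow 0 27 ;; setPow 26 28 ;; setSucc) .skip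

/-- Compute lengths, powers of two, and symmetric centroid paths. -/
def measure (c : ℕ) : Prog := .set 8 (R 3) ;; .loop (R 8) (measureOne c)

/-- This bound is why all later phases skip variables with `occ = 0`: their expansions are not part
of the text, and their lengths need not fit into a word. -/
theorem _root_.RLSLP.len_le_text {A : Fin G.numVars} (h : 0 < G.occ A) :
    G.len A ≤ G.text.length :=
  le_trans (Nat.le_mul_of_pos_left _ h) (RLSLP.occ_mul_len_le A)

theorem wp_setLen (hf : Fits G c w) {s : State} (hs : Env G c s) {A : Fin G.numVars}
    (h5 : s.reg 5 = recAt c G.numVars A) (h6 : s.reg 6 = 2 + 3 * A) (hA : 0 < G.occ A)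
    (hlen : ∀ B, (G.rule A).Mentions B → s.mem (recAt c G.numVars B) = G.len B)
    {Q : ℕ → State → Prop}
    (hQ : ∀ t s', t ≤ 100 → s'.mem = Function.update s.mem (recAt c G.numVars A) (G.len A) →
      (∀ x, x ≠ 10 → x ≠ 11 → s'.reg x = s.reg x) →
      (∀ B D, G.rule A = .pair B D → s'.reg 10 = recAt c G.numVars B ∧
        s'.reg 11 = recAt c G.numVars D) → Q t s') :
    wp w O (setLen c) Q s := by
  have h1 := hf.rec_lt A.2.le
  have h2 := le_recAt (c := c) (V := G.numVars) A
  have h3 := RLSLP.len_le_text hA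
  have hVA := A.2
  have c0 := hs.cell0 A
  have c1 := hs.cell A (j := 1) (by omega)
  have c2 := hs.cell A (j := 2) (by omega)
  simp only [setLen, wp, safe_load, safe_add, safe_mul, safe_reg, safe_num, safe_equal, val_add,
    val_mul, val_load, val_reg, val_num, val_equal, State.set_reg, State.set_mem, cost_load,
    cost_add, cost_mul, cost_reg, cost_num, cost_bin, val_recE, safe_recE, cost_recE, h5, h6, hs.r2,
    c0, c1, c2, fold_recAt, if_true, true_and, and_true, and_assoc, Nat.reduceEqDiff, if_false]
  cases hr : G.rule A with
  | term a =>
    simp only [RLRule.encode, List.getD_cons_zero, ne_eq, not_true, false_imp_iff, true_imp_iff,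
      true_and]
    repeat refine And.intro (by omega) ?_
    refine hQ _ _ (by omega) ?_ ?_ ?_
    · simp [RLSLP.len_term hr]
    · simp
    · simp [hr]
  | run B t =>
    have hB := hf.rec_lt B.2.le
    have hB' := le_recAt (c := c) (V := G.numVars) B
    have hl := hlen B (by simp [hr, RLRule.Mentions])
    have hlr := RLSLP.len_run hr
    simp only [hr, RLRule.encode, List.getD_cons_zero, ne_eq, OfNat.ofNat_ne_zero,
      OfNat.ofNat_ne_one, not_false_eq_true, false_imp_iff, true_imp_iff, and_true, true_and,
      List.getD_cons_succ, not_true, if_false, hl, fold_recAt, ← hlr]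
    repeat refine And.intro (by omega) ?_
    refine hQ _ _ (by omega) ?_ ?_ ?_
    · rfl
    · intro x hx _
      simp [State.set_reg, hx]
    · simp [hr]
  | pair B D =>
    have hB := hf.rec_lt B.2.le
    have hB' := le_recAt (c := c) (V := G.numVars) B
    have hD := hf.rec_lt D.2.le
    have hD' := le_recAt (c := c) (V := G.numVars) D
    have hl := hlen B (by simp [hr, RLRule.Mentions])
    have hl' := hlen D (by simp [hr, RLRule.Mentions])
    have hlr := RLSLP.len_pair hr
    simp only [hr, RLRule.encode, List.getD_cons_zero, ne_eq, one_ne_zero,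
      not_false_eq_true, false_imp_iff, true_imp_iff, and_true, true_and,
      List.getD_cons_succ, not_true, if_true, hl, hl', fold_recAt, ← hlr]
    repeat refine And.intro (by omega) ?_
    refine hQ _ _ (by omega) ?_ ?_ ?_
    · rfl
    · intro x hx hx'
      simp [State.set_reg, hx, hx']
    · intro B' D' h
      simp only [hr, RLRule.pair.injEq] at h
      simp [State.set_reg, h.1, h.2]

theorem wp_setPow {s : State} {f g x N : ℕ} (hx : s.mem (s.reg 5 + f) = x) (h0 : 0 < x)
    (hxN : Nat.log 2 x ≤ N) (hw : 2 * x + 10 < 2 ^ w) (hf : s.reg 5 + f < 2 ^ w)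
    (hg : s.reg 5 + g < 2 ^ w) {Q : ℕ → State → Prop}
    (hQ : ∀ t s', t ≤ 20 * (N + 2) →
      s'.mem = Function.update s.mem (s.reg 5 + g) (2 ^ Nat.log 2 x) →
      (∀ y, y ≠ 9 → s'.reg y = s.reg y) → Q t s') :
    wp w O (setPow f g) Q s := by
  simp only [setPow, wp, safe_num, val_num, cost_num]
  refine ⟨by omega, ?_⟩
  -- The loop test amounts to `2 ^ (k + 1) ≤ x`, so the power never exceeds `x` and the round
  -- counter is the distance of `k` to the logarithm.
  refine wp_loop (fun n s' => ∃ k, k + n = Nat.log 2 x ∧ s'.reg 9 = 2 ^ k ∧ s'.mem = s.mem ∧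
    ∀ y, y ≠ 9 → s'.reg y = s.reg y) 4 ?_ (N := Nat.log 2 x) ?_ ?_
  · rintro n s' ⟨k, hk, h9, hm, hr⟩
    have h5 := hr 5 (by omega)
    have hkx : 2 ^ k ≤ x := le_trans (Nat.pow_le_pow_right (by norm_num) (by omega))
      (Nat.pow_log_le_self 2 h0.ne')
    simp only [safe_less, safe_add, safe_mul, safe_load, safe_reg, safe_num, safe_const, val_less,
      val_add, val_mul, val_load, val_reg, val_num, val_const, h9, h5, hm, hx, true_and, and_true,
      wp, cost_mul, cost_num, cost_reg]
    refine ⟨by omega, fun hne => ?_⟩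
    have hlt : 2 ^ (k + 1) ≤ x := by
      by_contra hc
      rw [if_neg (by rw [pow_succ] at hc; omega)] at hne; exact hne rfl
    have := Nat.le_log_of_pow_le (by norm_num) hlt
    refine ⟨n - 1, by omega, by omega, by omega, k + 1, by omega, ?_, ?_, ?_⟩
    · rw [State.set_reg, if_pos rfl, pow_succ, mul_comm]
    · exact hm
    · intro y hy
      rw [State.set_reg, if_neg hy, hr y hy]
  · exact ⟨0, by omega, by simp [State.set_reg], rfl, fun y hy => by simp [State.set_reg, hy]⟩
  rintro t s' n ht ⟨k, hk, h9, hm, hr⟩ hex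
  have h5 := hr 5 (by omega)
  simp only [val_less, val_add, val_mul, val_load, val_reg, val_num, val_const, h9, h5, hm, hx]
    at hex
  have hkx : k = Nat.log 2 x := by
    by_contra hc
    have h1 : 2 ^ (k + 1) ≤ x := le_trans (Nat.pow_le_pow_right (by norm_num) (by omega))
      (Nat.pow_log_le_self 2 h0.ne')
    rw [pow_succ] at h1
    rw [if_pos (by omega)] at hex; omega
  simp only [safe_add, safe_reg, safe_const, val_add, val_reg, val_const, h9, h5, true_and, cost_add,
    cost_reg, cost_const, cost_bin, cost_mul, cost_load, cost_num, hkx] at ht ⊢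
  refine ⟨by omega, ?_⟩
  refine hQ _ _ ?_ ?_ ?_
  · have : (Nat.log 2 x + 1) * (4 + (1 + 1 + 1 + (1 + 1 + 1 + 1 + 1 + 1) + 1) + 1) ≤
      20 * (N + 1) := by
      nlinarith
    omega
  · rw [State.put_mem, hm]
  · intro y hy
    rw [State.put_reg, hr y hy]

theorem _root_.RLSLP.sc_eq_none {A : Fin G.numVars} (h : ∀ B D, G.rule A ≠ .pair B D) :
    G.sc A = none := by
  unfold RLSLP.sc
  split
  · rfl
  · split
    · rename_i hr
      exact absurd hr (h _ _)
    · rfl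

theorem _root_.RLSLP.ne_of_mentions {A B : Fin G.numVars} (h : (G.rule A).Mentions B) : B ≠ A := by
  rintro rfl
  exact G.acyclic B (Relation.TransGen.single h)

theorem pow_two_eq_iff {a b : ℕ} : 2 ^ a = 2 ^ b ↔ a = b :=
  (Nat.pow_right_injective (le_refl 2)).eq_iff

/-- The memory after the successor of a variable on its symmetric centroid path was entered. -/
noncomputable def succMem (G : RLSLP σ) (c : ℕ) (m : ℕ → ℕ) (A : Fin G.numVars) : ℕ → ℕ :=
  (G.sc A).elim m fun B => Function.update (Function.update m (recAt c G.numVars A + 30)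
    (recAt c G.numVars B)) (recAt c G.numVars B + 29) (G.occ A)

theorem wp_setSucc (hf : Fits G c w) {s : State} (hs : Env G c s) {A : Fin G.numVars}
    (h5 : s.reg 5 = recAt c G.numVars A) (h6 : s.reg 6 = 2 + 3 * A) (hA : 0 < G.occ A)
    (h10 : ∀ B D, G.rule A = .pair B D → s.reg 10 = recAt c G.numVars B ∧
      s.reg 11 = recAt c G.numVars D)
    (h26 : s.mem (recAt c G.numVars A + 26) = G.occ A)
    (hp : ∀ B, B = A ∨ (G.rule A).Mentions B → s.mem (recAt c G.numVars B + 27) = 2 ^ G.lw B ∧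
      s.mem (recAt c G.numVars B + 28) = 2 ^ G.lu B) {Q : ℕ → State → Prop}
    (hQ : ∀ t s', t ≤ 100 → s'.mem = succMem G c s.mem A → (∀ x, s'.reg x = s.reg x) → Q t s') :
    wp w O setSucc Q s := by
  have h1 := hf.rec_lt A.2.le
  have h2 := le_recAt (c := c) (V := G.numVars) A
  have hst := lt_stride (c := c) (f := 31)
  have c0 := hs.cell0 A
  obtain ⟨pA, pA'⟩ := hp A (Or.inl rfl)
  cases hr : G.rule A with
  | term a =>
    simp only [setSucc, wp, safe_equal, safe_load, safe_reg, safe_num, val_equal, val_load, val_reg,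
      val_num, cost_load, cost_reg, cost_num, cost_bin, h6, c0, hr, RLRule.encode,
      List.getD_cons_zero, ne_eq, not_true, false_imp_iff, true_imp_iff, true_and, zero_ne_one,
      if_false]
    repeat refine And.intro (by omega) ?_
    exact hQ _ _ (by omega) (by rw [succMem, RLSLP.sc_eq_none (by simp [hr])]; rfl)
      fun _ => rfl
  | run B t =>
    simp only [setSucc, wp, safe_equal, safe_load, safe_reg, safe_num, val_equal, val_load, val_reg,
      val_num, cost_load, cost_reg, cost_num, cost_bin, h6, c0, hr, RLRule.encode,
      List.getD_cons_zero, ne_eq, not_true, false_imp_iff, true_imp_iff, true_and,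
      OfNat.ofNat_ne_one, if_false]
    repeat refine And.intro (by omega) ?_
    exact hQ _ _ (by omega) (by rw [succMem, RLSLP.sc_eq_none (by simp [hr])]; rfl)
      fun _ => rfl
  | pair B D =>
    have hB := hf.rec_lt B.2.le
    have hB' := le_recAt (c := c) (V := G.numVars) B
    have hD := hf.rec_lt D.2.le
    have hD' := le_recAt (c := c) (V := G.numVars) D
    obtain ⟨pB, pB'⟩ := hp B (by simp [hr, RLRule.Mentions])
    obtain ⟨pD, pD'⟩ := hp D (by simp [hr, RLRule.Mentions])
    obtain ⟨r10, r11⟩ := h10 B D hr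
    have e26 : ∀ v, Function.update s.mem (recAt c G.numVars A + 30) v (recAt c G.numVars A + 26) =
        G.occ A := fun v => by
      rw [Function.update_of_ne (by omega), h26]
    have hsc := RLSLP.sc_ne_none_left hr hA
    have k1 : ∀ p q : Prop, ∀ [Decidable p] [Decidable q],
        (if p then 1 else 0) * (if q then 1 else 0) = if p ∧ q then 1 else 0 := by
      intro p q _ _; split_ifs <;> simp_all
    have k2 : ∀ p : Prop, ∀ [Decidable p], (if p then 1 else 0) < 2 ^ w := by
      intro p _; split_ifs <;> omega
    simp only [setSucc, same, link, wp, safe_equal, safe_load, safe_reg, safe_num, safe_mul,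
      safe_add, val_equal, val_load, val_mul, val_add, val_reg, State.put_reg, State.put_mem,
      val_num, cost_load, cost_reg, cost_num, cost_bin, cost_add, cost_mul, h5, h6, r10, r11, c0,
      hr, RLRule.encode, k1, k2, e26,
      List.getD_cons_zero, ne_eq, not_true, false_imp_iff, true_imp_iff, true_and, one_ne_zero,
      not_false_eq_true, and_true, if_true, pA, pA', pB, pB', pD, pD', pow_two_eq_iff, and_assoc]
    repeat refine And.intro (by omega) ?_
    by_cases q1 : G.lw B = G.lw A ∧ G.lu B = G.lu A
    · rw [if_pos q1] at hsc
      simp only [q1, and_self, if_true, one_ne_zero, not_false_eq_true, true_imp_iff, false_imp_iff,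
        and_true]
      repeat refine And.intro (by omega) ?_
      exact hQ _ _ (by omega) (by rw [succMem, hsc]; rfl) fun _ => rfl
    · rw [if_neg q1] at hsc
      simp only [q1, if_false, not_true, true_imp_iff, false_imp_iff, true_and]
      repeat refine And.intro (by omega) ?_
      by_cases q2 : G.lw D = G.lw A ∧ G.lu D = G.lu A
      · rw [if_pos q2] at hsc
        simp only [q2, and_self, if_true, one_ne_zero, not_false_eq_true, true_imp_iff,
          false_imp_iff, and_true]
        repeat refine And.intro (by omega) ?_
        exact hQ _ _ (by omega) (by rw [succMem, hsc]; rfl) fun _ => rfl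
      · rw [if_neg q2] at hsc
        simp only [q2, if_false, not_true, true_imp_iff, false_imp_iff, true_and]
        exact hQ _ _ (by omega) (by rw [succMem, hsc]; rfl) fun _ => rfl

theorem wp_fetch (hf : Fits G c w) {s : State} (hs : Env G c s) {ord : List (Fin G.numVars)}
    {k : ℕ} (h8 : s.reg 8 = k + 1) (hk : k < ord.length) (hkV : k < G.numVars)
    (hord : s.mem (recAt c G.numVars k + 25) = ord[k]) {Q : ℕ → State → Prop}
    (hQ : ∀ t s', t ≤ 40 → s'.mem = s.mem → s'.reg 8 = k →
      s'.reg 5 = recAt c G.numVars ord[k] → s'.reg 6 = 2 + 3 * ord[k].1 →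
      (∀ x, x ≠ 4 → x ≠ 5 → x ≠ 6 → x ≠ 8 → s'.reg x = s.reg x) → Q t s') :
    wp w O (fetch c) Q s := by
  have h1 := hf.rec_lt hkV.le
  have h2 := le_recAt (c := c) (V := G.numVars) k
  have h3 := hf.rec_lt ord[k].2.le
  have h4 := le_recAt (c := c) (V := G.numVars) ord[k]
  have h5 := ord[k].2
  simp only [fetch, wp, safe_load, safe_add, safe_sub, safe_mul, safe_reg, safe_num, val_add,
    val_sub, val_mul, val_load, val_reg, val_num, State.set_reg, State.set_mem, cost_load, cost_add,
    cost_sub, cost_mul, cost_reg, cost_num, val_recE, safe_recE, cost_recE, h8, hs.r2, fold_recAt,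
    if_true, true_and, and_true, and_assoc, Nat.reduceEqDiff, if_false, Nat.add_sub_cancel, hord]
  repeat refine And.intro (by omega) ?_
  refine hQ _ _ (by omega) rfl ?_ ?_ ?_ ?_
  · simp [State.set_reg]
  · simp [State.set_reg]
  · simp [State.set_reg]
  · intro x g4 g5 g6 g8
    simp [State.set_reg, g4, g5, g6, g8]

/-- The tables that are computed by `measure`, where the variables in `P` have been processed. -/
structure Measured (G : RLSLP σ) (c : ℕ) (m : ℕ → ℕ) (ord P : List (Fin G.numVars)) : Prop where
  ord : ∀ i (hi : i < ord.length), m (recAt c G.numVars i + 25) = ord[i]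
  occ : ∀ A : Fin G.numVars, m (recAt c G.numVars A + 26) = G.occ A
  null : ∀ f < 33, m (recAt c G.numVars G.numVars + f) = 0
  len : ∀ A ∈ P, 0 < G.occ A → m (recAt c G.numVars A + 0) = G.len A
  pow : ∀ A ∈ P, 0 < G.occ A → m (recAt c G.numVars A + 27) = 2 ^ G.lw A ∧
    m (recAt c G.numVars A + 28) = 2 ^ G.lu A
  pp : ∀ B : Fin G.numVars, m (recAt c G.numVars B + 29) =
    ∑ A, if A ∈ P ∧ G.sc A = some B then G.occ A else 0
  sc : ∀ A : Fin G.numVars, m (recAt c G.numVars A + 30) =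
    if A ∈ P then (G.sc A).elim 0 fun B => recAt c G.numVars B else 0

theorem Searched.measured {m : ℕ → ℕ} {ord : List (Fin G.numVars)} (h : Searched G c m ord) :
    Measured G c m ord [] :=
  ⟨h.ord, h.occ, fun f hf => h.zero _ le_rfl f hf (Or.inl rfl), by simp, by simp,
    fun B => by simpa using h.zero _ B.2.le 29 (by omega) (by simp),
    fun B => by simpa using h.zero _ B.2.le 30 (by omega) (by simp)⟩

/-- The memory after a variable has been processed by `measureOne`. -/
noncomputable def measureMem (G : RLSLP σ) (c : ℕ) (m : ℕ → ℕ) (A : Fin G.numVars) : ℕ → ℕ :=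
  succMem G c (Function.update (Function.update (Function.update m (recAt c G.numVars A + 0)
    (G.len A)) (recAt c G.numVars A + 27) (2 ^ G.lw A)) (recAt c G.numVars A + 28) (2 ^ G.lu A)) A

theorem succMem_apply (m : ℕ → ℕ) (A : Fin G.numVars) {B f : ℕ} (hf : f < 33) :
    succMem G c m A (recAt c G.numVars B + f) =
      if f = 30 ∧ B = A ∧ G.sc A ≠ none then (G.sc A).elim 0 fun D => recAt c G.numVars D
      else if f = 29 ∧ (G.sc A).map Fin.val = some B then G.occ A
      else m (recAt c G.numVars B + f) := by
  cases h : G.sc A with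
  | none => simp [succMem, h]
  | some D =>
    simp only [succMem, h, Option.elim_some, ne_eq, reduceCtorEq, not_false_eq_true, and_true]
    rw [update_recAt (by omega) hf, update_recAt (by omega) hf]
    split_ifs <;> grind

theorem measureMem_apply (m : ℕ → ℕ) (A : Fin G.numVars) {B f : ℕ} (hf : f < 33) :
    measureMem G c m A (recAt c G.numVars B + f) =
      if f = 30 ∧ B = A ∧ G.sc A ≠ none then (G.sc A).elim 0 fun D => recAt c G.numVars D
      else if f = 29 ∧ (G.sc A).map Fin.val = some B then G.occ A
      else if B = A ∧ f = 28 then 2 ^ G.lu A else if B = A ∧ f = 27 then 2 ^ G.lw A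
      else if B = A ∧ f = 0 then G.len A else m (recAt c G.numVars B + f) := by
  rw [measureMem, succMem_apply _ _ hf, update_recAt (by omega) hf, update_recAt (by omega) hf,
    update_recAt (by omega) hf]

theorem Measured.step {m : ℕ → ℕ} {ord P : List (Fin G.numVars)} (h : Measured G c m ord P)
    {A : Fin G.numVars} (hA : A ∉ P) :
    Measured G c (measureMem G c m A) ord (A :: P) := by
  refine ⟨fun i hi => ?_, fun B => ?_, fun f hf => ?_, fun B hB h0 => ?_, fun B hB h0 => ?_,
    fun B => ?_, fun B => ?_⟩
  · simp [measureMem_apply, h.ord i hi]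
  · simp [measureMem_apply, h.occ]
  · rw [measureMem_apply _ _ hf, h.null f hf]
    have := A.2
    rw [if_neg (by omega), if_neg, if_neg (by omega), if_neg (by omega), if_neg (by omega)]
    cases h : G.sc A with
    | none => simp
    | some D =>
      have := D.2
      simp; omega
  · rw [measureMem_apply _ _ (by omega)]
    by_cases hBA : B = A
    · subst hBA; simp
    · have : B.1 ≠ A.1 := fun h => hBA (Fin.ext h)
      simpa [this] using h.len B (by simpa [hBA] using hB) h0
  · rw [measureMem_apply _ _ (by omega), measureMem_apply _ _ (by omega)]
    by_cases hBA : B = A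
    · subst hBA; simp
    · have : B.1 ≠ A.1 := fun h => hBA (Fin.ext h)
      simp [this, h.pow B (by simpa [hBA] using hB) h0]
  · rw [measureMem_apply _ _ (by omega)]
    have e : (∑ D, if D ∈ A :: P ∧ G.sc D = some B then G.occ D else 0) =
        (if G.sc A = some B then G.occ A else 0) +
          ∑ D, if D ∈ P ∧ G.sc D = some B then G.occ D else 0 := by
      have : (if G.sc A = some B then G.occ A else 0) =
          ∑ D, if D = A then (if G.sc D = some B then G.occ D else 0) else 0 := by simp
      rw [this, ← Finset.sum_add_distrib]
      refine Finset.sum_congr rfl fun D _ => ?_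
      by_cases hD : D = A
      · subst hD; simp [hA]
      · simp [hD]
    rw [e, ← h.pp B]
    cases hsc : G.sc A with
    | none => simp
    | some D =>
      by_cases hDB : D = B
      · subst hDB
        -- The entry for the path predecessor is written only once: a predecessor of `D` among the
        -- variables in `P` would be `A` itself, by `sc_inj`.
        have hz : m (recAt c G.numVars D + 29) = 0 := by
          rw [h.pp]
          refine Finset.sum_eq_zero fun X _ => ?_
          rw [if_neg]
          rintro ⟨h1, h2⟩
          exact hA (RLSLP.sc_inj h2 hsc ▸ h1)
        simp [hz]
      · have : ¬ (D : ℕ) = B := fun h => hDB (Fin.ext h)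
        simp [this, hDB]
  · rw [measureMem_apply _ _ (by omega), h.sc]
    by_cases hBA : B = A
    · subst hBA
      cases hsc : G.sc B <;> simp [hA]
    · have : ¬ (B : ℕ) = A := fun h => hBA (Fin.ext h)
      simp [this, hBA]

theorem measureMem_input (m : ℕ → ℕ) (A : Fin G.numVars) {x : ℕ} (hx : x < 2 + 3 * G.numVars) :
    measureMem G c m A x = m x := by
  unfold measureMem succMem
  cases G.sc A with
  | none => simp only [Option.elim_none, update_input hx]
  | some B => simp only [Option.elim_some, update_input hx]

/-- A variable without occurrences has no successor and contributes nothing to any `pp`, so the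
tables already describe it. -/
theorem Measured.skip {m : ℕ → ℕ} {ord P : List (Fin G.numVars)} (h : Measured G c m ord P)
    {A : Fin G.numVars} (hA : G.occ A = 0) : Measured G c m ord (A :: P) := by
  have hsc : G.sc A = none := by simp [RLSLP.sc, hA]
  refine ⟨h.ord, h.occ, h.null, fun B hB h0 => ?_, fun B hB h0 => ?_, fun B => ?_, fun B => ?_⟩
  · refine h.len B ?_ h0
    rcases List.mem_cons.mp hB with rfl | hB
    · omega
    · exact hB
  · refine h.pow B ?_ h0
    rcases List.mem_cons.mp hB with rfl | hB
    · omega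
    · exact hB
  · rw [h.pp]
    refine Finset.sum_congr rfl fun D _ => ?_
    by_cases hD : D = A
    · subst hD; simp [hA]
    · simp [hD]
  · rw [h.sc]
    by_cases hB : B = A
    · subst hB; simp [hsc]
    · simp [hB]

theorem wp_measureOne (hf : Fits G c w) {s : State} (hs : Env G c s) {ord : List (Fin G.numVars)}
    (ho : G.TopOrder ord) (hlen : ord.length = G.numVars) {k : ℕ} (h8 : s.reg 8 = k + 1)
    (hk : k < ord.length) (hm : Measured G c s.mem ord (ord.drop (k + 1))) {Q : ℕ → State → Prop}
    (hQ : ∀ t s', t ≤ 400 * (Nat.log 2 G.text.length + 1) → Env G c s' → s'.reg 8 = k →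
      Measured G c s'.mem ord (ord.drop k) → Q t s') :
    wp w O (measureOne c) Q s := by
  rw [List.drop_eq_getElem_cons hk] at hQ
  simp only [measureOne, wp]
  refine wp_fetch hf hs h8 hk (by omega) (hm.ord k hk) ?_
  intro t0 s0 ht0 m0 e8 e5 e6 er
  set A := ord[k] with hA
  have hs0 : Env G c s0 := hs.congr (er 2 (by simp) (by simp) (by simp) (by simp))
    (er 3 (by simp) (by simp) (by simp) (by simp)) (er 44 (by simp) (by simp) (by simp) (by simp))
    (fun _ _ => by rw [m0])
  have h1 := hf.rec_lt A.2.le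
  have hst := lt_stride (c := c) (f := 31)
  rw [← m0] at hm
  have hAP : A ∉ ord.drop (k + 1) := ho.not_mem_drop hk
  simp only [safe_load, safe_add, safe_reg, safe_num, val_load, val_add, val_reg, val_num, e5, hm.occ,
    true_and, cost_load, cost_add, cost_reg, cost_num]
  refine ⟨by omega, fun hne => ?_, fun h0 => ?_⟩
  swap
  · exact hQ _ _ (by omega) hs0 e8 (hm.skip h0)
  have h0 : 0 < G.occ A := Nat.pos_of_ne_zero hne
  have hch : ∀ B, (G.rule A).Mentions B → B ∈ ord.drop (k + 1) ∧ 0 < G.occ B := fun B hB =>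
    ⟨ho.mem_drop hk hB, RLSLP.occ_pos_of_mentions hB h0⟩
  have hlt := RLSLP.len_le_text h0
  have hot := RLSLP.occ_le A
  refine wp_setLen hf hs0 e5 e6 h0 (fun B hB => hm.len B (hch B hB).1 (hch B hB).2) ?_
  intro t1 s1 ht1 m1 r1 p1
  have e15 := (r1 5 (by simp) (by simp)).trans e5
  refine wp_setPow (x := G.len A) (N := Nat.log 2 G.text.length) ?_ (RLSLP.len_pos A)
    (Nat.log_mono_right hlt) (by omega) (by omega) (by omega) ?_
  · rw [e15, m1, add_zero, Function.update_self]
  intro t2 s2 ht2 m2 r2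
  have e25 := (r2 5 (by simp)).trans e15
  refine wp_setPow (x := G.occ A) (N := Nat.log 2 G.text.length) ?_ h0
    (Nat.log_mono_right hot) (by omega) (by omega) (by omega) ?_
  · rw [e25, m2, m1, e15, Function.update_of_ne (by omega), Function.update_of_ne (by omega),
      hm.occ]
  intro t3 s3 ht3 m3 r3
  have hr3 : ∀ x, x ≠ 9 → x ≠ 10 → x ≠ 11 → s3.reg x = s0.reg x := fun x h9 h10 h11 => by
    rw [r3 x h9, r2 x h9, r1 x h10 h11]
  have m3' : s3.mem = Function.update (Function.update (Function.update s0.mem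
      (recAt c G.numVars A + 0) (G.len A)) (recAt c G.numVars A + 27) (2 ^ G.lw A))
      (recAt c G.numVars A + 28) (2 ^ G.lu A) := by
    rw [m3, m2, m1, e15, e25]; rfl
  have hs3 : Env G c s3 := by
    refine hs0.congr (hr3 2 (by simp) (by simp) (by simp)) (hr3 3 (by simp) (by simp) (by simp))
      (hr3 44 (by simp) (by simp) (by simp)) fun x hx => ?_
    rw [m3', update_input hx, update_input hx, update_input hx]
  refine wp_setSucc hf hs3 ((hr3 5 (by simp) (by simp) (by simp)).trans e5)
    ((hr3 6 (by simp) (by simp) (by simp)).trans e6) h0 ?_ ?_ ?_ ?_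
  · intro B D hr
    rw [r3 10 (by simp), r2 10 (by simp), r3 11 (by simp), r2 11 (by simp)]
    exact p1 B D hr
  · rw [m3', update_recAt (by omega) (by omega), update_recAt (by omega) (by omega),
      update_recAt (by omega) (by omega), hm.occ]
    simp
  · intro B hB
    rw [m3', update_recAt (by omega) (by omega), update_recAt (by omega) (by omega),
      update_recAt (by omega) (by omega), update_recAt (by omega) (by omega),
      update_recAt (by omega) (by omega), update_recAt (by omega) (by omega)]
    rcases hB with rfl | hB
    · simp
    · have : ¬ (B : ℕ) = A := fun h => RLSLP.ne_of_mentions hB (Fin.ext h)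
      simp [this, hm.pow B (hch B hB).1 (hch B hB).2]
  intro t4 s4 ht4 m4 r4
  have m4' : s4.mem = measureMem G c s0.mem A := by rw [m4, m3']; rfl
  refine hQ _ _ (by omega) (hs3.congr (r4 2) (r4 3) (r4 44) fun x hx => ?_) ?_ ?_
  · rw [m4', measureMem_input _ _ hx, m3', update_input hx, update_input hx, update_input hx]
  · rw [r4 8, hr3 8 (by simp) (by simp) (by simp), e8]
  · rw [m4']; exact hm.step hAP

theorem wp_measure (hf : Fits G c w) {s : State} (hs : Env G c s) {ord : List (Fin G.numVars)}
    (ho : Searched G c s.mem ord) {Q : ℕ → State → Prop}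
    (hQ : ∀ t s', t ≤ 500 * ((G.numVars + 1) * (Nat.log 2 G.text.length + 1)) → Env G c s' →
      Measured G c s'.mem ord ord → Q t s') :
    wp w O (measure c) Q s := by
  simp only [measure, wp, safe_reg, val_reg, cost_reg, true_and]
  refine wp_loop (fun n s' => n ≤ ord.length ∧ Env G c s' ∧ s'.reg 8 = n ∧
    Measured G c s'.mem ord (ord.drop n)) (400 * (Nat.log 2 G.text.length + 1)) ?_
    (N := G.numVars) ?_ ?_
  · rintro n s' ⟨hn, he, h8, hm⟩
    refine ⟨trivial, fun hne => ?_⟩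
    rw [val_reg, h8] at hne
    obtain ⟨k, rfl⟩ : ∃ k, n = k + 1 := ⟨n - 1, by omega⟩
    refine ⟨k, rfl, wp_measureOne hf he ho.top ho.length h8 (by omega) hm ?_⟩
    intro t s1 ht he1 h81 hm1
    exact ⟨ht, by omega, he1, h81, hm1⟩
  · refine ⟨ho.length.ge, hs.set (by decide), by simp [State.set_reg, hs.r3], ?_⟩
    rw [List.drop_eq_nil_of_le ho.length.le]
    exact ho.measured
  rintro t s' n ht ⟨hn, he, h8, hm⟩ hex
  rw [val_reg, h8] at hex
  subst hex
  refine hQ _ _ ?_ he (by simpa using hm)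
  have h1 : 1 ≤ (G.numVars + 1) * (Nat.log 2 G.text.length + 1) := Nat.mul_pos (by omega) (by omega)
  rw [cost_reg] at ht
  have h2 : (G.numVars + 1) * (400 * (Nat.log 2 G.text.length + 1) + 1 + 1) ≤
      402 * ((G.numVars + 1) * (Nat.log 2 G.text.length + 1)) := by nlinarith
  omega

/-- The number of occurrences of the predecessor has been entered. -/
theorem Measured.pp_eq {m : ℕ → ℕ} {ord : List (Fin G.numVars)} (h : Measured G c m ord ord)
    (ho : G.TopOrder ord) (B : Fin G.numVars) : m (recAt c G.numVars B + 29) = G.pp B := by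
  rw [h.pp, RLSLP.pp]
  simp [ho.mem]

end measure

/-! # Levels -/

section level
variable {σ c w : ℕ} {O : Subroutines c} {G : RLSLP σ}

theorem _root_.RLSLP.pow_le_text {A : Fin G.numVars} (h : 0 < G.occ A) :
    2 ^ (G.lw A + G.lu A + 2) ≤ 4 * G.text.length := by
  have := RLSLP.pow_add_le_text h
  rw [pow_add]; omega

/-- The condition in `lam` passes from larger to smaller exponents, since a further division by a
power of two is monotone. A search that starts at zero may stop at the first failure. -/
theorem _root_.RLSLP.lam_eq {A B : Fin G.numVars} (h : G.sc A = some B) {l : ℕ}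
    (h1 : (G.lo A - 1) / 2 ^ l < (G.hi A - 1) / 2 ^ l)
    (h2 : ¬ (G.lo A - 1) / 2 ^ (l + 1) < (G.hi A - 1) / 2 ^ (l + 1)) : G.lam A = l := by
  refine le_antisymm (not_lt.mp fun hlt => h2 ?_) (RLSLP.le_lam h h1)
  have h3 := RLSLP.lam_spec h
  obtain ⟨d, hd⟩ := Nat.exists_eq_add_of_le hlt
  rw [Nat.succ_eq_add_one] at hd
  rw [hd, pow_add, ← Nat.div_div_eq_div_mul, ← Nat.div_div_eq_div_mul] at h3
  by_contra hc
  exact absurd (Nat.div_le_div_right (not_lt.mp hc)) (not_le.mpr h3)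

/-- The left end of the interval of the variable whose record stands at the given address. -/
def loE (e : Expr) : Expr :=
  M (e + 29) * M (e + 27) + (2 * M (e + 27) - M (e + 0)) * M (e + 28)

/-- Compute the level of the variable whose record stands at the address in register 5. -/
def setLevel : Prog :=
  .ite (M (R 5 + 30)) (.set 9 (loE (R 5) - 1) ;; .set 10 (loE (M (R 5 + 30)) - 1) ;; .set 11 1 ;;
    .loop (Expr.less (R 9 / (2 * R 11)) (R 10 / (2 * R 11))) (.set 11 (2 * R 11)))
    (.set 11 (4 * (M (R 5 + 27) * M (R 5 + 28)))) ;;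
  .store (R 5 + 32) (R 11)

theorem loE_spec (hf : Fits G c w) {s : State} {ord : List (Fin G.numVars)}
    (hm : Measured G c s.mem ord ord) (ho : G.TopOrder ord) {A : Fin G.numVars} (hA : 0 < G.occ A)
    {e : Expr} (he : e.Safe w s) (hv : e.val s = recAt c G.numVars A) :
    (loE e).Safe w s ∧ (loE e).val s = G.lo A ∧ (loE e).cost = 5 * e.cost + 21 := by
  have h1 := hf.rec_lt A.2.le
  have hst := lt_stride (c := c) (f := 31)
  have h2 := lt_of_lt_of_le (RLSLP.lo_lt A) (RLSLP.pow_le_text hA)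
  have h3 := RLSLP.len_le_text hA
  have h4 := RLSLP.pow_lw_le A
  obtain ⟨p1, p2⟩ := hm.pow A (ho.mem A) hA
  have h5 : G.lo A = G.pp A * 2 ^ G.lw A + (2 * 2 ^ G.lw A - G.len A) * 2 ^ G.lu A := rfl
  simp only [loE, safe_add, safe_mul, safe_sub, safe_load, safe_num, val_add, val_mul, val_sub,
    val_load, val_num, cost_add, cost_mul, cost_sub, cost_load, cost_num, he, hv, hm.pp_eq ho,
    hm.len A (ho.mem A) hA, p1, p2, true_and, and_assoc, ← h5]
  repeat refine And.intro (by omega) ?_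
  omega

/-- The level is kept as the power `2 ^ lam`, found by doubling. At the end of a path it is `4 * 2 ^
lw * 2 ^ lu`. Later only comparisons of levels are needed, for which the powers serve as well. -/
theorem wp_setLevel (hf : Fits G c w) {s : State} {ord : List (Fin G.numVars)}
    (hm : Measured G c s.mem ord ord) (ho : G.TopOrder ord) {A : Fin G.numVars} (hA : 0 < G.occ A)
    (h5 : s.reg 5 = recAt c G.numVars A) {Q : ℕ → State → Prop}
    (hQ : ∀ t s', t ≤ 200 * (Nat.log 2 G.text.length + 1) →
      s'.mem = Function.update s.mem (recAt c G.numVars A + 32) (2 ^ G.lam A) →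
      (∀ x, x ≠ 9 → x ≠ 10 → x ≠ 11 → s'.reg x = s.reg x) → Q t s') :
    wp w O setLevel Q s := by
  have h1 := hf.rec_lt A.2.le
  have hst := lt_stride (c := c) (f := 32)
  have h4 := RLSLP.pow_le_text hA
  obtain ⟨p1, p2⟩ := hm.pow A (ho.mem A) hA
  have hsc := hm.sc A
  rw [if_pos (ho.mem A)] at hsc
  simp only [setLevel, wp, safe_load, safe_add, safe_reg, safe_num, val_load, val_add, val_reg,
    val_num, h5, hsc, true_and, cost_load, cost_add, cost_reg, cost_num]
  refine ⟨by omega, fun hne => ?_, fun he => ?_⟩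
  swap
  · have hnone : G.sc A = none := by
      cases h : G.sc A with
      | none => rfl
      | some B =>
        have := le_recAt (c := c) (V := G.numVars) B
        simp only [h, Option.elim_some] at he; omega
    have e4 : 4 * (2 ^ G.lw A * 2 ^ G.lu A) = 2 ^ G.lam A := by
      rw [RLSLP.lam_none hnone, pow_add, pow_add]; ring
    have e5 : 2 ^ (G.lw A + G.lu A + 2) = 2 ^ G.lam A := by rw [RLSLP.lam_none hnone]
    simp only [safe_mul, safe_load, safe_add, safe_reg, safe_num, val_mul, val_load, val_add,
      val_reg, val_num, h5, p1, p2, e4, State.set_reg, Nat.reduceEqDiff, if_true, if_false, true_and,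
      and_assoc, cost_mul, cost_load, cost_add, cost_reg, cost_num]
    repeat refine And.intro (by omega) ?_
    refine hQ _ _ (by omega) rfl fun x _ _ hx => by simp [State.set_reg, hx]
  obtain ⟨B, hB⟩ : ∃ B, G.sc A = some B := by
    cases h : G.sc A with
    | none => simp [h] at hne
    | some B => exact ⟨B, rfl⟩
  rw [hB, Option.elim_some] at hsc
  have hoB := RLSLP.occ_pos_of_mentions (RLSLP.sc_mentions hB) hA
  have hlA := lt_of_lt_of_le (RLSLP.lo_lt A) h4
  have hlB := lt_of_lt_of_le (RLSLP.lo_lt B) (RLSLP.pow_le_text hoB)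
  have hhi := RLSLP.hi_eq hB
  obtain ⟨a1, a2, a3⟩ := loE_spec hf hm ho hA (e := R 5) (by simp) h5
  obtain ⟨b1, b2, b3⟩ := loE_spec hf (s := s.set 9 (G.lo A - 1)) hm ho hoB (e := M (R 5 + 30))
    (by simp [h5]; omega) (by simp [h5, hsc])
  rw [← hhi] at b2 hlB
  simp only [safe_sub, safe_num, val_sub, val_num, cost_sub, cost_num, a1, a2, a3, b1, b2, b3,
    true_and, and_assoc]
  repeat refine And.intro (by omega) ?_
  refine wp_loop (fun n s' => ∃ l, n + l = G.lam A ∧ s'.reg 9 = G.lo A - 1 ∧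
    s'.reg 10 = G.hi A - 1 ∧ s'.reg 11 = 2 ^ l ∧
    (G.lo A - 1) / 2 ^ l < (G.hi A - 1) / 2 ^ l ∧ s'.mem = s.mem ∧
    ∀ y, y ≠ 9 → y ≠ 10 → y ≠ 11 → s'.reg y = s.reg y) 4 ?_ (N := G.lam A) ?_ ?_
  · rintro n s' ⟨l, hl, r9, r10, r11, hlt, hmem, hr⟩
    have e1 : 2 * 2 ^ l = 2 ^ (l + 1) := by rw [pow_succ, mul_comm]
    have e2 : 2 ^ (l + 1) ≤ 2 ^ (G.lw A + G.lu A + 2) :=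
      Nat.pow_le_pow_right (by norm_num) (by have := RLSLP.lam_lt hB; omega)
    simp only [safe_less, safe_div, safe_mul, safe_reg, safe_num, val_less, val_div, val_mul,
      val_reg, val_num, r9, r10, r11, e1, true_and, wp, cost_mul, cost_reg, cost_num]
    refine ⟨by omega, fun hne => ?_⟩
    have hlt' : (G.lo A - 1) / 2 ^ (l + 1) < (G.hi A - 1) / 2 ^ (l + 1) := by
      by_contra hc
      rw [if_neg hc] at hne; exact hne rfl
    have := RLSLP.le_lam hB hlt'
    refine ⟨n - 1, by omega, by omega, by omega, l + 1, by omega, ?_, ?_, ?_, hlt', hmem, ?_⟩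
    · simp [State.set_reg, r9]
    · simp [State.set_reg, r10]
    · simp [State.set_reg]
    · intro y h9 h10 h11
      simp [State.set_reg, h11, hr y h9 h10 h11]
  · have := RLSLP.lo_lt_hi hB
    have := RLSLP.lo_pos A
    refine ⟨0, by omega, ?_, ?_, ?_, ?_, rfl, fun y h9 h10 h11 => ?_⟩
    · simp [State.set_reg]
    · simp [State.set_reg]
    · simp [State.set_reg]
    · simp; omega
    · simp [State.set_reg, h9, h10, h11]
  rintro t s' n ht ⟨l, hl, r9, r10, r11, hlt, hmem, hr⟩ hex
  have e1 : 2 * 2 ^ l = 2 ^ (l + 1) := by rw [pow_succ, mul_comm]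
  have e5 := (hr 5 (by simp) (by simp) (by simp)).trans h5
  simp only [val_less, val_div, val_mul, val_reg, val_num, r9, r10, r11, e1] at hex
  have hll : G.lam A = l := by
    refine RLSLP.lam_eq hB hlt fun hc => ?_
    rw [if_pos hc] at hex; omega
  simp only [safe_add, safe_reg, safe_num, val_add, val_reg, val_num, e5, r11, true_and, and_assoc,
    cost_bin, cost_div, cost_mul, cost_add, cost_load, cost_reg, cost_num] at ht ⊢
  repeat refine And.intro (by omega) ?_
  refine hQ _ _ ?_ ?_ fun x h9 h10 h11 => hr x h9 h10 h11
  · have h6 := RLSLP.lam_lt hB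
    have h7 := RLSLP.lw_add_lu_le hA
    omega
  · rw [State.put_mem, hmem, hll]

end level

/-! # The invariant of balancing -/

section balanced
variable {σ c w : ℕ} {O : Subroutines c} {G : RLSLP σ}

/-- Field `f` of the record of variable number `A` is final when the variables in `P` have been
processed and the side nodes of the variables in `T` are complete. -/
def Own (G : RLSLP σ) (c : ℕ) (P : List (Fin G.numVars)) (T : Set (Fin G.numVars)) (A f : ℕ) :
    Prop :=
  A = G.numVars ∨ (24 ≤ f ∧ f < 32) ∨
  (∃ B ∈ P, B.1 = A ∧ 0 < G.occ B ∧ (f < 8 ∨ 32 ≤ f ∧ f < 33 + c)) ∨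
  ∃ B ∈ T, B.1 = A ∧ (8 ≤ f ∧ f < 24 ∨ 33 + c ≤ f)

/-- The cells that are final when the variables in `P` have been processed and the side nodes of
the variables in `T` are complete. -/
def cells (G : RLSLP σ) (c : ℕ) (P : List (Fin G.numVars)) (T : Set (Fin G.numVars)) : Set ℕ :=
  {x | x < 2 + 3 * G.numVars ∨
    ∃ A ≤ G.numVars, ∃ f < stride c, x = recAt c G.numVars A + f ∧ Own G c P T A f}

variable {P P' : List (Fin G.numVars)} {T T' : Set (Fin G.numVars)}

theorem mem_cells {A f : ℕ} (hA : A ≤ G.numVars) (hf : f < stride c) :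
    recAt c G.numVars A + f ∈ cells G c P T ↔ Own G c P T A f := by
  constructor
  · rintro (h | ⟨B, -, g, hg, h, h'⟩)
    · have := le_recAt (c := c) (V := G.numVars) A
      omega
    · obtain ⟨rfl, rfl⟩ := recAt_add_inj hf hg h
      exact h'
  · exact fun h => Or.inr ⟨A, hA, f, hf, rfl, h⟩

theorem cells_lt {x : ℕ} (hx : x ∈ cells G c P T) : x < recAt c G.numVars (G.numVars + 1) := by
  rcases hx with h | ⟨B, hB, g, hg, h, -⟩
  · have := le_recAt (c := c) (V := G.numVars) (G.numVars + 1)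
    omega
  · have := recAt_le (c := c) hB
    omega

theorem Own.mono {A f : ℕ} (h : Own G c P T A f) (hP : P ⊆ P') (hT : T ⊆ T') :
    Own G c P' T' A f := by
  rcases h with h | h | ⟨B, hB, h⟩ | ⟨B, hB, h⟩
  · exact Or.inl h
  · exact Or.inr (Or.inl h)
  · exact Or.inr (Or.inr (Or.inl ⟨B, hP hB, h⟩))
  · exact Or.inr (Or.inr (Or.inr ⟨B, hT hB, h⟩))

theorem cells_mono (hP : P ⊆ P') (hT : T ⊆ T') : cells G c P T ⊆ cells G c P' T' := by
  rintro x (h | ⟨B, hB, g, hg, h, h'⟩)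
  · exact Or.inl h
  · exact Or.inr ⟨B, hB, g, hg, h, h'.mono hP hT⟩

theorem own_node {A : Fin G.numVars} {f : ℕ} (hf : f < 8 ∨ 32 ≤ f ∧ f < 33 + c) :
    Own G c P T A f ↔ A ∈ P ∧ 0 < G.occ A := by
  have := A.2
  constructor
  · rintro (h | h | ⟨B, hB, h, h', -⟩ | ⟨B, -, -, h⟩)
    · omega
    · omega
    · rw [← Fin.ext h]; exact ⟨hB, h'⟩
    · omega
  · exact fun h => Or.inr (Or.inr (Or.inl ⟨A, h.1, rfl, h.2, hf⟩))

theorem own_side {A : Fin G.numVars} {f : ℕ} (hf : 8 ≤ f ∧ f < 24 ∨ 33 + c ≤ f) :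
    Own G c P T A f ↔ A ∈ T := by
  have := A.2
  constructor
  · rintro (h | h | ⟨B, hB, h, h', h''⟩ | ⟨B, hB, h, -⟩)
    · omega
    · omega
    · omega
    · rw [← Fin.ext h]; exact hB
  · exact fun h => Or.inr (Or.inr (Or.inr ⟨A, h, rfl, hf⟩))

/-- The two side nodes and the node of a variable share one record, at offsets that keep node cells
and value blocks apart. Only the value block has to be shown fresh. -/
theorem layout_cells (hf : Fits G c w) {A : Fin G.numVars} {f g : ℕ} (h1 : f + 8 ≤ 24) (h2 : 33 ≤ g)
    (h3 : g + c ≤ stride c) (h : ∀ i < c, ¬ Own G c P T A (g + i)) :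
    Layout c w (cells G c P T) (recAt c G.numVars A + f) (recAt c G.numVars A + g)
      (recAt c G.numVars (G.numVars + 1)) := by
  have k1 := hf.size_le
  have k2 := recAt_le (c := c) A.2.le
  have k3 := le_recAt (c := c) (V := G.numVars) A
  refine ⟨by omega, by omega, by omega, by omega, by omega, fun i hi j hj => by omega,
    fun x => cells_lt, fun j hj => ?_⟩
  rw [add_assoc, mem_cells A.2.le (by omega)]
  exact h j hj

theorem Measured.congr {m m' : ℕ → ℕ} {ord : List (Fin G.numVars)} (h : Measured G c m ord ord)
    (hm : ∀ x ∈ cells G c P T, m' x = m x) (hlo : ord.length = G.numVars)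
    (hlen : ∀ A : Fin G.numVars, 0 < G.occ A → m' (recAt c G.numVars A + 0) = G.len A) :
    Measured G c m' ord ord := by
  have key : ∀ A ≤ G.numVars, ∀ f, (24 ≤ f ∧ f < 32) →
      m' (recAt c G.numVars A + f) = m (recAt c G.numVars A + f) := fun A hA f hf =>
    hm _ ((mem_cells hA (lt_stride (by omega))).mpr (Or.inr (Or.inl hf)))
  refine ⟨fun i hi => ?_, fun A => ?_, fun f hf => ?_, fun A hA => hlen A, fun A hA h0 => ?_,
    fun B => ?_, fun A => ?_⟩
  · rw [key i (by omega) _ (by omega), h.ord]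
  · rw [key A A.2.le _ (by omega), h.occ]
  · rw [hm _ ((mem_cells le_rfl (lt_stride hf)).mpr (Or.inl rfl)), h.null f hf]
  · rw [key A A.2.le _ (by omega), key A A.2.le _ (by omega)]; exact h.pow A hA h0
  · rw [key B B.2.le _ (by omega), h.pp]
  · rw [key A A.2.le _ (by omega), h.sc]

variable (val : List (Fin σ) → Fin c → ℕ)

/-- The balanced nodes of the variables in `P` are complete, and so are the side nodes of the
variables in `T`. -/
structure Balanced (G : RLSLP σ) (m : ℕ → ℕ) (ord P : List (Fin G.numVars))
    (T : Set (Fin G.numVars)) : Prop where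
  tables : Measured G c m ord ord
  level : ∀ A ∈ P, 0 < G.occ A → m (recAt c G.numVars A + 32) = 2 ^ G.lam A
  node : ∀ A ∈ P, 0 < G.occ A → Rep val m (cells G c P T) (recAt c G.numVars (G.numVars + 1))
    (recAt c G.numVars A) (G.expand A) (G.rk A)
  sides : ∀ A ∈ P, 0 < G.occ A → G.sc A ≠ none → ∃ N, ∃ X : ℕ → List (Fin σ), G.Next A N ∧
    m (recAt c G.numVars A + 5) = recAt c G.numVars N ∧ X 2 = G.expand N ∧
    G.expand A = X 0 ++ (X 1 ++ (X 2 ++ (X 3 ++ X 4))) ∧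
    ∀ i < 5, i ≠ 2 → Rep val m (cells G c P T) (recAt c G.numVars (G.numVars + 1))
      (m (recAt c G.numVars A + (3 + i))) (X i) (G.rkT A - 1)

variable {val}

/-- The lengths are a separate hypothesis because the length field is part of the node: it counts as
final only once the variable belongs to `P`, but it has been in use since `measure`. -/
theorem Balanced.congr {m m' : ℕ → ℕ} {ord : List (Fin G.numVars)} (h : Balanced val G m ord P T)
    (hm : ∀ x ∈ cells G c P T, m' x = m x) (hlo : ord.length = G.numVars) (hT : T ⊆ T')
    (hlen : ∀ A : Fin G.numVars, 0 < G.occ A → m' (recAt c G.numVars A + 0) = G.len A) :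
    Balanced val G m' ord P T' := by
  have key : ∀ A ∈ P, 0 < G.occ A → ∀ f, (f < 8 ∨ f = 32) →
      m' (recAt c G.numVars A + f) = m (recAt c G.numVars A + f) := fun A hA h0 f hf =>
    hm _ ((mem_cells A.2.le (lt_stride (by omega))).mpr ((own_node (by omega)).mpr ⟨hA, h0⟩))
  have hF := cells_mono (G := G) (c := c) (List.Subset.refl P) hT
  refine ⟨h.tables.congr hm hlo hlen, fun A hA h0 => ?_, fun A hA h0 => ?_,
    fun A hA h0 hsc => ?_⟩
  · rw [key A hA h0 _ (by omega), h.level A hA h0]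
  · exact (h.node A hA h0).congr hm hF le_rfl
  · obtain ⟨N, X, h1, h2, h3, h4, h5⟩ := h.sides A hA h0 hsc
    refine ⟨N, X, h1, ?_, h3, h4, fun i hi hi2 => ?_⟩
    · rw [key A hA h0 _ (by omega), h2]
    · rw [key A hA h0 _ (by omega)]
      exact (h5 i hi hi2).congr hm hF le_rfl

/-- The extra record behind those of the variables consists of zeros and represents the empty
string. It stands in wherever a concatenation has fewer than five proper children. -/
theorem Balanced.null {m : ℕ → ℕ} {ord : List (Fin G.numVars)} (h : Balanced val G m ord P T)
    (r : ℕ) : Rep val m (cells G c P T) (recAt c G.numVars (G.numVars + 1))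
      (recAt c G.numVars G.numVars) [] r := by
  refine .leaf ⟨fun i hi => ?_, ?_, fun h => absurd rfl h⟩ (by simp)
  · exact (mem_cells le_rfl (lt_stride (by omega))).mpr (Or.inl rfl)
  · simpa using h.tables.null 0 (by omega)

theorem Measured.balanced {m : ℕ → ℕ} {ord : List (Fin G.numVars)} (h : Measured G c m ord ord) :
    Balanced val G m ord [] ∅ :=
  ⟨h, by simp, by simp, by simp⟩

/-- The variables whose side nodes belong to variables in `P`. -/
def sidesOf (P : List (Fin G.numVars)) : Set (Fin G.numVars) := {d | ∃ A ∈ P, G.Prev A d}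

theorem Balanced.skip {m : ℕ → ℕ} {ord : List (Fin G.numVars)}
    (h : Balanced val G m ord P (sidesOf P)) {A : Fin G.numVars} (hA : G.occ A = 0) :
    Balanced val G m ord (A :: P) (sidesOf (A :: P)) := by
  have hsub : sidesOf P ⊆ sidesOf (A :: P) := fun d ⟨B, hB, h⟩ =>
    ⟨B, List.mem_cons_of_mem _ hB, h⟩
  have hF := cells_mono (G := G) (c := c) (List.subset_cons_self A P) hsub
  have key : ∀ B ∈ A :: P, 0 < G.occ B → B ∈ P := by
    intro B hB h0
    rcases List.mem_cons.mp hB with rfl | hB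
    · omega
    · exact hB
  refine ⟨h.tables, fun B hB h0 => h.level B (key B hB h0) h0, fun B hB h0 => ?_,
    fun B hB h0 hsc => ?_⟩
  · exact (h.node B (key B hB h0) h0).congr (fun _ _ => rfl) hF le_rfl
  · obtain ⟨N, X, h1, h2, h3, h4, h5⟩ := h.sides B (key B hB h0) h0 hsc
    exact ⟨N, X, h1, h2, h3, h4, fun i hi hi2 =>
      (h5 i hi hi2).congr (fun _ _ => rfl) hF le_rfl⟩

/-- A further variable has been processed. -/
theorem Balanced.cons {m m' : ℕ → ℕ} {ord : List (Fin G.numVars)} (h : Balanced val G m ord P T)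
    (hm : ∀ x ∈ cells G c P T, m' x = m x) (hlo : ord.length = G.numVars)
    {A : Fin G.numVars} (hT : T ⊆ T')
    (hlen : ∀ B : Fin G.numVars, 0 < G.occ B → m' (recAt c G.numVars B + 0) = G.len B)
    (hlevel : m' (recAt c G.numVars A + 32) = 2 ^ G.lam A)
    (hnode : Rep val m' (cells G c (A :: P) T') (recAt c G.numVars (G.numVars + 1))
      (recAt c G.numVars A) (G.expand A) (G.rk A))
    (hsides : G.sc A ≠ none → ∃ N, ∃ X : ℕ → List (Fin σ), G.Next A N ∧
      m' (recAt c G.numVars A + 5) = recAt c G.numVars N ∧ X 2 = G.expand N ∧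
      G.expand A = X 0 ++ (X 1 ++ (X 2 ++ (X 3 ++ X 4))) ∧
      ∀ i < 5, i ≠ 2 → Rep val m' (cells G c (A :: P) T') (recAt c G.numVars (G.numVars + 1))
        (m' (recAt c G.numVars A + (3 + i))) (X i) (G.rkT A - 1)) :
    Balanced val G m' ord (A :: P) T' := by
  have h' := h.congr hm hlo hT hlen
  have hF := cells_mono (G := G) (c := c) (List.subset_cons_self A P) (subset_refl T')
  refine ⟨h'.tables, fun B hB h0 => ?_, fun B hB h0 => ?_, fun B hB h0 hsc => ?_⟩
  · rcases List.mem_cons.mp hB with rfl | hB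
    · exact hlevel
    · exact h'.level B hB h0
  · rcases List.mem_cons.mp hB with rfl | hB
    · exact hnode
    · exact (h'.node B hB h0).congr (fun _ _ => rfl) hF le_rfl
  · rcases List.mem_cons.mp hB with rfl | hB
    · exact hsides hsc
    · obtain ⟨N, X, h1, h2, h3, h4, h5⟩ := h'.sides B hB h0 hsc
      exact ⟨N, X, h1, h2, h3, h4, fun i hi hi2 =>
        (h5 i hi hi2).congr (fun _ _ => rfl) hF le_rfl⟩

end balanced

/-! # Concatenation nodes -/

/-- Make the node whose address is in register 30 a concatenation of the nodes at the addresses in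
the registers from 20 on. -/
def catNode : Prog :=
  .store (R 30 + 3) (R 20) ;; .store (R 30 + 4) (R 21) ;; .store (R 30 + 5) (R 22) ;;
  .store (R 30 + 6) (R 23) ;; .store (R 30 + 7) (R 24) ;; makeCat

section catNode
variable {c σ w : ℕ} {O : Subroutines c} {val : List (Fin σ) → Fin c → ℕ}

theorem wp_catNode (hO : Composes w O val) {F F' : Set ℕ} {s : State} {r : ℕ}
    {X : ℕ → List (Fin σ)} (hL : Layout c w F (s.reg 30) (s.reg 43) (s.reg 44))
    (hX : ∀ i < 5, Rep val s.mem F (s.reg 44) (s.reg (20 + i)) (X i) r)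
    (hF : F ⊆ F') (hq : ∀ i < 8, s.reg 30 + i ∉ F ∧ s.reg 30 + i ∈ F')
    (hD : ∀ i < c, s.reg 43 + i ∈ F')
    (hlen : (X 0 ++ (X 1 ++ (X 2 ++ (X 3 ++ X 4)))).length < 2 ^ w) {Q : ℕ → State → Prop}
    (hQ : ∀ t s', t ≤ 900 * O.timeH →
      Rep val s'.mem F' (s.reg 44) (s.reg 30) (X 0 ++ (X 1 ++ (X 2 ++ (X 3 ++ X 4)))) (r + 1) →
      (∀ i < 5, s'.mem (s.reg 30 + (3 + i)) = s.reg (20 + i)) →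
      (∀ x, (∀ i < 8, x ≠ s.reg 30 + i) → (∀ i < c, x ≠ s.reg 43 + i) →
        (∀ i < c, x ≠ s.reg 44 + i) → s'.mem x = s.mem x) →
      (∀ x, x < 32 ∨ x = 43 ∨ x = 44 → s'.reg x = s.reg x) → Q t s') :
    wp w O catNode Q s := by
  have hpow := hL.pow
  have htop := hL.top
  have hnode := hL.node
  have hpos := hO.pos
  simp only [catNode, wp, safe_add, safe_reg, safe_num, val_add, val_reg, val_num, State.put_reg,
    cost_add, cost_reg, cost_num, true_and, and_assoc]
  repeat refine And.intro (by omega) ?_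
  set s1 := ((((s.put (s.reg 30 + 3) (s.reg 20)).put (s.reg 30 + 4) (s.reg 21)).put
    (s.reg 30 + 5) (s.reg 22)).put (s.reg 30 + 6) (s.reg 23)).put (s.reg 30 + 7) (s.reg 24) with hs1
  have hreg : ∀ x, s1.reg x = s.reg x := fun _ => rfl
  have hfr : ∀ x, (∀ i < 8, x ≠ s.reg 30 + i) → s1.mem x = s.mem x := by
    intro x hx
    simp only [hs1, State.put_mem, Function.update_of_ne (hx 3 (by omega)),
      Function.update_of_ne (hx 4 (by omega)), Function.update_of_ne (hx 5 (by omega)),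
      Function.update_of_ne (hx 6 (by omega)), Function.update_of_ne (hx 7 (by omega))]
  have hch : ∀ i < 5, s1.mem (s.reg 30 + (3 + i)) = s.reg (20 + i) := by
    intro i hi
    interval_cases i <;> simp [hs1, State.put_mem, Function.update_apply]
  refine wp_makeCat hO (s := s1) (r := r) hL (fun i hi => ?_) hF hq hD hlen fun t s' ht hR hm hr => ?_
  · rw [add_assoc, hreg 30, hch i hi]
    exact (hX i hi).congr (fun x hx => hfr x fun j hj h => (hq j hj).1 (h ▸ hx)) subset_rfl le_rfl
  refine hQ _ _ (by omega) hR (fun i hi => ?_) (fun x h1 h2 h3 => ?_) hr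
  · rw [hm, hch i hi]
    · intro j hj
      rw [hreg]; omega
    · intro j hj
      exact hL.disj _ (by omega) j hj
    · intro j hj
      rw [hreg]; omega
  · rw [hm x (fun i hi => h1 i (by omega)) h2 h3, hfr x h1]

end catNode

/-! # Balancing -/

section balance
variable {σ c w : ℕ} {O : Subroutines c} {G : RLSLP σ} {val : List (Fin σ) → Fin c → ℕ}
  {P : List (Fin G.numVars)} {T : Set (Fin G.numVars)} {ord : List (Fin G.numVars)}

/-- The node of a variable with a rule `A → a`. -/
def termNode : Prog := .callF (R 5 + 33) (M (R 6 + 1)) ;; .store (R 5 + 1) (R 5 + 33)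

/-- The node of a variable with a rule `A → B ^ t`. -/
def runNode (c : ℕ) : Prog :=
  .set 10 (recE c (M (R 6 + 1))) ;; .store (R 5 + 3) (R 10) ;; .store (R 5 + 2) (M (R 6 + 2)) ;;
  .set 40 0 ;; .set 41 (M (R 10 + 1)) ;; .set 42 (M (R 6 + 2)) ;; .set 43 (R 5 + 33) ;; prepend ;;
  .store (R 5 + 1) (R 40)

/-- Make the side nodes of the variable whose record stands at the address in register 14, and go
to the next variable of higher level on the path. -/
def sideNodes (c : ℕ) : Prog :=
  .set 20 (R 12) ;; .set 21 (M (R 14 + 3)) ;; .set 22 (M (R 14 + 4)) ;; .set 23 (R 15) ;;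
  .set 24 (R 15) ;; .set 30 (R 14 + 8) ;; .set 43 (R 14 + Expr.const (33 + c)) ;; catNode ;;
  .set 12 (R 30) ;; .set 20 (M (R 14 + 6)) ;; .set 21 (M (R 14 + 7)) ;; .set 22 (R 13) ;;
  .set 30 (R 14 + 16) ;; .set 43 (R 14 + Expr.const (33 + 2 * c)) ;; catNode ;; .set 13 (R 30) ;;
  .set 14 (M (R 14 + 5))

/-- The last step for a variable with a rule `A → B C`. -/
def pairTop : Prog :=
  .set 20 (R 10) ;; .set 21 (R 12) ;; .set 22 (R 14) ;; .set 23 (R 13) ;; .set 24 (R 11) ;;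
  .set 30 (R 5) ;; .set 43 (R 5 + 33) ;; catNode

/-- The node of a variable with a rule `A → B C`. -/
def pairNode (c : ℕ) : Prog :=
  .set 10 (recE c (M (R 6 + 1))) ;; .set 11 (recE c (M (R 6 + 2))) ;; .set 15 (recE c (R 3)) ;;
  .set 12 (R 15) ;; .set 13 (R 15) ;; .set 14 (R 15) ;;
  .ite (M (R 5 + 30)) (.set 14 (M (R 5 + 30)) ;;
    .ite (Expr.equal (R 10) (R 14)) (.set 10 (R 15)) (.set 11 (R 15)) ;;
    .loop (Expr.less (M (R 14 + 32)) (M (R 5 + 32))) (sideNodes c)) .skip ;; pairTop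

/-- Process the next variable in reverse topological order. -/
def balanceOne (c : ℕ) : Prog :=
  fetch c ;; .ite (M (R 5 + 26)) (setLevel ;; .ite (M (R 6))
    (.ite (Expr.equal (M (R 6)) 1) (pairNode c) (runNode c)) termNode) .skip

/-- Build the balanced nodes. -/
def balance (c : ℕ) : Prog := .set 8 (R 3) ;; .loop (R 8) (balanceOne c)

/-- The node of a further variable is complete. -/
theorem Balanced.finish {m m' : ℕ → ℕ} (h : Balanced val G m ord P T)
    (hlo : ord.length = G.numVars) (ho : G.TopOrder ord) {A : Fin G.numVars} (hA : A ∉ P)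
    (hfr : ∀ x < recAt c G.numVars (G.numVars + 1), (∀ i < 8, x ≠ recAt c G.numVars A + i) →
      (∀ i < c, x ≠ recAt c G.numVars A + 33 + i) → m' x = m x)
    (hlevel : m (recAt c G.numVars A + 32) = 2 ^ G.lam A)
    (hnode : Rep val m' (cells G c (A :: P) T) (recAt c G.numVars (G.numVars + 1))
      (recAt c G.numVars A) (G.expand A) (G.rk A))
    (hsides : G.sc A ≠ none → ∃ N, ∃ X : ℕ → List (Fin σ), G.Next A N ∧
      m' (recAt c G.numVars A + 5) = recAt c G.numVars N ∧ X 2 = G.expand N ∧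
      G.expand A = X 0 ++ (X 1 ++ (X 2 ++ (X 3 ++ X 4))) ∧
      ∀ i < 5, i ≠ 2 → Rep val m' (cells G c (A :: P) T) (recAt c G.numVars (G.numVars + 1))
        (m' (recAt c G.numVars A + (3 + i))) (X i) (G.rkT A - 1)) :
    Balanced val G m' ord (A :: P) T := by
  have k1 := recAt_le (c := c) A.2.le
  have k2 := lt_stride (c := c) (f := 32)
  have hst : 33 + c ≤ stride c := by unfold stride; omega
  refine h.cons (fun x hx => hfr x (cells_lt hx) (fun i hi he => ?_) (fun i hi he => ?_)) hlo
    subset_rfl (fun B h0 => ?_) ?_ hnode hsides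
  · rw [he, mem_cells A.2.le (by omega), own_node (by omega)] at hx
    exact hA hx.1
  · rw [he, add_assoc, mem_cells A.2.le (by omega), own_node (by omega)] at hx
    exact hA hx.1
  · by_cases hBA : B = A
    · subst hBA
      simpa [RLSLP.len] using hnode.head.len
    · have hne : ¬ (B : ℕ) = A := fun h => hBA (Fin.ext h)
      have k3 := recAt_le (c := c) B.2.le
      rw [hfr, h.tables.len B (ho.mem B) h0]
      · omega
      · intro i hi
        exact recAt_ne (by omega) (by omega) (by omega)
      · intro i hi
        rw [add_assoc]
        exact recAt_ne (by omega) (by omega) (by omega)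
  · rw [hfr, hlevel]
    · omega
    · intro i hi; omega
    · intro i hi; omega

theorem Env.frame {s s' : State} (h : Env G c s) (h2 : s'.reg 2 = s.reg 2)
    (h3 : s'.reg 3 = s.reg 3) (h44 : s'.reg 44 = s.reg 44) {A : Fin G.numVars}
    (hm : ∀ x < recAt c G.numVars (G.numVars + 1), (∀ i < stride c, x ≠ recAt c G.numVars A + i) →
      s'.mem x = s.mem x) : Env G c s' := by
  have k1 := recAt_le (c := c) A.2.le
  have k2 := le_recAt (c := c) (V := G.numVars) A
  exact h.congr h2 h3 h44 fun x hx => hm x (by omega) fun i _ => by omega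

theorem wp_termNode (hf : Fits G c w) (hO : Composes w O val) {s : State} (hs : Env G c s)
    (h : Balanced val G s.mem ord P T) (hlo : ord.length = G.numVars) (ho : G.TopOrder ord)
    {A : Fin G.numVars} (hA : A ∉ P) (h0 : 0 < G.occ A) (h5 : s.reg 5 = recAt c G.numVars A)
    (h6 : s.reg 6 = 2 + 3 * A) (hlevel : s.mem (recAt c G.numVars A + 32) = 2 ^ G.lam A)
    {a : Fin σ} (hr : G.rule A = .term a) {Q : ℕ → State → Prop}
    (hQ : ∀ t s', t ≤ O.timeF + 30 → Env G c s' → s'.reg 8 = s.reg 8 →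
      Balanced val G s'.mem ord (A :: P) T → Q t s') :
    wp w O termNode Q s := by
  have hpos := hO.pos
  have h1 := hf.rec_lt A.2.le
  have h2 := le_recAt (c := c) (V := G.numVars) A
  have h3 := hf.size_le
  have k1 := recAt_le (c := c) A.2.le
  have hst : stride c = 33 + 3 * c := by unfold stride; rfl
  have c1 := hs.cell A (j := 1) (by omega)
  have hVA := A.2
  rw [hr] at c1
  simp only [RLRule.encode, List.getD_cons_succ, List.getD_cons_zero] at c1
  simp only [termNode, wp, safe_add, safe_load, safe_reg, safe_num, val_add, val_load, val_reg,
    val_num, h5, h6, c1, hO.f_eq, cost_add, cost_load, cost_reg, cost_num, true_and, and_assoc]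
  repeat refine And.intro (by omega) ?_
  set m' := (State.put ⟨s.reg, writeBlock w s.mem (recAt c G.numVars A + 33) (val [a])⟩
    (recAt c G.numVars A + 1) (recAt c G.numVars A + 33)).mem with hm'
  have hfr : ∀ x, x ≠ recAt c G.numVars A + 1 → (∀ i < c, x ≠ recAt c G.numVars A + 33 + i) →
      m' x = s.mem x := by
    intro x hx hx'
    rw [hm', State.put_mem, Function.update_of_ne hx]
    exact writeBlock_of_ne hx'
  have e1 : m' (recAt c G.numVars A + 1) = recAt c G.numVars A + 33 := by
    rw [hm', State.put_mem, Function.update_self]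
  refine hQ _ _ (by omega) (hs.frame (A := A) rfl rfl rfl fun x _ hx =>
    hfr x (hx 1 (by omega)) fun i hi => ?_) rfl (h.finish hlo ho hA (fun x _ hx hx' =>
    hfr x (hx 1 (by omega)) hx') hlevel ?_ ?_)
  · rw [add_assoc]; exact hx _ (by omega)
  · change Rep val m' _ _ _ _ _
    refine .leaf ⟨fun i hi => ?_, ?_, fun _ => ?_⟩ ?_
    · exact (mem_cells A.2.le (by omega)).mpr ((own_node (by omega)).mpr ⟨by simp, h0⟩)
    · have := h.tables.len A (ho.mem A) h0
      rw [hfr _ (by omega) (fun i _ => by omega)]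
      simpa [RLSLP.len] using this
    · rw [e1]
      refine ⟨by omega, by omega, fun i hi => ?_, ?_⟩
      · rw [add_assoc]
        exact (mem_cells A.2.le (by omega)).mpr ((own_node (by omega)).mpr ⟨by simp, h0⟩)
      · rw [RLSLP.expand_term hr, hm', State.put_mem]
        rw [readBlock_congr (m := writeBlock w s.mem (recAt c G.numVars A + 33) (val [a]))]
        · exact readBlock_writeBlock (hO.lt _) (by omega)
        · intro i hi
          exact Function.update_of_ne (by omega) _ _
    · simp [RLSLP.expand_term hr]
  · intro hsc
    exact absurd (RLSLP.sc_eq_none (by simp [hr])) hsc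

theorem wp_runNode (hf : Fits G c w) (hO : Composes w O val) {s : State} (hs : Env G c s)
    (h : Balanced val G s.mem ord P T) (hlo : ord.length = G.numVars) (ho : G.TopOrder ord)
    {A : Fin G.numVars} (hA : A ∉ P) (h0 : 0 < G.occ A) (h5 : s.reg 5 = recAt c G.numVars A)
    (h6 : s.reg 6 = 2 + 3 * A) (hlevel : s.mem (recAt c G.numVars A + 32) = 2 ^ G.lam A)
    {B : Fin G.numVars} {t₀ : ℕ} (hr : G.rule A = .run B t₀) (hB : B ∈ P) {Q : ℕ → State → Prop}
    (hQ : ∀ t s', t ≤ 200 * (O.timeH * (Nat.log 2 G.text.length + 1)) → Env G c s' →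
      s'.reg 8 = s.reg 8 → Balanced val G s'.mem ord (A :: P) T → Q t s') :
    wp w O (runNode c) Q s := by
  have hpos := hO.pos
  have h1 := hf.rec_lt A.2.le
  have h2 := le_recAt (c := c) (V := G.numVars) A
  have h1' := hf.rec_lt B.2.le
  have h2' := le_recAt (c := c) (V := G.numVars) B
  have h3 := hf.size_le
  have k1 := recAt_le (c := c) A.2.le
  have hst : stride c = 33 + 3 * c := by unfold stride; rfl
  have c1 := hs.cell A (j := 1) (by omega)
  have c2 := hs.cell A (j := 2) (by omega)
  have hVA := A.2
  have ht3 := G.three_le A B t₀ hr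
  have hlr := RLSLP.len_run hr
  have hlB := RLSLP.len_pos B
  have hlA := RLSLP.len_le_text h0
  have htA : t₀ ≤ G.len A := by rw [hlr]; exact Nat.le_mul_of_pos_right _ hlB
  have h0B := RLSLP.occ_pos_of_mentions (A := A) (B := B) (by simp [hr, RLRule.Mentions]) h0
  have hnB := h.node B hB h0B
  have hBne : G.expand B ≠ [] := by
    intro hc
    have : G.len B = 0 := by simp [RLSLP.len, hc]
    omega
  obtain ⟨p1, p2, p3, p4⟩ := hnB.head.ptr hBne
  have hcell : ∀ f, (f < 8 ∨ 33 ≤ f ∧ f < 33 + c) → recAt c G.numVars A + f ∉ cells G c P T := by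
    intro f hf hc
    rw [mem_cells A.2.le (by omega), own_node (by omega)] at hc
    exact hA hc.1
  have hcell' : ∀ f, (f < 8 ∨ 33 ≤ f ∧ f < 33 + c) →
      recAt c G.numVars A + f ∈ cells G c (A :: P) T := by
    intro f hf
    rw [mem_cells A.2.le (by omega), own_node (by omega)]
    exact ⟨by simp, h0⟩
  have hB1 := hnB.head.cells 1 (by omega)
  rw [hr] at c1 c2
  simp only [RLRule.encode, List.getD_cons_succ, List.getD_cons_zero] at c1 c2
  have e2 : Function.update s.mem (recAt c G.numVars A + 3) (recAt c G.numVars B)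
      (2 + 3 * A.1 + 2) = t₀ := by
    rw [Function.update_of_ne (by omega), c2]
  set m1 := Function.update (Function.update s.mem (recAt c G.numVars A + 3) (recAt c G.numVars B))
    (recAt c G.numVars A + 2) t₀ with hm1
  have hm1F : ∀ x, x ≠ recAt c G.numVars A + 3 → x ≠ recAt c G.numVars A + 2 → m1 x = s.mem x := by
    intro x hx hx'
    rw [hm1, Function.update_of_ne hx', Function.update_of_ne hx]
  have e3 : m1 (2 + 3 * A.1 + 2) = t₀ := by rw [hm1F _ (by omega) (by omega), c2]
  have hneF : ∀ x ∈ cells G c P T, m1 x = s.mem x := fun x hx =>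
    hm1F x (fun h => hcell 3 (by omega) (h ▸ hx)) (fun h => hcell 2 (by omega) (h ▸ hx))
  have e4 := hneF _ hB1
  simp only [runNode, wp, safe_add, safe_load, safe_reg, safe_num, val_add, val_load, val_reg,
    val_num, State.set_reg, State.set_mem, State.put_reg, State.put_mem, val_recE, safe_recE,
    cost_recE, h5, h6, hs.r2, c1, fold_recAt, e2, ← hm1, e3, e4, cost_add, cost_load, cost_reg,
    cost_num, true_and, and_assoc, Nat.reduceEqDiff, if_true, if_false]
  repeat refine And.intro (by omega) ?_
  -- The value of `B ^ t` is a power prepended to the empty string. Since `t ≤ len A ≤ n`, this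
  -- needs `O(log n)` calls of `h`.
  apply wp_prepend hO (X := G.expand B) (Y := []) (by omega)
  · simp only [State.set_reg, Nat.reduceEqDiff, if_true, if_false]; omega
  · simp [State.set_reg, Holds]
  · simp only [State.set_reg, State.put_reg, Nat.reduceEqDiff, if_true, if_false, hs.r44]; omega
  · simp only [State.set_reg, State.set_mem, State.put_reg, State.put_mem, Nat.reduceEqDiff,
      if_true, if_false, hs.r44, ← hm1]
    intro _
    refine ⟨p1, ?_, p2, fun i hi j hj he => ?_⟩
    · rw [← p4]
      exact readBlock_congr fun i hi => hneF _ (p3 i hi)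
    · rw [add_assoc] at he
      exact hcell (33 + j) (by omega) (he ▸ p3 i hi)
  · simp only [State.set_reg, Nat.reduceEqDiff, if_true, if_false]; omega
  · simp only [State.set_reg, State.put_reg, Nat.reduceEqDiff, if_true, if_false, hs.r44]; omega
  · simp only [State.set_reg, State.put_reg, Nat.reduceEqDiff, if_true, if_false, hs.r44]; omega
  simp only [State.set_reg, State.set_mem, State.put_reg, State.put_mem, Nat.reduceEqDiff, if_true,
    if_false, hs.r44, ← hm1, List.append_nil]
  intro t s' ht gH g40 gm gr
  have g5 := gr 5 (by simp)
  have g2 := gr 2 (by simp)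
  have g3 := gr 3 (by simp)
  have g8 := gr 8 (by simp)
  have g44 := gr 44 (by simp)
  simp only [Nat.reduceEqDiff, if_false, h5] at g5 g2 g3 g8 g44
  rw [g5]
  repeat refine And.intro (by omega) ?_
  have hfr : ∀ x < recAt c G.numVars (G.numVars + 1), x ≠ recAt c G.numVars A + 1 →
      x ≠ recAt c G.numVars A + 2 → x ≠ recAt c G.numVars A + 3 →
      (∀ i < c, x ≠ recAt c G.numVars A + 33 + i) →
      Function.update s'.mem (recAt c G.numVars A + 1) (s'.reg 40) x = s.mem x := by
    intro x hx x1 x2 x3 x4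
    rw [Function.update_of_ne x1, gm x x4 (fun i hi => by omega), hm1F x x3 x2]
  rw [← RLSLP.expand_run hr] at gH
  have hAne : G.expand A ≠ [] := by
    intro hc
    have : G.len A = 0 := by simp [RLSLP.len, hc]
    omega
  obtain ⟨q1, q2⟩ : s'.reg 40 ≠ 0 ∧ readBlock c s'.mem (s'.reg 40) = val (G.expand A) := by
    rcases gH with ⟨_, hc⟩ | hc
    · exact absurd hc hAne
    · exact hc
  have hlog : Nat.log 2 t₀ ≤ Nat.log 2 G.text.length := Nat.log_mono_right (by omega)
  have e5 : ∀ f, f = 2 ∨ f = 3 →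
      Function.update s'.mem (recAt c G.numVars A + 1) (s'.reg 40) (recAt c G.numVars A + f) =
        m1 (recAt c G.numVars A + f) := by
    intro f hf
    rw [Function.update_of_ne (by omega), gm _ (fun i _ => by omega) (fun i _ => by omega)]
  have eT : Function.update s'.mem (recAt c G.numVars A + 1) (s'.reg 40)
      (recAt c G.numVars A + 2) = t₀ := by
    rw [e5 2 (by omega), hm1, Function.update_self]
  have eB : Function.update s'.mem (recAt c G.numVars A + 1) (s'.reg 40)
      (recAt c G.numVars A + 3) = recAt c G.numVars B := by
    rw [e5 3 (by omega), hm1, Function.update_of_ne (by omega), Function.update_self]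
  refine hQ _ _ ?_ (hs.frame (A := A) g2 g3 g44 fun x hx hx' =>
    hfr x hx (hx' _ (by omega)) (hx' _ (by omega)) (hx' _ (by omega)) fun i hi => ?_) g8
    (h.finish hlo ho hA (fun x hx hx1 hx2 =>
      hfr x hx (hx1 _ (by omega)) (hx1 _ (by omega)) (hx1 _ (by omega)) hx2) hlevel ?_ ?_)
  · have h7 : 100 * O.timeH * (Nat.log 2 t₀ + 1) ≤
        100 * (O.timeH * (Nat.log 2 G.text.length + 1)) := by
      rw [mul_assoc]
      exact Nat.mul_le_mul_left _ (Nat.mul_le_mul_left _ (by omega))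
    have h8 : 1 ≤ O.timeH * (Nat.log 2 G.text.length + 1) := Nat.mul_pos hpos (by omega)
    omega
  · rw [add_assoc]; exact hx' _ (by omega)
  · have hrep := Rep.run (val := val)
      (m := Function.update s'.mem (recAt c G.numVars A + 1) (s'.reg 40))
      (F := cells G c (A :: P) T) (top := recAt c G.numVars (G.numVars + 1))
      (a := recAt c G.numVars A) (X := G.expand B) (r := G.rk B) (r' := G.rk A)
    rw [eT, eB, ← RLSLP.expand_run hr] at hrep
    refine hrep ⟨fun i hi => hcell' i (by omega), ?_, fun _ => ?_⟩ (by omega) ?_ hBne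
      (RLSLP.rk_lt_of_run hr h0)
    · rw [hfr _ (by omega) (by omega) (by omega) (by omega) (fun i _ => by omega)]
      simpa [RLSLP.len] using h.tables.len A (ho.mem A) h0
    · rw [Function.update_self]
      have hpc : (s'.reg 40 = s.mem (recAt c G.numVars B + 1)) ∨
          s'.reg 40 = recAt c G.numVars A + 33 := by
        rcases g40 with g | ⟨_, g⟩ | g
        · exact absurd g q1
        · exact Or.inl g
        · exact Or.inr g
      have hin : ∀ i < c, s'.reg 40 + i ∈ cells G c P T ∨
          s'.reg 40 + i = recAt c G.numVars A + (33 + i) := by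
        intro i hi
        rcases hpc with g | g
        · rw [g]; exact Or.inl (p3 i hi)
        · right; omega
      refine ⟨q1, ?_, fun i hi => ?_, ?_⟩
      · rcases hpc with g | g
        · rw [g]; exact p2
        · omega
      · rcases hin i hi with g | g
        · exact cells_mono (List.subset_cons_self A P) subset_rfl g
        · rw [g]; exact hcell' _ (by omega)
      · rw [← q2]
        refine readBlock_congr fun i hi => Function.update_of_ne ?_ _ _
        rcases hin i hi with g | g
        · exact fun he => hcell 1 (by omega) (he ▸ g)
        · omega
    · refine hnB.congr (fun x hx => ?_) (cells_mono (List.subset_cons_self A P) subset_rfl) le_rfl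
      refine hfr x (cells_lt hx) ?_ ?_ ?_ fun i hi he => ?_
      · exact fun he => hcell 1 (by omega) (he ▸ hx)
      · exact fun he => hcell 2 (by omega) (he ▸ hx)
      · exact fun he => hcell 3 (by omega) (he ▸ hx)
      · rw [add_assoc] at he
        exact hcell (33 + i) (by omega) (he ▸ hx)
  · intro hsc
    exact absurd (RLSLP.sc_eq_none (by simp [hr])) hsc

end balance

/-! ### Nodes of pair rules and side nodes -/

section balance
variable {σ c w : ℕ} {O : Subroutines c} {G : RLSLP σ} {val : List (Fin σ) → Fin c → ℕ}
  {P : List (Fin G.numVars)} {T : Set (Fin G.numVars)} {ord : List (Fin G.numVars)}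

/-- The rank of the node itself requires only the bound `rk A - 1` on the children. The second
bound, `rkT A - 1`, on all but the middle child is recorded for later use: these children are reused
in the side nodes of `A`, which are made for a variable before `A` on the path. -/
theorem wp_mainNode (hf : Fits G c w) (hO : Composes w O val) {s : State} (hs : Env G c s)
    (h : Balanced val G s.mem ord P T) (hlo : ord.length = G.numVars) (ho : G.TopOrder ord)
    {A : Fin G.numVars} (hA : A ∉ P) (h0 : 0 < G.occ A)
    (hlevel : s.mem (recAt c G.numVars A + 32) = 2 ^ G.lam A)
    (h30 : s.reg 30 = recAt c G.numVars A + 0) (h43 : s.reg 43 = recAt c G.numVars A + 33)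
    {X : ℕ → List (Fin σ)} (hcat : G.expand A = X 0 ++ (X 1 ++ (X 2 ++ (X 3 ++ X 4))))
    (hX : ∀ i < 5, Rep val s.mem (cells G c P T) (recAt c G.numVars (G.numVars + 1))
      (s.reg (20 + i)) (X i) (G.rk A - 1))
    (hsc : G.sc A ≠ none → ∃ N, G.Next A N ∧ s.reg 22 = recAt c G.numVars N ∧
      X 2 = G.expand N ∧ ∀ i < 5, i ≠ 2 → Rep val s.mem (cells G c P T)
        (recAt c G.numVars (G.numVars + 1)) (s.reg (20 + i)) (X i) (G.rkT A - 1))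
    {Q : ℕ → State → Prop}
    (hQ : ∀ t s', t ≤ 900 * O.timeH → Env G c s' → s'.reg 8 = s.reg 8 →
      Balanced val G s'.mem ord (A :: P) T → Q t s') :
    wp w O catNode Q s := by
  have h1 := hf.rec_lt A.2.le
  have h3 := hf.size_le
  have k1 := recAt_le (c := c) A.2.le
  have hst : stride c = 33 + 3 * c := by unfold stride; rfl
  have hlA := RLSLP.len_le_text h0
  have hrk : G.rk A - 1 + 1 = G.rk A := by
    have : 0 < G.rk A := by unfold RLSLP.rk; omega
    omega
  have hcell : ∀ f, (f < 8 ∨ 33 ≤ f ∧ f < 33 + c) → recAt c G.numVars A + f ∉ cells G c P T := by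
    intro f hf hc
    rw [mem_cells A.2.le (by omega), own_node (by omega)] at hc
    exact hA hc.1
  have hcell' : ∀ f, (f < 8 ∨ 33 ≤ f ∧ f < 33 + c) →
      recAt c G.numVars A + f ∈ cells G c (A :: P) T := by
    intro f hf
    rw [mem_cells A.2.le (by omega), own_node (by omega)]
    exact ⟨by simp, h0⟩
  have hL := layout_cells hf (P := P) (T := T) (A := A) (f := 0) (g := 33) (by omega) le_rfl
    (by omega) fun i hi hc => hcell (33 + i) (by omega) ((mem_cells A.2.le (by omega)).mpr hc)
  have hsub := cells_mono (G := G) (c := c) (List.subset_cons_self A P) (subset_refl T)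
  rw [← h30, ← h43, ← hs.r44] at hL
  refine wp_catNode hO hL (F' := cells G c (A :: P) T) (r := G.rk A - 1) (X := X) ?_ hsub ?_ ?_ ?_ ?_
  · rw [hs.r44]; exact hX
  · intro i hi
    rw [h30, add_zero]
    exact ⟨hcell i (by omega), hcell' i (by omega)⟩
  · intro i hi
    rw [h43, add_assoc]
    exact hcell' _ (by omega)
  · rw [← hcat]
    change G.len A < _
    omega
  intro t s' ht hR hch hfr hr
  rw [hrk, ← hcat, hs.r44, h30, add_zero] at hR
  rw [h30, h43, hs.r44, add_zero] at hfr
  rw [h30, add_zero] at hch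
  have hfr' : ∀ x < recAt c G.numVars (G.numVars + 1), (∀ i < 8, x ≠ recAt c G.numVars A + i) →
      (∀ i < c, x ≠ recAt c G.numVars A + 33 + i) → s'.mem x = s.mem x :=
    fun x hx hx1 hx2 => hfr x hx1 hx2 fun i hi => by omega
  refine hQ _ _ ht ?_ (hr 8 (by omega)) (h.finish hlo ho hA hfr' hlevel hR fun hne => ?_)
  · refine hs.frame (A := A) (hr 2 (by omega)) (hr 3 (by omega)) (hr 44 (by omega))
      fun x hx hx' => hfr' x hx (fun i hi => hx' i (by omega)) fun i hi => ?_
    rw [add_assoc]; exact hx' _ (by omega)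
  · obtain ⟨N, n1, n2, n3, n4⟩ := hsc hne
    refine ⟨N, X, n1, ?_, n3, hcat, fun i hi hi2 => ?_⟩
    · have := hch 2 (by omega)
      rw [← n2]; exact this
    · rw [hch i hi]
      refine (n4 i hi hi2).congr (fun x hx => hfr' x (cells_lt hx) (fun j hj he => ?_)
        (fun j hj he => ?_)) hsub le_rfl
      · exact hcell j (by omega) (he ▸ hx)
      · rw [add_assoc] at he
        exact hcell _ (by omega) (he ▸ hx)

-- One step along the Cartesian tree. The node of `D` already has the form left parts, `exp(N)`,
-- right parts, where `N` is the next variable of higher level. Moving the outer parts to the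
-- gathered strings replaces `D` by `N` as the uncovered middle, at the price of two concatenations
-- of rank `rkT D`.
set_option maxHeartbeats 400000 in
theorem wp_sideNodes (hf : Fits G c w) (hO : Composes w O val) {s : State} (hs : Env G c s)
    (h : Balanced val G s.mem ord P T) (hlo : ord.length = G.numVars) (ho : G.TopOrder ord)
    {D : Fin G.numVars} (hD : D ∈ P) (h0 : 0 < G.occ D) (hsc : G.sc D ≠ none) (hT : D ∉ T)
    (h14 : s.reg 14 = recAt c G.numVars D) (h15 : s.reg 15 = recAt c G.numVars G.numVars)
    {XL XR : List (Fin σ)} {r : ℕ} (hr : r < G.rkT D)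
    (hXL : Rep val s.mem (cells G c P T) (recAt c G.numVars (G.numVars + 1)) (s.reg 12) XL r)
    (hXR : Rep val s.mem (cells G c P T) (recAt c G.numVars (G.numVars + 1)) (s.reg 13) XR r)
    (hlen : (XL ++ (G.expand D ++ XR)).length ≤ G.text.length) {Q : ℕ → State → Prop}
    (hQ : ∀ t s' N YL YR, t ≤ 2000 * O.timeH → Env G c s' → G.Next D N →
      XL ++ (G.expand D ++ XR) = YL ++ (G.expand N ++ YR) → s'.reg 14 = recAt c G.numVars N →
      Balanced val G s'.mem ord P (T ∪ {D}) →
      Rep val s'.mem (cells G c P (T ∪ {D})) (recAt c G.numVars (G.numVars + 1)) (s'.reg 12) YL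
        (G.rkT D) →
      Rep val s'.mem (cells G c P (T ∪ {D})) (recAt c G.numVars (G.numVars + 1)) (s'.reg 13) YR
        (G.rkT D) →
      (∀ x, x < 12 ∨ x = 15 → s'.reg x = s.reg x) →
      (∀ A : Fin G.numVars, A ≠ D → s'.mem (recAt c G.numVars A + 32) =
        s.mem (recAt c G.numVars A + 32)) → Q t s') :
    wp w O (sideNodes c) Q s := by
  have hpos := hO.pos
  have h1 := hf.rec_lt D.2.le
  have h3 := hf.size_le
  have k1 := recAt_le (c := c) D.2.le
  have k2 := le_recAt (c := c) (V := G.numVars) D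
  have hst : stride c = 33 + 3 * c := by unfold stride; rfl
  obtain ⟨N, X, n1, n2, n3, n4, n5⟩ := h.sides D hD h0 hsc
  have hrk : G.rkT D - 1 + 1 = G.rkT D := by omega
  have hcell : ∀ f, (8 ≤ f ∧ f < 24 ∨ 33 + c ≤ f ∧ f < stride c) →
      recAt c G.numVars D + f ∉ cells G c P T := by
    intro f hf hc
    rw [mem_cells D.2.le (by omega), own_side (by omega)] at hc
    exact hT hc
  have hcell' : ∀ f, (8 ≤ f ∧ f < 24 ∨ 33 + c ≤ f ∧ f < stride c) →
      recAt c G.numVars D + f ∈ cells G c P (T ∪ {D}) := by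
    intro f hf
    rw [mem_cells D.2.le (by omega), own_side (by omega)]
    simp
  have hsub := cells_mono (G := G) (c := c) (List.Subset.refl P) (Set.subset_union_left (s := T)
    (t := {D}))
  have hL1 := layout_cells hf (P := P) (T := T) (A := D) (f := 8) (g := 33 + c) (by omega)
    (by omega) (by omega) fun i hi hc =>
      hcell (33 + c + i) (by omega) ((mem_cells D.2.le (by omega)).mpr hc)
  have hL2 := layout_cells hf (P := P) (T := T) (A := D) (f := 16) (g := 33 + 2 * c) (by omega)
    (by omega) (by omega) fun i hi hc =>
      hcell (33 + 2 * c + i) (by omega) ((mem_cells D.2.le (by omega)).mpr hc)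
  have hlens : XL.length + (X 0).length + (X 1).length ≤ G.text.length ∧
      (X 3).length + (X 4).length + XR.length ≤ G.text.length := by
    rw [n4] at hlen
    simp only [List.length_append] at hlen
    omega
  simp only [sideNodes, wp, safe_add, safe_load, safe_reg, safe_num, safe_const, val_add, val_load,
    val_reg, val_num, val_const, State.set_reg, State.set_mem, Nat.reduceEqDiff, if_true, if_false,
    h14, true_and, and_assoc]
  repeat refine And.intro (by omega) ?_
  -- The final cells together with those of the left side node; the construction of the right side
  -- node has to leave all of them unchanged.
  set F1 : Set ℕ := cells G c P T ∪ {x | ∃ i < 8, x = recAt c G.numVars D + (8 + i)} ∪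
    {x | ∃ i < c, x = recAt c G.numVars D + (33 + c + i)} with hF1
  have hF1' : F1 ⊆ cells G c P (T ∪ {D}) := by
    rintro x ((hx | ⟨i, hi, rfl⟩) | ⟨i, hi, rfl⟩)
    · exact hsub hx
    · exact hcell' _ (by omega)
    · exact hcell' _ (by omega)
  -- Left side node: what was gathered so far, then the two left parts of `D`.
  refine wp_catNode hO (F := cells G c P T) (F' := F1) (r := G.rkT D - 1)
    (X := fun i => [XL, X 0, X 1, [], []].getD i []) ?_ ?_ ?_ ?_ ?_ ?_ ?_
  · simp only [State.set_reg, Nat.reduceEqDiff, if_true, if_false, hs.r44]; exact hL1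
  · intro i hi
    interval_cases i <;> simp only [State.set_reg, State.set_mem, Nat.reduceEqDiff, Nat.reduceAdd,
      if_true, if_false, hs.r44, List.getD_cons_zero, List.getD_cons_succ, h14, h15]
    · exact hXL.mono (by omega)
    · exact n5 0 (by omega) (by omega)
    · exact n5 1 (by omega) (by omega)
    · exact h.null _
    · exact h.null _
  · intro x hx; exact Or.inl (Or.inl hx)
  · intro i hi
    simp only [State.set_reg, Nat.reduceEqDiff, if_true, if_false]
    rw [add_assoc]
    exact ⟨hcell _ (by omega), Or.inl (Or.inr ⟨i, hi, rfl⟩)⟩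
  · intro i hi
    simp only [State.set_reg, Nat.reduceEqDiff, if_true, if_false]
    rw [add_assoc]
    exact Or.inr ⟨i, hi, rfl⟩
  · simp only [List.getD_cons_zero, List.getD_cons_succ, List.length_append, List.length_nil]
    omega
  simp only [State.set_reg, State.set_mem, Nat.reduceEqDiff, if_true, if_false, hs.r44,
    List.getD_cons_zero, List.getD_cons_succ, List.append_nil, hrk]
  intro t1 s1 ht1 hR1 _ hfr1 hr1
  have hkeep1 : ∀ x ∈ cells G c P T, s1.mem x = s.mem x := by
    intro x hx
    have := cells_lt hx
    refine hfr1 x (fun i hi he => ?_) (fun i hi he => ?_) (fun i hi => by omega)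
    · rw [add_assoc] at he; exact hcell _ (by omega) (he ▸ hx)
    · rw [add_assoc] at he; exact hcell _ (by omega) (he ▸ hx)
  have hD' : ∀ f < 8, recAt c G.numVars D + f ∈ cells G c P T := fun f hf => by
    rw [mem_cells D.2.le (by omega), own_node (by omega)]; exact ⟨hD, h0⟩
  have e14 := hr1 14 (by omega)
  have e13 := hr1 13 (by omega)
  have e15 := hr1 15 (by omega)
  have e24 := hr1 24 (by omega)
  have e23 := hr1 23 (by omega)
  have e30 := hr1 30 (by omega)
  have e44 := hr1 44 (by omega)
  simp only [Nat.reduceEqDiff, if_true, if_false, h14, h15, hs.r44] at e14 e13 e15 e24 e23 e30 e44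
  have m3 := hkeep1 _ (hD' 6 (by omega))
  have m4 := hkeep1 _ (hD' 7 (by omega))
  simp only [e14, e13, e15, e24, e23, e30, m3, m4]
  repeat refine And.intro (by omega) ?_
  -- Right side node: the two right parts of `D`, then what was gathered so far.
  refine wp_catNode hO (F := cells G c P T) (F' := cells G c P (T ∪ {D})) (r := G.rkT D - 1)
    (X := fun i => [X 3, X 4, XR, [], []].getD i []) ?_ ?_ hsub ?_ ?_ ?_ ?_
  · simp only [State.set_reg, Nat.reduceEqDiff, if_true, if_false, e44]; exact hL2
  · intro i hi
    have key : ∀ {a X r}, Rep val s.mem (cells G c P T) (recAt c G.numVars (G.numVars + 1)) a X r →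
      Rep val s1.mem (cells G c P T) (recAt c G.numVars (G.numVars + 1)) a X r := fun h =>
        h.congr hkeep1 subset_rfl le_rfl
    interval_cases i <;> simp only [State.set_reg, State.set_mem, Nat.reduceEqDiff, Nat.reduceAdd,
      if_true, if_false, e44, List.getD_cons_zero, List.getD_cons_succ, e24, e23] <;> apply key
    · exact n5 3 (by omega) (by omega)
    · exact n5 4 (by omega) (by omega)
    · exact hXR.mono (by omega)
    · exact h.null _
    · exact h.null _
  · intro i hi
    simp only [State.set_reg, Nat.reduceEqDiff, if_true, if_false]
    rw [add_assoc]
    exact ⟨hcell _ (by omega), hcell' _ (by omega)⟩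
  · intro i hi
    simp only [State.set_reg, Nat.reduceEqDiff, if_true, if_false]
    rw [add_assoc]
    exact hcell' _ (by omega)
  · simp only [List.getD_cons_zero, List.getD_cons_succ, List.length_append, List.length_nil]
    omega
  simp only [State.set_reg, State.set_mem, Nat.reduceEqDiff, if_true, if_false, e44,
    List.getD_cons_zero, List.getD_cons_succ, List.append_nil, hrk]
  intro t2 s2 ht2 hR2 _ hfr2 hr2
  have hkeep2 : ∀ x ∈ F1, s2.mem x = s1.mem x := by
    intro x hx
    have := cells_lt (hF1' hx)
    refine hfr2 x (fun i hi he => ?_) (fun i hi he => ?_) (fun i hi => by omega)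
    · rcases hx with (hx | ⟨j, hj, hx⟩) | ⟨j, hj, hx⟩
      · rw [add_assoc] at he; exact hcell _ (by omega) (he ▸ hx)
      · omega
      · omega
    · rcases hx with (hx | ⟨j, hj, hx⟩) | ⟨j, hj, hx⟩
      · rw [add_assoc] at he; exact hcell _ (by omega) (he ▸ hx)
      · omega
      · omega
  have hkeep : ∀ x ∈ cells G c P T, s2.mem x = s.mem x := fun x hx =>
    (hkeep2 x (Or.inl (Or.inl hx))).trans (hkeep1 x hx)
  have hfr : ∀ x < recAt c G.numVars (G.numVars + 1),
      (∀ f < stride c, (8 ≤ f ∧ f < 24 ∨ 33 + c ≤ f) → x ≠ recAt c G.numVars D + f) →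
      s2.mem x = s.mem x := by
    intro x hx hx'
    have q1 : ∀ i < 16, x ≠ recAt c G.numVars D + (8 + i) := fun i hi =>
      hx' _ (by omega) (by omega)
    have q2 : ∀ i < 2 * c, x ≠ recAt c G.numVars D + (33 + c + i) := fun i hi =>
      hx' _ (by omega) (by omega)
    rw [hfr2, hfr1]
    · intro i hi; rw [add_assoc]; exact q1 i (by omega)
    · intro i hi; rw [add_assoc]; exact q2 i (by omega)
    · intro i hi; omega
    · intro i hi
      have := q1 (8 + i) (by omega)
      omega
    · intro i hi
      have := q2 (c + i) (by omega)
      omega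
    · intro i hi; omega
  have hfield : ∀ (A : Fin G.numVars) (f : ℕ), f < 33 → (f < 8 ∨ 24 ≤ f) →
      s2.mem (recAt c G.numVars A + f) = s.mem (recAt c G.numVars A + f) := by
    intro A f hf hf'
    have := recAt_le (c := c) A.2.le
    exact hfr _ (by omega) fun g hg hg' => recAt_ne (by omega) hg (by omega)
  have g14 := hr2 14 (by omega)
  have g12 := hr2 12 (by omega)
  have g30 := hr2 30 (by omega)
  have g44 := hr2 44 (by omega)
  simp only [Nat.reduceEqDiff, if_true, if_false, e14, e44] at g14 g12 g30 g44
  have e5 := (hfield D 5 (by omega) (by omega)).trans n2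
  simp only [g14, g30, e5, cost_add, cost_load, cost_reg, cost_num, cost_const]
  repeat refine And.intro (by omega) ?_
  refine hQ _ _ N (XL ++ (X 0 ++ X 1)) (X 3 ++ (X 4 ++ XR)) ?_ ?_ n1 ?_ ?_ ?_ ?_ ?_ ?_ ?_
  · clear * - ht1 ht2 hpos
    omega
  · refine hs.frame (A := D) ?_ ?_ ?_ fun x hx hx' => ?_
    · simp [State.set_reg, hr2 2 (by omega), hr1 2 (by omega)]
    · simp [State.set_reg, hr2 3 (by omega), hr1 3 (by omega)]
    · simp [State.set_reg, g44, hs.r44]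
    · exact hfr x hx fun f hf _ => hx' f hf
  · rw [n4, n3]; simp
  · simp [State.set_reg]
  · refine h.congr hkeep hlo Set.subset_union_left fun A hA => ?_
    have := hfield A 0 (by omega) (by omega)
    rw [State.set_mem, State.set_mem, this]
    exact h.tables.len A (ho.mem A) hA
  · simp only [State.set_reg, State.set_mem, Nat.reduceEqDiff, if_true, if_false, g12]
    exact hR1.congr hkeep2 hF1' le_rfl
  · simp only [State.set_reg, State.set_mem, Nat.reduceEqDiff, if_true, if_false]
    exact hR2
  · intro x hx
    have a1 := hr2 x (by omega)
    have a2 := hr1 x (by omega)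
    simp only [State.set_reg] at a1 a2 ⊢
    rw [if_neg (by omega), if_neg (by omega), a1]
    rw [if_neg (by omega), if_neg (by omega), if_neg (by omega), if_neg (by omega),
      if_neg (by omega), if_neg (by omega), a2]
    simp only [show x ≠ 43 by omega, show x ≠ 30 by omega, show x ≠ 24 by omega,
      show x ≠ 23 by omega, show x ≠ 22 by omega, show x ≠ 21 by omega, show x ≠ 20 by omega,
      if_false]
  · intro A _
    exact hfield A 32 (by omega) (by omega)

end balance

/-! ### Climbing along a symmetric centroid path -/

section balance
variable {σ c w : ℕ} {O : Subroutines c} {G : RLSLP σ} {val : List (Fin σ) → Fin c → ℕ}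
  {P : List (Fin G.numVars)} {T : Set (Fin G.numVars)} {ord : List (Fin G.numVars)}

theorem _root_.RLSLP.rk_pos (A : Fin G.numVars) : 0 < G.rk A := by
  unfold RLSLP.rk; omega

theorem _root_.RLSLP.rkT_pos (A : Fin G.numVars) : 0 < G.rkT A := by
  unfold RLSLP.rkT; omega

/-- In reverse topological order `P` is closed under passing to the variables in a rule, so
everything further down the path has already been processed. -/
theorem _root_.RLSLP.Walk.mem {b : ℕ} {A B : Fin G.numVars} (h : G.Walk b A B)
    (hP : ∀ X ∈ P, ∀ Y, (G.rule X).Mentions Y → Y ∈ P)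
    (hA : ∀ Y, (G.rule A).Mentions Y → Y ∈ P) : B ∈ P := by
  induction h with
  | single h => exact hA _ (RLSLP.sc_mentions h)
  | snoc _ _ hC ih => exact hP _ ih _ (RLSLP.sc_mentions hC)

/-- The variables whose side nodes are complete when those for `A` have been made up to `D`. -/
def sidesUpTo (P : List (Fin G.numVars)) (A D : Fin G.numVars) : Set (Fin G.numVars) :=
  sidesOf P ∪ {d | G.Prev A d ∧ G.lam d < G.lam D}

theorem sidesUpTo_subset {A D : Fin G.numVars} : sidesUpTo P A D ⊆ sidesOf (A :: P) := by
  rintro d (⟨B, hB, h⟩ | ⟨h, -⟩)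
  · exact ⟨B, List.mem_cons_of_mem _ hB, h⟩
  · exact ⟨A, by simp, h⟩

/-- What is known when the side nodes for the variable `A` have been made up to `D`. -/
structure Climb (G : RLSLP σ) (val : List (Fin σ) → Fin c → ℕ) (ord P : List (Fin G.numVars))
    (A B D : Fin G.numVars) (s₀ s : State) : Prop where
  env : Env G c s
  bal : Balanced val G s.mem ord P (sidesUpTo P A D)
  mem : D ∈ P
  walk : G.Walk (G.lam D) A D
  walk' : G.Walk (G.lam A) A D
  r14 : s.reg 14 = recAt c G.numVars D
  reg : ∀ x, x < 12 ∨ x = 15 → s.reg x = s₀.reg x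
  level : s.mem (recAt c G.numVars A + 32) = 2 ^ G.lam A
  rep : ∃ XL XR r, r < G.rkT D ∧ r < G.rkT A ∧ r < G.rk A ∧
    G.expand B = XL ++ (G.expand D ++ XR) ∧
    Rep val s.mem (cells G c P (sidesUpTo P A D)) (recAt c G.numVars (G.numVars + 1)) (s.reg 12)
      XL r ∧
    Rep val s.mem (cells G c P (sidesUpTo P A D)) (recAt c G.numVars (G.numVars + 1)) (s.reg 13)
      XR r

/-- Starting from the path successor, the climb moves to the next variable of higher level until the
level of `A` is exceeded. While it runs, `walk` makes `A` the last variable of higher level before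
`D`; when it ends, `walk'` makes `D` the next variable of higher level after `A`. Levels increase in
every round, so there are at most `lam A` rounds. -/
theorem wp_climb (hf : Fits G c w) (hO : Composes w O val) (hlo : ord.length = G.numVars)
    (ho : G.TopOrder ord) {A B : Fin G.numVars} (hA : A ∉ P) (h0 : 0 < G.occ A)
    (hP : ∀ X ∈ P, ∀ Y, (G.rule X).Mentions Y → Y ∈ P) (hsc : G.sc A = some B) {s : State}
    (h5 : s.reg 5 = recAt c G.numVars A) (h15 : s.reg 15 = recAt c G.numVars G.numVars)
    (h : Climb G val ord P A B B s s) {Q : ℕ → State → Prop}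
    (hQ : ∀ t s' N, t ≤ 4200 * (O.timeH * (Nat.log 2 G.text.length + 1)) → G.Next A N →
      Climb G val ord P A B N s s' → Q t s') :
    wp w O (.loop (Expr.less (M (R 14 + 32)) (M (R 5 + 32))) (sideNodes c)) Q s := by
  have hpos := hO.pos
  have h1 := hf.rec_lt A.2.le
  have hst := lt_stride (c := c) (f := 32)
  have hcond : ∀ {D s'}, Climb G val ord P A B D s s' →
      Expr.Safe w s' (Expr.less (M (R 14 + 32)) (M (R 5 + 32))) ∧
      Expr.val s' (Expr.less (M (R 14 + 32)) (M (R 5 + 32))) =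
        if G.lam D < G.lam A then 1 else 0 := by
    intro D s' hD
    have h2 := hf.rec_lt D.2.le
    have e5 := (hD.reg 5 (by omega)).trans h5
    have eD := hD.bal.level D hD.mem hD.walk.occ_pos
    simp only [safe_less, safe_load, safe_add, safe_reg, safe_num, val_less, val_load, val_add,
      val_reg, val_num, hD.r14, e5, eD, hD.level, true_and,
      Nat.pow_lt_pow_iff_right (show 1 < 2 by norm_num)]
    exact ⟨by omega, trivial⟩
  refine wp_loop (fun n s' => ∃ D, G.lam A ≤ n + G.lam D ∧ Climb G val ord P A B D s s')
    (2000 * O.timeH) ?_ (N := G.lam A) ?_ ?_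
  · rintro n s' ⟨D, hn, hD⟩
    obtain ⟨c1, c2⟩ := hcond hD
    refine ⟨c1, fun hne => ?_⟩
    have hlt : G.lam D < G.lam A := by
      by_contra hc
      rw [c2, if_neg hc] at hne; exact hne rfl
    refine ⟨n - 1, by omega, ?_⟩
    obtain ⟨XL, XR, r, r1, r2, r3, hcat, hXL, hXR⟩ := hD.rep
    have hlw := hD.walk.lw_lu
    have hscD : G.sc D ≠ none := by
      intro hc
      have e1 := RLSLP.lam_none hc
      have e2 := RLSLP.lam_lt hsc
      omega
    obtain ⟨D', hD'⟩ := Option.ne_none_iff_exists'.mp hscD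
    have hDA : D ≠ A := fun he => hA (he ▸ hD.mem)
    have hoB := RLSLP.occ_pos_of_mentions (RLSLP.sc_mentions hsc) h0
    have hlenB := RLSLP.len_le_text hoB
    have hprev : G.Prev A D := ⟨hD.walk, hlt⟩
    refine wp_sideNodes hf hO hD.env hD.bal hlo ho hD.mem hD.walk.occ_pos hscD ?_ hD.r14
      ((hD.reg 15 (by omega)).trans h15) r1 hXL hXR ?_ ?_
    -- The side nodes of `D` are still free: by `Prev.unique` only `A` makes them, and `A` is not in
    -- `P`; those made in this climb belong to variables of lower level than `D`.
    · rintro (⟨A', hA', h'⟩ | ⟨-, h'⟩)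
      · exact hA (h'.unique hprev ▸ hA')
      · omega
    · rw [← hcat]; exact hlenB
    intro t s1 N YL YR ht hs1 hN hcat1 h14 hbal hYL hYR hreg hlev
    have hsub : sidesUpTo P A D ∪ {D} ⊆ sidesUpTo P A N := by
      rintro d ((hd | ⟨hd, hd'⟩) | hd)
      · exact Or.inl hd
      · exact Or.inr ⟨hd, lt_trans hd' hN.2⟩
      · rw [Set.mem_singleton_iff] at hd
        subst hd
        exact Or.inr ⟨hprev, hN.2⟩
    have hsubc := cells_mono (G := G) (c := c) (List.Subset.refl P) hsub
    have hNP : N ∈ P := hN.1.mem hP fun Y hY => hP D hD.mem Y hY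
    have hlw' := hN.1.lw_lu
    refine ⟨ht, N, by have := hN.2; omega, ⟨hs1, ?_, hNP, ?_, ?_, h14, ?_, ?_, ?_⟩⟩
    · exact hbal.congr (fun _ _ => rfl) hlo hsub fun A hA => hbal.tables.len A (ho.mem A) hA
    · exact (hD.walk.mono hN.2.le).trans hN.2 (hN.1.mono hN.2.le)
    · exact hD.walk'.trans hlt (hN.1.mono hlt.le)
    · intro x hx
      rw [hreg x hx, hD.reg x hx]
    · rw [hlev A hDA.symm, hD.level]
    · refine ⟨YL, YR, G.rkT D, ?_, ?_, ?_, hcat.trans hcat1,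
        hYL.congr (fun _ _ => rfl) hsubc le_rfl, hYR.congr (fun _ _ => rfl) hsubc le_rfl⟩
      · exact RLSLP.rkT_lt hD' hlw'.1.symm hlw'.2.symm hN.2
      · exact RLSLP.rkT_lt hD' hlw.1 hlw.2 hlt
      · exact RLSLP.rkT_lt_rk hsc hlw.1 hlw.2 hlt
  · exact ⟨B, by omega, h⟩
  rintro t s' n ht ⟨D, hn, hD⟩ hex
  rw [(hcond hD).2] at hex
  have hge : ¬ G.lam D < G.lam A := by
    intro hc
    rw [if_pos hc] at hex; omega
  -- The loop ends with a level at least that of `A`; equality is impossible for variables joined by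
  -- a walk of lower levels.
  have hne := hD.walk'.lam_ne
  refine hQ t s' D ?_ ⟨hD.walk', by omega⟩ hD
  have h6 := RLSLP.lam_lt hsc
  have h7 := RLSLP.lw_add_lu_le h0
  simp only [cost_bin, cost_load, cost_add, cost_reg, cost_num] at ht
  have h8 : (G.lam A + 1) * (2000 * O.timeH + (1 + 1 + 1 + 1 + (1 + 1 + 1 + 1) + 1) + 1) ≤
      (2 * (Nat.log 2 G.text.length + 1)) * (2010 * O.timeH) :=
    Nat.mul_le_mul (by omega) (by omega)
  have h9 : (2 * (Nat.log 2 G.text.length + 1)) * (2010 * O.timeH) =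
      4020 * (O.timeH * (Nat.log 2 G.text.length + 1)) := by ring
  omega

theorem wp_pairTop (hf : Fits G c w) (hO : Composes w O val) {s : State} (hs : Env G c s)
    (h : Balanced val G s.mem ord P T) (hlo : ord.length = G.numVars) (ho : G.TopOrder ord)
    {A : Fin G.numVars} (hT : T ⊆ sidesOf (A :: P)) (hA : A ∉ P) (h0 : 0 < G.occ A)
    (h5 : s.reg 5 = recAt c G.numVars A)
    (hlevel : s.mem (recAt c G.numVars A + 32) = 2 ^ G.lam A)
    {X : ℕ → List (Fin σ)} (hcat : G.expand A = X 0 ++ (X 1 ++ (X 2 ++ (X 3 ++ X 4))))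
    (hX : ∀ i < 5, Rep val s.mem (cells G c P T) (recAt c G.numVars (G.numVars + 1))
      (s.reg ([10, 12, 14, 13, 11].getD i 0)) (X i) (G.rk A - 1))
    (hsc : G.sc A ≠ none → ∃ N, G.Next A N ∧ s.reg 14 = recAt c G.numVars N ∧
      X 2 = G.expand N ∧ ∀ i < 5, i ≠ 2 → Rep val s.mem (cells G c P T)
        (recAt c G.numVars (G.numVars + 1)) (s.reg ([10, 12, 14, 13, 11].getD i 0)) (X i)
        (G.rkT A - 1))
    {Q : ℕ → State → Prop}
    (hQ : ∀ t s', t ≤ 950 * O.timeH → Env G c s' → s'.reg 8 = s.reg 8 →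
      Balanced val G s'.mem ord (A :: P) (sidesOf (A :: P)) → Q t s') :
    wp w O pairTop Q s := by
  have hpos := hO.pos
  have h1 := hf.rec_lt A.2.le
  have hst := lt_stride (c := c) (f := 32)
  have hreg : ∀ s' : State, s'.reg 20 = s.reg 10 → s'.reg 21 = s.reg 12 → s'.reg 22 = s.reg 14 →
      s'.reg 23 = s.reg 13 → s'.reg 24 = s.reg 11 → ∀ i < 5,
      s'.reg (20 + i) = s.reg ([10, 12, 14, 13, 11].getD i 0) := by
    intro s' a0 a1 a2 a3 a4 i hi
    interval_cases i <;> assumption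
  simp only [pairTop, wp, safe_add, safe_reg, safe_num, val_add, val_reg, val_num, State.set_reg,
    State.set_mem, Nat.reduceEqDiff, if_true, if_false, h5, cost_add, cost_reg, cost_num,
    true_and, and_assoc]
  repeat refine And.intro (by omega) ?_
  set s1 := ((((((s.set 20 (s.reg 10)).set 21 (s.reg 12)).set 22 (s.reg 14)).set 23
    (s.reg 13)).set 24 (s.reg 11)).set 30 (recAt c G.numVars A)).set 43
      (recAt c G.numVars A + 33) with hs1
  have hr := hreg s1 (by simp [hs1]) (by simp [hs1]) (by simp [hs1]) (by simp [hs1])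
    (by simp [hs1])
  have hm : s1.mem = s.mem := rfl
  refine wp_mainNode (s := s1) hf hO (A := A) (T := T) (P := P) (ord := ord) (X := X)
    (hs.congr (by simp [hs1]) (by simp [hs1]) (by simp [hs1]) fun _ _ => rfl) h hlo ho hA h0 hlevel
    (by simp [hs1]) (by simp [hs1]) hcat (fun i hi => ?_) (fun hne => ?_) ?_
  · rw [hr i hi]; exact hX i hi
  · obtain ⟨N, n1, n2, n3, n4⟩ := hsc hne
    refine ⟨N, n1, by simp [hs1, n2], n3, fun i hi hi2 => ?_⟩
    rw [hr i hi]; exact n4 i hi hi2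
  · intro t s' ht hs' h8 hb
    refine hQ _ _ (by omega) hs' (by simpa [hs1] using h8) (hb.congr (fun _ _ => rfl) hlo hT
      fun A hA => hb.tables.len A (ho.mem A) hA)

/-- The node of `A` when the side nodes have been made. -/
theorem wp_climbTop (hf : Fits G c w) (hO : Composes w O val) {s₀ s : State}
    (hlo : ord.length = G.numVars) (ho : G.TopOrder ord) {A E N : Fin G.numVars} (hA : A ∉ P)
    (h0 : 0 < G.occ A) (h5 : s₀.reg 5 = recAt c G.numVars A)
    (hN : G.Next A N) (hC : Climb G val ord P A E N s₀ s) {L Z : List (Fin σ)}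
    (hcat : G.expand A = L ++ (G.expand E ++ Z)) {r : ℕ} (hr : r < G.rk A) (hr' : r < G.rkT A)
    (hL : Rep val s.mem (cells G c P (sidesUpTo P A N)) (recAt c G.numVars (G.numVars + 1))
      (s₀.reg 10) L r)
    (hZ : Rep val s.mem (cells G c P (sidesUpTo P A N)) (recAt c G.numVars (G.numVars + 1))
      (s₀.reg 11) Z r) {Q : ℕ → State → Prop}
    (hQ : ∀ t s', t ≤ 950 * O.timeH → Env G c s' → s'.reg 8 = s₀.reg 8 →
      Balanced val G s'.mem ord (A :: P) (sidesOf (A :: P)) → Q t s') :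
    wp w O pairTop Q s := by
  obtain ⟨XL, XR, q, -, q2, q3, hcat', hXL, hXR⟩ := hC.rep
  have g5 := (hC.reg 5 (by omega)).trans h5
  have g10 := hC.reg 10 (by omega)
  have g11 := hC.reg 11 (by omega)
  have g8 := hC.reg 8 (by omega)
  rw [← g10] at hL
  rw [← g11] at hZ
  have hnN := hC.bal.node N hC.mem hN.1.occ_pos
  rw [← hC.r14] at hnN
  have hrN := RLSLP.rk_lt_of_next hN
  refine wp_pairTop hf hO hC.env hC.bal hlo ho sidesUpTo_subset hA h0 g5 hC.level
    (X := fun i => [L, XL, G.expand N, XR, Z].getD i []) ?_ ?_ ?_ ?_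
  · simp [hcat, hcat']
  · intro i hi
    interval_cases i
    · exact hL.mono (by omega)
    · exact hXL.mono (by omega)
    · exact hnN.mono (by omega)
    · exact hXR.mono (by omega)
    · exact hZ.mono (by omega)
  · intro _
    refine ⟨N, hN, hC.r14, rfl, fun i hi hi2 => ?_⟩
    interval_cases i
    · exact hL.mono (by omega)
    · exact hXL.mono (by omega)
    · exact absurd rfl hi2
    · exact hXR.mono (by omega)
    · exact hZ.mono (by omega)
  · intro t s' ht hs' h8 hb
    exact hQ t s' ht hs' (h8.trans g8) hb

theorem wp_pairNode (hf : Fits G c w) (hO : Composes w O val) {s : State} (hs : Env G c s)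
    (h : Balanced val G s.mem ord P (sidesOf P)) (hlo : ord.length = G.numVars)
    (ho : G.TopOrder ord) {A : Fin G.numVars} (hA : A ∉ P) (h0 : 0 < G.occ A)
    (hP : ∀ X ∈ P, ∀ Y, (G.rule X).Mentions Y → Y ∈ P)
    (hPA : ∀ Y, (G.rule A).Mentions Y → Y ∈ P) (h5 : s.reg 5 = recAt c G.numVars A)
    (h6 : s.reg 6 = 2 + 3 * A) (hlevel : s.mem (recAt c G.numVars A + 32) = 2 ^ G.lam A)
    {B D : Fin G.numVars} (hr : G.rule A = .pair B D) {Q : ℕ → State → Prop}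
    (hQ : ∀ t s', t ≤ 6000 * (O.timeH * (Nat.log 2 G.text.length + 1)) → Env G c s' →
      s'.reg 8 = s.reg 8 → Balanced val G s'.mem ord (A :: P) (sidesOf (A :: P)) → Q t s') :
    wp w O (pairNode c) Q s := by
  have hpos := hO.pos
  have h1 := hf.rec_lt A.2.le
  have h2 := le_recAt (c := c) (V := G.numVars) A
  have h1B := hf.rec_lt B.2.le
  have h2B := le_recAt (c := c) (V := G.numVars) B
  have h1D := hf.rec_lt D.2.le
  have h2D := le_recAt (c := c) (V := G.numVars) D
  have h1V := hf.rec_lt (le_refl G.numVars)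
  have h2V := le_recAt (c := c) (V := G.numVars) G.numVars
  have hVA := A.2
  have hst := lt_stride (c := c) (f := 32)
  have c1 := hs.cell A (j := 1) (by omega)
  have c2 := hs.cell A (j := 2) (by omega)
  rw [hr] at c1 c2
  simp only [RLRule.encode, List.getD_cons_succ, List.getD_cons_zero] at c1 c2
  have hBm : (G.rule A).Mentions B := by simp [hr, RLRule.Mentions]
  have hDm : (G.rule A).Mentions D := by simp [hr, RLRule.Mentions]
  have hoB := RLSLP.occ_pos_of_mentions hBm h0
  have hoD := RLSLP.occ_pos_of_mentions hDm h0
  have hnB := h.node B (hPA B hBm) hoB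
  have hnD := h.node D (hPA D hDm) hoD
  have hexp := RLSLP.expand_pair hr
  have hscm := h.tables.sc A
  rw [if_pos (ho.mem A)] at hscm
  have hL1 : 1 ≤ O.timeH * (Nat.log 2 G.text.length + 1) := Nat.mul_pos hpos (by omega)
  have hL2 : O.timeH ≤ O.timeH * (Nat.log 2 G.text.length + 1) :=
    Nat.le_mul_of_pos_right _ (by omega)
  simp only [pairNode, wp, safe_add, safe_load, safe_reg, safe_num, val_add, val_load,
    val_reg, val_num, State.set_reg, State.set_mem, val_recE, safe_recE, cost_recE, h5, h6, hs.r2,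
    hs.r3, c1, c2, fold_recAt, hscm, cost_add, cost_load, cost_reg, cost_num, true_and, and_assoc,
    Nat.reduceEqDiff, if_true, if_false]
  repeat refine And.intro (by omega) ?_
  refine ⟨fun hne => ?_, fun he => ?_⟩
  swap
  · have hnone : G.sc A = none := by
      cases h' : G.sc A with
      | none => rfl
      | some B =>
        have := le_recAt (c := c) (V := G.numVars) B
        simp only [h', Option.elim_some] at he; omega
    refine wp_pairTop hf hO (A := A) (T := sidesOf P) (P := P) (ord := ord)
      (X := fun i => [G.expand B, [], [], [], G.expand D].getD i []) ?_ ?_ hlo ho ?_ hA h0 ?_ ?_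
      ?_ ?_ ?_ ?_
    · exact hs.congr (by simp [State.set_reg]) (by simp [State.set_reg]) (by simp [State.set_reg])
        fun _ _ => rfl
    · exact h
    · exact fun d ⟨X, hX, h⟩ => ⟨X, List.mem_cons_of_mem _ hX, h⟩
    · simp [State.set_reg, h5]
    · exact hlevel
    · simp [hexp]
    · intro i hi
      interval_cases i <;> simp only [State.set_reg, State.set_mem, Nat.reduceEqDiff,
        Nat.reduceAdd, if_true, if_false, List.getD_cons_zero, List.getD_cons_succ]
      · exact hnB.mono (Nat.le_sub_one_of_lt (RLSLP.rk_lt_of_last hnone h0 (Or.inl hr)))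
      · exact h.null _
      · exact h.null _
      · exact h.null _
      · exact hnD.mono (Nat.le_sub_one_of_lt (RLSLP.rk_lt_of_last hnone h0 (Or.inr hr)))
    · exact fun h => absurd hnone h
    · intro t s' ht hs' h8 hb
      exact hQ _ _ (by omega) hs' (by simpa [State.set_reg] using h8) hb
  obtain ⟨E, hE⟩ : ∃ E, G.sc A = some E := by
    cases h' : G.sc A with
    | none => simp [h'] at hne
    | some B => exact ⟨B, rfl⟩
  have hEP : E ∈ P := hPA E (RLSLP.sc_mentions hE)
  have h1E := hf.rec_lt E.2.le
  simp only [hE, Option.elim_some, safe_equal, safe_reg, val_equal, val_reg, State.set_reg,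
    Nat.reduceEqDiff, if_true, if_false, true_and, and_assoc, cost_bin, cost_reg]
  repeat refine And.intro (by omega) ?_
  have hinit : ∀ s1 : State, s1.mem = s.mem → (∀ x, x < 10 → s1.reg x = s.reg x) →
      s1.reg 44 = s.reg 44 →
      s1.reg 12 = recAt c G.numVars G.numVars → s1.reg 13 = recAt c G.numVars G.numVars →
      s1.reg 14 = recAt c G.numVars E → Climb G val ord P A E E s1 s1 := by
    intro s1 hm1 hr1 r44 r12 r13 r14
    have hb : Balanced val G s1.mem ord P (sidesUpTo P A E) := by
      rw [hm1]
      exact h.congr (fun _ _ => rfl) hlo Set.subset_union_left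
        fun A hA => h.tables.len A (ho.mem A) hA
    refine ⟨hs.congr (hr1 2 (by omega)) (hr1 3 (by omega)) r44 fun _ _ => by rw [hm1], hb, hEP,
      .single hE, .single hE, r14, fun _ _ => rfl, by rw [hm1, hlevel], [], [], 0,
      RLSLP.rkT_pos _, RLSLP.rkT_pos _, RLSLP.rk_pos _, by simp, ?_, ?_⟩
    · rw [r12]; exact hb.null 0
    · rw [r13]; exact hb.null 0
  -- The successor may be the left or the right child. In both cases one of `L` and `Z` is the
  -- sibling and the other is empty, and the climb is the same.
  have hfin : ∀ (s1 : State) (L Z : List (Fin σ)) (r : ℕ) (Q' : ℕ → ℕ → State → Prop),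
      s1.mem = s.mem → (∀ x, x < 10 → s1.reg x = s.reg x) → s1.reg 44 = s.reg 44 →
      s1.reg 12 = recAt c G.numVars G.numVars → s1.reg 13 = recAt c G.numVars G.numVars →
      s1.reg 14 = recAt c G.numVars E → s1.reg 15 = recAt c G.numVars G.numVars →
      G.expand A = L ++ (G.expand E ++ Z) → r < G.rk A → r < G.rkT A →
      (∀ m N, Balanced val G m ord P (sidesUpTo P A N) →
        Rep val m (cells G c P (sidesUpTo P A N)) (recAt c G.numVars (G.numVars + 1))
          (s1.reg 10) L r ∧
        Rep val m (cells G c P (sidesUpTo P A N)) (recAt c G.numVars (G.numVars + 1))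
          (s1.reg 11) Z r) →
      (∀ t t' s', t ≤ 4200 * (O.timeH * (Nat.log 2 G.text.length + 1)) → t' ≤ 950 * O.timeH →
        Env G c s' → s'.reg 8 = s.reg 8 →
        Balanced val G s'.mem ord (A :: P) (sidesOf (A :: P)) → Q' t t' s') →
      wp w O (.loop (Expr.less (M (R 14 + 32)) (M (R 5 + 32))) (sideNodes c))
        (fun t s' => wp w O pairTop (fun t' s'' => Q' t t' s'') s') s1 := by
    intro s1 L Z r Q' hm1 hr1 r44 r12 r13 r14 r15 hLZ b1 b2 hbd hQ'
    refine wp_climb hf hO hlo ho hA h0 hP hE ((hr1 5 (by omega)).trans h5) r15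
      (hinit s1 hm1 hr1 r44 r12 r13 r14) ?_
    intro t s2 N ht hN hC
    obtain ⟨hL, hZ⟩ := hbd _ _ hC.bal
    refine wp_climbTop hf hO hlo ho hA h0 ((hr1 5 (by omega)).trans h5) hN hC hLZ b1 b2 hL hZ ?_
    intro t' s' ht' hs' h8 hb
    exact hQ' t t' s' ht ht' hs' (h8.trans (hr1 8 (by omega))) hb
  have hsub : ∀ N, cells G c P (sidesOf P) ⊆ cells G c P (sidesUpTo P A N) := fun N =>
    cells_mono (List.Subset.refl P) Set.subset_union_left
  have hEB : recAt c G.numVars B = recAt c G.numVars E ↔ B = E := by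
    constructor
    · intro he
      have := recAt_add_inj (f := 0) (f' := 0) (lt_stride (by omega)) (lt_stride (by omega)) he
      exact Fin.ext this.1
    · rintro rfl; rfl
  obtain ⟨-, -, -, K, hK, hrK⟩ := RLSLP.sc_spec hE
  have hrkK := RLSLP.rk_sibling hE hrK hK
  rw [hr] at hrK
  simp only [RLRule.pair.injEq] at hrK
  refine ⟨fun hne => ?_, fun heq => ?_⟩
  · have hBE : B = E := by
      by_contra hc
      rw [if_neg (fun h => hc (hEB.mp h))] at hne; exact hne rfl
    obtain ⟨rfl, rfl⟩ : B = E ∧ D = K := by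
      rcases hrK with h' | ⟨rfl, rfl⟩
      · exact h'
      · have := (RLSLP.sc_spec hE).2.1
        rw [hBE] at hK; omega
    refine hfin _ [] (G.expand D) (G.rk D) _ ?_ ?_ ?_ ?_ ?_ ?_ ?_ ?_ hrkK.2 hrkK.1 ?_ ?_
    · rfl
    · intro x hx; simp only [State.set_reg]; grind
    · simp [State.set_reg]
    · simp [State.set_reg]
    · simp [State.set_reg]
    · simp [State.set_reg]
    · simp [State.set_reg]
    · simp [hexp]
    · intro m N hb
      simp only [State.set_reg, Nat.reduceEqDiff, if_true, if_false]
      exact ⟨hb.null _, hb.node D (hPA D hDm) hoD⟩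
    · intro t t' s' ht ht' hs' h8 hb
      exact hQ _ _ (by omega) hs' h8 hb
  · have hBE : B ≠ E := by
      intro hc
      rw [if_pos (hEB.mpr hc)] at heq; omega
    obtain ⟨rfl, rfl⟩ : B = K ∧ D = E := by
      rcases hrK with ⟨h', -⟩ | h'
      · exact absurd h' hBE
      · exact h'
    refine hfin _ (G.expand B) [] (G.rk B) _ ?_ ?_ ?_ ?_ ?_ ?_ ?_ ?_ hrkK.2 hrkK.1 ?_ ?_
    · rfl
    · intro x hx; simp only [State.set_reg]; grind
    · simp [State.set_reg]
    · simp [State.set_reg]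
    · simp [State.set_reg]
    · simp [State.set_reg]
    · simp [State.set_reg]
    · simp [hexp]
    · intro m N hb
      simp only [State.set_reg, Nat.reduceEqDiff, if_true, if_false]
      exact ⟨hb.node B (hPA B hBm) hoB, hb.null _⟩
    · intro t t' s' ht ht' hs' h8 hb
      exact hQ _ _ (by omega) hs' h8 hb

theorem wp_balanceOne (hf : Fits G c w) (hO : Composes w O val) {s : State} (hs : Env G c s)
    (hlo : ord.length = G.numVars) (ho : G.TopOrder ord) {k : ℕ} (h8 : s.reg 8 = k + 1)
    (hk : k < ord.length)
    (h : Balanced val G s.mem ord (ord.drop (k + 1)) (sidesOf (ord.drop (k + 1))))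
    {Q : ℕ → State → Prop}
    (hQ : ∀ t s', t ≤ O.timeF + 7000 * (O.timeH * (Nat.log 2 G.text.length + 1)) → Env G c s' →
      s'.reg 8 = k → Balanced val G s'.mem ord (ord.drop k) (sidesOf (ord.drop k)) → Q t s') :
    wp w O (balanceOne c) Q s := by
  have hpos := hO.pos
  rw [List.drop_eq_getElem_cons hk] at hQ
  simp only [balanceOne, wp]
  refine wp_fetch hf hs h8 hk (by omega) (h.tables.ord k hk) ?_
  intro t0 s0 ht0 m0 e8 e5 e6 er
  have hAP : ord[k] ∉ ord.drop (k + 1) := ho.not_mem_drop hk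
  have hPA : ∀ Y, (G.rule ord[k]).Mentions Y → Y ∈ ord.drop (k + 1) := fun Y => ho.mem_drop hk
  have hP : ∀ X ∈ ord.drop (k + 1), ∀ Y, (G.rule X).Mentions Y → Y ∈ ord.drop (k + 1) := by
    intro X hX Y hY
    obtain ⟨j, hj, rfl⟩ := List.mem_drop_iff_getElem.mp hX
    have := ho.mem_drop (i := k + 1 + j) (by omega) hY
    rw [show k + 1 + j + 1 = k + 1 + (j + 1) by omega, ← List.drop_drop] at this
    exact List.mem_of_mem_drop this
  generalize ord[k] = A at *
  generalize ord.drop (k + 1) = P at *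
  have hs0 : Env G c s0 := hs.congr (er 2 (by simp) (by simp) (by simp) (by simp))
    (er 3 (by simp) (by simp) (by simp) (by simp)) (er 44 (by simp) (by simp) (by simp) (by simp))
    (fun _ _ => by rw [m0])
  have h1 := hf.rec_lt A.2.le
  have h2 := le_recAt (c := c) (V := G.numVars) A
  have hst := lt_stride (c := c) (f := 32)
  have hL1 : 1 ≤ O.timeH * (Nat.log 2 G.text.length + 1) := Nat.mul_pos hpos (by omega)
  have hL2 : Nat.log 2 G.text.length + 1 ≤ O.timeH * (Nat.log 2 G.text.length + 1) :=
    Nat.le_mul_of_pos_left _ hpos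
  have hVA := A.2
  rw [← m0] at h
  simp only [safe_load, safe_add, safe_reg, safe_num, val_load, val_add, val_reg, val_num, e5,
    h.tables.occ, true_and, cost_load, cost_add, cost_reg, cost_num]
  refine ⟨by omega, fun hne => ?_, fun h0 => ?_⟩
  swap
  · exact hQ _ _ (by omega) hs0 e8 (h.skip h0)
  have h0 : 0 < G.occ A := Nat.pos_of_ne_zero hne
  refine wp_setLevel hf h.tables ho h0 e5 ?_
  intro t1 s1 ht1 m1 r1
  have g5 := (r1 5 (by simp) (by simp) (by simp)).trans e5
  have g6 := (r1 6 (by simp) (by simp) (by simp)).trans e6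
  have g8 := (r1 8 (by simp) (by simp) (by simp)).trans e8
  have hs1 : Env G c s1 := hs0.congr (r1 2 (by simp) (by simp) (by simp))
    (r1 3 (by simp) (by simp) (by simp)) (r1 44 (by simp) (by simp) (by simp))
    fun x hx => by rw [m1, update_input hx]
  have h' : Balanced val G s1.mem ord P (sidesOf P) := by
    refine h.congr (fun x hx => ?_) hlo subset_rfl fun B hB => ?_
    · rw [m1]
      refine Function.update_of_ne ?_ _ _
      rintro rfl
      rw [mem_cells A.2.le (by omega), own_node (by omega)] at hx
      exact hAP hx.1
    · rw [m1, update_recAt (by omega) (by omega), if_neg (by omega)]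
      exact h.tables.len B (ho.mem B) hB
  have hlev : s1.mem (recAt c G.numVars A + 32) = 2 ^ G.lam A := by
    rw [m1, Function.update_self]
  have hT : sidesOf P ⊆ sidesOf (A :: P) := fun d ⟨X, hX, h⟩ => ⟨X, List.mem_cons_of_mem _ hX, h⟩
  have c0 := hs1.cell0 A
  simp only [g6, c0, safe_equal, safe_load, safe_reg, safe_num, val_equal, val_load, val_reg,
    val_num, cost_load, cost_reg, cost_num, cost_bin, true_and]
  cases hr : G.rule A with
  | term a =>
    simp only [RLRule.encode, List.getD_cons_zero, ne_eq, not_true, false_imp_iff,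
      true_imp_iff, true_and]
    refine wp_termNode hf hO hs1 h' hlo ho hAP h0 g5 g6 hlev hr ?_
    intro t s' ht hs' h8' hb
    exact hQ _ _ (by omega) hs' (h8'.trans g8)
      (hb.congr (fun _ _ => rfl) hlo hT fun A hA => hb.tables.len A (ho.mem A) hA)
  | run B t₀ =>
    simp only [RLRule.encode, List.getD_cons_zero, ne_eq, OfNat.ofNat_ne_zero,
      OfNat.ofNat_ne_one, not_false_eq_true, not_true, false_imp_iff, true_imp_iff, true_and,
      and_true, if_false]
    repeat refine And.intro (by omega) ?_
    refine wp_runNode hf hO hs1 h' hlo ho hAP h0 g5 g6 hlev hr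
      (hPA B (by simp [hr, RLRule.Mentions])) ?_
    intro t s' ht hs' h8' hb
    exact hQ _ _ (by omega) hs' (h8'.trans g8)
      (hb.congr (fun _ _ => rfl) hlo hT fun A hA => hb.tables.len A (ho.mem A) hA)
  | pair B D =>
    simp only [RLRule.encode, List.getD_cons_zero, ne_eq, one_ne_zero,
      not_false_eq_true, not_true, false_imp_iff, true_imp_iff, true_and, and_true, if_true]
    repeat refine And.intro (by omega) ?_
    refine wp_pairNode hf hO hs1 h' hlo ho hAP h0 hP hPA g5 g6 hlev hr ?_
    intro t s' ht hs' h8' hb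
    exact hQ _ _ (by omega) hs' (h8'.trans g8) hb

theorem wp_balance (hf : Fits G c w) (hO : Composes w O val) {s : State} (hs : Env G c s)
    (hlo : ord.length = G.numVars) (ho : G.TopOrder ord) (h : Measured G c s.mem ord ord)
    {Q : ℕ → State → Prop}
    (hQ : ∀ t s', t ≤ 8000 * ((G.numVars + 1) *
        (O.timeF + O.timeH * (Nat.log 2 G.text.length + 1))) → Env G c s' →
      Balanced val G s'.mem ord ord (sidesOf ord) → Q t s') :
    wp w O (balance c) Q s := by
  have hpos := hO.pos
  have hL1 : 1 ≤ O.timeH * (Nat.log 2 G.text.length + 1) := Nat.mul_pos hpos (by omega)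
  simp only [balance, wp, safe_reg, val_reg, cost_reg, true_and]
  refine wp_loop (fun n s' => n ≤ ord.length ∧ Env G c s' ∧ s'.reg 8 = n ∧
    Balanced val G s'.mem ord (ord.drop n) (sidesOf (ord.drop n)))
    (O.timeF + 7000 * (O.timeH * (Nat.log 2 G.text.length + 1))) ?_ (N := G.numVars) ?_ ?_
  · rintro n s' ⟨hn, he, h8, hm⟩
    refine ⟨trivial, fun hne => ?_⟩
    rw [val_reg, h8] at hne
    obtain ⟨k, rfl⟩ : ∃ k, n = k + 1 := ⟨n - 1, by omega⟩
    refine ⟨k, rfl, wp_balanceOne hf hO he hlo ho h8 (by omega) hm ?_⟩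
    intro t s1 ht he1 h81 hm1
    exact ⟨ht, by omega, he1, h81, hm1⟩
  · refine ⟨hlo.ge, hs.set (by decide), by simp [State.set_reg, hs.r3], ?_⟩
    rw [List.drop_eq_nil_of_le hlo.le]
    have hb : Balanced val G s.mem ord [] ∅ := h.balanced
    exact hb.congr (fun _ _ => rfl) hlo (Set.empty_subset _) fun A hA => h.len A (ho.mem A) hA
  rintro t s' n ht ⟨hn, he, h8, hm⟩ hex
  rw [val_reg, h8] at hex
  subst hex
  refine hQ _ _ ?_ he (by simpa using hm)
  rw [cost_reg] at ht
  have h1 : 1 ≤ (G.numVars + 1) * (O.timeF + O.timeH * (Nat.log 2 G.text.length + 1)) :=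
    Nat.mul_pos (by omega) (by omega)
  have h2 : (G.numVars + 1) * (O.timeF + 7000 * (O.timeH * (Nat.log 2 G.text.length + 1)) + 1 + 1) ≤
      (G.numVars + 1) * (7002 * (O.timeF + O.timeH * (Nat.log 2 G.text.length + 1))) :=
    Nat.mul_le_mul_left _ (by omega)
  have h3 : (G.numVars + 1) * (7002 * (O.timeF + O.timeH * (Nat.log 2 G.text.length + 1))) =
    7002 * ((G.numVars + 1) * (O.timeF + O.timeH * (Nat.log 2 G.text.length + 1))) := by ring
  omega

/-- The program that builds the data structure. -/
def build (c : ℕ) : Prog :=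
  .set 3 (M 0) ;; .set 2 (2 + 3 * R 3) ;; .set 44 (recE c (R 3 + 1)) ;; search c ;; measure c ;;
  balance c

theorem wp_build (hf : Fits G c w) (hO : Composes w O val) {Q : ℕ → State → Prop}
    (hQ : ∀ t s' ord, t ≤ 20000 * ((G.numVars + 1) *
        (O.timeF + O.timeH * (Nat.log 2 G.text.length + 1))) → Env G c s' →
      Balanced val G s'.mem ord ord (sidesOf ord) → G.TopOrder ord → Q t s') :
    wp w O (build c) Q (State.ofInput G.encode) := by
  have hpos := hO.pos
  have h1 := hf.rec_lt (le_refl G.numVars)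
  have h2 := le_recAt (c := c) (V := G.numVars) G.numVars
  have h3 := hf.size_le
  have h4 := fold_recAt (c := c) (V := G.numVars) (G.numVars + 1)
  have hst := lt_stride (c := c) (f := 32)
  have hL1 : 1 ≤ O.timeH * (Nat.log 2 G.text.length + 1) := Nat.mul_pos hpos (by omega)
  have hL2 : Nat.log 2 G.text.length + 1 ≤ O.timeH * (Nat.log 2 G.text.length + 1) :=
    Nat.le_mul_of_pos_left _ hpos
  have e0 : (State.ofInput G.encode).mem 0 = G.numVars := rfl
  have hz : ∀ x, 2 + 3 * G.numVars ≤ x → (State.ofInput G.encode).mem x = 0 := fun x hx => by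
    change G.encode.getD x 0 = 0
    rw [List.getD_eq_default]
    rw [RLSLP.length_encode]; exact hx
  simp only [build, wp, safe_add, safe_mul, safe_load, safe_reg, safe_num, val_add, val_mul,
    val_load, val_reg, val_num, State.set_reg, State.set_mem, val_recE, safe_recE, cost_recE, e0, h4,
    cost_add, cost_mul, cost_load, cost_reg, cost_num, true_and, and_assoc, Nat.reduceEqDiff,
    if_true, if_false]
  have h5 := le_recAt (c := c) (V := G.numVars) (G.numVars + 1)
  have h6 : stride c ≤ stride c * (G.numVars + 1) := Nat.le_mul_of_pos_right _ (by omega)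
  have h7 := Nat.zero_le G.text.length
  have h8 := Nat.zero_le c
  repeat refine And.intro (by linarith) ?_
  have he : Env G c ((((State.ofInput G.encode).set 3 G.numVars).set 2 (2 + 3 * G.numVars)).set 44
      (recAt c G.numVars (G.numVars + 1))) :=
    ⟨by simp [State.set_reg], by simp [State.set_reg], by simp [State.set_reg], fun _ _ => rfl⟩
  refine wp_search hf he ⟨fun A => ?_, by simp, fun A => ?_, fun A _ f _ _ => ?_⟩ ?_
  · have := le_recAt (c := c) (V := G.numVars) A
    exact hz _ (by omega)
  · have := le_recAt (c := c) (V := G.numVars) A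
    exact hz _ (by omega)
  · have := le_recAt (c := c) (V := G.numVars) A
    exact hz _ (by omega)
  intro t1 s1 ord ht1 he1 ho1
  refine wp_measure hf he1 ho1 fun t2 s2 ht2 he2 hm2 => ?_
  refine wp_balance hf hO he2 ho1.length ho1.top hm2 fun t3 s3 ht3 he3 hb => ?_
  refine hQ _ _ ord ?_ he3 hb ho1.top
  have k1 : (G.numVars + 1) * (Nat.log 2 G.text.length + 1) ≤
      (G.numVars + 1) * (O.timeF + O.timeH * (Nat.log 2 G.text.length + 1)) :=
    Nat.mul_le_mul_left _ (by omega)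
  have k2 : (G.numVars + 1) ≤
      (G.numVars + 1) * (O.timeF + O.timeH * (Nat.log 2 G.text.length + 1)) :=
    Nat.le_mul_of_pos_right _ (by omega)
  omega

end balance

end WordRAM

/-! # Slices of lists -/

section slice
variable {α : Type*}

/-- The part of a list from position `l` to position `u`, counted from zero, without the latter. -/
def slice (X : List α) (l u : ℕ) : List α := (X.take u).drop l

theorem slice_eq_nil {X : List α} {l u : ℕ} (h : u ≤ l) : slice X l u = [] := by
  unfold slice
  exact List.drop_eq_nil_of_le (le_trans (List.length_take_le _ _) h)

theorem slice_full (X : List α) : slice X 0 X.length = X := by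
  simp [slice]

/-- Positions are clipped at the border for the first string and shifted by its length, with
truncated subtraction, for the second. The query program performs this computation at every child.
-/
theorem slice_append (X Y : List α) (l u : ℕ) : slice (X ++ Y) l u =
    slice X (min l X.length) (min u X.length) ++ slice Y (l - X.length) (u - X.length) := by
  unfold slice
  rw [List.take_append, List.drop_append]
  congr 1
  · rcases le_total u X.length with h | h
    · rw [min_eq_left h]
      rcases le_total l X.length with h' | h'
      · rw [min_eq_left h']
      · rw [min_eq_right h', List.drop_eq_nil_of_le (by simp; omega),
          List.drop_eq_nil_of_le (by simp)]
    · rw [min_eq_right h, List.take_of_length_le h, List.take_length]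
      rcases le_total l X.length with h' | h'
      · rw [min_eq_left h']
      · rw [min_eq_right h', List.drop_eq_nil_of_le h', List.drop_eq_nil_of_le le_rfl]
  · rw [List.length_take]
    rcases le_total u X.length with h | h
    · rw [Nat.sub_eq_zero_of_le h]; simp
    · rw [min_eq_right h]

theorem slice_split (X : List α) {l m u : ℕ} (h1 : l ≤ m) (h2 : m ≤ u) :
    slice X l u = slice X l m ++ slice X m u := by
  unfold slice
  have h : X.take u = X.take m ++ (X.take u).drop m := by
    conv_lhs => rw [← List.take_append_drop m (X.take u)]
    rw [List.take_take, min_eq_left h2]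
  conv_lhs => rw [h]
  rcases le_total m X.length with h' | h'
  · rw [List.drop_append_of_le_length (by simp; omega)]
  · have e : (X.take u).drop m = [] := List.drop_eq_nil_of_le (by simp; omega)
    rw [e]; simp

theorem flatten_replicate_add (X : List α) (p q : ℕ) : (List.replicate (p + q) X).flatten =
    (List.replicate p X).flatten ++ (List.replicate q X).flatten := by
  rw [List.replicate_add, List.flatten_append]

theorem slice_replicate (X : List α) {t q k : ℕ} (h : q + k ≤ t) :
    slice (List.replicate t X).flatten (q * X.length) ((q + k) * X.length) =
      (List.replicate k X).flatten := by
  obtain ⟨d, rfl⟩ := Nat.exists_eq_add_of_le h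
  rw [flatten_replicate_add, flatten_replicate_add]
  unfold slice
  rw [List.take_left' (by simp [add_mul]), List.drop_left' (by simp)]

theorem slice_replicate_copy (X : List α) {t q l u : ℕ} (h : q < t) (hu : u ≤ X.length) :
    slice (List.replicate t X).flatten (q * X.length + l) (q * X.length + u) = slice X l u := by
  obtain ⟨d, rfl⟩ := Nat.exists_eq_add_of_lt h
  rw [show q + d + 1 = q + (1 + d) by ring, flatten_replicate_add, flatten_replicate_add]
  unfold slice
  have e1 : ((List.replicate q X).flatten ++ ((List.replicate 1 X).flatten ++
      (List.replicate d X).flatten)).take (q * X.length + u) =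
      (List.replicate q X).flatten ++ X.take u := by
    rw [List.take_append, List.take_of_length_le (by simp)]
    simp [List.take_append_of_le_length hu]
  rw [e1, List.drop_append]
  rw [List.drop_eq_nil_of_le (by simp)]
  simp

/-- The number of ends of a slice that cut a string of length `n`, but `0` for an empty slice. -/
def cuts (n l u : ℕ) : ℕ :=
  if l < u then (if 0 < l then 1 else 0) + (if u < n then 1 else 0) else 0

/-- An end that lies strictly inside of one part touches the other part at most at its border, and
an empty part counts nothing. So no end is counted twice. -/
theorem cuts_append (a b l u : ℕ) (h : u ≤ a + b) :
    cuts a (min l a) (min u a) + cuts b (l - a) (u - a) ≤ cuts (a + b) l u := by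
  unfold cuts
  split_ifs <;> omega

theorem cuts_le (n l u : ℕ) : cuts n l u ≤ 2 := by
  unfold cuts
  split_ifs <;> omega

theorem cuts_pos {n l u : ℕ} (h : l < u) (hu : u ≤ n) (hne : ¬ (l = 0 ∧ u = n)) :
    0 < cuts n l u := by
  unfold cuts
  split_ifs <;> omega

/-- The positions at which a slice of a power of a string of length `b` is split into a part of a
copy, some complete copies, and a part of a copy. -/
structure Splits (b t l u m₁ m₂ : ℕ) : Prop where
  le₁ : l ≤ m₁
  le₂ : m₁ ≤ m₂
  le₃ : m₂ ≤ u
  left_le : l % b + (m₁ - l) ≤ b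
  right_le : u - m₂ ≤ b
  left : m₁ = l ∨ ∃ q < t, l = q * b + l % b
  mid : ∃ q k, q + k ≤ t ∧ (m₁ = q * b ∧ m₂ = (q + k) * b ∨ k = 0 ∧ m₁ = m₂)
  right : m₂ = u ∨ ∃ q < t, m₂ = q * b
  cuts_le : cuts b (l % b) (l % b + (m₁ - l)) + cuts b 0 (u - m₂) ≤ cuts (t * b) l u

/-- The left end is rounded up and the right end down to a multiple of `b`. The minimum and maximum
take care of slices without a multiple of `b` between their ends. -/
theorem splits {b t l u m₁ m₂ : ℕ} (hb : 0 < b) (hlu : l < u) (hu : u ≤ t * b)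
    (h1 : m₁ = min u ((l + b - 1) / b * b)) (h2 : m₂ = max m₁ (u / b * b)) :
    Splits b t l u m₁ m₂ := by
  have hl := Nat.div_add_mod l b
  have hlm := Nat.mod_lt l hb
  have hu' := Nat.div_add_mod u b
  have hum := Nat.mod_lt u hb
  rw [mul_comm] at hl hu'
  have hq : l / b < t := by
    rw [Nat.div_lt_iff_lt_mul hb]; omega
  have hq' : u / b ≤ t := by
    rw [← Nat.mul_div_cancel t hb]; exact Nat.div_le_div_right hu
  have hceil : (l + b - 1) / b * b = if l % b = 0 then l / b * b else (l / b + 1) * b := by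
    split_ifs with h
    · congr 1
      refine Nat.div_eq_of_lt_le (by omega) ?_
      rw [add_mul]; omega
    · congr 1
      refine Nat.div_eq_of_lt_le ?_ ?_
      · rw [add_mul]; omega
      · rw [add_mul, add_mul]; omega
  have hmono : l / b ≤ u / b := Nat.div_le_div_right hlu.le
  have hmul : l / b * b ≤ u / b * b := Nat.mul_le_mul_right _ hmono
  have hut : u / b < t ∨ u % b = 0 := by
    rcases Nat.lt_or_ge (u / b) t with h | h
    · exact Or.inl h
    · right
      have : u / b = t := le_antisymm hq' h
      rw [this] at hu'; omega
  have hlt : (l / b + 1) * b ≤ t * b := Nat.mul_le_mul_right _ hq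
  have hsame : u / b = l / b ∨ (l / b + 1) * b ≤ u / b * b := by
    rcases Nat.lt_or_ge (l / b) (u / b) with h | h
    · exact Or.inr (Nat.mul_le_mul_right _ h)
    · exact Or.inl (le_antisymm h hmono)
  have hun : u / b < t → (u / b + 1) * b ≤ t * b := fun h => Nat.mul_le_mul_right _ h
  rw [hceil] at h1
  have e1 : (l / b + 1) * b = l / b * b + b := by ring
  have e2 : (u / b + 1) * b = u / b * b + b := by ring
  rw [e1] at h1 hlt hsame
  rw [e2] at hun
  by_cases h0 : l % b = 0
  · rw [if_pos h0] at h1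
    have hm1 : m₁ = l := by omega
    have hm2 : m₂ = u / b * b := by omega
    refine ⟨by omega, by omega, by omega, by omega, by omega, Or.inl hm1,
      ⟨l / b, u / b - l / b, by omega, Or.inl ⟨by omega, ?_⟩⟩, ?_, ?_⟩
    · rw [Nat.add_sub_cancel' hmono]; exact hm2
    · rcases hut with h | h
      · exact Or.inr ⟨_, h, hm2⟩
      · left; omega
    · unfold cuts
      split_ifs <;> omega
  · rw [if_neg h0] at h1
    -- Either the slice stays inside of one copy, and both split positions equal `u`, or it reaches
    -- the next multiple of `b`.
    rcases hsame with h | h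
    · have hub : u / b * b = l / b * b := by rw [h]
      have hm1 : m₁ = u := by omega
      have hm2 : m₂ = u := by omega
      refine ⟨by omega, by omega, by omega, by omega, by omega, Or.inr ⟨_, hq, hl.symm⟩,
        ⟨0, 0, by omega, Or.inr ⟨rfl, by omega⟩⟩, Or.inl hm2, ?_⟩
      unfold cuts
      split_ifs <;> omega
    · have hm1 : m₁ = (l / b + 1) * b := by rw [e1]; omega
      have hm2 : m₂ = u / b * b := by rw [e1] at hm1; omega
      have hlu' : l / b + 1 ≤ u / b := by
        refine Nat.le_of_mul_le_mul_right (c := b) ?_ hb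
        rw [e1]; exact h
      refine ⟨by omega, by omega, by omega, by omega, by omega, Or.inr ⟨_, hq, hl.symm⟩,
        ⟨l / b + 1, u / b - (l / b + 1), by omega, Or.inl ⟨hm1, ?_⟩⟩, ?_, ?_⟩
      · rw [Nat.add_sub_cancel' hlu']; exact hm2
      · rcases hut with h | h
        · exact Or.inr ⟨_, h, hm2⟩
        · left; omega
      · rw [e1] at hm1
        unfold cuts
        split_ifs <;> omega

theorem Splits.slice_eq {X : List α} {t l u m₁ m₂ : ℕ} (h : Splits X.length t l u m₁ m₂) :
    slice (List.replicate t X).flatten l u =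
      slice X (l % X.length) (l % X.length + (m₁ - l)) ++
        ((List.replicate ((m₂ - m₁) / X.length) X).flatten ++ slice X 0 (u - m₂)) := by
  have h1 := h.le₁
  have h2 := h.le₂
  have h3 := h.le₃
  rw [slice_split _ h1 (h2.trans h3), slice_split _ h2 h3]
  congr 1
  · rcases h.left with he | ⟨q, hq, he⟩
    · rw [slice_eq_nil (by omega), slice_eq_nil (by omega)]
    · have e : q * X.length + (l % X.length + (m₁ - l)) = m₁ := by omega
      have key := slice_replicate_copy X (l := l % X.length) hq h.left_le
      rwa [← he, e] at key
  congr 1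
  · obtain ⟨q, k, hk, ⟨e1, e2⟩ | ⟨e1, e2⟩⟩ := h.mid
    · rw [e1, e2, slice_replicate X hk, add_mul, Nat.add_sub_cancel_left]
      rcases Nat.eq_zero_or_pos X.length with h0 | h0
      · rw [List.length_eq_zero_iff] at h0
        subst h0; simp
      · rw [Nat.mul_div_cancel _ h0]
    · rw [slice_eq_nil (by omega), e2]; simp
  · rcases h.right with he | ⟨q, hq, he⟩
    · rw [slice_eq_nil (by omega), slice_eq_nil (by omega)]
    · have : u = q * X.length + (u - m₂) := by omega
      rw [this, he]
      have := slice_replicate_copy X (l := 0) hq h.right_le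
      rw [add_zero] at this
      rw [Nat.add_sub_cancel_left, ← he]
      rw [← he] at this
      exact this

end slice

namespace WordRAM

local notation "R" => Expr.reg
local notation "M" => Expr.load

/-! # Queries -/

/-- Push the contents of three registers to the stack whose end is in register 6. -/
def push (x y z : ℕ) : Prog :=
  .store (R 6) (R x) ;; .store (R 6 + 1) (R y) ;; .store (R 6 + 2) (R z) ;; .set 6 (R 6 + 3)

/-- Write the minimum of two registers to a register. -/
def setMin (x y z : ℕ) : Prog :=
  .ite (Expr.less (R y) (R z)) (.set x (R y)) (.set x (R z))

/-- Write the maximum of two registers to a register. -/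
def setMax (x y z : ℕ) : Prog :=
  .ite (Expr.less (R y) (R z)) (.set x (R z)) (.set x (R y))

/-- Push the part of child number `i` of the node in register 10 that lies in the slice given by
registers 11 and 12, and make these relative to the end of the child. -/
def pushChild (i : ℕ) : Prog :=
  .set 13 (M (R 10 + Expr.const (3 + i))) ;; .set 14 (M (R 13)) ;;
  setMin 15 11 14 ;; setMin 16 12 14 ;;
  push 13 15 16 ;; .set 11 (R 11 - R 14) ;; .set 12 (R 12 - R 14)

/-- Push the parts of a slice of a concatenation. -/
def catStep : Prog :=
  pushChild 0 ;; pushChild 1 ;; pushChild 2 ;; pushChild 3 ;; pushChild 4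

/-- Push the parts of a slice of a power that is cut at positions inside of a copy. -/
def splitRun : Prog :=
  .set 17 ((R 11 + R 14 - 1) / R 14 * R 14) ;;
  setMin 17 12 17 ;; .set 18 (R 12 / R 14 * R 14) ;; setMax 18 17 18 ;;
  .set 15 (R 11 % R 14) ;; .set 16 (R 15 + (R 17 - R 11)) ;; push 13 15 16 ;;
  .set 15 0 ;; .set 16 (R 18 - R 17) ;; push 10 15 16 ;;
  .set 16 (R 12 - R 18) ;; push 13 15 16

/-- Split a slice of a power, or prepare the computation of its value. -/
def runStep : Prog :=
  .set 13 (M (R 10 + 3)) ;; .set 14 (M (R 13)) ;;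
  .ite (R 11 % R 14 + R 12 % R 14) splitRun
    (.set 42 ((R 12 - R 11) / R 14) ;; .set 41 (M (R 13 + 1)))

/-- Treat the slice from register 11 to register 12 of the string of the node in register 10. -/
def sliceStep : Prog :=
  .ite (Expr.less (R 11) (R 12))
    (.ite (Expr.equal (R 12 - R 11) (M (R 10))) (.set 42 1 ;; .set 41 (M (R 10 + 1)))
      (.ite (M (R 10 + 2)) runStep catStep)) .skip

/-- Treat the slice on the top of the stack. -/
def queryBody : Prog :=
  .set 6 (R 6 - 3) ;; .set 10 (M (R 6)) ;; .set 11 (M (R 6 + 1)) ;; .set 12 (M (R 6 + 2)) ;;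
  .set 42 0 ;; sliceStep ;; prepend

section query
variable {c σ w : ℕ} {O : Subroutines c} {val : List (Fin σ) → Fin c → ℕ} {B : ℕ} {m₀ : ℕ → ℕ}

theorem wp_setMin {s : State} {x y z : ℕ} {Q : ℕ → State → Prop} (hw : 1 < 2 ^ w)
    (hQ : Q 6 (s.set x (min (s.reg y) (s.reg z)))) : wp w O (setMin x y z) Q s := by
  simp only [setMin, wp, safe_less, safe_reg, val_less, val_reg, cost_bin, cost_reg, true_and]
  refine ⟨hw, fun h => ?_, fun h => ?_⟩
  · rwa [min_eq_left (by by_contra h'; simp [show ¬ s.reg y < s.reg z by omega] at h)] at hQ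
  · rwa [min_eq_right (by by_contra h'; simp [show s.reg y < s.reg z by omega] at h)] at hQ

theorem wp_setMax {s : State} {x y z : ℕ} {Q : ℕ → State → Prop} (hw : 1 < 2 ^ w)
    (hQ : Q 6 (s.set x (max (s.reg y) (s.reg z)))) : wp w O (setMax x y z) Q s := by
  simp only [setMax, wp, safe_less, safe_reg, val_less, val_reg, cost_bin, cost_reg, true_and]
  refine ⟨hw, fun h => ?_, fun h => ?_⟩
  · rwa [max_eq_right (by by_contra h'; simp [show ¬ s.reg y < s.reg z by omega] at h)] at hQ
  · rwa [max_eq_left (by by_contra h'; simp [show s.reg y < s.reg z by omega] at h)] at hQ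

theorem wp_push {s : State} {x y z : ℕ} (h6 : s.reg 6 + 3 < 2 ^ w) {Q : ℕ → State → Prop}
    (hQ : ∀ s', s'.mem (s.reg 6) = s.reg x → s'.mem (s.reg 6 + 1) = s.reg y →
      s'.mem (s.reg 6 + 2) = s.reg z → (∀ a < s.reg 6, s'.mem a = s.mem a) →
      s'.reg 6 = s.reg 6 + 3 → (∀ y, y ≠ 6 → s'.reg y = s.reg y) → Q 17 s') :
    wp w O (push x y z) Q s := by
  simp only [push, wp, safe_add, safe_reg, safe_num, val_add, val_reg, val_num, State.put_reg,
    cost_add, cost_reg, cost_num, true_and, and_assoc]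
  repeat refine And.intro (by omega) ?_
  refine hQ _ ?_ ?_ ?_ (fun a ha => ?_) ?_ (fun y hy => ?_)
  · simp [State.put_mem]
  · simp [State.put_mem]
  · simp [State.put_mem]
  · simp only [State.set_mem, State.put_mem]
    rw [Function.update_of_ne (by omega), Function.update_of_ne (by omega),
      Function.update_of_ne (by omega)]
  · simp
  · simp [hy]

variable (val B m₀) in
/-- A state of a query: the data structure is in the cells below `B`, two blocks and the stack
follow, and register 40 represents the string `Y`. -/
structure QueryState (Y : List (Fin σ)) (s : State) : Prop where
  r5 : s.reg 5 = B + 2 * c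
  r43 : s.reg 43 = B
  r44 : s.reg 44 = B + c
  mem : ∀ x < B, s.mem x = m₀ x
  holds : Holds val s.mem (s.reg 40) Y
  top : s.reg 40 ≤ B

variable (w O val B m₀) in
/-- The slice from `l` to `u` of the node `a` is removed from the stack and the string `Z`
prepended to the result, within time `T` and by means of at most `h` more cells of the stack. -/
def Treats (a l u : ℕ) (Z : List (Fin σ)) (T h : ℕ) : Prop :=
  ∀ s Y p, QueryState val B m₀ Y s → s.reg 6 = p + 3 → B + 2 * c ≤ p → s.mem p = a →
    s.mem (p + 1) = l → s.mem (p + 2) = u → p + 3 + h < 2 ^ w →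
    ∃ t s', t ≤ T ∧ Iter w O (Expr.less (R 5) (R 6)) queryBody s t s' ∧
      QueryState val B m₀ (Z ++ Y) s' ∧ s'.reg 6 = p ∧ ∀ x < p, B + 2 * c ≤ x → s'.mem x = s.mem x

/-- The rightmost part lies on the top of the stack and is treated first, so that prepending
assembles the parts in their order. The stack above an entry is empty again when that entry is
reached, whence the parts share the extra space `h`. -/
theorem treats_all {N : ℕ} {a l u T : ℕ → ℕ} {Z : ℕ → List (Fin σ)} {h : ℕ}
    (H : ∀ i < N, Treats w O val B m₀ (a i) (l i) (u i) (Z i) (T i) h) {s : State}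
    {Y : List (Fin σ)} {p : ℕ} (hs : QueryState val B m₀ Y s) (h6 : s.reg 6 = p + 3 * N)
    (hp : B + 2 * c ≤ p) (he : ∀ i < N, s.mem (p + 3 * i) = a i ∧ s.mem (p + 3 * i + 1) = l i ∧
      s.mem (p + 3 * i + 2) = u i) (hh : p + 3 * N + h < 2 ^ w) :
    ∃ t s', t ≤ ∑ i ∈ Finset.range N, T i ∧
      Iter w O (Expr.less (R 5) (R 6)) queryBody s t s' ∧
      QueryState val B m₀ ((List.range N).flatMap Z ++ Y) s' ∧ s'.reg 6 = p ∧
      ∀ x < p, B + 2 * c ≤ x → s'.mem x = s.mem x := by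
  induction N generalizing s Y with
  | zero => exact ⟨0, s, by simp, .refl s, by simpa using hs, by simpa using h6, fun _ _ _ => rfl⟩
  | succ N ih =>
    obtain ⟨e1, e2, e3⟩ := he N (by omega)
    obtain ⟨t, s₁, ht, hi, hs₁, h6₁, hm⟩ := H N (by omega) s Y (p + 3 * N) hs (by omega) (by omega)
      e1 e2 e3 (by omega)
    obtain ⟨t', s', ht', hi', hs', h6', hm'⟩ := ih (fun i hi => H i (by omega)) hs₁ h6₁
      (fun i hi => by
        rw [hm _ (by omega) (by omega), hm _ (by omega) (by omega), hm _ (by omega) (by omega)]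
        exact he i (by omega)) (by omega)
    refine ⟨t + t', s', ?_, hi.trans hi', ?_, h6', fun x hx hB => ?_⟩
    · rw [Finset.sum_range_succ]; omega
    · rw [List.range_succ, List.flatMap_append]
      simpa using hs'
    · rw [hm' x hx hB, hm x (by omega) hB]

/-- The registers and the stack after slices have been pushed. -/
structure Pushed (p N : ℕ) (a l u : ℕ → ℕ) (s₁ s : State) : Prop where
  r6 : s.reg 6 = p + 3 * N
  ent : ∀ i < N, s.mem (p + 3 * i) = a i ∧ s.mem (p + 3 * i + 1) = l i ∧
    s.mem (p + 3 * i + 2) = u i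
  mem : ∀ x < p, s.mem x = s₁.mem x
  reg : ∀ x, x = 5 ∨ x = 10 ∨ x = 40 ∨ x = 43 ∨ x = 44 → s.reg x = s₁.reg x

/-- A slice has been taken from the stack into registers. -/
structure Loaded (w c B : ℕ) (m₀ : ℕ → ℕ) (p a l u : ℕ) (s : State) : Prop where
  r6 : s.reg 6 = p
  r10 : s.reg 10 = a
  r11 : s.reg 11 = l
  r12 : s.reg 12 = u
  r42 : s.reg 42 = 0
  base : B + 2 * c ≤ p
  mem : ∀ x < B, s.mem x = m₀ x

/-- A round takes an entry from the stack, lets `sliceStep` push `N` parts or prepare a power `X ^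
k`, and runs `prepend`. The pushed parts are treated in later rounds, so they come to stand to the
left of the power. In the applications `N` or `k` is zero. -/
theorem Treats.of_sliceStep (hO : Composes w O val) (hB : B ≠ 0) {N T₀ h k : ℕ} {a l u : ℕ}
    {a' l' u' T : ℕ → ℕ} {Z : ℕ → List (Fin σ)} {X : List (Fin σ)} (hk : k < 2 ^ w)
    (hw : 10 ≤ 2 ^ w)
    (H : ∀ i < N, Treats w O val B m₀ (a' i) (l' i) (u' i) (Z i) (T i) h)
    (step : ∀ p s₁, Loaded w c B m₀ p a l u s₁ → p + 3 + 3 * N + h < 2 ^ w →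
      wp w O sliceStep (fun t s₂ => t ≤ T₀ ∧ Pushed p N a' l' u' s₁ s₂ ∧ s₂.reg 42 = k ∧
        (k ≠ 0 → s₂.reg 41 ≠ 0 ∧ s₂.reg 41 + c ≤ B ∧
          readBlock c m₀ (s₂.reg 41) = val X)) s₁) :
    Treats w O val B m₀ a l u ((List.range N).flatMap Z ++ (List.replicate k X).flatten)
      (T₀ + 100 + 100 * O.timeH * (Nat.log 2 k + 1) + ∑ i ∈ Finset.range N, T i) (3 * N + h) := by
  intro s Y p hs h6 hp e0 e1 e2 hh
  have hpos := hO.pos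
  have hb : wp w O queryBody (fun t s' => t ≤ T₀ + 60 + 100 * O.timeH * (Nat.log 2 k + 1) ∧
      QueryState val B m₀ ((List.replicate k X).flatten ++ Y) s' ∧ s'.reg 6 = p + 3 * N ∧
      (∀ i < N, s'.mem (p + 3 * i) = a' i ∧ s'.mem (p + 3 * i + 1) = l' i ∧
        s'.mem (p + 3 * i + 2) = u' i) ∧ ∀ x < p, B + 2 * c ≤ x → s'.mem x = s.mem x) s := by
    simp only [queryBody, wp, safe_add, safe_sub, safe_load, safe_reg, safe_num, val_add, val_sub,
      val_load, val_reg, val_num, State.set_reg, State.set_mem, cost_add, cost_sub, cost_load,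
      cost_reg, cost_num, true_and, and_assoc, Nat.reduceEqDiff, if_true, if_false, h6,
      Nat.add_sub_cancel, e0, e1, e2]
    repeat refine And.intro (by omega) ?_
    refine wp_mono (step p _ ⟨?_, ?_, ?_, ?_, ?_, hp, hs.mem⟩ (by omega)) ?_
    · simp [State.set_reg]
    · simp [State.set_reg]
    · simp [State.set_reg]
    · simp [State.set_reg]
    · simp [State.set_reg]
    rintro t s₂ ⟨ht, hP, h42, hX⟩
    have g40 : s₂.reg 40 = s.reg 40 := by simpa [State.set_reg] using hP.reg 40 (by simp)
    have g43 : s₂.reg 43 = B := by simpa [State.set_reg, hs.r43] using hP.reg 43 (by simp)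
    have g44 : s₂.reg 44 = B + c := by simpa [State.set_reg, hs.r44] using hP.reg 44 (by simp)
    have g5 : s₂.reg 5 = B + 2 * c := by simpa [State.set_reg, hs.r5] using hP.reg 5 (by simp)
    have gm : ∀ x < p, s₂.mem x = s.mem x := fun x hx => hP.mem x hx
    have htop := hs.top
    refine wp_prepend hO hw (X := X) (Y := Y) (by omega) ?_ (by omega) ?_ (by omega) (by omega)
      (by omega) ?_
    · rw [g40]
      exact hs.holds.congr fun i hi => gm _ (by omega)
    · intro hne
      obtain ⟨x1, x2, x3⟩ := hX (by omega)
      refine ⟨x1, ?_, by omega, fun i hi j hj => by omega⟩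
      rw [← x3]
      exact readBlock_congr fun i hi => (gm _ (by omega)).trans (hs.mem _ (by omega))
    rw [h42, g43, g44]
    intro t' s' ht' hH hr hm hreg
    have gm' : ∀ x, x < B ∨ B + 2 * c ≤ x → s'.mem x = s₂.mem x := fun x hx =>
      hm x (fun i hi => by omega) fun i hi => by omega
    refine ⟨by omega, ⟨?_, ?_, ?_, fun x hx => ?_, hH, ?_⟩, ?_, fun i hi => ?_, fun x hx hx' => ?_⟩
    · rw [hreg 5 (by omega), g5]
    · rw [hreg 43 (by omega), g43]
    · rw [hreg 44 (by omega), g44]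
    · rw [gm' x (Or.inl hx), gm x (by omega), hs.mem x hx]
    · rcases hr with hr | ⟨hne, hr⟩ | hr
      · omega
      · have := hX hne
        omega
      · omega
    · rw [hreg 6 (by omega), hP.r6]
    · rw [gm' _ (by omega), gm' _ (by omega), gm' _ (by omega)]
      exact hP.ent i hi
    · rw [gm' x (by omega), gm x hx]
  obtain ⟨t, s₁, hx, ht, hs₁, h6₁, he₁, hm₁⟩ := wp_sound hb
  obtain ⟨t', s', ht', hi', hs', h6', hm'⟩ := treats_all H hs₁ h6₁ hp he₁ (by omega)
  have hc : (Expr.less (R 5) (R 6)).eval w s ≠ 0 := by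
    rw [Expr.eval_eq_val (by simp only [safe_less, safe_reg, true_and]; omega)]
    have := hs.r5
    simp only [val_less, val_reg, h6]
    rw [if_pos (by omega)]
    exact one_ne_zero
  refine ⟨_, s', ?_, .step hc hx hi', by simpa using hs', h6', fun x hx hx' => ?_⟩
  · simp only [cost_bin, cost_reg]; omega
  · rw [hm' x hx hx', hm₁ x hx hx']

end query

/-! ### Slices that need no splitting -/

section query
variable {c σ w : ℕ} {O : Subroutines c} {val : List (Fin σ) → Fin c → ℕ} {B : ℕ} {m₀ : ℕ → ℕ}

theorem Treats.mono {a l u T T' h h' : ℕ} {Z : List (Fin σ)}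
    (H : Treats w O val B m₀ a l u Z T h) (hT : T ≤ T') (hh : h ≤ h') :
    Treats w O val B m₀ a l u Z T' h' := by
  intro s Y p hs h6 hp e0 e1 e2 hw
  obtain ⟨t, s', ht, H'⟩ := H s Y p hs h6 hp e0 e1 e2 (by omega)
  exact ⟨t, s', ht.trans hT, H'⟩

theorem Pushed.zero {p : ℕ} {a l u : ℕ → ℕ} {s : State} (h : s.reg 6 = p) :
    Pushed p 0 a l u s s :=
  ⟨by omega, fun i hi => by omega, fun _ _ => rfl, fun _ _ => rfl⟩

theorem Pushed.set {p N : ℕ} {a l u : ℕ → ℕ} {s₁ s : State} (h : Pushed p N a l u s₁ s) {x v : ℕ}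
    (hx : x ≠ 5 ∧ x ≠ 6 ∧ x ≠ 10 ∧ x ≠ 40 ∧ x ≠ 43 ∧ x ≠ 44) : Pushed p N a l u s₁ (s.set x v) := by
  refine ⟨?_, h.ent, h.mem, fun y hy => ?_⟩
  · rw [State.set_reg, if_neg (by omega)]; exact h.r6
  · rw [State.set_reg, if_neg (by omega)]; exact h.reg y hy

theorem treats_flat (hO : Composes w O val) (hB : B ≠ 0) (hw : 10 ≤ 2 ^ w) {a l u h : ℕ}
    {X : List (Fin σ)} (hX : Head val m₀ (Set.Iio B) B a X) (hlen : X.length < 2 ^ w)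
    (hlu : u ≤ l ∨ l = 0 ∧ u = X.length) :
    Treats w O val B m₀ a l u (slice X l u) (400 * O.timeH) h := by
  have hpos := hO.pos
  have hc0 : a < B := hX.cells 0 (by omega)
  have hc1 : a + 1 < B := hX.cells 1 (by omega)
  by_cases hl : u ≤ l
  · have := Treats.of_sliceStep (m₀ := m₀) (h := h) (k := 0) (N := 0) (T₀ := 20) (a := a) (l := l)
      (u := u) (a' := id) (l' := id) (u' := id) (T := id) (Z := fun _ => []) (X := []) hO hB
      (by omega) hw (fun i hi => by omega) (fun p s₁ hL hh => by
        simp only [sliceStep, wp, safe_less, safe_reg, val_less, val_reg, cost_bin, cost_reg, hL.r11,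
          hL.r12, true_and]
        rw [if_neg (by omega)]
        exact ⟨by omega, fun h => absurd rfl h, fun _ => ⟨by omega, .zero hL.r6, hL.r42,
          fun h => absurd rfl h⟩⟩)
    rw [slice_eq_nil hl]
    refine Treats.mono (by simpa using this) ?_ le_rfl
    omega
  · obtain ⟨rfl, rfl⟩ : l = 0 ∧ u = X.length := by omega
    have hne : X ≠ [] := by rintro rfl; simp at hl
    obtain ⟨x1, x2, x3, x4⟩ := hX.ptr hne
    have := Treats.of_sliceStep (m₀ := m₀) (h := h) (k := 1) (N := 0) (T₀ := 40) (a := a) (l := 0)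
      (u := X.length) (a' := id) (l' := id) (u' := id) (T := id) (Z := fun _ => []) (X := X) hO hB
      (by omega) hw (fun i hi => by omega) (fun p s₁ hL hh => by
        have hb := hL.base
        simp only [sliceStep, wp, safe_less, safe_reg, val_less, val_reg, cost_bin, cost_reg, hL.r11,
          hL.r12, true_and]
        rw [if_pos (by omega)]
        refine ⟨by omega, fun _ => ?_, fun h => absurd h one_ne_zero⟩
        simp only [safe_equal, safe_sub, safe_reg, safe_load, safe_add, safe_num, val_equal, val_sub,
          val_add, val_num, val_load, State.set_reg, State.set_mem, val_reg, cost_bin, cost_sub, cost_reg, cost_load,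
          cost_add, cost_num, hL.r11, hL.r12, hL.r10, hL.mem _ hc0, hL.mem _ hc1, hX.len, true_and,
          Nat.sub_zero, if_true, Nat.reduceEqDiff, if_false]
        refine ⟨by omega, fun _ => ⟨by omega, by omega, by omega, ?_, fun _ => ⟨x1, x2, x4⟩⟩, fun h =>
          h.elim⟩
        exact ((Pushed.zero hL.r6).set (by omega)).set (by omega))
    rw [slice_full]
    refine Treats.mono (by simpa using this) ?_ le_rfl
    omega

theorem treats_power (hO : Composes w O val) (hB : B ≠ 0) (hw : 10 ≤ 2 ^ w) {a q k h t : ℕ}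
    {X : List (Fin σ)} (ht : m₀ (a + 2) = t) (h0 : t ≠ 0)
    (hA : Head val m₀ (Set.Iio B) B a (List.replicate t X).flatten)
    (hX : Head val m₀ (Set.Iio B) B (m₀ (a + 3)) X) (hne : X ≠ [])
    (hlen : (List.replicate t X).flatten.length < 2 ^ w) (hqk : q + k ≤ t) :
    Treats w O val B m₀ a (q * X.length) ((q + k) * X.length) (List.replicate k X).flatten
      (500 * O.timeH + 100 * O.timeH * Nat.log 2 t) h := by
  have hpos := hO.pos
  have hb : 0 < X.length := List.length_pos_iff.mpr hne
  have hlt : (List.replicate t X).flatten.length = t * X.length := by simp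
  have hu : (q + k) * X.length ≤ t * X.length := Nat.mul_le_mul_right _ hqk
  have hkq : (q + k) * X.length = q * X.length + k * X.length := add_mul _ _ _
  -- The program tests for empty and for full slices first, so these do not reach the computation of
  -- a power.
  by_cases hf : k = 0 ∨ q = 0 ∧ k = t
  · rw [← slice_replicate X hqk]
    refine Treats.mono (treats_flat hO hB hw hA hlen ?_) (h := h) ?_ le_rfl
    · rcases hf with rfl | ⟨rfl, rfl⟩
      · left; simp
      · right; simp
    · omega
  have hk : 0 < k * X.length := Nat.mul_pos (by omega) hb
  have hkt : (k + 1) * X.length ≤ t * X.length := Nat.mul_le_mul_right _ (by omega)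
  have hk1 : (k + 1) * X.length = k * X.length + X.length := by ring
  have hkw : k ≤ k * X.length := Nat.le_mul_of_pos_right _ hb
  have hc0 : a < B := hA.cells 0 (by omega)
  have hc2 : a + 2 < B := hA.cells 2 (by omega)
  have hc3 : a + 3 < B := hA.cells 3 (by omega)
  have hx0 : m₀ (a + 3) < B := hX.cells 0 (by omega)
  have hx1 : m₀ (a + 3) + 1 < B := hX.cells 1 (by omega)
  have hdiv : (q * X.length + k * X.length - q * X.length) / X.length = k := by
    rw [Nat.add_sub_cancel_left, Nat.mul_div_cancel _ hb]
  -- Both ends are at borders of copies. The sum of the two remainders vanishes, which selects the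
  -- branch without splitting.
  have hmod : q * X.length % X.length + (q * X.length + k * X.length) % X.length = 0 := by
    rw [← add_mul]; simp
  obtain ⟨x1, x2, x3, x4⟩ := hX.ptr hne
  have := Treats.of_sliceStep (m₀ := m₀) (h := h) (k := k) (N := 0) (T₀ := 100) (a := a)
    (l := q * X.length) (u := (q + k) * X.length) (a' := id) (l' := id) (u' := id) (T := id)
    (Z := fun _ => []) (X := X) hO hB (by omega) hw (fun i hi => by omega) (fun p s₁ hL hh => by
      have hbp := hL.base
      rw [hkq] at hL
      simp only [sliceStep, wp, safe_less, safe_reg, val_less, val_reg, cost_bin, cost_reg, hL.r11,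
        hL.r12, true_and, safe_equal, safe_sub, safe_load, safe_add, safe_num, val_equal, val_sub,
        val_add, val_num, val_load, State.set_reg, State.set_mem, cost_sub,
        cost_load, cost_add, cost_num, hL.r10, hL.mem _ hc0, hL.mem _ hc2, hA.len, hlt, ht]
      rw [if_pos (by omega), if_neg (by omega)]
      refine ⟨by omega, fun _ => ⟨by omega, fun h => absurd rfl h, fun _ => ⟨by omega, fun _ => ?_,
        fun h => absurd h h0⟩⟩, fun h => absurd h one_ne_zero⟩
      simp only [runStep, wp, safe_reg, val_reg, cost_bin, cost_reg, safe_sub, safe_load, safe_add,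
        safe_num, safe_mod, safe_div, val_sub, val_mod, val_div, val_add, val_num, val_load,
        State.set_reg, State.set_mem, cost_sub, cost_load, cost_add, cost_mod, cost_div, cost_num,
        hL.r10, hL.r11, hL.r12, hL.mem _ hc3, hL.mem _ hx0, hL.mem _ hx1, hX.len, true_and,
        if_true, Nat.reduceEqDiff, if_false, hmod, hdiv, and_assoc]
      refine ⟨by omega, by omega, by omega, by omega, by omega, fun h => absurd rfl h, fun _ =>
        ⟨by omega, by omega, by omega, by omega, by omega, ?_, fun _ => ⟨x1, x2, x4⟩⟩⟩
      exact ((((Pushed.zero hL.r6).set (by omega)).set (by omega)).set (by omega)).set (by omega))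
  have hlog : Nat.log 2 k ≤ Nat.log 2 t := Nat.log_mono_right (by omega)
  have hm : 100 * O.timeH * Nat.log 2 k ≤ 100 * O.timeH * Nat.log 2 t := Nat.mul_le_mul_left _ hlog
  refine Treats.mono (by simpa using this) ?_ le_rfl
  rw [mul_add]
  omega

end query

/-! ### Splitting slices of concatenations and powers -/

section query
variable {c σ w : ℕ} {O : Subroutines c} {val : List (Fin σ) → Fin c → ℕ} {B : ℕ} {m₀ : ℕ → ℕ}

/-- What remains of a position after the passage of the first strings of the given lengths. -/
def offset (L : ℕ → ℕ) (x : ℕ) : ℕ → ℕ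
  | 0 => x
  | i + 1 => offset L x i - L i

/-- The state after the parts of the first `i` children have been pushed. -/
structure CatState (m₀ : ℕ → ℕ) (a : ℕ) (L : ℕ → ℕ) (l u p : ℕ) (s₁ : State) (i : ℕ) (s : State) :
    Prop where
  pushed : Pushed p i (fun j => m₀ (a + 3 + j)) (fun j => min (offset L l j) (L j))
    (fun j => min (offset L u j) (L j)) s₁ s
  r11 : s.reg 11 = offset L l i
  r12 : s.reg 12 = offset L u i
  r42 : s.reg 42 = 0

theorem wp_pushChild {a l u p i : ℕ} {L : ℕ → ℕ} {s₁ s : State} (hw : 10 ≤ 2 ^ w)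
    (hs : CatState m₀ a L l u p s₁ i s) (hm : ∀ x < B, s₁.mem x = m₀ x) (hBp : B ≤ p)
    (ha : a + 3 + i < B) (hc : m₀ (a + 3 + i) < B) (hL : m₀ (m₀ (a + 3 + i)) = L i)
    (hp : p + 3 * i + 3 < 2 ^ w) (h10 : s₁.reg 10 = a) (hl : offset L l i < 2 ^ w)
    (hu : offset L u i < 2 ^ w) {Q : ℕ → State → Prop}
    (hQ : ∀ t s', t ≤ 50 → CatState m₀ a L l u p s₁ (i + 1) s' → Q t s') :
    wp w O (pushChild i) Q s := by
  have hP := hs.pushed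
  have g10 : s.reg 10 = a := (hP.reg 10 (by simp)).trans h10
  have gm : ∀ x < B, s.mem x = m₀ x := fun x hx => (hP.mem x (by omega)).trans (hm x hx)
  have ha' : a + (3 + i) < B := by omega
  have hc' : m₀ (a + (3 + i)) < B := by rwa [← add_assoc]
  have hL' : m₀ (m₀ (a + (3 + i))) = L i := by rwa [← add_assoc]
  simp only [pushChild, wp, safe_reg, val_reg, cost_bin, cost_reg, safe_sub, safe_load, safe_add,
    safe_num, safe_const, val_const, cost_const, val_sub, val_add, val_num, val_load,
    State.set_reg, State.set_mem, cost_sub, cost_load, cost_add, cost_num,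
    g10, gm _ ha', gm _ hc', hL', true_and, if_true, Nat.reduceEqDiff, if_false, and_assoc]
  repeat refine And.intro (by omega) ?_
  refine wp_setMin (by omega) ?_
  refine wp_setMin (by omega) ?_
  refine wp_push (by simp [State.set_reg, hP.r6]; omega) ?_
  simp only [State.set_reg, State.set_mem, hs.r11, hs.r12, hP.r6, if_true, Nat.reduceEqDiff, if_false]
  intro s' e1 e2 e3 em e6 er
  have f11 := er 11 (by omega)
  have f12 := er 12 (by omega)
  have f14 := er 14 (by omega)
  have f42 := er 42 (by omega)
  simp only [State.set_reg, hs.r11, hs.r12, hs.r42, if_true, Nat.reduceEqDiff, if_false] at f11 f12 f14 f42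
  rw [f11, f12, f14]
  refine ⟨hl, hu, hQ _ _ (by omega) ⟨⟨?_, ?_, ?_, ?_⟩, ?_, ?_, ?_⟩⟩
  · simp [State.set_reg, e6]; omega
  · intro j hj
    simp only [State.set_mem]
    rcases Nat.lt_succ_iff_lt_or_eq.mp hj with hj | rfl
    · rw [em _ (by omega), em _ (by omega), em _ (by omega)]
      exact hP.ent j hj
    · rw [e1, e2, e3, ← add_assoc]
      exact ⟨rfl, rfl, rfl⟩
  · intro x hx
    simp only [State.set_mem]
    rw [em x (by omega), hP.mem x hx]
  · intro x hx
    rw [← hP.reg x hx, State.set_reg, State.set_reg, if_neg (by omega), if_neg (by omega),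
      er x (by omega)]
    rw [if_neg (by omega), if_neg (by omega), if_neg (by omega), if_neg (by omega)]
  · simp [State.set_reg, offset]
  · simp [State.set_reg, offset, f14]
  · simp [State.set_reg, f42]

theorem offset_le (L : ℕ → ℕ) (x i : ℕ) : offset L x i ≤ x := by
  induction i with
  | zero => exact le_rfl
  | succ i ih => exact (Nat.sub_le _ _).trans ih

theorem wp_catStep {a l u p : ℕ} {L : ℕ → ℕ} {s₁ : State} (hw : 10 ≤ 2 ^ w)
    (hs : Loaded w c B m₀ p a l u s₁) (ha : a + 7 < B)
    (hc : ∀ i < 5, m₀ (a + 3 + i) < B) (hL : ∀ i < 5, m₀ (m₀ (a + 3 + i)) = L i)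
    (hp : p + 15 < 2 ^ w) (hl : l < 2 ^ w) (hu : u < 2 ^ w) {Q : ℕ → State → Prop}
    (hQ : ∀ s', Pushed p 5 (fun j => m₀ (a + 3 + j)) (fun j => min (offset L l j) (L j))
      (fun j => min (offset L u j) (L j)) s₁ s' → s'.reg 42 = 0 → ∀ t ≤ 250, Q t s') :
    wp w O catStep Q s₁ := by
  have hb := hs.base
  have hl' := fun i => (offset_le L l i).trans_lt hl
  have hu' := fun i => (offset_le L u i).trans_lt hu
  have step : ∀ i < 5, ∀ s Q, CatState m₀ a L l u p s₁ i s →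
      (∀ t s', t ≤ 50 → CatState m₀ a L l u p s₁ (i + 1) s' → Q t s') → wp w O (pushChild i) Q s :=
    fun i hi s Q h hQ => wp_pushChild hw h hs.mem (by omega) (by omega) (hc i hi) (hL i hi)
      (by omega) hs.r10 (hl' i) (hu' i) hQ
  simp only [catStep, wp]
  refine step 0 (by omega) _ _ ⟨.zero hs.r6, hs.r11, hs.r12, hs.r42⟩ fun t0 s ht0 h => ?_
  refine step 1 (by omega) _ _ h fun t1 s ht1 h => ?_
  refine step 2 (by omega) _ _ h fun t2 s ht2 h => ?_
  refine step 3 (by omega) _ _ h fun t3 s ht3 h => ?_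
  refine step 4 (by omega) _ _ h fun t4 s ht4 h => ?_
  exact hQ _ h.pushed h.r42 _ (by omega)

theorem wp_splitRun {a l u p b q : ℕ} {s₁ s : State} (hw : 10 ≤ 2 ^ w)
    (hP : Pushed p 0 id id id s₁ s)
    (h10 : s.reg 10 = a) (h11 : s.reg 11 = l) (h12 : s.reg 12 = u) (h13 : s.reg 13 = q)
    (h14 : s.reg 14 = b) (h42 : s.reg 42 = 0) (hp : p + 9 < 2 ^ w) (hlu : l ≤ u)
    (hu : u + b < 2 ^ w)
    {m₁ m₂ : ℕ} (h1 : m₁ = min u ((l + b - 1) / b * b)) (h2 : m₂ = max m₁ (u / b * b))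
    (hlm : l ≤ m₁) (hb : l % b + (m₁ - l) ≤ b) {Q : ℕ → State → Prop}
    (hQ : ∀ s', Pushed p 3 (fun i => if i = 1 then a else q) (fun i => if i = 0 then l % b else 0)
      (fun i => if i = 0 then l % b + (m₁ - l) else if i = 1 then m₂ - m₁ else u - m₂) s₁ s' →
      s'.reg 42 = 0 → ∀ t ≤ 150, Q t s') :
    wp w O splitRun Q s := by
  have k1 : (l + b - 1) / b ≤ l + b - 1 := Nat.div_le_self _ _
  have k2 : (l + b - 1) / b * b ≤ l + b - 1 := Nat.div_mul_le_self _ _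
  have k3 : u / b * b ≤ u := Nat.div_mul_le_self _ _
  have k4 : l % b ≤ l := Nat.mod_le _ _
  have g6 := hP.r6
  simp only [splitRun, wp, safe_reg, val_reg, cost_bin, cost_reg, safe_sub, safe_mul, safe_div,
    safe_add, safe_num, val_sub, val_add, val_num, val_mul, val_div, cost_mul, cost_div,
    State.set_reg, State.set_mem, cost_sub, cost_add, cost_num, h11, h14, true_and, if_true,
    Nat.reduceEqDiff, if_false, and_assoc]
  refine ⟨by omega, by omega, by omega, by omega, by omega, wp_setMin (by omega) ?_⟩
  simp only [State.set_reg, State.set_mem, h12, h14, true_and, if_true, Nat.reduceEqDiff, if_false,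
    ← h1]
  refine ⟨by omega, by omega, wp_setMax (by omega) ?_⟩
  simp only [State.set_reg, State.set_mem, h11, h12, h14, true_and, if_true, Nat.reduceEqDiff,
    if_false, ← h2, wp, safe_reg, safe_mod, val_mod, val_reg, cost_mod, cost_reg]
  refine ⟨by omega, by omega, by omega, wp_push ?_ ?_⟩
  · simp only [State.set_reg, Nat.reduceEqDiff, if_false, g6]; omega
  simp only [State.set_reg, State.set_mem, h10, h11, h12, h13, h14, g6, true_and, if_true,
    Nat.reduceEqDiff, if_false]
  intro s₂ a1 a2 a3 am a6 ar
  have f10 := ar 10 (by omega)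
  have f12 := ar 12 (by omega)
  have f13 := ar 13 (by omega)
  have f17 := ar 17 (by omega)
  have f18 := ar 18 (by omega)
  have f42 := ar 42 (by omega)
  simp only [State.set_reg, h10, h12, h13, h42, if_true, Nat.reduceEqDiff, if_false] at f10 f12 f13 f17 f18 f42
  simp only [f17, f18]
  refine ⟨by omega, by omega, wp_push ?_ ?_⟩
  · simp only [State.set_reg, Nat.reduceEqDiff, if_false, a6]; omega
  simp only [State.set_reg, State.set_mem, f10, f12, f13, f17, f18, a6, if_true,
    Nat.reduceEqDiff, if_false]
  intro s₃ b1 b2 b3 bm b6 br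
  have g12 := br 12 (by omega)
  have g13 := br 13 (by omega)
  have g15 := br 15 (by omega)
  have g18 := br 18 (by omega)
  have g42 := br 42 (by omega)
  simp only [State.set_reg, f12, f13, f18, f42, if_true, Nat.reduceEqDiff, if_false] at g12 g13 g15 g18 g42
  simp only [g12, g18]
  refine ⟨by omega, wp_push ?_ ?_⟩
  · simp only [State.set_reg, Nat.reduceEqDiff, if_false, b6]; omega
  simp only [State.set_reg, State.set_mem, g12, g13, g15, g18, b6, if_true,
    Nat.reduceEqDiff, if_false]
  intro s₄ c1 c2 c3 cm c6 cr
  have q42 := cr 42 (by omega)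
  simp only [State.set_reg, g42, if_true, Nat.reduceEqDiff, if_false] at q42
  refine hQ _ ⟨?_, ?_, ?_, ?_⟩ q42 _ (by omega)
  · omega
  · intro i hi
    obtain rfl | rfl | rfl : i = 0 ∨ i = 1 ∨ i = 2 := by omega
    · rw [cm _ (by omega), cm _ (by omega), cm _ (by omega), bm _ (by omega), bm _ (by omega),
        bm _ (by omega)]
      exact ⟨a1, a2, a3⟩
    · rw [cm _ (by omega), cm _ (by omega), cm _ (by omega)]
      exact ⟨b1, b2, b3⟩
    · exact ⟨c1, c2, c3⟩
  · intro x hx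
    rw [cm x (by omega), bm x (by omega), am x (by omega), hP.mem x hx]
  · intro x hx
    rw [← hP.reg x hx, cr x (by omega)]
    rw [if_neg (by omega), br x (by omega)]
    rw [if_neg (by omega), if_neg (by omega), ar x (by omega)]
    rw [if_neg (by omega), if_neg (by omega), if_neg (by omega), if_neg (by omega),
      if_neg (by omega), if_neg (by omega)]

end query
-- The time of a query, by induction over the tree
section query
variable {c σ w : ℕ} {O : Subroutines c} {val : List (Fin σ) → Fin c → ℕ} {B : ℕ} {m₀ : ℕ → ℕ}

theorem slice_cat {α : Type*} (X : ℕ → List α) (l u : ℕ) :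
    slice (X 0 ++ (X 1 ++ (X 2 ++ (X 3 ++ X 4)))) l u =
      (List.range 5).flatMap fun i => slice (X i)
        (min (offset (fun i => (X i).length) l i) (X i).length)
        (min (offset (fun i => (X i).length) u i) (X i).length) := by
  rw [← List.append_nil (X 4), slice_append, slice_append, slice_append, slice_append,
    slice_append (X 4)]
  simp [List.range_succ, offset, slice]

/-- `cuts_append` along the nested concatenation, with an empty string after the fifth child so that
all five are clipped alike. -/
theorem cuts_cat (L : ℕ → ℕ) {l u : ℕ} (hu : u ≤ L 0 + (L 1 + (L 2 + (L 3 + L 4)))) :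
    ∑ i ∈ Finset.range 5, cuts (L i) (min (offset L l i) (L i)) (min (offset L u i) (L i)) ≤
      cuts (L 0 + (L 1 + (L 2 + (L 3 + L 4)))) l u := by
  have h0 := cuts_append (L 0) (L 1 + (L 2 + (L 3 + L 4))) l u hu
  have h1 := cuts_append (L 1) (L 2 + (L 3 + L 4)) (l - L 0) (u - L 0) (by omega)
  have h2 := cuts_append (L 2) (L 3 + L 4) (l - L 0 - L 1) (u - L 0 - L 1) (by omega)
  have h3 := cuts_append (L 3) (L 4) (l - L 0 - L 1 - L 2) (u - L 0 - L 1 - L 2) (by omega)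
  have h4 := cuts_append (L 4) 0 (l - L 0 - L 1 - L 2 - L 3) (u - L 0 - L 1 - L 2 - L 3) (by omega)
  rw [add_zero] at h4
  simp only [Finset.sum_range_succ, Finset.sum_range_zero, offset, zero_add]
  omega

theorem treats_cat (hO : Composes w O val) (hB : B ≠ 0) (hw : 10 ≤ 2 ^ w) {a l u h : ℕ}
    {T : ℕ → ℕ} {X : ℕ → List (Fin σ)}
    (hA : Head val m₀ (Set.Iio B) B a (X 0 ++ (X 1 ++ (X 2 ++ (X 3 ++ X 4)))))
    (h2 : m₀ (a + 2) = 0) (hX : ∀ i < 5, Head val m₀ (Set.Iio B) B (m₀ (a + 3 + i)) (X i))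
    (hlen : (X 0 ++ (X 1 ++ (X 2 ++ (X 3 ++ X 4)))).length < 2 ^ w)
    (hlu : l < u) (hu : u ≤ (X 0 ++ (X 1 ++ (X 2 ++ (X 3 ++ X 4)))).length)
    (hne : ¬ (l = 0 ∧ u = (X 0 ++ (X 1 ++ (X 2 ++ (X 3 ++ X 4)))).length))
    (H : ∀ i < 5, Treats w O val B m₀ (m₀ (a + 3 + i))
      (min (offset (fun i => (X i).length) l i) (X i).length)
      (min (offset (fun i => (X i).length) u i) (X i).length) (slice (X i)
      (min (offset (fun i => (X i).length) l i) (X i).length)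
      (min (offset (fun i => (X i).length) u i) (X i).length)) (T i) h) :
    Treats w O val B m₀ a l u (slice (X 0 ++ (X 1 ++ (X 2 ++ (X 3 ++ X 4)))) l u)
      (600 * O.timeH + ∑ i ∈ Finset.range 5, T i) (15 + h) := by
  have hpos := hO.pos
  have hc0 : a < B := hA.cells 0 (by omega)
  have hc2 : a + 2 < B := hA.cells 2 (by omega)
  have hc7 : a + 7 < B := hA.cells 7 (by omega)
  have := Treats.of_sliceStep (m₀ := m₀) (h := h) (k := 0) (N := 5) (T₀ := 300) (X := []) (a := a)
    (l := l) (u := u) hO hB (by omega) hw H (fun p s₁ hL hh => by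
      have hbp := hL.base
      simp only [sliceStep, wp, safe_less, safe_reg, val_less, val_reg, cost_bin, cost_reg, hL.r11,
        hL.r12, true_and, safe_equal, safe_sub, safe_load, safe_add, safe_num, val_equal, val_sub,
        val_add, val_num, val_load, State.set_reg, State.set_mem, cost_sub,
        cost_load, cost_add, cost_num, hL.r10, hL.mem _ hc0, hL.mem _ hc2, hA.len, h2]
      rw [if_pos hlu, if_neg (by omega)]
      refine ⟨by omega, fun _ => ⟨by omega, fun h => absurd rfl h, fun _ => ⟨by omega,
        fun h => absurd rfl h, fun _ => ?_⟩⟩, fun h => absurd h one_ne_zero⟩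
      refine wp_catStep hw hL hc7 (fun i hi => (hX i hi).cells 0 (by omega))
        (fun i hi => (hX i hi).len) (by omega) (by omega) (by omega) ?_
      exact fun s' hP h42 t ht => ⟨by omega, hP, h42, fun h => absurd rfl h⟩)
  rw [slice_cat]
  refine Treats.mono (by simpa using this) ?_ le_rfl
  omega

/-- The two outer parts lie within one copy each and together have no more cut ends than the given
slice. The complete copies in between cost `log t` calls of `h` and no descent. -/
theorem treats_run (hO : Composes w O val) (hB : B ≠ 0) (hw : 10 ≤ 2 ^ w) {a l u h t T : ℕ}
    {X : List (Fin σ)} (ht : m₀ (a + 2) = t) (h0 : t ≠ 0)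
    (hA : Head val m₀ (Set.Iio B) B a (List.replicate t X).flatten)
    (hX : Head val m₀ (Set.Iio B) B (m₀ (a + 3)) X) (hne : X ≠ [])
    (hlen : 2 * (List.replicate t X).flatten.length < 2 ^ w) (hlu : l < u)
    (hu : u ≤ (List.replicate t X).flatten.length)
    (hfull : ¬ (l = 0 ∧ u = (List.replicate t X).flatten.length))
    (H : ∀ l' u', u' ≤ X.length → Treats w O val B m₀ (m₀ (a + 3)) l' u' (slice X l' u')
      (400 * O.timeH + cuts X.length l' u' * T) h) :
    Treats w O val B m₀ a l u (slice (List.replicate t X).flatten l u)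
      (1800 * O.timeH + cuts (List.replicate t X).flatten.length l u * T +
        100 * O.timeH * Nat.log 2 t) (9 + h) := by
  have hpos := hO.pos
  have hb : 0 < X.length := List.length_pos_iff.mpr hne
  have hlt : (List.replicate t X).flatten.length = t * X.length := by simp
  have hbt : X.length ≤ t * X.length := Nat.le_mul_of_pos_left _ (by omega)
  by_cases hal : l % X.length = 0 ∧ u % X.length = 0
  · obtain ⟨q, rfl⟩ : ∃ q, l = q * X.length :=
      ⟨_, (Nat.div_mul_cancel (Nat.dvd_of_mod_eq_zero hal.1)).symm⟩
    obtain ⟨v, rfl⟩ : ∃ v, u = v * X.length :=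
      ⟨_, (Nat.div_mul_cancel (Nat.dvd_of_mod_eq_zero hal.2)).symm⟩
    have hqv : q < v := by
      by_contra h
      exact absurd hlu (not_lt.mpr (Nat.mul_le_mul_right _ (not_lt.mp h)))
    obtain ⟨k, rfl⟩ := Nat.exists_eq_add_of_le hqv.le
    rw [hlt] at hu
    have hqk := Nat.le_of_mul_le_mul_right hu hb
    rw [slice_replicate X hqk]
    refine (treats_power hO hB hw ht h0 hA hX hne (by omega) hqk (h := 9 + h)).mono ?_ le_rfl
    omega
  obtain ⟨m₁, h1⟩ : ∃ m₁, m₁ = min u ((l + X.length - 1) / X.length * X.length) := ⟨_, rfl⟩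
  obtain ⟨m₂, h2⟩ : ∃ m₂, m₂ = max m₁ (u / X.length * X.length) := ⟨_, rfl⟩
  have hs := splits hb hlu (hlt ▸ hu) h1 h2
  have hc0 : a < B := hA.cells 0 (by omega)
  have hc2 : a + 2 < B := hA.cells 2 (by omega)
  have hc3 : a + 3 < B := hA.cells 3 (by omega)
  have hx0 : m₀ (a + 3) < B := hX.cells 0 (by omega)
  -- The complete copies are pushed as a slice of the same node. All copies are equal, so the slice
  -- may start at position zero instead of `m₁`.
  have hmid : Treats w O val B m₀ a 0 (m₂ - m₁)
      (List.replicate ((m₂ - m₁) / X.length) X).flatten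
      (500 * O.timeH + 100 * O.timeH * Nat.log 2 t) h := by
    obtain ⟨k, hk, e⟩ : ∃ k ≤ t, m₂ - m₁ = k * X.length := by
      obtain ⟨q, k, hk, ⟨e1, e2⟩ | ⟨e1, e2⟩⟩ := hs.mid
      · exact ⟨k, by omega, by rw [e1, e2, add_mul, Nat.add_sub_cancel_left]⟩
      · exact ⟨0, by omega, by omega⟩
    rw [e, Nat.mul_div_cancel _ hb]
    have := treats_power hO hB hw ht h0 hA hX hne (by omega) (q := 0) (k := k) (by omega) (h := h)
    simpa using this
  have := Treats.of_sliceStep (m₀ := m₀) (h := h) (k := 0) (N := 3) (T₀ := 250) (X := []) (a := a)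
    (l := l) (u := u) (a' := fun i => if i = 1 then a else m₀ (a + 3))
    (l' := fun i => if i = 0 then l % X.length else 0)
    (u' := fun i => if i = 0 then l % X.length + (m₁ - l) else if i = 1 then m₂ - m₁ else u - m₂)
    (Z := fun i => if i = 0 then slice X (l % X.length) (l % X.length + (m₁ - l)) else
      if i = 1 then (List.replicate ((m₂ - m₁) / X.length) X).flatten else slice X 0 (u - m₂))
    (T := fun i => if i = 0 then
        400 * O.timeH + cuts X.length (l % X.length) (l % X.length + (m₁ - l)) * T else
      if i = 1 then 500 * O.timeH + 100 * O.timeH * Nat.log 2 t else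
        400 * O.timeH + cuts X.length 0 (u - m₂) * T)
    hO hB (by omega) hw (fun i hi => by
      obtain rfl | rfl | rfl : i = 0 ∨ i = 1 ∨ i = 2 := by omega
      · exact H _ _ hs.left_le
      · exact hmid
      · exact H _ _ hs.right_le) (fun p s₁ hL hh => by
      have hbp := hL.base
      have hml := Nat.mod_lt l hb
      have hmu := Nat.mod_lt u hb
      simp only [sliceStep, wp, safe_less, safe_reg, val_less, val_reg, cost_bin, cost_reg, hL.r11,
        hL.r12, true_and, safe_equal, safe_sub, safe_load, safe_add, safe_num, val_equal, val_sub,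
        val_add, val_num, val_load, State.set_reg, State.set_mem, cost_sub,
        cost_load, cost_add, cost_num, hL.r10, hL.mem _ hc0, hL.mem _ hc2, hA.len, ht]
      rw [if_pos hlu, if_neg (by omega)]
      refine ⟨by omega, fun _ => ⟨by omega, fun h => absurd rfl h, fun _ => ⟨by omega, fun _ => ?_,
        fun h => absurd h h0⟩⟩, fun h => absurd h one_ne_zero⟩
      simp only [runStep, wp, safe_reg, val_reg, cost_bin, cost_reg, safe_sub, safe_load, safe_add,
        safe_num, safe_mod, safe_div, val_sub, val_mod, val_div, val_add, val_num, val_load,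
        State.set_reg, State.set_mem, cost_sub, cost_load, cost_add, cost_mod, cost_div, cost_num,
        hL.r10, hL.r11, hL.r12, hL.mem _ hc3, hL.mem _ hx0, hX.len, true_and,
        if_true, Nat.reduceEqDiff, if_false, and_assoc]
      refine ⟨by omega, by omega, by omega, by omega, by omega, fun _ => ?_, fun h => by omega⟩
      refine wp_splitRun (a := a) (l := l) (u := u) (b := X.length) (q := m₀ (a + 3)) hw
        (((Pushed.zero hL.r6).set (by omega)).set (by omega)) ?_ ?_ ?_ ?_ ?_ ?_ (by omega) hlu.le
        (by omega) h1 h2 hs.le₁ hs.left_le ?_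
      · simp [State.set_reg, hL.r10]
      · simp [State.set_reg, hL.r11]
      · simp [State.set_reg, hL.r12]
      · simp [State.set_reg]
      · simp [State.set_reg]
      · simp [State.set_reg, hL.r42]
      exact fun s' hP h42 t ht => ⟨by omega, hP, h42, fun h => absurd rfl h⟩)
  have hcut := Nat.mul_le_mul_right T hs.cuts_le
  rw [add_mul] at hcut
  rw [hs.slice_eq, hlt]
  simp only [Finset.sum_range_succ, Finset.sum_range_zero, List.range_succ, List.range_zero,
    List.flatMap_append, List.flatMap_nil, List.flatMap_singleton, List.nil_append, if_true,
    one_ne_zero, if_false, OfNat.ofNat_ne_zero, OfNat.ofNat_ne_one, zero_add,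
    List.replicate_zero, List.flatten_nil, List.append_nil, Nat.log_zero_right, mul_one,
    List.append_assoc] at this
  refine this.mono ?_ (by omega)
  omega

/-- Induction over the tree. Parts that are whole or empty have no cut ends and cost a constant
number of calls. A slice that is neither has at least one cut end, and each of its cut ends then
pays for one more rank, while the cut ends themselves are distributed among the parts. The stack
grows by at most five entries of three cells for each level. -/
theorem Rep.treats (hO : Composes w O val) (hB : B ≠ 0) (hw : 10 ≤ 2 ^ w) {a r : ℕ}
    {X : List (Fin σ)} (h : Rep val m₀ (Set.Iio B) B a X r) (hlen : 2 * X.length < 2 ^ w)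
    {l u : ℕ} (hu : u ≤ X.length) :
    Treats w O val B m₀ a l u (slice X l u)
      (400 * O.timeH + cuts X.length l u * (r * (4000 * O.timeH))) (15 * (r + 1)) := by
  have hpos := hO.pos
  induction h generalizing l u with
  | @leaf a X r h hX =>
    exact (treats_flat hO hB hw h (by omega) (by omega)).mono (Nat.le_add_right _ _) le_rfl
  | @cat a X r r' h h2 hX hr ih =>
    by_cases hf : u ≤ l ∨ l = 0 ∧ u = (X 0 ++ (X 1 ++ (X 2 ++ (X 3 ++ X 4)))).length
    · exact (treats_flat hO hB hw h (by omega) hf).mono (Nat.le_add_right _ _) le_rfl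
    rw [not_or] at hf
    have hcp := cuts_pos (not_le.mp hf.1) hu hf.2
    refine (treats_cat hO hB hw h h2 (fun i hi => (hX i hi).head) (by omega) (not_le.mp hf.1) hu hf.2
      fun i hi => ih i hi ?_ (min_le_right _ _)).mono ?_ (by omega)
    · have : (X i).length ≤ (X 0 ++ (X 1 ++ (X 2 ++ (X 3 ++ X 4)))).length := by
        simp only [List.length_append]
        interval_cases i <;> omega
      omega
    simp only [List.length_append] at hu hcp ⊢
    have hc := Nat.mul_le_mul_right (r * (4000 * O.timeH))
      (cuts_cat (fun i => (X i).length) (l := l) hu)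
    rw [Finset.sum_mul] at hc
    -- The rank that is lost, together with the 400 of the node, pays for its own 600 and for 400 at
    -- each of the five parts.
    have hk := Nat.mul_le_mul_left (cuts ((X 0).length + ((X 1).length + ((X 2).length +
      ((X 3).length + (X 4).length)))) l u) (Nat.mul_le_mul_right (4000 * O.timeH) hr)
    rw [Nat.succ_mul, mul_add] at hk
    have hk' := Nat.mul_le_mul_right (4000 * O.timeH) hcp
    rw [Finset.sum_add_distrib, Finset.sum_const, Finset.card_range, smul_eq_mul]
    omega
  | @run a X r r' h h2 hX hne hr ih =>
    by_cases hf : u ≤ l ∨ l = 0 ∧ u = (List.replicate (m₀ (a + 2)) X).flatten.length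
    · exact (treats_flat hO hB hw h (by omega) hf).mono (Nat.le_add_right _ _) le_rfl
    rw [not_or] at hf
    have hcp := cuts_pos (not_le.mp hf.1) hu hf.2
    have hXl : X.length ≤ (List.replicate (m₀ (a + 2)) X).flatten.length := by
      simp only [List.length_flatten, List.map_replicate, List.sum_replicate, smul_eq_mul]
      exact Nat.le_mul_of_pos_left _ (by omega)
    refine (treats_run hO hB hw rfl h2 h hX.head hne hlen (not_le.mp hf.1) hu hf.2
      fun l' u' hu' => ih (by omega) hu').mono ?_ (by omega)
    -- At a run at least `log t + 1` ranks are lost; they pay for the constant part and for the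
    -- squarings.
    have hk := Nat.mul_le_mul_left (cuts (List.replicate (m₀ (a + 2)) X).flatten.length l u)
      (Nat.mul_le_mul_right (4000 * O.timeH) (show r + (Nat.log 2 (m₀ (a + 2)) + 1) ≤ r' by omega))
    rw [add_mul, mul_add] at hk
    have hk' := Nat.mul_le_mul_right ((Nat.log 2 (m₀ (a + 2)) + 1) * (4000 * O.timeH)) hcp
    have e1 : (Nat.log 2 (m₀ (a + 2)) + 1) * (4000 * O.timeH) =
      4000 * (O.timeH * Nat.log 2 (m₀ (a + 2))) + 4000 * O.timeH := by ring
    have e2 : 100 * O.timeH * Nat.log 2 (m₀ (a + 2)) =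
      100 * (O.timeH * Nat.log 2 (m₀ (a + 2))) := by ring
    rw [Nat.succ_eq_add_one, zero_add, one_mul] at hk'
    omega

end query

/-- The program that answers queries. -/
def query (c : ℕ) : Prog :=
  .set 7 (M 0) ;; .set 2 (2 + 3 * R 7) ;; .set 43 (recE c (R 7 + 1)) ;;
  .set 44 (R 43 + Expr.const c) ;; .set 5 (R 44 + Expr.const c) ;; .set 6 (R 5) ;; .set 40 0 ;;
  .set 8 (recE c (M 1)) ;; .set 9 (R 0 - 1) ;; push 8 9 1 ;;
  .loop (Expr.less (R 5) (R 6)) queryBody ;; .set 0 (R 40)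

section query
variable {c σ w : ℕ} {O : Subroutines c} {val : List (Fin σ) → Fin c → ℕ} {G : RLSLP σ}

theorem wp_query (hf : Fits G c w) (hO : Composes w O val) {m : ℕ → ℕ} (hm0 : m 0 = G.numVars)
    (hm1 : m 1 = G.start)
    (hr : Rep val m (Set.Iio (recAt c G.numVars (G.numVars + 1))) (recAt c G.numVars (G.numVars + 1))
      (recAt c G.numVars G.start) G.text (G.rk G.start)) {i j : ℕ} (hi : 1 ≤ i) (hij : i ≤ j)
    (hj : j ≤ G.text.length) :
    wp w O (query c) (fun t s' => t ≤ 100000 * (O.timeH * (Nat.log 2 G.text.length + 1)) ∧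
      (∀ a < recAt c G.numVars (G.numVars + 1), s'.mem a = m a) ∧
      readBlock c s'.mem (s'.reg 0) = val (substring G.text i j)) (State.ofQuery i j m) := by
  have hpos := hO.pos
  have h1 := hf.size_le
  have h2 := fold_recAt (c := c) (V := G.numVars) (G.numVars + 1)
  have h3 := fold_recAt (c := c) (V := G.numVars) G.start
  have h4 := recAt_le (c := c) (V := G.numVars) G.start.2.le
  have h5 := le_recAt (c := c) (V := G.numVars) (G.numVars + 1)
  have h6 : stride c ≤ stride c * (G.numVars + 1) := Nat.le_mul_of_pos_right _ (by omega)
  have hst := lt_stride (c := c) (f := 32) (by omega)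
  have h7 := Nat.zero_le G.text.length
  have h8 := Nat.zero_le c
  have hrk := G.rk_start_le
  have hlog : Nat.log 2 G.text.length ≤ G.text.length := Nat.log_le_self 2 _
  have hV := G.start.2
  generalize hS : recAt c G.numVars (G.numVars + 1) = S at *
  simp only [query, wp, safe_add, safe_sub, safe_mul, safe_load, safe_reg, safe_num, safe_const,
    val_const, cost_const, val_add, val_mul, val_sub, val_load, val_reg, val_num, State.set_reg,
    State.set_mem, val_recE, safe_recE, cost_recE, State.ofQuery, hm0, hm1, h2, h3, cost_add,
    cost_mul, cost_sub, cost_load, cost_reg, cost_num, true_and, and_assoc, Nat.reduceEqDiff,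
    if_true, if_false]
  repeat refine And.intro (by linarith) ?_
  refine wp_push ?_ ?_
  · simp [State.set_reg]; omega
  simp only [State.set_reg, State.set_mem, Nat.reduceEqDiff, if_true, if_false]
  intro s a1 a2 a3 am a6 ar
  have f5 := ar 5 (by omega)
  have f40 := ar 40 (by omega)
  have f43 := ar 43 (by omega)
  have f44 := ar 44 (by omega)
  simp only [Nat.reduceEqDiff, if_true, if_false] at f5 f40 f43 f44
  have hs : QueryState val S m ([] : List (Fin σ)) s :=
    ⟨by omega, f43, f44, fun x hx => am x (by omega), Or.inl ⟨f40, rfl⟩, by omega⟩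
  -- The only entry on the stack is the start variable with the slice from `i - 1` to `j`, in
  -- positions counted from zero. The stack lies behind the data structure and two blocks; as the
  -- rank is logarithmic, it fits into the room reserved by `Fits`.
  obtain ⟨t, s', ht, hI, hs', h6', -⟩ := hr.treats hO (by omega) (by omega) (by omega)
    (l := i - 1) hj s [] (S + c + c) hs a6 (by omega) a1 a2 a3 (by omega)
  have hex : (Expr.less (R 5) (R 6)).eval w s' = 0 := by
    rw [Expr.eval_eq_val (by simp only [safe_less, safe_reg, true_and]; omega)]
    have := hs'.r5
    simp only [val_less, val_reg, h6']
    rw [if_neg (by omega)]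
  refine ⟨_, s', hI.exec hex, ?_, hs'.mem, ?_⟩
  · have k1 : cuts G.text.length (i - 1) j * (G.rk G.start * (4000 * O.timeH)) ≤
        2 * ((11 * Nat.log 2 G.text.length + 3) * (4000 * O.timeH)) :=
      Nat.mul_le_mul (cuts_le _ _ _) (Nat.mul_le_mul_right _ hrk)
    have k2 : 2 * ((11 * Nat.log 2 G.text.length + 3) * (4000 * O.timeH)) =
        88000 * (O.timeH * Nat.log 2 G.text.length) + 24000 * O.timeH := by ring
    rw [mul_add O.timeH]
    simp only [cost_bin, cost_reg]
    omega
  -- The substring is nonempty because `i ≤ j`, so the resulting pointer is not the one for the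
  -- empty string.
  · have hne : slice G.text (i - 1) j ++ [] ≠ [] := by
      rw [List.append_nil, ← List.length_pos_iff]
      simp only [slice, List.length_drop, List.length_take]
      omega
    rcases hs'.holds with ⟨_, h⟩ | ⟨_, h⟩
    · exact absurd h hne
    · simpa [slice, substring] using h

end query

end WordRAM

/-! ### The main theorem -/

open WordRAM in
theorem WordRAM.Subroutines.Compute.composes {σ c w : ℕ} {R : Type*} {O : Subroutines c}
    {enc : R ↪ (Fin c → Fin (2 ^ w))} {f : List (Fin σ) → R} {h : R → R → R}
    (hO : O.Compute enc f h) (hf : IsComposition f h) (ht : 1 ≤ O.timeH) :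
    Composes w O fun X => code enc (f X) :=
  ⟨hO.f_eq, fun X Y => by rw [hO.h_eq, hf], fun X k => (enc (f X) k).2, ht⟩

/-- The values of `f` are represented by `c` words of `w` bits, which is possible if there are at
most `n ^ c` of them, as `n ≤ 2 ^ w`. The programs and the constant `K` depend only on `c`. The
data structure is the contents `D` of the first `S` memory cells when `build` halts. The program
`query` may find arbitrary words in the other cells, it leaves the data structure intact, and it
returns the address of the answer in register `0`. -/
theorem mainTheorem8 (c : ℕ) :
    ∃ (build query : WordRAM.Prog) (K : ℕ),
      ∀ (σ : ℕ) (R : Type*) (f : List (Fin σ) → R) (h : R → R → R), IsComposition f h →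
      ∀ (G : RLSLP σ) (n : ℕ), n = G.text.length →
      ∀ w : ℕ, K * (n + G.size) ≤ 2 ^ w → (∀ x ∈ G.encode, x < 2 ^ w) →
      ∀ (enc : R ↪ (Fin c → Fin (2 ^ w))) (O : WordRAM.Subroutines c),
        O.Compute enc f h → 1 ≤ O.timeH →
        ∃ (t : ℕ) (D : WordRAM.State) (S : ℕ),
          WordRAM.Exec w O build (WordRAM.State.ofInput G.encode) t D ∧
          t ≤ K * (G.size * (O.timeF + O.timeH * (Nat.log 2 n + 1))) ∧
          S ≤ K * G.size ∧ S ≤ 2 ^ w ∧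
          ∀ m : ℕ → ℕ, (∀ a, m a < 2 ^ w) → (∀ a < S, m a = D.mem a) →
          ∀ i j : ℕ, 1 ≤ i → i ≤ j → j ≤ n →
            ∃ (t' : ℕ) (s' : WordRAM.State),
              WordRAM.Exec w O query (WordRAM.State.ofQuery i j m) t' s' ∧
              t' ≤ K * (O.timeH * (Nat.log 2 n + 1)) ∧
              (∀ a < S, s'.mem a = D.mem a) ∧
              WordRAM.readBlock c s'.mem (s'.reg 0) =
                WordRAM.code enc (f (substring G.text i j)) := by
  -- The summand 100000 covers the time of a query and, with `numVars + 1 ≤ 2 * |G|`, that of the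
  -- construction. The summand `100 * c` covers the blocks of `c` words in the records.
  refine ⟨WordRAM.build c, WordRAM.query c, 100000 + 100 * c, ?_⟩
  rintro σ R f h hh G n rfl w hw _ enc O hO ht
  have hV : 1 ≤ G.numVars := Nat.pos_of_ne_zero fun h0 => by
    have := G.start.2
    omega
  have hVs := G.numVars_le_size
  have hcV : c ≤ c * G.numVars := Nat.le_mul_of_pos_right _ hV
  have hcs : c * G.numVars ≤ c * G.size := Nat.mul_le_mul_left _ hVs
  -- The data structure consists of the input, one record for each variable, and the null record.
  have hS : WordRAM.recAt c G.numVars (G.numVars + 1) =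
      35 + 36 * G.numVars + 3 * (c * G.numVars) + 3 * c := by
    unfold WordRAM.recAt WordRAM.stride; ring
  have hK : (100000 + 100 * c) * (G.text.length + G.size) = 100000 * G.text.length +
      100 * (c * G.text.length) + 100000 * G.size + 100 * (c * G.size) := by ring
  have hK' : (100000 + 100 * c) * G.size = 100000 * G.size + 100 * (c * G.size) := by ring
  rw [hK] at hw
  have hF : WordRAM.Fits G c w := ⟨by omega⟩
  have hC := hO.composes hh ht
  obtain ⟨t, D, hx, ord, htm, hE, hB, hord⟩ := WordRAM.wp_sound (WordRAM.wp_build hF hC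
    (Q := fun t s' => ∃ ord, t ≤ 20000 * ((G.numVars + 1) *
      (O.timeF + O.timeH * (Nat.log 2 G.text.length + 1))) ∧ WordRAM.Env G c s' ∧
      WordRAM.Balanced _ G s'.mem ord ord (WordRAM.sidesOf ord) ∧ G.TopOrder ord)
    fun t s' ord h1 h2 h3 h4 => ⟨ord, h1, h2, h3, h4⟩)
  refine ⟨t, D, WordRAM.recAt c G.numVars (G.numVars + 1), hx, ?_, by omega, by omega, ?_⟩
  · refine htm.trans ?_
    rw [← mul_assoc, ← mul_assoc]
    exact Nat.mul_le_mul_right _ (by omega)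
  intro m _ hm i j hi hij hj
  -- The representation of the text uses only cells below the end of the data structure, so it
  -- carries over to a memory with arbitrary contents beyond it.
  obtain ⟨t', s', hx', ht', hm', hr⟩ := WordRAM.wp_sound (WordRAM.wp_query hF hC (m := m)
    (by rw [hm _ (by omega), hE.inp _ (by omega)]; rfl)
    (by rw [hm _ (by omega), hE.inp _ (by omega)]; rfl)
    ((hB.node G.start (hord.mem _) RLSLP.occ_start).congr
      (fun x hx => hm x (WordRAM.cells_lt hx)) (fun x hx => WordRAM.cells_lt hx) le_rfl) hi hij hj)
  refine ⟨t', s', hx', ht'.trans (Nat.mul_le_mul_right _ (by omega)), fun a ha => ?_, hr⟩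
  rw [hm' a ha, hm a ha]
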